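/- **Setting.** Let $X$ be a (small) topological groupoid. A *vector bundle* on $X$ is a complex vector bundle of finite (locally constant) rank on the space of objects with a continuous fibrewise linear action of the arrows. A *center element* $\xi$ of $X$ is a continuous natural transformation $\mathrm{id}_X\Rightarrow\mathrm{id}_X$. $K_{rot}(X,\xi)$ is the Grothendieck group of the monoid (under $\oplus$, up to isomorphism of all coefficients) of formal power series $F(q)=\sum_{a\in\mathbb Q_{\ge 0}}V_aq^a$ of vector bundles on $X$, with locally bounded denominators (every object has a neighbourhood and an $N\ge1$ such that over it $V_a=0$ unless $Na\in\mathbb N$), satisfying the *rotation condition*: $\xi$ acts on $V_a$ as $e^{2\pi i a}$. It is a ring under $\otimes$, and functors compatible with the center elements act by pull-back. The inertia groupoid $\Lambda X$ has as objects the automorphisms $g\in \mathrm{aut}(x)$ in $X$ and as arrows $g\to g'$ the arrows $h$ of $X$ with $hg=g'h$; its canonical center element $\xi^1$ is $g$ at the object $g$. *Orbifold Tate K-theory* is $K_{Tate}(X)=K_{rot}(\Lambda X,\xi^1)$. **Transfers.** If $f\colon X\to Y$ has essentially finite homotopy fibres, $f_!$ is induced by the right Kan extension $(RKan_fV)_y=\lim_{(y\to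 f(x))}V_x$, i.e. the space of compatible sections over the homotopy fibre; $f_!$ in $K_{Tate}$ means $(\Lambda f)_!$ in $K_{rot}$. **Atiyah operations.** $S_n\!\smallint\! X$ is the groupoid of families of $n$ objects of $X$, an arrow being a permutation together with arrows of $X$ between corresponding members; $S(X)=\coprod_{n\ge 0}S_n\!\smallint\! X$ (with center element $S\xi$ acting by $\xi$ on each member of a family). For a series $V$, $P_n(V)$ is the external tensor power $V^{\otimes n}$ with the permutation action of $S_n$. Let $\bullet$ be external product followed by transfer along concatenation $S_i\!\smallint\! X\times S_j\!\smallint\! X\to S_{i+j}\!\smallint\! X$. Then $P=(P_n)_n\colon K_{rot}(X,\xi)\to K_{rot}(S(X),S\xi)=\prod_nK_{rot}(S_n\!\smallint\! X,S\xi)$ is extended to virtual elements by $P(V)=P(V-W)\bullet P(W)$. The total Atiyah symmetric power is $S_t(x)=\sum_n t^n\,(\mathrm{pr}_n)_!\,\delta_n^*P_n(x)\in K_{rot}(X,\xi)[[t]]$, with the diagonal $\delta_n\colon (\mathrm{pt}/\!\!/S_n)\times X\to S_n\!\smallint\! X$ and the projection $\mathrm{pr}_n\colon(\mathrm{pt}/\!\!/S_n)\times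 X\to X$ (the center element of $(\mathrm{pt}/\!\!/S_n)\times X$ being $(1,\xi)$). **Power operation of Tate K-theory.** For $k\ge1$ let $\Phi_k(X)\subset \Lambda(S_k\!\smallint\! X)$ be the full subgroupoid of those automorphisms of families of $k$ objects whose permutation is the standard $k$-cycle, and $\Phi(X)=\coprod_{k\ge1}\Phi_k(X)$, with center element $\varphi$ given by the automorphism itself. Let $Q\colon S(\Phi(X))\to\Lambda(S(X))$ be concatenation, so that $Q^*\colon K_{Tate}(S(X))\to K_{rot}(S(\Phi (X)),S\varphi)=\prod_nK_{rot}(S_n\!\smallint\!\Phi(X),S\varphi)$. Let $\theta\colon K_{Tate}(X)\to K_{rot}(\Phi (X),\varphi)$ be the additive operation sending $\sum V_aq^a$ on $\Phi_k(X)$ to $\sum (Z_k^*V_a)q^{a/k}$, where $Z_k$ sends an object of $\Phi_k(X)$ to the automorphism of its first member obtained by going once around the cycle; arrows of $\Phi_k(X)$ which fix the first index act through $V_a$, and $\varphi$ acts on the coefficient of $q^{a/k}$ as $e^{2\pi i a/k}$. If $Q^*$ is bijective, put $P^{Tate}=(Q^*)^{-1}\circ P\circ\theta\colon K_{Tate}(X)\to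 K_{Tate}(S(X))$, and let $S_t^{Tate}(F)=\sum_n t^n(\mathrm{pr}_n)_!\,\delta_n^*P^{Tate}(F)\in K_{Tate}(X)[[t]]$, where now $(\mathrm{pr}_n)_!$ and the pull-back along $\delta_n\colon(\mathrm{pt}/\!\!/S_n)\times X\to S_n\!\smallint\! X\subset S(X)$ are taken in $K_{Tate}$. **The operators $\beta_k$.** For $k\ge1$, let $\Pi_k\colon\Lambda X\to\Lambda X$ be the $k$th power map, $g\mapsto g^k$ on objects and $h\mapsto h$ on arrows. The additive operator $\beta_k\colon K_{Tate}(X)\to K_{Tate}(X)$ sends $F=\sum V_aq^a$ to $\left[\Pi_k^*F(q^{1/k})\right]^{\mathbb Z/k}$, where the generator of $\mathbb Z/k$ acts on the coefficient $\Pi_k^*V_a$ of $q^{a/k}$ by $\xi^1\cdot e^{-2\pi i a/k}$; that is, one takes in each coefficient $\Pi_k^*V_a$ the $e^{2\pi ia/k}$-eigenbundle of $\xi^1$. **Theorem.** Let $X$ be a topological groupoid. Then $Q^*$ is bijective (so $P^{Tate}$ and $S_t^{Tate}$ are defined), and for every $F\in K_{Tate}(X)$ $$S_t^{Tate}(F)=\prod_{k\ge1}S_{t^k}(\beta_k(F))\quad\text{in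 } K_{Tate}(X)[[t]],$$ where $S_t$ is the total Atiyah symmetric power on $K_{Tate}(X)=K_{rot}(\Lambda X,\xi^1)$ and the infinite product is understood $t$-adically: for every $n$, the coefficient of $t^n$ on the left is the coefficient of $t^n$ in $\prod_{k=1}^{M}S_{t^k}(\beta_k(F))$ for every $M\ge n$. -/

import Mathlib

universe u

noncomputable section

open Filter Topology CategoryTheory
open scoped TensorProduct NNRat

namespace OrbTate

set_option linter.unusedSectionVars false
set_option linter.unusedVariables false

/-! ### Complex vector bundles over a space -/

/-- A complex vector bundle of finite rank over `B` (the rank may vary with the component): a family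
of complex vector spaces with a topology on the total space which is locally, over `B`, fibrewise
linearly homeomorphic to a product with some `ℂⁿ`. -/
structure VB (B : Type u) [TopologicalSpace B] where
  fib : B → Type u
  [acg : ∀ b, AddCommGroup (fib b)]
  [mod : ∀ b, Module ℂ (fib b)]
  top : TopologicalSpace (Σ b, fib b)
  locTriv : ∀ b, ∃ (n : ℕ) (e : Bundle.Trivialization (Fin n → ℂ) (Sigma.fst : (Σ b, fib b) → B)),
    b ∈ e.baseSet ∧ ∀ y ∈ e.baseSet, IsLinearMap ℂ fun v : fib y => (e ⟨y, v⟩).2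

attribute [instance] VB.acg VB.mod

/-- The total space of a vector bundle. -/
def VB.Tot {B : Type u} [TopologicalSpace B] (E : VB B) : Type u := Σ b, E.fib b

instance {B : Type u} [TopologicalSpace B] (E : VB B) : TopologicalSpace E.Tot := E.top

/-- The point of the total space given by a vector `v` in the fibre over `b`. -/
def VB.pt {B : Type u} [TopologicalSpace B] (E : VB B) (b : B) (v : E.fib b) : E.Tot := ⟨b, v⟩

section Triv

variable {B : Type u} [TopologicalSpace B]

/-- A local trivialization over `U`, given by linear coordinates on the fibres. -/
structure IsLT {fib : B → Type u} [∀ b, AddCommGroup (fib b)] [∀ b, Module ℂ (fib b)]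
    (top : TopologicalSpace (Σ b, fib b)) (U : Set B) {ι : Type} (τ : ∀ y, fib y →ₗ[ℂ] (ι → ℂ)) :
    Prop where
  isOpen : IsOpen U
  bij : ∀ y ∈ U, Function.Bijective (τ y)
  nhds : ∀ y ∈ U, ∀ v : fib y, @nhds _ top (⟨y, v⟩ : Σ b, fib b) =
    comap (fun p : Σ b, fib b => (p.1, τ p.1 p.2)) (𝓝 (y, τ y v))

/-- The inverse of a bijective linear map (and zero if the map is not bijective). -/
def linv {V W : Type*} [AddCommGroup V] [Module ℂ V] [AddCommGroup W] [Module ℂ W]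
    (f : V →ₗ[ℂ] W) : W →ₗ[ℂ] V := by
  classical exact if h : Function.Bijective f then (LinearEquiv.ofBijective f h).symm else 0

theorem linv_left {V W : Type*} [AddCommGroup V] [Module ℂ V] [AddCommGroup W] [Module ℂ W]
    {f : V →ₗ[ℂ] W} (h : Function.Bijective f) (v : V) : linv f (f v) = v := by
  simp only [linv, dif_pos h]
  exact (LinearEquiv.ofBijective f h).symm_apply_apply v

theorem linv_right {V W : Type*} [AddCommGroup V] [Module ℂ V] [AddCommGroup W] [Module ℂ W]
    {f : V →ₗ[ℂ] W} (h : Function.Bijective f) (w : W) : f (linv f w) = w := by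
  simp only [linv, dif_pos h]
  exact (LinearEquiv.ofBijective f h).apply_symm_apply w

theorem VB.exists_lt (E : VB B) (b : B) : ∃ (n : ℕ) (U : Set B)
    (τ : ∀ y, E.fib y →ₗ[ℂ] (Fin n → ℂ)), b ∈ U ∧ IsLT E.top U τ := by
  classical
  obtain ⟨n, e, hb, hl⟩ := E.locTriv b
  let _ := E.top
  have hsrc : ∀ p : Σ b, E.fib b, p ∈ e.source ↔ p.1 ∈ e.baseSet := fun p => by
    rw [e.source_eq]; rfl
  have key : ∀ y ∈ e.baseSet, ∀ v : E.fib y, e ⟨y, v⟩ = (y, (e ⟨y, v⟩).2) := fun y hy v =>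
    Prod.ext (e.proj_toFun _ ((hsrc _).2 hy)) rfl
  refine ⟨n, e.baseSet, fun y => if h : y ∈ e.baseSet then (hl y h).mk' _ else 0, hb,
    e.open_baseSet, ?_, ?_⟩
  · intro y hy
    simp only [dif_pos hy]
    constructor
    · intro v w hvw
      have h2 : e ⟨y, v⟩ = e ⟨y, w⟩ := by
        rw [key y hy, key y hy w]; exact Prod.ext rfl hvw
      have := e.injOn ((hsrc ⟨y, v⟩).2 hy) ((hsrc ⟨y, w⟩).2 hy) h2
      exact eq_of_heq (Sigma.mk.inj this).2
    · intro c
      have ht : (y, c) ∈ e.target := by rw [e.target_eq]; exact ⟨hy, trivial⟩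
      have h1 := e.right_inv ht
      have h0 : (e.toOpenPartialHomeomorph.symm (y, c)) ∈ e.source := e.map_target ht
      have h3 := e.proj_toFun _ h0
      obtain ⟨p, hp⟩ : ∃ p, p = e.toOpenPartialHomeomorph.symm (y, c) := ⟨_, rfl⟩
      rw [← hp] at h1 h3
      obtain ⟨y', v⟩ := p
      have h4 : y' = y := by
        have := h3.symm; exact this.trans (congrArg Prod.fst h1)
      subst h4
      exact ⟨v, congrArg Prod.snd h1⟩
  · intro y hy v
    have hs : (⟨y, v⟩ : Σ b, E.fib b) ∈ e.source := (hsrc _).2 hy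
    have hev : ∀ᶠ p in @nhds _ E.top (⟨y, v⟩ : Σ b, E.fib b), p ∈ e.source :=
      e.open_source.mem_nhds hs
    have hf : ∀ p ∈ e.source, (p.1, (if h : p.1 ∈ e.baseSet then (hl p.1 h).mk' _ else
        (0 : E.fib p.1 →ₗ[ℂ] (Fin n → ℂ))) p.2) = e p := by
      intro p hp
      have hp' := (hsrc p).1 hp
      simp only [dif_pos hp']
      exact (key p.1 hp' p.2).symm
    rw [hf ⟨y, v⟩ hs]
    apply le_antisymm
    · rw [← map_le_iff_le_comap]
      have h1 : Tendsto e (𝓝 ⟨y, v⟩) (𝓝 (e ⟨y, v⟩)) := e.continuousAt hs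
      exact (h1.congr' (hev.mono fun p hp => (hf p hp).symm))
    · have h2 : Tendsto e.toOpenPartialHomeomorph.symm (𝓝 (e ⟨y, v⟩)) (𝓝 ⟨y, v⟩) := by
        have := e.toOpenPartialHomeomorph.symm.continuousAt (x := e ⟨y, v⟩) (e.map_source hs)
        have h3 := e.left_inv hs
        unfold ContinuousAt at this
        rwa [show e.toOpenPartialHomeomorph.symm (e ⟨y, v⟩) = ⟨y, v⟩ from h3] at this
      have h4 := h2.comp (tendsto_comap (f := fun p : Σ b, E.fib b => (p.1, (if h : p.1 ∈ e.baseSet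
        then (hl p.1 h).mk' _ else (0 : E.fib p.1 →ₗ[ℂ] (Fin n → ℂ))) p.2)) (x := 𝓝 (e ⟨y, v⟩)))
      have h5 : ∀ᶠ p in comap (fun p : Σ b, E.fib b => (p.1, (if h : p.1 ∈ e.baseSet
        then (hl p.1 h).mk' _ else (0 : E.fib p.1 →ₗ[ℂ] (Fin n → ℂ))) p.2)) (𝓝 (e ⟨y, v⟩)),
          p.1 ∈ e.baseSet := by
        have h6 : ∀ᶠ q in 𝓝 (e ⟨y, v⟩), q.1 ∈ e.baseSet :=
          continuousAt_fst.eventually (e.open_baseSet.mem_nhds (by rw [key y hy v]; exact hy))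
        exact tendsto_comap.eventually h6
      have h6 := h4.congr' (f₂ := id) (h5.mono fun p hp => by
        have hp' := (hsrc p).2 hp
        simp only [Function.comp_apply]
        rw [hf p hp']
        exact e.left_inv hp')
      exact tendsto_id'.1 h6

/-- A vector bundle from linear local coordinates. -/
theorem locTriv_of_isLT {fib : B → Type u} [∀ b, AddCommGroup (fib b)] [∀ b, Module ℂ (fib b)]
    (top : TopologicalSpace (Σ b, fib b))
    (h : ∀ b, ∃ (ι : Type) (_ : Finite ι) (U : Set B) (τ : ∀ y, fib y →ₗ[ℂ] (ι → ℂ)),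
      b ∈ U ∧ IsLT top U τ) (b : B) :
    ∃ (n : ℕ) (e : Bundle.Trivialization (Fin n → ℂ) (Sigma.fst : (Σ b, fib b) → B)),
      b ∈ e.baseSet ∧ ∀ y ∈ e.baseSet, IsLinearMap ℂ fun v : fib y => (e ⟨y, v⟩).2 := by
  classical
  obtain ⟨ι, _, U, τ, hb, hU, hbij, hn⟩ := h b
  obtain ⟨n, ⟨eq⟩⟩ := Finite.exists_equiv_fin ι
  let L : (ι → ℂ) ≃ₗ[ℂ] (Fin n → ℂ) := LinearEquiv.funCongrLeft ℂ ℂ eq.symm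
  have hL : Continuous L := L.toLinearMap.continuous_of_finiteDimensional
  have hL' : Continuous L.symm := L.symm.toLinearMap.continuous_of_finiteDimensional
  let f : (Σ b, fib b) → B × (Fin n → ℂ) := fun p => (p.1, L (τ p.1 p.2))
  let g : B × (Fin n → ℂ) → Σ b, fib b := fun q => ⟨q.1, linv (τ q.1) (L.symm q.2)⟩
  have hfst : ∀ p : Σ b, fib b, p.1 ∈ U → ContinuousAt (fun p : Σ b, fib b => (p.1, τ p.1 p.2)) p := by
    intro p hp
    have : Tendsto (fun p : Σ b, fib b => (p.1, τ p.1 p.2)) (𝓝 p) (𝓝 (p.1, τ p.1 p.2)) := by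
      rw [show p = ⟨p.1, p.2⟩ from rfl, hn p.1 hp p.2]; exact tendsto_comap
    exact this
  have hopen : IsOpen ((Sigma.fst : (Σ b, fib b) → B) ⁻¹' U) := by
    rw [isOpen_iff_mem_nhds]
    intro p hp
    exact (continuousAt_fst.comp (hfst p hp)).preimage_mem_nhds (hU.mem_nhds hp)
  refine ⟨n, { toFun := f, invFun := g, source := Sigma.fst ⁻¹' U, target := U ×ˢ Set.univ
               baseSet := U, open_baseSet := hU, source_eq := rfl, target_eq := rfl
               proj_toFun := fun _ _ => rfl
               map_source' := fun p hp => ⟨hp, trivial⟩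
               map_target' := fun q hq => hq.1
               left_inv' := ?_, right_inv' := ?_, open_source := hopen
               open_target := hU.prod isOpen_univ
               continuousOn_toFun := ?_, continuousOn_invFun := ?_ }, hb, ?_⟩
  · rintro ⟨y, v⟩ hp
    simp only [f, g, L.symm_apply_apply]
    rw [linv_left (hbij y hp)]
  · rintro ⟨y, c⟩ hq
    simp only [f, g]
    rw [linv_right (hbij y hq.1), L.apply_symm_apply]
  · intro p hp
    apply ContinuousAt.continuousWithinAt
    exact (continuousAt_fst.comp (hfst p hp)).prodMk
      (hL.continuousAt.comp (continuousAt_snd.comp (hfst p hp)))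
  · rintro ⟨y, c⟩ hq
    apply ContinuousAt.continuousWithinAt
    have h1 : @nhds _ top (g (y, c)) = _ := hn y hq.1 (linv (τ y) (L.symm c))
    unfold ContinuousAt
    rw [h1, tendsto_comap_iff, linv_right (hbij y hq.1)]
    have : Tendsto (fun q : B × (Fin n → ℂ) => (q.1, L.symm q.2)) (𝓝 (y, c))
        (𝓝 (y, L.symm c)) :=
      continuousAt_fst.prodMk (hL'.continuousAt.comp continuousAt_snd)
    refine this.congr' ?_
    filter_upwards [(hU.prod isOpen_univ).mem_nhds hq] with q hq
    simp only [Function.comp_apply, g]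
    rw [linv_right (hbij q.1 hq.1)]
  · intro y hy
    exact (L.toLinearMap.comp (τ y)).isLinear

/-- Continuity of a map into the total space is continuity of its coordinates. -/
theorem IsLT.continuousAt_iff {fib : B → Type u} [∀ b, AddCommGroup (fib b)]
    [∀ b, Module ℂ (fib b)] {top : TopologicalSpace (Σ b, fib b)} {U : Set B} {ι : Type}
    {τ : ∀ y, fib y →ₗ[ℂ] (ι → ℂ)} (h : IsLT top U τ) {T : Type*} [TopologicalSpace T]
    {F : T → Σ b, fib b} {t : T} (ht : (F t).1 ∈ U) :
    ContinuousAt F t ↔ ContinuousAt (fun s => (F s).1) t ∧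
      ContinuousAt (fun s => τ (F s).1 (F s).2) t := by
  unfold ContinuousAt
  rw [show 𝓝 (F t) = _ from h.nhds (F t).1 ht (F t).2, tendsto_comap_iff, nhds_prod_eq,
    Filter.tendsto_prod_iff']
  rfl

theorem comap_nhds_congr {Z A A' : Type*} [TopologicalSpace A] [TopologicalSpace A'] {f : Z → A}
    {g : Z → A'} {z : Z} (F : A → A') (G : A' → A) (hF : ContinuousAt F (f z))
    (hG : ContinuousAt G (g z)) (h1 : ∀ᶠ a in 𝓝 (f z), ∀ z, f z = a → g z = F a)
    (h2 : ∀ᶠ a in 𝓝 (g z), ∀ z, g z = a → f z = G a) :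
    comap f (𝓝 (f z)) = comap g (𝓝 (g z)) := by
  apply le_antisymm
  · rw [← tendsto_iff_comap]
    have h3 := hF.tendsto.comp (tendsto_comap (f := f))
    rw [← h1.self_of_nhds z rfl] at h3
    exact h3.congr' ((tendsto_comap.eventually h1).mono fun w hw => (hw w rfl).symm)
  · rw [← tendsto_iff_comap]
    have h3 := hG.tendsto.comp (tendsto_comap (f := g))
    rw [← h2.self_of_nhds z rfl] at h3
    exact h3.congr' ((tendsto_comap.eventually h2).mono fun w hw => (hw w rfl).symm)

end Triv

section Constructions

variable {B : Type u} [TopologicalSpace B]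

theorem IsLT.mono {fib : B → Type u} [∀ b, AddCommGroup (fib b)] [∀ b, Module ℂ (fib b)]
    {top : TopologicalSpace (Σ b, fib b)} {U U' : Set B} {ι : Type}
    {τ : ∀ y, fib y →ₗ[ℂ] (ι → ℂ)} (h : IsLT top U τ) (hU : IsOpen U') (hs : U' ⊆ U) :
    IsLT top U' τ :=
  ⟨hU, fun y hy => h.bij y (hs hy), fun y hy => h.nhds y (hs hy)⟩

theorem VB.contFst (E : VB B) : Continuous (fun p : E.Tot => p.1) := by
  rw [continuous_iff_continuousAt]
  intro p
  obtain ⟨n, U, τ, hb, h⟩ := E.exists_lt p.1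
  exact ((h.continuousAt_iff (F := fun p : E.Tot => p) (t := p) hb).1 continuousAt_id).1

variable {T : Type*} [TopologicalSpace T] {t : T}

theorem VB.contAtFst (E : VB B) {g : T → B} {u : ∀ t, E.fib (g t)}
    (h : ContinuousAt (fun t => E.pt (g t) (u t)) t) : ContinuousAt g t :=
  E.contFst.continuousAt.comp h

theorem VB.continuousAt_sum (E : VB B) {κ : Type*} [Fintype κ] {g : T → B} {c : κ → T → ℂ}
    {u : κ → ∀ t, E.fib (g t)} (hg : ContinuousAt g t) (hc : ∀ k, ContinuousAt (c k) t)
    (hu : ∀ k, ContinuousAt (fun t => E.pt (g t) (u k t)) t) :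
    ContinuousAt (fun t => E.pt (g t) (∑ k, c k t • u k t)) t := by
  obtain ⟨n, U, τ, hb, h⟩ := E.exists_lt (g t)
  refine (h.continuousAt_iff (F := fun t => E.pt (g t) (∑ k, c k t • u k t)) hb).2 ⟨hg, ?_⟩
  change ContinuousAt (fun s => τ (g s) (∑ k, c k s • u k s)) t
  simp only [map_sum, map_smul]
  exact tendsto_finsetSum _ fun k _ => (hc k).smul
    ((h.continuousAt_iff (F := fun t => E.pt (g t) (u k t)) hb).1 (hu k)).2

theorem IsLT.frame {fib : B → Type u} [∀ b, AddCommGroup (fib b)] [∀ b, Module ℂ (fib b)]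
    {top : TopologicalSpace (Σ b, fib b)} {U : Set B} {ι : Type}
    {τ : ∀ y, fib y →ₗ[ℂ] (ι → ℂ)} (h : IsLT top U τ) {g : T → B} (hg : ContinuousAt g t)
    (hb : g t ∈ U) {c : T → ι → ℂ} (hc : ContinuousAt c t) :
    ContinuousAt (fun t => (⟨g t, linv (τ (g t)) (c t)⟩ : Σ b, fib b)) t := by
  refine (h.continuousAt_iff (F := fun t => (⟨g t, linv (τ (g t)) (c t)⟩ : Σ b, fib b)) hb).2
    ⟨hg, hc.congr ?_⟩
  filter_upwards [hg.eventually (h.isOpen.mem_nhds hb)] with s hs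
  exact (linv_right (h.bij _ hs) _).symm

theorem sum_linv_single {V ι : Type*} [AddCommGroup V] [Module ℂ V] [Fintype ι] [DecidableEq ι]
    {f : V →ₗ[ℂ] (ι → ℂ)} (h : Function.Bijective f) (v : V) :
    v = ∑ j, f v j • linv f (Pi.single j 1) := by
  apply h.1
  simp only [map_sum, map_smul, linv_right h]
  exact pi_eq_sum_univ' (f v)

/-- A fibrewise linear map is continuous if it is so on a local frame. -/
theorem IsLT.continuousAt_map {fib : B → Type u} [∀ b, AddCommGroup (fib b)]
    [∀ b, Module ℂ (fib b)]
    {top : TopologicalSpace (Σ b, fib b)} {U : Set B} {ι : Type} [Fintype ι] [DecidableEq ι]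
    {τ : ∀ y, fib y →ₗ[ℂ] (ι → ℂ)} (h : IsLT top U τ) {q : T → Σ b, fib b}
    (hq : ContinuousAt q t) (hb : (q t).1 ∈ U) {B' : Type u} [TopologicalSpace B'] (F : VB B')
    {g : T → B'} (hg : ContinuousAt g t) (L : ∀ t, fib (q t).1 →ₗ[ℂ] F.fib (g t))
    (hL : ∀ j, ContinuousAt (fun t => F.pt (g t) (L t (linv (τ (q t).1) (Pi.single j 1)))) t) :
    ContinuousAt (fun t => F.pt (g t) (L t (q t).2)) t := by
  have hq2 := (h.continuousAt_iff hb).1 hq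
  have h1 := F.continuousAt_sum (c := fun j t => τ (q t).1 (q t).2 j) hg
    (fun j => (continuous_apply j).continuousAt.comp hq2.2) hL
  refine h1.congr ?_
  filter_upwards [hq2.1.eventually (h.isOpen.mem_nhds hb)] with s hs
  conv_rhs => rw [sum_linv_single (h.bij _ hs) (q s).2]
  simp only [map_sum, map_smul]

/-- Change of coordinates for neighbourhood filters, used to verify local triviality. -/
theorem isLT_of_induced {A : Type u} [TopologicalSpace A] {fib : A → Type u}
    [∀ b, AddCommGroup (fib b)] [∀ b, Module ℂ (fib b)] {Z C : Type*} [TopologicalSpace Z]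
    [TopologicalSpace C] {j : (Σ a, fib a) → Z} {U : Set A} (hU : IsOpen U) {ι : Type}
    {τ : ∀ y, fib y →ₗ[ℂ] (ι → ℂ)} (hbij : ∀ y ∈ U, Function.Bijective (τ y))
    (coord : Z → C) (F : C → A × (ι → ℂ)) (G : A × (ι → ℂ) → C)
    (hcoord : ∀ y ∈ U, ∀ v, 𝓝 (j ⟨y, v⟩) = comap coord (𝓝 (coord (j ⟨y, v⟩))))
    (hF : ∀ y ∈ U, ∀ v, ContinuousAt F (coord (j ⟨y, v⟩)))
    (hG : ∀ y ∈ U, ∀ v, ContinuousAt G (y, τ y v))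
    (h1 : ∀ p, F (coord (j p)) = (p.1, τ p.1 p.2))
    (h2 : ∀ p : Σ a, fib a, p.1 ∈ U → G (p.1, τ p.1 p.2) = coord (j p)) :
    IsLT (TopologicalSpace.induced j inferInstance) U τ := by
  refine ⟨hU, hbij, fun y hy v => ?_⟩
  rw [nhds_induced, hcoord y hy v, comap_comap]
  refine comap_nhds_congr (f := coord ∘ j) (g := fun p : Σ a, fib a => (p.1, τ p.1 p.2))
    (z := ⟨y, v⟩) F G (hF y hy v) (hG y hy v) (.of_forall ?_) ?_
  · rintro _ z rfl
    exact (h1 z).symm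
  · filter_upwards [(hU.prod isOpen_univ).mem_nhds (show (y, τ y v) ∈ U ×ˢ Set.univ from
      ⟨hy, trivial⟩)] with a ha z hz
    subst hz
    exact (h2 z ha.1).symm

theorem nhds_prod_comap {Z₁ Z₂ C₁ C₂ : Type*} [TopologicalSpace Z₁] [TopologicalSpace Z₂]
    [TopologicalSpace C₁] [TopologicalSpace C₂] {z₁ : Z₁} {z₂ : Z₂} {f₁ : Z₁ → C₁} {f₂ : Z₂ → C₂}
    (h₁ : 𝓝 z₁ = comap f₁ (𝓝 (f₁ z₁))) (h₂ : 𝓝 z₂ = comap f₂ (𝓝 (f₂ z₂))) :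
    𝓝 (z₁, z₂) = comap (Prod.map f₁ f₂) (𝓝 (f₁ z₁, f₂ z₂)) := by
  rw [nhds_prod_eq, h₁, h₂, nhds_prod_eq, Filter.prod_comap_comap_eq]; rfl

theorem nhds_pi_comap {I : Type*} {Z C : I → Type*} [∀ i, TopologicalSpace (Z i)]
    [∀ i, TopologicalSpace (C i)] {z : ∀ i, Z i} {f : ∀ i, Z i → C i}
    (h : ∀ i, 𝓝 (z i) = comap (f i) (𝓝 (f i (z i)))) :
    𝓝 z = comap (Pi.map f) (𝓝 (Pi.map f z)) := by
  rw [nhds_pi, nhds_pi, Filter.pi, Filter.pi, comap_iInf]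
  congr 1; funext i
  rw [h i, comap_comap, comap_comap]; rfl

theorem IsLT.nhds' {E : VB B} {U : Set B} {ι : Type} {τ : ∀ y, E.fib y →ₗ[ℂ] (ι → ℂ)}
    (h : IsLT E.top U τ) {y : B} (hy : y ∈ U) (v : E.fib y) :
    𝓝 (E.pt y v) = comap (fun p : E.Tot => (p.1, τ p.1 p.2)) (𝓝 (y, τ y v)) := h.nhds y hy v

/-- The pull-back of a vector bundle. -/
def VB.pull {A : Type u} [TopologicalSpace A] (E : VB B) (f : A → B) (hf : Continuous f) : VB A where
  fib a := E.fib (f a)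
  top := TopologicalSpace.induced
    (fun p : Σ a, E.fib (f a) => (p.1, E.pt (f p.1) p.2)) inferInstance
  locTriv := locTriv_of_isLT _ fun a => by
    obtain ⟨n, U, τ, hb, h⟩ := E.exists_lt (f a)
    refine ⟨Fin n, inferInstance, f ⁻¹' U, fun a => τ (f a), hb,
      isLT_of_induced (h.isOpen.preimage hf) (fun y hy => h.bij _ hy)
      (Prod.map id fun p : E.Tot => (p.1, τ p.1 p.2)) (fun x => (x.1, x.2.2))
      (fun x => (x.1, (f x.1, x.2))) (fun y hy v => ?_) (fun y hy v => by fun_prop)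
      (fun y hy v => by fun_prop) (fun p => rfl) (fun p hp => rfl)⟩
    exact nhds_prod_comap comap_id.symm (h.nhds' hy v)

/-- The direct sum of two vector bundles. -/
def VB.prod (E F : VB B) : VB B where
  fib b := E.fib b × F.fib b
  top := TopologicalSpace.induced
    (fun p : Σ b, E.fib b × F.fib b => (E.pt p.1 p.2.1, F.pt p.1 p.2.2)) inferInstance
  locTriv := locTriv_of_isLT _ fun b => by
    obtain ⟨n, U, τ, hb, h⟩ := E.exists_lt b
    obtain ⟨n', U', τ', hb', h'⟩ := F.exists_lt b
    refine ⟨Fin n ⊕ Fin n', inferInstance, U ∩ U', fun y =>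
      (LinearEquiv.sumArrowLequivProdArrow (Fin n) (Fin n') ℂ ℂ).symm.toLinearMap ∘ₗ
        ((τ y).prodMap (τ' y)), ⟨hb, hb'⟩,
      isLT_of_induced (h.isOpen.inter h'.isOpen) (fun y hy => ?_)
      (Prod.map (fun p : E.Tot => (p.1, τ p.1 p.2)) fun p : F.Tot => (p.1, τ' p.1 p.2))
      (fun x => (x.1.1, Sum.elim x.1.2 x.2.2))
      (fun x => ((x.1, fun i => x.2 (.inl i)), (x.1, fun i => x.2 (.inr i))))
      (fun y hy v => ?_) (fun y hy v => ?_)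
      (fun y hy v => by fun_prop) (fun p => rfl) (fun p hp => rfl)⟩
    · exact (LinearEquiv.sumArrowLequivProdArrow (Fin n) (Fin n') ℂ ℂ).symm.bijective.comp
        ((h.bij y hy.1).prodMap (h'.bij y hy.2))
    · exact nhds_prod_comap (h.nhds' hy.1 v.1) (h'.nhds' hy.2 v.2)
    · refine Continuous.continuousAt (continuous_fst.fst.prodMk (continuous_pi ?_))
      rintro (i | i) <;> simp only [Sum.elim_inl, Sum.elim_inr] <;> fun_prop

theorem VB.isLT_zero (E : VB B) {U : Set B} (hU : IsOpen U) (hs : ∀ y ∈ U, Subsingleton (E.fib y))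
    {ι : Type} [IsEmpty ι] : IsLT E.top U (fun y => (0 : E.fib y →ₗ[ℂ] (ι → ℂ))) := by
  refine ⟨hU, fun y hy => ?_, fun y hy v => ?_⟩
  · have := hs y hy
    exact ⟨Function.injective_of_subsingleton _, fun c => ⟨0, Subsingleton.elim _ _⟩⟩
  · obtain ⟨n, U', τ, hb, h⟩ := E.exists_lt y
    rw [h.nhds y hb v]
    have := hs y hy
    refine comap_nhds_congr (f := fun p : Σ b, E.fib b => (p.1, τ p.1 p.2)) (z := ⟨y, v⟩)
      (g := fun p : Σ b, E.fib b => (p.1, (0 : ι → ℂ))) (fun x => (x.1, 0)) (fun x => (x.1, 0))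
      (by fun_prop) (by fun_prop) (.of_forall ?_) ?_
    · rintro _ z rfl; rfl
    · filter_upwards [(hU.prod isOpen_univ).mem_nhds (show (y, (0 : ι → ℂ)) ∈ U ×ˢ Set.univ from
        ⟨hy, trivial⟩)] with a ha z hz
      subst hz
      have := hs z.1 ha.1
      rw [Subsingleton.elim z.2 0, map_zero]

/-- The direct sum of a family of vector bundles, locally all but finitely many of which are zero. -/
def VB.pi {I : Type} (E : I → VB B)
    (hE : ∀ b, ∃ s : Finset I, ∀ᶠ y in 𝓝 b, ∀ i ∉ s, Subsingleton ((E i).fib y)) : VB B where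
  fib b := ∀ i, (E i).fib b
  top := TopologicalSpace.induced
    (fun p : Σ b, ∀ i, (E i).fib b => (p.1, fun i => (E i).pt p.1 (p.2 i))) inferInstance
  locTriv := locTriv_of_isLT _ fun b => by
    classical
    obtain ⟨s, hs⟩ := hE b
    obtain ⟨W, hW, hWo, hbW⟩ := eventually_nhds_iff.1 hs
    choose n U τ hb h using fun i => (E i).exists_lt b
    let V : Set B := W ∩ ⋂ i ∈ s, U i
    have hV : IsOpen V := hWo.inter (isOpen_biInter_finset fun i _ => (h i).isOpen)
    have key : ∀ i, ∃ (m : ℕ) (σ : ∀ y, (E i).fib y →ₗ[ℂ] (Fin m → ℂ)),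
        (i ∉ s → m = 0) ∧ IsLT (E i).top V σ := by
      intro i
      by_cases hi : i ∈ s
      · exact ⟨n i, τ i, fun h => (h hi).elim, (h i).mono hV fun y hy =>
          Set.mem_iInter₂.1 hy.2 i hi⟩
      · exact ⟨0, fun _ => 0, fun _ => rfl, (E i).isLT_zero hV fun y hy => hW y hy.1 i hi⟩
    choose m σ hm hσ using key
    have hfin : Finite (Σ i, Fin (m i)) := by
      have : Function.Injective (fun x : Σ i, Fin (m i) => (⟨⟨x.1, by
          by_contra hi; have := x.2.2; simp [hm _ hi] at this⟩, x.2⟩ :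
          Σ i : {i // i ∈ s}, Fin (m i.1))) := by
        rintro ⟨i, a⟩ ⟨j, c⟩ h
        simp only [Sigma.mk.injEq, Subtype.mk.injEq] at h
        obtain ⟨rfl, h⟩ := h
        rw [eq_of_heq h]
      exact Finite.of_injective _ this
    refine ⟨Σ i, Fin (m i), hfin, V, fun y => LinearMap.pi fun x =>
      (LinearMap.proj x.2) ∘ₗ (σ x.1 y) ∘ₗ (LinearMap.proj x.1), ?_,
      isLT_of_induced hV (fun y hy => ⟨fun v w hvw => ?_, fun c => ?_⟩)
      (Prod.map id (Pi.map fun i (p : (E i).Tot) => (p.1, σ i p.1 p.2)))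
      (fun x => (x.1, fun k => (x.2 k.1).2 k.2)) (fun x => (x.1, fun i => (x.1, fun k => x.2 ⟨i, k⟩)))
      (fun y hy v => ?_) (fun y hy v => by fun_prop) (fun y hy v => by fun_prop) (fun p => rfl)
      (fun p hp => rfl)⟩
    · exact ⟨hbW, Set.mem_iInter₂.2 fun i _ => hb i⟩
    · funext i
      apply ((hσ i).bij y hy).1
      funext k
      exact congrFun hvw ⟨i, k⟩
    · choose v hv using fun i => ((hσ i).bij y hy).2 fun k => c ⟨i, k⟩
      exact ⟨v, funext fun k => congrFun (hv k.1) k.2⟩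
    · exact nhds_prod_comap comap_id.symm (nhds_pi_comap fun i => (hσ i).nhds' hy (v i))

/-- A family of subspaces of the fibres of a vector bundle (given by injections `i y` into them)
which is the image of a continuous fibrewise projection is a vector bundle, with the subspace
topology. -/
def VB.embed (E : VB B) (fib : B → Type u) [∀ b, AddCommGroup (fib b)] [∀ b, Module ℂ (fib b)]
    (i : ∀ y, fib y →ₗ[ℂ] E.fib y) (hi : ∀ y, Function.Injective (i y))
    (hp : ∃ p : ∀ y, E.fib y →ₗ[ℂ] E.fib y, Continuous (fun q : E.Tot => E.pt q.1 (p q.1 q.2)) ∧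
      (∀ y v, p y (i y v) = i y v) ∧ ∀ y v, ∃ w, p y v = i y w) : VB B where
  fib := fib
  top := TopologicalSpace.induced (fun q : Σ b, fib b => E.pt q.1 (i q.1 q.2)) inferInstance
  locTriv := locTriv_of_isLT _ fun b => by
    classical
    obtain ⟨p, hpc, hp1, hp2⟩ := hp
    obtain ⟨n, U, τ, hb, h⟩ := E.exists_lt b
    -- the projection in coordinates
    let P : B → ((Fin n → ℂ) →L[ℂ] (Fin n → ℂ)) := fun y =>
      LinearMap.toContinuousLinearMap (τ y ∘ₗ p y ∘ₗ linv (τ y))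
    have hP : ∀ y, y ∈ U → ContinuousAt P y := by
      intro y hy
      rw [continuousAt_clm_apply]
      intro c
      have h1 : ContinuousAt (fun z => E.pt z (linv (τ z) c)) y :=
        h.frame (c := fun _ => c) continuousAt_id hy continuousAt_const
      have h2 := hpc.continuousAt.comp h1
      exact ((h.continuousAt_iff (F := fun z => E.pt z (p z (linv (τ z) c))) (t := y) hy).1 h2).2
    have hPτ : ∀ y, y ∈ U → ∀ v, P y (τ y v) = τ y (p y v) := by
      intro y hy v
      change τ y (p y (linv (τ y) (τ y v))) = _
      rw [linv_left (h.bij y hy)]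
    have hPP : ∀ y, y ∈ U → P y * P y = P y := by
      intro y hy
      ext1 c
      obtain ⟨v, rfl⟩ := (h.bij y hy).2 c
      change P y (P y (τ y v)) = P y (τ y v)
      rw [hPτ y hy, hPτ y hy]
      obtain ⟨w, hw⟩ := hp2 y v
      rw [hw, hp1]
    let S : B → ((Fin n → ℂ) →L[ℂ] (Fin n → ℂ)) := fun y => P b * P y + (1 - P b) * (1 - P y)
    have hSc : ∀ y, y ∈ U → ContinuousAt S y := fun y hy =>
      (continuousAt_const.mul (hP y hy)).add (continuousAt_const.mul (continuousAt_const.sub (hP y hy)))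
    have hSb : S b = 1 := by
      have := hPP b hb
      simp only [S, mul_sub, sub_mul, this]; simp
    have hSP : ∀ y, y ∈ U → S y * P y = P b * P y := by
      intro y hy
      have := hPP y hy
      simp only [S, add_mul, mul_assoc, sub_mul, one_mul, this]; simp
    have hPS : ∀ y, P b * S y = P b * P y := by
      intro y
      have := hPP b hb
      simp only [S, mul_add, mul_sub, ← mul_assoc, this, mul_one]; simp
    let U' : Set B := U ∩ {y | IsUnit (S y)}
    have hU' : IsOpen U' := by
      rw [isOpen_iff_mem_nhds]
      rintro y ⟨hy, hu⟩
      exact inter_mem (h.isOpen.mem_nhds hy) ((hSc y hy).preimage_mem_nhds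
        (Units.isOpen.mem_nhds hu))
    let R : Submodule ℂ (Fin n → ℂ) := LinearMap.range (P b).toLinearMap
    let bas := Module.finBasis ℂ R
    let L : (Fin n → ℂ) →ₗ[ℂ] (Fin (Module.finrank ℂ R) → ℂ) :=
      bas.equivFun.toLinearMap ∘ₗ (P b).toLinearMap.rangeRestrict
    let M : (Fin (Module.finrank ℂ R) → ℂ) →ₗ[ℂ] (Fin n → ℂ) :=
      R.subtype ∘ₗ bas.equivFun.symm.toLinearMap
    have hL : Continuous L := L.continuous_of_finiteDimensional
    have hM : Continuous M := M.continuous_of_finiteDimensional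
    have hML : ∀ c, M (L c) = P b c := by
      intro c
      simp only [M, L, LinearMap.comp_apply, LinearEquiv.coe_coe, LinearEquiv.symm_apply_apply]
      rfl
    have hLM : ∀ d, L (M d) = d := by
      intro d
      simp only [M, L, LinearMap.comp_apply, LinearEquiv.coe_coe]
      have : (P b).toLinearMap.rangeRestrict (R.subtype (bas.equivFun.symm d)) =
          bas.equivFun.symm d := by
        apply Subtype.ext
        obtain ⟨c, hc⟩ := (bas.equivFun.symm d).2
        change P b ((bas.equivFun.symm d : R) : Fin n → ℂ) = _
        rw [← hc]
        exact congrArg (fun A : (Fin n → ℂ) →L[ℂ] (Fin n → ℂ) => A c) (hPP b hb)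
      rw [this, LinearEquiv.apply_symm_apply]
    -- `S y` maps the image of `P y` isomorphically to that of `P b`
    have hPi : ∀ y, y ∈ U → ∀ v, P y (τ y (i y v)) = τ y (i y v) := fun y hy v => by
      rw [hPτ y hy, hp1]
    have hMS : ∀ y, y ∈ U → ∀ v, M (L (S y (τ y (i y v)))) = S y (τ y (i y v)) := by
      intro y hy v
      rw [hML]
      have e1 := congrArg (fun A : (Fin n → ℂ) →L[ℂ] (Fin n → ℂ) => A (τ y (i y v))) (hPS y)
      have e2 := congrArg (fun A : (Fin n → ℂ) →L[ℂ] (Fin n → ℂ) => A (τ y (i y v))) (hSP y hy)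
      change P b (S y _) = P b (P y _) at e1
      change S y (P y _) = P b (P y _) at e2
      rw [e1, ← e2, hPi y hy]
    have hinv : ∀ y, y ∈ U' → ∀ c, Ring.inverse (S y) (S y c) = c := by
      intro y hy c
      exact congrArg (fun A : (Fin n → ℂ) →L[ℂ] (Fin n → ℂ) => A c) (Ring.inverse_mul_cancel _ hy.2)
    refine ⟨Fin (Module.finrank ℂ R), inferInstance, U', fun y =>
      L ∘ₗ (S y).toLinearMap ∘ₗ τ y ∘ₗ i y, ⟨hb, (hSb ▸ isUnit_one : IsUnit (S b))⟩,
      isLT_of_induced hU' (fun y hy => ⟨fun v w hvw => ?_, fun d => ?_⟩)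
      (fun q : E.Tot => (q.1, τ q.1 q.2)) (fun x => (x.1, L (S x.1 x.2)))
      (fun x => (x.1, Ring.inverse (S x.1) (M x.2))) (fun y hy v => h.nhds' hy.1 (i y v))
      (fun y hy v => ?_) (fun y hy v => ?_) (fun p => rfl) (fun q hq => ?_)⟩
    · have h1 := congrArg M hvw
      change M (L (S y (τ y (i y v)))) = M (L (S y (τ y (i y w)))) at h1
      rw [hMS y hy.1, hMS y hy.1] at h1
      have h2 := congrArg (fun c => (Ring.inverse (S y) : (Fin n → ℂ) →L[ℂ] (Fin n → ℂ)) c) h1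
      rw [hinv y hy, hinv y hy] at h2
      exact hi y ((h.bij y hy.1).1 h2)
    · have e0 : S y (Ring.inverse (S y) (M d)) = M d :=
        congrArg (fun A : (Fin n → ℂ) →L[ℂ] (Fin n → ℂ) => A (M d)) (Ring.mul_inverse_cancel _ hy.2)
      obtain ⟨v, hv⟩ := (h.bij y hy.1).2 (Ring.inverse (S y) (M d))
      obtain ⟨w, hw⟩ := hp2 y v
      have e1 := congrArg (fun A : (Fin n → ℂ) →L[ℂ] (Fin n → ℂ) => A (τ y v)) (hPS y)
      have e2 := congrArg (fun A : (Fin n → ℂ) →L[ℂ] (Fin n → ℂ) => A (τ y v)) (hSP y hy.1)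
      change P b (S y _) = P b (P y _) at e1
      change S y (P y _) = P b (P y _) at e2
      refine ⟨w, ?_⟩
      change L (S y (τ y (i y w))) = d
      rw [← hw, ← hPτ y hy.1, e2, ← e1, hv, e0, ← hML, hLM, hLM]
    · have h1 : ContinuousAt (fun x : B × (Fin n → ℂ) => S x.1 x.2) (y, τ y (i y v)) :=
        ((hSc y hy.1).comp (f := Prod.fst) (x := (y, τ y (i y v))) continuousAt_fst).clm_apply
          continuousAt_snd
      exact continuousAt_fst.prodMk (hL.continuousAt.comp h1)
    · obtain ⟨s, hs⟩ := hy.2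
      have h0 : ContinuousAt Ring.inverse (S y) := by
        rw [← hs]; exact NormedRing.inverse_continuousAt s
      have h1 := (ContinuousAt.comp (f := S) (x := y) h0 (hSc y hy.1)).comp
        (f := (Prod.fst : B × (Fin (Module.finrank ℂ R) → ℂ) → B))
        (x := (y, (L ∘ₗ (S y).toLinearMap ∘ₗ τ y ∘ₗ i y) v)) continuousAt_fst
      exact continuousAt_fst.prodMk (h1.clm_apply (hM.continuousAt.comp continuousAt_snd))
    · change (q.1, Ring.inverse (S q.1) (M (L (S q.1 (τ q.1 (i q.1 q.2)))))) = (q.1, τ q.1 (i q.1 q.2))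
      rw [hMS q.1 hq.1, hinv q.1 hq]

/-- The topology on a family of vector spaces defined by local coordinates. -/
@[reducible] def coordTop (fib : B → Type u) [∀ b, AddCommGroup (fib b)] [∀ b, Module ℂ (fib b)]
    (ι : B → Type) (τ : ∀ b y, fib y →ₗ[ℂ] (ι b → ℂ)) : TopologicalSpace (Σ b, fib b) :=
  TopologicalSpace.mkOfNhds fun p =>
    comap (fun q : Σ b, fib b => (q.1, τ p.1 q.1 q.2)) (𝓝 (p.1, τ p.1 p.1 p.2))

theorem isLT_coordTop {fib : B → Type u} [∀ b, AddCommGroup (fib b)] [∀ b, Module ℂ (fib b)]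
    {ι : B → Type} [∀ b, Fintype (ι b)] [∀ b, DecidableEq (ι b)] {U : B → Set B}
    (hU : ∀ b, IsOpen (U b)) (hbU : ∀ b, b ∈ U b)
    {τ : ∀ b y, fib y →ₗ[ℂ] (ι b → ℂ)} (hbij : ∀ b, ∀ y ∈ U b, Function.Bijective (τ b y))
    (htrans : ∀ b b', ∀ y ∈ U b ∩ U b', ∀ j,
      ContinuousAt (fun z => τ b' z (linv (τ b z) (Pi.single j 1))) y) (b : B) :
    IsLT (coordTop fib ι τ) (U b) (τ b) := by
  have hjoint : ∀ b b', ∀ y ∈ U b ∩ U b', ∀ c,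
      ContinuousAt (fun x : B × (ι b → ℂ) => (x.1, τ b' x.1 (linv (τ b x.1) x.2))) (y, c) := by
    intro b b' y hy c
    refine continuousAt_fst.prodMk ?_
    have h1 : (fun x : B × (ι b → ℂ) => τ b' x.1 (linv (τ b x.1) x.2)) = fun x =>
        ∑ j, x.2 j • τ b' x.1 (linv (τ b x.1) (Pi.single j 1)) := by
      funext x
      conv_lhs => rw [pi_eq_sum_univ' x.2]
      simp only [map_sum, map_smul]
    rw [h1]
    refine tendsto_finsetSum _ fun j _ => Filter.Tendsto.smul
      (((continuous_apply j).comp continuous_snd).tendsto (y, c)) ?_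
    exact (htrans b b' y hy j).comp (f := Prod.fst) (x := (y, c)) continuousAt_fst
  have hcomap : ∀ b b', ∀ y ∈ U b ∩ U b', ∀ v : fib y,
      comap (fun q : Σ b, fib b => (q.1, τ b q.1 q.2)) (𝓝 (y, τ b y v)) =
      comap (fun q : Σ b, fib b => (q.1, τ b' q.1 q.2)) (𝓝 (y, τ b' y v)) := by
    intro b b' y hy v
    have hev : ∀ (b b'), y ∈ U b ∩ U b' → ∀ᶠ a in 𝓝 (y, τ b y v), ∀ z : Σ b, fib b,
        (z.1, τ b z.1 z.2) = a → (z.1, τ b' z.1 z.2) = (a.1, τ b' a.1 (linv (τ b a.1) a.2)) := by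
      intro b b' hy
      filter_upwards [((hU b).prod isOpen_univ).mem_nhds (show (y, τ b y v) ∈ U b ×ˢ Set.univ from
        ⟨hy.1, trivial⟩)] with a ha z hz
      subst hz
      simp only [linv_left (hbij b z.1 ha.1)]
    exact comap_nhds_congr (f := fun q : Σ b, fib b => (q.1, τ b q.1 q.2)) (z := ⟨y, v⟩)
      _ _ (hjoint b b' y hy (τ b y v)) (hjoint b' b y hy.symm (τ b' y v)) (hev b b' hy)
      (hev b' b hy.symm)
  refine ⟨hU b, hbij b, fun y hy v => ?_⟩
  rw [coordTop, TopologicalSpace.nhds_mkOfNhds]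
  · exact hcomap y b y ⟨hbU y, hy⟩ v
  · intro p
    exact (tendsto_pure_left.2 fun s hs => mem_of_mem_nhds hs).le_comap
  · rintro p s ⟨t, ht, hts⟩
    have h1 : ∀ᶠ a in 𝓝 (p.1, τ p.1 p.1 p.2), a.1 ∈ U p.1 ∧ t ∈ 𝓝 a :=
      (continuousAt_fst.eventually ((hU p.1).mem_nhds (hbU p.1))).and (eventually_mem_nhds_iff.2 ht)
    filter_upwards [tendsto_comap.eventually h1] with q hq
    rw [show q = ⟨q.1, q.2⟩ from rfl, hcomap q.1 p.1 q.1 ⟨hbU q.1, hq.1⟩ q.2]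
    exact ⟨t, hq.2, hts⟩

/-- Chosen local coordinates of a vector bundle around `b`. -/
def VB.rk (E : VB B) (b : B) : ℕ := (E.exists_lt b).choose
def VB.nbhd (E : VB B) (b : B) : Set B := (E.exists_lt b).choose_spec.choose
def VB.coord (E : VB B) (b : B) : ∀ y, E.fib y →ₗ[ℂ] (Fin (E.rk b) → ℂ) :=
  (E.exists_lt b).choose_spec.choose_spec.choose
theorem VB.mem_nbhd (E : VB B) (b : B) : b ∈ E.nbhd b :=
  (E.exists_lt b).choose_spec.choose_spec.choose_spec.1
theorem VB.isLT (E : VB B) (b : B) : IsLT E.top (E.nbhd b) (E.coord b) :=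
  (E.exists_lt b).choose_spec.choose_spec.choose_spec.2
def VB.frame (E : VB B) (b : B) (j : Fin (E.rk b)) (y : B) : E.fib y :=
  linv (E.coord b y) (Pi.single j 1)

theorem VB.frame_cont (E : VB B) (b : B) (j : Fin (E.rk b)) {g : T → B} (hg : ContinuousAt g t)
    (hb : g t ∈ E.nbhd b) : ContinuousAt (fun s => E.pt (g s) (E.frame b j (g s))) t :=
  (E.isLT b).frame (c := fun _ => Pi.single j 1) hg hb continuousAt_const

theorem linv_eq {V W : Type*} [AddCommGroup V] [Module ℂ V] [AddCommGroup W] [Module ℂ W]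
    {f : V →ₗ[ℂ] W} (h : Function.Bijective f) {v : V} {w : W} (e : f v = w) : linv f w = v := by
  rw [← e, linv_left h]

/-- The basis of a fibre given by the chosen frame. -/
def coordBasis {V : Type*} [AddCommGroup V] [Module ℂ V] {ι : Type} [Finite ι]
    {f : V →ₗ[ℂ] (ι → ℂ)} (h : Function.Bijective f) : Module.Basis ι ℂ V :=
  .ofEquivFun (LinearEquiv.ofBijective f h)

theorem coordBasis_repr {V : Type*} [AddCommGroup V] [Module ℂ V] {ι : Type} [Finite ι]
    {f : V →ₗ[ℂ] (ι → ℂ)} (h : Function.Bijective f) (v : V) (i : ι) :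
    (coordBasis h).repr v i = f v i := rfl

/-- Tensor products of coordinates. -/
def tensorCoord {V W : Type*} [AddCommGroup V] [Module ℂ V] [AddCommGroup W] [Module ℂ W]
    {ι κ : Type} (f : V →ₗ[ℂ] (ι → ℂ)) (g : W →ₗ[ℂ] (κ → ℂ)) : V ⊗[ℂ] W →ₗ[ℂ] (ι × κ → ℂ) :=
  LinearMap.pi fun x => TensorProduct.lift
    ((LinearMap.mul ℂ ℂ).compl₁₂ (LinearMap.proj x.1 ∘ₗ f) (LinearMap.proj x.2 ∘ₗ g))

theorem tensorCoord_tmul {V W : Type*} [AddCommGroup V] [Module ℂ V] [AddCommGroup W] [Module ℂ W]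
    {ι κ : Type} (f : V →ₗ[ℂ] (ι → ℂ)) (g : W →ₗ[ℂ] (κ → ℂ)) (v : V) (w : W) (x : ι × κ) :
    tensorCoord f g (v ⊗ₜ w) x = f v x.1 * g w x.2 := rfl

theorem tensorCoord_bij {V W : Type*} [AddCommGroup V] [Module ℂ V] [AddCommGroup W] [Module ℂ W]
    {ι κ : Type} [Finite ι] [Finite κ] {f : V →ₗ[ℂ] (ι → ℂ)} {g : W →ₗ[ℂ] (κ → ℂ)}
    (hf : Function.Bijective f) (hg : Function.Bijective g) :
    Function.Bijective (tensorCoord f g) := by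
  have : tensorCoord f g = ((coordBasis hf).tensorProduct (coordBasis hg)).equivFun.toLinearMap := by
    apply TensorProduct.ext'
    intro v w
    funext x
    rw [tensorCoord_tmul]
    change _ = ((coordBasis hf).tensorProduct (coordBasis hg)).repr (v ⊗ₜ[ℂ] w) (x.1, x.2)
    rw [Module.Basis.tensorProduct_repr_tmul_apply, coordBasis_repr, coordBasis_repr, smul_eq_mul,
      mul_comm]
  rw [this]
  exact LinearEquiv.bijective _

theorem VB.tensor_isLT (E F : VB B) (b : B) : IsLT (coordTop (fun b => E.fib b ⊗[ℂ] F.fib b)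
    (fun b => Fin (E.rk b) × Fin (F.rk b)) fun b y => tensorCoord (E.coord b y) (F.coord b y))
    (E.nbhd b ∩ F.nbhd b) (fun y => tensorCoord (E.coord b y) (F.coord b y)) := by
  have hbij : ∀ b, ∀ y ∈ E.nbhd b ∩ F.nbhd b,
      Function.Bijective (tensorCoord (E.coord b y) (F.coord b y)) := fun b y hy =>
    tensorCoord_bij ((E.isLT b).bij y hy.1) ((F.isLT b).bij y hy.2)
  refine isLT_coordTop (U := fun b => E.nbhd b ∩ F.nbhd b)
    (fun b => (E.isLT b).isOpen.inter (F.isLT b).isOpen)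
    (fun b => ⟨E.mem_nbhd b, F.mem_nbhd b⟩) hbij (fun b b' y hy j => ?_) b
  have h1 : ∀ᶠ z in 𝓝 y, tensorCoord (E.coord b' z) (F.coord b' z) (E.frame b j.1 z ⊗ₜ F.frame b j.2 z)
      = tensorCoord (E.coord b' z) (F.coord b' z)
        (linv (tensorCoord (E.coord b z) (F.coord b z)) (Pi.single j 1)) := by
    filter_upwards [((E.isLT b).isOpen.inter (F.isLT b).isOpen).mem_nhds hy.1] with z hz
    congr 1
    refine (linv_eq (hbij b z hz) ?_).symm
    funext x
    rw [tensorCoord_tmul]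
    simp only [VB.frame, linv_right ((E.isLT b).bij z hz.1),
      linv_right ((F.isLT b).bij z hz.2), Pi.single_apply, Prod.ext_iff, ite_and, mul_ite, mul_one,
      mul_zero]
    split_ifs <;> rfl
  refine ContinuousAt.congr (continuousAt_pi.2 fun x => ?_) h1
  have e1 := (((E.isLT b').continuousAt_iff (F := fun z => E.pt z (E.frame b j.1 z)) hy.2.1).1
    (E.frame_cont b j.1 continuousAt_id hy.1.1)).2
  have e2 := (((F.isLT b').continuousAt_iff (F := fun z => F.pt z (F.frame b j.2 z)) hy.2.2).1
    (F.frame_cont b j.2 continuousAt_id hy.1.2)).2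
  exact (continuousAt_pi.1 e1 x.1).mul (continuousAt_pi.1 e2 x.2)

/-- The tensor product of two vector bundles. -/
def VB.tensor (E F : VB B) : VB B where
  fib b := E.fib b ⊗[ℂ] F.fib b
  top := coordTop _ (fun b => Fin (E.rk b) × Fin (F.rk b)) fun b y =>
    tensorCoord (E.coord b y) (F.coord b y)
  locTriv := locTriv_of_isLT _ fun b =>
    ⟨_, inferInstance, E.nbhd b ∩ F.nbhd b, _, ⟨E.mem_nbhd b, F.mem_nbhd b⟩, E.tensor_isLT F b⟩

theorem VB.tensor_cont (E F : VB B) {g : T → B} {v : ∀ t, E.fib (g t)} {w : ∀ t, F.fib (g t)}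
    (hv : ContinuousAt (fun s => E.pt (g s) (v s)) t)
    (hw : ContinuousAt (fun s => F.pt (g s) (w s)) t) :
    ContinuousAt (fun s => (E.tensor F).pt (g s) (v s ⊗ₜ w s)) t := by
  refine ((E.tensor_isLT F (g t)).continuousAt_iff (F := fun s => (E.tensor F).pt (g s) (v s ⊗ₜ w s))
    ⟨E.mem_nbhd _, F.mem_nbhd _⟩).2 ⟨E.contAtFst hv, continuousAt_pi.2 fun x => ?_⟩
  have e1 := ((E.isLT (g t)).continuousAt_iff (F := fun s => E.pt (g s) (v s)) (E.mem_nbhd _)).1 hv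
  have e2 := ((F.isLT (g t)).continuousAt_iff (F := fun s => F.pt (g s) (w s)) (F.mem_nbhd _)).1 hw
  exact (continuousAt_pi.1 e1.2 x.1).mul (continuousAt_pi.1 e2.2 x.2)

/-- Tensor products of coordinates. -/
def piCoord {I : Type} [Fintype I] {V : I → Type*} [∀ i, AddCommGroup (V i)] [∀ i, Module ℂ (V i)]
    {ι : I → Type} (f : ∀ i, V i →ₗ[ℂ] (ι i → ℂ)) : (⨂[ℂ] i, V i) →ₗ[ℂ] ((∀ i, ι i) → ℂ) :=
  LinearMap.pi fun x => PiTensorProduct.lift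
    ((MultilinearMap.mkPiAlgebra ℂ I ℂ).compLinearMap fun i => LinearMap.proj (x i) ∘ₗ f i)

theorem piCoord_tprod {I : Type} [Fintype I] {V : I → Type*} [∀ i, AddCommGroup (V i)]
    [∀ i, Module ℂ (V i)] {ι : I → Type} (f : ∀ i, V i →ₗ[ℂ] (ι i → ℂ)) (v : ∀ i, V i)
    (x : ∀ i, ι i) : piCoord f (PiTensorProduct.tprod ℂ v) x = ∏ i, f i (v i) (x i) := by
  simp [piCoord]

theorem piCoord_bij {I : Type} [Fintype I] {V : I → Type*} [∀ i, AddCommGroup (V i)]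
    [∀ i, Module ℂ (V i)] {ι : I → Type} [∀ i, Finite (ι i)] {f : ∀ i, V i →ₗ[ℂ] (ι i → ℂ)}
    (hf : ∀ i, Function.Bijective (f i)) : Function.Bijective (piCoord f) := by
  have : piCoord f = (Basis.piTensorProduct fun i => coordBasis (hf i)).equivFun.toLinearMap := by
    apply PiTensorProduct.ext
    ext v x
    simp [piCoord_tprod, coordBasis_repr]
  rw [this]
  exact LinearEquiv.bijective _

theorem VB.piTensor_isLT {I : Type} [Fintype I] [DecidableEq I] (E : I → VB B) (b : B) :
    IsLT (coordTop (fun b => ⨂[ℂ] i, (E i).fib b)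
    (fun b => ∀ i, Fin ((E i).rk b)) fun b y => piCoord fun i => (E i).coord b y)
    (⋂ i, (E i).nbhd b) (fun y => piCoord fun i => (E i).coord b y) := by
  have hbij : ∀ b, ∀ y ∈ ⋂ i, (E i).nbhd b,
      Function.Bijective (piCoord fun i => (E i).coord b y) := fun b y hy =>
    piCoord_bij fun i => ((E i).isLT b).bij y (Set.mem_iInter.1 hy i)
  have hopen : ∀ b, IsOpen (⋂ i, (E i).nbhd b) := fun b =>
    isOpen_iInter_of_finite fun i => ((E i).isLT b).isOpen
  refine isLT_coordTop (U := fun b => ⋂ i, (E i).nbhd b) hopen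
    (fun b => Set.mem_iInter.2 fun i => (E i).mem_nbhd b) hbij (fun b b' y hy j => ?_) b
  have h1 : ∀ᶠ z in 𝓝 y, (piCoord fun i => (E i).coord b' z)
        (PiTensorProduct.tprod ℂ fun i => (E i).frame b (j i) z)
      = (piCoord fun i => (E i).coord b' z)
        (linv (piCoord fun i => (E i).coord b z) (Pi.single j 1)) := by
    filter_upwards [(hopen b).mem_nhds hy.1] with z hz
    congr 1
    refine (linv_eq (hbij b z hz) ?_).symm
    funext x
    rw [piCoord_tprod]
    simp only [VB.frame, linv_right (((E _).isLT b).bij z (Set.mem_iInter.1 hz _)), Pi.single_apply]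
    rw [Finset.prod_ite_zero]
    simp [funext_iff]
  refine ContinuousAt.congr (continuousAt_pi.2 fun x => ?_) h1
  have e1 := fun i => ((((E i).isLT b').continuousAt_iff
    (F := fun z => (E i).pt z ((E i).frame b (j i) z)) (Set.mem_iInter.1 hy.2 i)).1
    ((E i).frame_cont b (j i) continuousAt_id (Set.mem_iInter.1 hy.1 i))).2
  simp only [piCoord_tprod]
  exact tendsto_finsetProd _ fun i _ => continuousAt_pi.1 (e1 i) (x i)

/-- The tensor product of a finite family of vector bundles. -/
def VB.piTensor {I : Type} [Fintype I] [DecidableEq I] (E : I → VB B) : VB B where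
  fib b := ⨂[ℂ] i, (E i).fib b
  top := coordTop _ (fun b => ∀ i, Fin ((E i).rk b)) fun b y => piCoord fun i => (E i).coord b y
  locTriv := locTriv_of_isLT _ fun b =>
    ⟨_, inferInstance, _, _, Set.mem_iInter.2 fun i => (E i).mem_nbhd b, VB.piTensor_isLT E b⟩

theorem VB.piTensor_cont {I : Type} [Fintype I] [DecidableEq I] (E : I → VB B) {g : T → B}
    {v : ∀ t i, (E i).fib (g t)} (hg : ContinuousAt g t)
    (hv : ∀ i, ContinuousAt (fun s => (E i).pt (g s) (v s i)) t) :
    ContinuousAt (fun s => (VB.piTensor E).pt (g s) (PiTensorProduct.tprod ℂ (v s))) t := by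
  refine ((VB.piTensor_isLT E (g t)).continuousAt_iff
    (F := fun s => (VB.piTensor E).pt (g s) (PiTensorProduct.tprod ℂ (v s)))
    (Set.mem_iInter.2 fun i => (E i).mem_nbhd _)).2 ⟨hg, continuousAt_pi.2 fun x => ?_⟩
  have e1 := fun i => (((E i).isLT (g t)).continuousAt_iff (F := fun s => (E i).pt (g s) (v s i))
    ((E i).mem_nbhd _)).1 (hv i)
  change ContinuousAt (fun s => piCoord (fun i => (E i).coord (g t) (g s))
    (PiTensorProduct.tprod ℂ (v s)) x) t
  simp only [piCoord_tprod]
  exact tendsto_finsetProd _ fun i _ => continuousAt_pi.1 (e1 i).2 (x i)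

/-- Transport between equal members of a family of bundles. -/
def VB.castFib {I : Type} (E : I → VB B) {i j : I} (h : i = j) (b : B) :
    (E i).fib b ≃ₗ[ℂ] (E j).fib b := by
  subst h; exact LinearEquiv.refl ℂ _

/-- The pull-back of a family of vector bundles `E i` on `B` along a continuous map `f : A → B` and
a locally constant map `k : A → I`: its fibre over `a` is the fibre of `E (k a)` over `f a`. -/
def VB.lpull {A : Type u} [TopologicalSpace A] {I : Type} (E : I → VB B) (k : A → I)
    (hk : IsLocallyConstant k) (f : A → B) (hf : Continuous f) : VB A where
  fib a := (E (k a)).fib (f a)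
  top := TopologicalSpace.induced (fun p : Σ a, (E (k a)).fib (f a) =>
    (p.1, (⟨k p.1, (E (k p.1)).pt (f p.1) p.2⟩ : Σ i, (E i).Tot))) inferInstance
  locTriv := locTriv_of_isLT _ fun a => by
    classical
    obtain ⟨n, U, τ, hb, h⟩ := (E (k a)).exists_lt (f a)
    let σ : ∀ (i : I) (b : B), (E i).fib b →ₗ[ℂ] (Fin n → ℂ) := fun i b =>
      if hi : i = k a then τ b ∘ₗ (VB.castFib E hi b).toLinearMap else 0
    have hσ : ∀ b, σ (k a) b = τ b := fun b => by simp [σ, VB.castFib]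
    let _ : TopologicalSpace I := ⊥
    have : DiscreteTopology I := ⟨rfl⟩
    have hkc : Continuous k := hk.continuous
    have hk' : IsOpen {x | k x = k a} := hk.isOpen_fiber (k a)
    refine ⟨Fin n, inferInstance, {x | k x = k a} ∩ f ⁻¹' U, fun x => σ (k x) (f x), ⟨rfl, hb⟩,
      isLT_of_induced (hk'.inter (h.isOpen.preimage hf)) (fun y hy => ?_)
      (Prod.map id fun p : Σ i, (E i).Tot => (p.1, (p.2.1, σ p.1 p.2.1 p.2.2)))
      (fun x => (x.1, x.2.2.2)) (fun x => (x.1, (k x.1, (f x.1, x.2)))) (fun y hy v => ?_)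
      (fun y hy v => by fun_prop) (fun y hy v => by fun_prop) (fun p => rfl) (fun p hp => rfl)⟩
    · have := h.bij _ hy.2
      rw [← hσ, ← show k y = k a from hy.1] at this
      exact this
    · refine nhds_prod_comap comap_id.symm ?_
      have key : ∀ i, i = k a → ∀ b ∈ U, ∀ v : (E i).fib b,
          𝓝 (⟨i, (E i).pt b v⟩ : Σ i, (E i).Tot) =
          comap (fun p : Σ i, (E i).Tot => (p.1, (p.2.1, σ p.1 p.2.1 p.2.2)))
            (𝓝 (i, (b, σ i b v))) := by
        rintro i rfl b hb v
        rw [Sigma.nhds_mk, h.nhds' hb v, hσ, nhds_prod_eq (x := k a), nhds_discrete I]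
        ext s
        simp only [mem_map, mem_comap]
        constructor
        · rintro ⟨t, ht, hs⟩
          refine ⟨{k a} ×ˢ t, prod_mem_prod (mem_pure.2 rfl) ht, ?_⟩
          rintro ⟨i, p⟩ ⟨hi, hp⟩
          obtain rfl : i = k a := hi
          simp only [hσ] at hp
          exact hs hp
        · rintro ⟨t, ht, hs⟩
          refine ⟨Prod.mk (k a) ⁻¹' t, ?_, fun p hp => hs ?_⟩
          · rw [pure_prod] at ht; exact ht
          · simp only [Set.mem_preimage, hσ]; exact hp
      exact key (k y) hy.1 (f y) hy.2 v

end Constructions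

section ContLemmas

variable {B : Type u} [TopologicalSpace B] {T : Type*} [TopologicalSpace T] {t : T}

theorem continuousAt_prod_iff {Y Z : Type*} [TopologicalSpace Y] [TopologicalSpace Z]
    {f : T → Y} {g : T → Z} :
    ContinuousAt (fun s => (f s, g s)) t ↔ ContinuousAt f t ∧ ContinuousAt g t := by
  unfold ContinuousAt
  rw [nhds_prod_eq, Filter.tendsto_prod_iff']

theorem VB.pull_iff {A : Type u} [TopologicalSpace A] (E : VB B) (f : A → B) (hf : Continuous f)
    {g : T → A} {v : ∀ t, E.fib (f (g t))} :
    ContinuousAt (fun s => (E.pull f hf).pt (g s) (v s)) t ↔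
      ContinuousAt g t ∧ ContinuousAt (fun s => E.pt (f (g s)) (v s)) t :=
  (Topology.IsInducing.continuousAt_iff (f := fun s => (E.pull f hf).pt (g s) (v s)) ⟨rfl⟩).trans
    continuousAt_prod_iff

theorem VB.prod_iff (E F : VB B) {g : T → B} {v : ∀ t, E.fib (g t)} {w : ∀ t, F.fib (g t)} :
    ContinuousAt (fun s => (E.prod F).pt (g s) (v s, w s)) t ↔
      ContinuousAt (fun s => E.pt (g s) (v s)) t ∧ ContinuousAt (fun s => F.pt (g s) (w s)) t :=
  (Topology.IsInducing.continuousAt_iff (f := fun s => (E.prod F).pt (g s) (v s, w s)) ⟨rfl⟩).trans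
    continuousAt_prod_iff

theorem VB.pi_iff {I : Type} (E : I → VB B)
    (hE : ∀ b, ∃ s : Finset I, ∀ᶠ y in 𝓝 b, ∀ i ∉ s, Subsingleton ((E i).fib y)) {g : T → B}
    {v : ∀ t i, (E i).fib (g t)} :
    ContinuousAt (fun s => (VB.pi E hE).pt (g s) (v s)) t ↔
      ContinuousAt g t ∧ ∀ i, ContinuousAt (fun s => (E i).pt (g s) (v s i)) t :=
  (Topology.IsInducing.continuousAt_iff (f := fun s => (VB.pi E hE).pt (g s) (v s)) ⟨rfl⟩).trans
    (continuousAt_prod_iff.trans (and_congr_right fun _ => continuousAt_pi))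

theorem VB.embed_iff (E : VB B) (fib : B → Type u) [∀ b, AddCommGroup (fib b)]
    [∀ b, Module ℂ (fib b)] (i : ∀ y, fib y →ₗ[ℂ] E.fib y) (hi) (hp) {g : T → B}
    {v : ∀ t, fib (g t)} :
    ContinuousAt (fun s => (E.embed fib i hi hp).pt (g s) (v s)) t ↔
      ContinuousAt (fun s => E.pt (g s) (i (g s) (v s))) t :=
  Topology.IsInducing.continuousAt_iff (f := fun s => (E.embed fib i hi hp).pt (g s) (v s)) ⟨rfl⟩

theorem continuousAt_sigma_iff {I : Type*} {Z : I → Type*} [∀ i, TopologicalSpace (Z i)]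
    {c : T → Σ i, Z i} : ContinuousAt c t ↔ ∀ w ∈ 𝓝 (c t).2, ∀ᶠ s in 𝓝 t,
      ∃ z ∈ w, c s = ⟨(c t).1, z⟩ := by
  unfold ContinuousAt
  rw [Sigma.nhds_eq, tendsto_def]
  constructor
  · intro h w hw
    filter_upwards [h _ (image_mem_map hw)] with s hs
    obtain ⟨z, hz, e⟩ := hs
    exact ⟨z, hz, e.symm⟩
  · intro h w hw
    filter_upwards [h _ hw] with s ⟨z, hz, e⟩
    simpa [e] using hz

theorem VB.lpull_iff {A : Type u} [TopologicalSpace A] {I : Type} (E : I → VB B) (k : A → I)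
    (hk : IsLocallyConstant k) (f : A → B) (hf : Continuous f) {g : T → A}
    {v : ∀ t, (E (k (g t))).fib (f (g t))} {i : I} (hi : ∀ᶠ s in 𝓝 t, k (g s) = i)
    (v' : ∀ t, (E i).fib (f (g t))) (hv : ∀ s (h : k (g s) = i), v' s = VB.castFib E h _ (v s)) :
    ContinuousAt (fun s => (VB.lpull E k hk f hf).pt (g s) (v s)) t ↔
      ContinuousAt g t ∧ ContinuousAt (fun s => (E i).pt (f (g s)) (v' s)) t := by
  refine (Topology.IsInducing.continuousAt_iff
    (f := fun s => (VB.lpull E k hk f hf).pt (g s) (v s)) ⟨rfl⟩).trans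
    (continuousAt_prod_iff.trans (and_congr_right fun _ => ?_))
  have e1 : (fun s => (⟨k (g s), (E (k (g s))).pt (f (g s)) (v s)⟩ : Σ i, (E i).Tot)) =ᶠ[𝓝 t]
      fun s => ⟨i, (E i).pt (f (g s)) (v' s)⟩ := by
    filter_upwards [hi] with s hs
    rw [hv s hs]
    generalize v s = w
    generalize k (g s) = j at hs w
    subst hs
    rfl
  exact (continuousAt_congr e1).trans
    (Topology.IsEmbedding.sigmaMk (σ := fun i => (E i).Tot)).isInducing.continuousAt_iff.symm

/-- Continuity of finite families of varying length. -/
theorem continuousAt_fam {Z : Type*} [TopologicalSpace Z] {c : T → Σ n, (Fin n → Z)}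
    (h1 : ∀ᶠ s in 𝓝 t, (c s).1 = (c t).1)
    (h2 : ∀ j : Fin (c t).1, ∃ f : T → Z, ContinuousAt f t ∧
      ∀ᶠ s in 𝓝 t, ∀ i : Fin (c s).1, i.val = j.val → (c s).2 i = f s) : ContinuousAt c t := by
  choose f hf hfe using h2
  rw [← eventually_all] at hfe
  have e : (fun s => (⟨(c t).1, fun j => f j s⟩ : Σ n, (Fin n → Z))) =ᶠ[𝓝 t] c := by
    filter_upwards [h1, hfe] with s hs hs'
    generalize c s = d at hs hs'
    obtain ⟨n, d⟩ := d
    obtain rfl : n = (c t).1 := hs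
    congr 1
    funext j
    exact (hs' j j rfl).symm
  refine ContinuousAt.congr ?_ e
  exact continuous_sigmaMk.continuousAt.comp (continuousAt_pi.2 hf)

theorem eventually_fam_card {Z : Type*} [TopologicalSpace Z] {c : T → Σ n, (Fin n → Z)}
    (h : ContinuousAt c t) : ∀ᶠ s in 𝓝 t, (c s).1 = (c t).1 := by
  filter_upwards [continuousAt_sigma_iff.1 h _ univ_mem] with s ⟨z, _, e⟩
  rw [e]

theorem continuousAt_fam_apply {Z : Type*} [TopologicalSpace Z] {c : T → Σ n, (Fin n → Z)}
    (h : ContinuousAt c t) (i : Fin (c t).1) : ∃ g : T → Z, ContinuousAt g t ∧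
      ∀ s, ∀ j : Fin (c s).1, j.val = i.val → (c s).2 j = g s := by
  refine ⟨fun s => if h : i.val < (c s).1 then (c s).2 ⟨i, h⟩ else (c t).2 i, ?_, ?_⟩
  · intro w hw
    simp only [Fin.is_lt, ↓reduceDIte, Fin.eta] at hw
    rw [mem_map]
    have h1 := continuousAt_sigma_iff.1 h _ ((continuous_apply i).continuousAt.preimage_mem_nhds hw)
    filter_upwards [h1] with s ⟨z, hz, e⟩
    simp only [Set.mem_preimage]
    generalize c s = d at e
    subst e
    simpa using hz
  · rintro s ⟨j, hj⟩ rfl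
    simp [hj]

end ContLemmas

/-! ### Topological groupoids -/

/-- The arrows of a groupoid. -/
structure Arr (X : Type u) [Groupoid.{u} X] : Type u where
  src : X
  tgt : X
  hom : src ⟶ tgt

/-- A groupoid with topologies on objects and arrows such that source and target are continuous. -/
class ArrTop (X : Type u) [Groupoid.{u} X] [TopologicalSpace X] where
  top : TopologicalSpace (Arr X)
  src_cont : Continuous fun a : Arr X => a.src
  tgt_cont : Continuous fun a : Arr X => a.tgt

instance {X : Type u} [Groupoid.{u} X] [TopologicalSpace X] [ArrTop X] : TopologicalSpace (Arr X) :=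
  ArrTop.top

/-- An arrow as a point of the space of arrows. -/
def arr {X : Type u} [Groupoid.{u} X] {x y : X} (f : x ⟶ y) : Arr X := ⟨x, y, f⟩

/-- A topological groupoid: units, inverses and composition are also continuous. -/
class TopGpd (X : Type u) [Groupoid.{u} X] [TopologicalSpace X] [ArrTop X] : Prop where
  id_cont : Continuous fun x : X => arr (𝟙 x)
  inv_cont : Continuous fun a : Arr X => arr (Groupoid.inv a.hom)
  comp_cont : Continuous fun p : {p : Arr X × Arr X // p.1.tgt = p.2.src} =>
    arr (p.1.1.hom ≫ eqToHom p.2 ≫ p.1.2.hom)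

/-- The topology on arrows which is induced by source, target and a further map. -/
@[reducible] def ArrTop.ofCode {X : Type u} [Groupoid.{u} X] [TopologicalSpace X] {C : Type*}
    [TopologicalSpace C] (code : Arr X → C) : ArrTop X :=
  let _ : TopologicalSpace (Arr X) :=
    TopologicalSpace.induced (fun a => (a.src, a.tgt, code a)) inferInstance
  have h : Continuous fun a : Arr X => (a.src, a.tgt, code a) := continuous_induced_dom
  { top := inferInstance
    src_cont := continuous_fst.comp h
    tgt_cont := continuous_fst.comp (continuous_snd.comp h) }

theorem ArrTop.ofCode_iff {X : Type u} [Groupoid.{u} X] [TopologicalSpace X] {C : Type*}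
    [TopologicalSpace C] (code : Arr X → C) {T : Type*} [TopologicalSpace T] {t : T}
    {a : T → Arr X} : @ContinuousAt _ _ _ (ArrTop.ofCode code).top a t ↔
      ContinuousAt (fun s => (a s).src) t ∧ ContinuousAt (fun s => (a s).tgt) t ∧
      ContinuousAt (fun s => code (a s)) t := by
  let _ := (ArrTop.ofCode code).top
  exact (Topology.IsInducing.continuousAt_iff (f := a) ⟨rfl⟩).trans
    (continuousAt_prod_iff.trans (and_congr_right fun _ => continuousAt_prod_iff))

section Gpd

variable {X : Type u} [Groupoid.{u} X] [TopologicalSpace X] [ArrTop X]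
  {T : Type*} [TopologicalSpace T] {t : T}

theorem contAt_src {x y : T → X} {f : ∀ s, x s ⟶ y s} (h : ContinuousAt (fun s => arr (f s)) t) :
    ContinuousAt x t := ArrTop.src_cont.continuousAt.comp h

theorem contAt_tgt {x y : T → X} {f : ∀ s, x s ⟶ y s} (h : ContinuousAt (fun s => arr (f s)) t) :
    ContinuousAt y t := ArrTop.tgt_cont.continuousAt.comp h

theorem contAt_comp [TopGpd X] {x y z : T → X} {f : ∀ s, x s ⟶ y s} {g : ∀ s, y s ⟶ z s}
    (hf : ContinuousAt (fun s => arr (f s)) t) (hg : ContinuousAt (fun s => arr (g s)) t) :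
    ContinuousAt (fun s => arr (f s ≫ g s)) t := by
  have h : ContinuousAt (fun s => (⟨(arr (f s), arr (g s)), rfl⟩ :
      {p : Arr X × Arr X // p.1.tgt = p.2.src})) t :=
    Topology.IsInducing.subtypeVal.continuousAt_iff.2 (continuousAt_prod_iff.2 ⟨hf, hg⟩)
  have h2 := TopGpd.comp_cont.continuousAt.comp h
  refine h2.congr (.of_forall fun s => ?_)
  simp [arr]

/-- A center element: a continuous natural transformation from the identity to itself. -/
structure Cen (X : Type u) [Groupoid.{u} X] [TopologicalSpace X] [ArrTop X] where
  app : ∀ x : X, x ⟶ x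
  nat : ∀ {x y : X} (f : x ⟶ y), app x ≫ f = f ≫ app y
  cont : Continuous fun x => arr (app x)

/-- A continuous functor. -/
structure CFun (X : Type u) [Groupoid.{u} X] [TopologicalSpace X] [ArrTop X]
    (Y : Type u) [Groupoid.{u} Y] [TopologicalSpace Y] [ArrTop Y] extends X ⥤ Y where
  obj_cont : Continuous obj
  map_cont : Continuous fun a : Arr X => arr (map a.hom)

theorem CFun.contAt {Y : Type u} [Groupoid.{u} Y] [TopologicalSpace Y] [ArrTop Y] (F : CFun X Y)
    {x y : T → X} {f : ∀ s, x s ⟶ y s} (h : ContinuousAt (fun s => arr (f s)) t) :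
    ContinuousAt (fun s => arr (F.map (f s))) t := F.map_cont.continuousAt.comp h

end Gpd

/-! ### The inertia groupoid -/

/-- Powers of an automorphism. -/
def iter {X : Type u} [Groupoid.{u} X] {x : X} (g : x ⟶ x) : ℕ → (x ⟶ x)
  | 0 => 𝟙 x
  | n + 1 => iter g n ≫ g

theorem iter_comm {X : Type u} [Groupoid.{u} X] {x y : X} {g : x ⟶ x} {g' : y ⟶ y} {h : x ⟶ y}
    (e : g ≫ h = h ≫ g') : ∀ n, iter g n ≫ h = h ≫ iter g' n
  | 0 => by simp [iter]
  | n + 1 => by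
    simp only [iter, Category.assoc]; rw [e, ← Category.assoc, iter_comm e n, Category.assoc]

/-- An object of the inertia groupoid of `X`: an automorphism in `X`. -/
@[ext] structure Inertia (X : Type u) [Groupoid.{u} X] : Type u where
  pt : X
  loop : pt ⟶ pt

section Inertia

variable {X : Type u} [Groupoid.{u} X]

instance : Groupoid.{u} (Inertia X) where
  Hom p q := {h : p.pt ⟶ q.pt // p.loop ≫ h = h ≫ q.loop}
  id p := ⟨𝟙 _, by simp⟩
  comp f g := ⟨f.1 ≫ g.1, by rw [← Category.assoc, f.2, Category.assoc, g.2, Category.assoc]⟩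
  inv f := ⟨Groupoid.inv f.1, by
    have h := f.2
    simp only [Groupoid.inv_eq_inv] at h ⊢
    rw [IsIso.eq_inv_comp, ← Category.assoc, ← h, Category.assoc, IsIso.hom_inv_id,
      Category.comp_id]⟩
  id_comp f := Subtype.ext (Category.id_comp _)
  comp_id f := Subtype.ext (Category.comp_id _)
  assoc f g h := Subtype.ext (Category.assoc _ _ _)
  inv_comp f := Subtype.ext (Groupoid.inv_comp _)
  comp_inv f := Subtype.ext (Groupoid.comp_inv _)

variable [TopologicalSpace X] [ArrTop X]

instance : TopologicalSpace (Inertia X) := TopologicalSpace.induced (fun p => arr p.loop) inferInstance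

instance : ArrTop (Inertia X) := ArrTop.ofCode fun a : Arr (Inertia X) => arr a.hom.1

variable {T : Type*} [TopologicalSpace T] {t : T}

theorem Inertia.obj_iff {p : T → Inertia X} :
    ContinuousAt p t ↔ ContinuousAt (fun s => arr (p s).loop) t :=
  Topology.IsInducing.continuousAt_iff ⟨rfl⟩

theorem Inertia.arr_iff {p q : T → Inertia X} {f : ∀ s, p s ⟶ q s} :
    ContinuousAt (fun s => arr (f s)) t ↔
    ContinuousAt (fun s => arr (p s).loop) t ∧ ContinuousAt (fun s => arr (q s).loop) t ∧
      ContinuousAt (fun s => arr (f s).1) t := by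
  rw [← Inertia.obj_iff, ← Inertia.obj_iff]
  exact ArrTop.ofCode_iff _

/-- The canonical center element of the inertia groupoid. -/
def Inertia.cen (X : Type u) [Groupoid.{u} X] [TopologicalSpace X] [ArrTop X] : Cen (Inertia X) where
  app p := ⟨p.loop, rfl⟩
  nat f := Subtype.ext f.2
  cont := continuous_iff_continuousAt.2 fun _ => Inertia.arr_iff.2
    ⟨Inertia.obj_iff.1 continuousAt_id, Inertia.obj_iff.1 continuousAt_id,
      Inertia.obj_iff.1 continuousAt_id⟩

/-- The functor on inertia groupoids induced by a functor. -/
def Inertia.map {Y : Type u} [Groupoid.{u} Y] [TopologicalSpace Y] [ArrTop Y] (F : CFun X Y) :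
    CFun (Inertia X) (Inertia Y) where
  obj p := ⟨F.obj p.pt, F.map p.loop⟩
  map f := ⟨F.map f.1, by rw [← F.map_comp, f.2, F.map_comp]⟩
  map_id p := Subtype.ext (F.map_id _)
  map_comp f g := Subtype.ext (F.map_comp _ _)
  obj_cont := continuous_iff_continuousAt.2 fun p => Inertia.obj_iff.2
    (F.contAt (Inertia.obj_iff.1 continuousAt_id))
  map_cont := continuous_iff_continuousAt.2 fun a => by
    have h := Inertia.arr_iff.1 (continuousAt_id (X := Arr (Inertia X)) (x := a))
    exact Inertia.arr_iff.2 ⟨F.contAt h.1, F.contAt h.2.1, F.contAt h.2.2⟩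

theorem contAt_iter [TopGpd X] {x : T → X} {g : ∀ s, x s ⟶ x s}
    (h : ContinuousAt (fun s => arr (g s)) t) :
    ∀ n, ContinuousAt (fun s => arr (iter (g s) n)) t
  | 0 => TopGpd.id_cont.continuousAt.comp (contAt_src h)
  | n + 1 => contAt_comp (contAt_iter h n) h

/-- The power map of the inertia groupoid, which sends the automorphism `g` to `g ^ k`. -/
def Inertia.powMap (X : Type u) [Groupoid.{u} X] [TopologicalSpace X] [ArrTop X] [TopGpd X] (k : ℕ) :
    CFun (Inertia X) (Inertia X) where
  obj p := ⟨p.pt, iter p.loop k⟩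
  map f := ⟨f.1, iter_comm f.2 k⟩
  map_id _ := rfl
  map_comp _ _ := rfl
  obj_cont := continuous_iff_continuousAt.2 fun p => Inertia.obj_iff.2
    (contAt_iter (Inertia.obj_iff.1 continuousAt_id) k)
  map_cont := continuous_iff_continuousAt.2 fun a => by
    have h := Inertia.arr_iff.1 (continuousAt_id (X := Arr (Inertia X)) (x := a))
    exact Inertia.arr_iff.2 ⟨contAt_iter h.1 k, contAt_iter h.2.1 k, h.2.2⟩

end Inertia

/-! ### Symmetric powers of groupoids -/

/-- A morphism between finite families of objects: a bijection `perm` of the index sets and arrows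
from `x i` to `y (perm i)`. -/
structure FamHom {X : Type u} [Groupoid.{u} X] {I J : Type} (x : I → X) (y : J → X) : Type u where
  perm : I ≃ J
  hom : ∀ i j, perm i = j → (x i ⟶ y j)

section FamHom

variable {X : Type u} [Groupoid.{u} X] {I J K L : Type} {x : I → X} {y : J → X} {z : K → X}
  {w : L → X}

theorem FamHom.ext {A B : FamHom x y} (h1 : A.perm = B.perm)
    (h2 : ∀ i j h h', A.hom i j h = B.hom i j h') : A = B := by
  obtain ⟨σ, a⟩ := A
  obtain ⟨τ, b⟩ := B
  obtain rfl : σ = τ := h1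
  congr 1
  funext i j h
  exact h2 i j h h

def FamHom.id (x : I → X) : FamHom x x := ⟨.refl I, fun i j h => eqToHom (by rw [← h]; rfl)⟩

def FamHom.comp (A : FamHom x y) (B : FamHom y z) : FamHom x z :=
  ⟨A.perm.trans B.perm, fun i k h => A.hom i _ rfl ≫ B.hom _ k h⟩

def FamHom.inv (A : FamHom x y) : FamHom y x :=
  ⟨A.perm.symm, fun j i h => Groupoid.inv (A.hom i j (by rw [← h, Equiv.apply_symm_apply]))⟩

theorem FamHom.comp_hom (A : FamHom x y) (B : FamHom y z) (i j k) (h : A.perm i = j)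
    (h' : B.perm j = k) (h'') : (A.comp B).hom i k h'' = A.hom i j h ≫ B.hom j k h' := by
  subst h; rfl

theorem FamHom.id_comp (A : FamHom x y) : (FamHom.id x).comp A = A :=
  FamHom.ext rfl fun i j h h' => by
    rw [FamHom.comp_hom (FamHom.id x) A i i j rfl h']
    simp [FamHom.id]

theorem FamHom.comp_id (A : FamHom x y) : A.comp (FamHom.id y) = A :=
  FamHom.ext rfl fun i j h h' => by
    rw [FamHom.comp_hom A (FamHom.id y) i j j h' rfl]
    simp [FamHom.id]

theorem FamHom.assoc (A : FamHom x y) (B : FamHom y z) (C : FamHom z w) :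
    (A.comp B).comp C = A.comp (B.comp C) :=
  FamHom.ext rfl fun i j h h' => by simp only [FamHom.comp, Category.assoc]; rfl

theorem FamHom.inv_comp (A : FamHom x y) : A.inv.comp A = FamHom.id y :=
  FamHom.ext (Equiv.symm_trans_self _) fun i j h h' => by
    obtain rfl : i = j := h'
    rw [FamHom.comp_hom A.inv A i _ i rfl (Equiv.apply_symm_apply _ _)]
    simp [FamHom.inv, FamHom.id]

theorem FamHom.comp_inv (A : FamHom x y) : A.comp A.inv = FamHom.id x :=
  FamHom.ext (Equiv.self_trans_symm _) fun i j h h' => by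
    obtain rfl : i = j := h'
    rw [FamHom.comp_hom A A.inv i _ i rfl (Equiv.symm_apply_apply _ _)]
    simp [FamHom.inv, FamHom.id]

/-- Reindexing of families. -/
def FamHom.reindex (A : FamHom x y) (e : I ≃ K) (e' : J ≃ L) :
    FamHom (x ∘ e.symm) (y ∘ e'.symm) :=
  ⟨(e.symm.trans A.perm).trans e', fun k l h => A.hom _ _ (by rw [← h]; simp)⟩

/-- Disjoint unions of families. -/
def FamHom.sum (A : FamHom x y) (B : FamHom z w) : FamHom (Sum.elim x z) (Sum.elim y w) :=
  ⟨A.perm.sumCongr B.perm, fun p q h => match p, q, h with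
    | .inl _, .inl _, h => A.hom _ _ (Sum.inl_injective h)
    | .inr _, .inr _, h => B.hom _ _ (Sum.inr_injective h)
    | .inl _, .inr _, h => (Sum.inl_ne_inr h).elim
    | .inr _, .inl _, h => (Sum.inr_ne_inl h).elim⟩

/-- A family of automorphisms. -/
def FamHom.diag (g : ∀ i, x i ⟶ x i) : FamHom x x :=
  ⟨.refl I, fun i j h => g i ≫ eqToHom (by rw [← h]; rfl)⟩

theorem FamHom.diag_hom (g : ∀ i, x i ⟶ x i) (i h) : (FamHom.diag g).hom i i h = g i := by
  simp [FamHom.diag]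

theorem FamHom.diag_comm {g : ∀ i, x i ⟶ x i} {g' : ∀ i, y i ⟶ y i} (A : FamHom x y)
    (h : ∀ i j e, g i ≫ A.hom i j e = A.hom i j e ≫ g' j) :
    (FamHom.diag g).comp A = A.comp (FamHom.diag g') :=
  FamHom.ext rfl fun i j e e' => by
    rw [FamHom.comp_hom (FamHom.diag g) A i i j rfl e', FamHom.comp_hom A (FamHom.diag g') i j j e' rfl]
    exact (congrArg (· ≫ A.hom i j e') (FamHom.diag_hom g i _)).trans
      ((h i j e').trans (congrArg (A.hom i j e' ≫ ·) (FamHom.diag_hom g' j _).symm))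

theorem FamHom.reindex_id (e : I ≃ K) : (FamHom.id x).reindex e e = FamHom.id (x ∘ e.symm) :=
  FamHom.ext (by ext; simp [FamHom.reindex, FamHom.id]) fun i j h h' => rfl

theorem FamHom.reindex_comp {I' J' K' : Type} (A : FamHom x y) (B : FamHom y z) (e : I ≃ I')
    (e' : J ≃ J') (e'' : K ≃ K') :
    (A.comp B).reindex e e'' = (A.reindex e e').comp (B.reindex e' e'') :=
  FamHom.ext (by ext; simp [FamHom.reindex, FamHom.comp]) fun i j h h' => by
    rw [FamHom.comp_hom (A.reindex e e') (B.reindex e' e'') i _ j rfl h']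
    exact FamHom.comp_hom A B _ _ _ _ _ _

theorem FamHom.sum_id : (FamHom.id x).sum (FamHom.id z) = FamHom.id (Sum.elim x z) :=
  FamHom.ext (by ext p; rcases p with p | p <;> rfl) (by
    rintro (i | i) (j | j) h h'
    · rfl
    · exact (Sum.inl_ne_inr h').elim
    · exact (Sum.inr_ne_inl h').elim
    · rfl)

theorem FamHom.sum_comp {I' K' : Type} {x' : I' → X} {z' : K' → X} (A : FamHom x y)
    (A' : FamHom y x') (B : FamHom z w) (B' : FamHom w z') :
    (A.comp A').sum (B.comp B') = (A.sum B).comp (A'.sum B') :=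
  FamHom.ext (by ext p; rcases p with p | p <;> rfl) (by
    rintro (i | i) (j | j) h h'
    · rfl
    · exact (Sum.inl_ne_inr h').elim
    · exact (Sum.inr_ne_inl h').elim
    · rfl)

theorem arr_hom_congr (A : FamHom x y) {i i' j j'} (h : A.perm i = j)
    (h' : A.perm i' = j') (e : i = i') : arr (A.hom i j h) = arr (A.hom i' j' h') := by
  subst e; subst h; subst h'; rfl

end FamHom

/-- The symmetric power `Sₙ ∫ X`: its objects are families of `n` objects of `X`. -/
def SymN (n : ℕ) (X : Type u) : Type u := Fin n → X

/-- The total symmetric power of `X`. -/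
def Sym (X : Type u) : Type u := Σ n, (Fin n → X)

section Sym

variable {X : Type u} [Groupoid.{u} X] {n : ℕ}

instance : Groupoid.{u} (SymN n X) where
  Hom x y := FamHom (I := Fin n) (J := Fin n) x y
  id x := FamHom.id (I := Fin n) x
  comp := FamHom.comp
  inv := FamHom.inv
  id_comp := FamHom.id_comp
  comp_id := FamHom.comp_id
  assoc := FamHom.assoc
  inv_comp := FamHom.inv_comp
  comp_inv := FamHom.comp_inv

instance : Groupoid.{u} (Sym X) where
  Hom x y := FamHom x.2 y.2
  id x := FamHom.id x.2
  comp := FamHom.comp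
  inv := FamHom.inv
  id_comp := FamHom.id_comp
  comp_id := FamHom.comp_id
  assoc := FamHom.assoc
  inv_comp := FamHom.inv_comp
  comp_inv := FamHom.comp_inv

variable [TopologicalSpace X] [ArrTop X]

instance : TopologicalSpace (SymN n X) := inferInstanceAs (TopologicalSpace (Fin n → X))

instance : TopologicalSpace (Sym X) := inferInstanceAs (TopologicalSpace (Σ n, (Fin n → X)))

instance : ArrTop (SymN n X) := ArrTop.ofCode fun (a : Arr (SymN n X)) (i : Fin n) =>
  ((a.hom.perm i : ℕ), arr (a.hom.hom i _ rfl))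

instance : ArrTop (Sym X) := ArrTop.ofCode fun (a : Arr (Sym X)) =>
  (⟨a.src.1, fun i => ((a.hom.perm i : ℕ), arr (a.hom.hom i _ rfl))⟩ : Σ n, (Fin n → ℕ × Arr X))

variable {T : Type*} [TopologicalSpace T] {t : T}

theorem continuousAt_nat_iff {f : T → ℕ} : ContinuousAt f t ↔ ∀ᶠ s in 𝓝 t, f s = f t := by
  unfold ContinuousAt
  rw [nhds_discrete ℕ, tendsto_pure]

theorem SymN.arr_iff {x y : T → SymN n X} {f : ∀ s, x s ⟶ y s} :
    ContinuousAt (fun s => arr (f s)) t ↔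
    ∀ i, (∀ᶠ s in 𝓝 t, (f s).perm i = (f t).perm i) ∧
      ContinuousAt (fun s => arr ((f s).hom i _ rfl)) t := by
  refine (ArrTop.ofCode_iff _).trans ⟨fun h i => ?_, fun h => ⟨?_, ?_, ?_⟩⟩
  · have h1 := continuousAt_prod_iff.1 (continuousAt_pi.1 h.2.2 i)
    refine ⟨?_, h1.2⟩
    filter_upwards [continuousAt_nat_iff.1 h1.1] with s hs
    exact Fin.ext hs
  · exact continuousAt_pi.2 fun i => contAt_src (h i).2
  · refine continuousAt_pi.2 fun j => ?_
    have h1 := contAt_tgt (h ((f t).perm.symm j)).2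
    refine h1.congr ?_
    filter_upwards [(h ((f t).perm.symm j)).1] with s hs
    rw [hs, Equiv.apply_symm_apply]; rfl
  · refine continuousAt_pi.2 fun i => continuousAt_prod_iff.2 ⟨continuousAt_nat_iff.2 ?_, (h i).2⟩
    filter_upwards [(h i).1] with s hs
    exact congrArg Fin.val hs

end Sym

section SymTop

variable {X : Type u} [Groupoid.{u} X] [TopologicalSpace X] [ArrTop X] {n : ℕ}
  {T : Type*} [TopologicalSpace T] {t : T}

theorem Sym.hn {x y : Sym X} (f : x ⟶ y) : y.1 = x.1 := by
  simpa using (Fintype.card_congr f.perm).symm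

theorem Sym.obj_of {x : T → Sym X} (hn : ∀ᶠ s in 𝓝 t, (x s).1 = (x t).1)
    (h : ∀ i : Fin (x t).1, ∃ g : T → X, ContinuousAt g t ∧
      ∀ᶠ s in 𝓝 t, ∀ j : Fin (x s).1, j.val = i.val → (x s).2 j = g s) : ContinuousAt x t :=
  continuousAt_fam hn h

theorem Sym.arr_iff {x y : T → Sym X} {f : ∀ s, x s ⟶ y s} : ContinuousAt (fun s => arr (f s)) t ↔
    (∀ᶠ s in 𝓝 t, (x s).1 = (x t).1) ∧
    ∀ i : Fin (x t).1, (∀ᶠ s in 𝓝 t, ∀ j : Fin (x s).1, (j : ℕ) = i →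
      ((f s).perm j : ℕ) = (f t).perm i) ∧ ∃ g : T → Arr X, ContinuousAt g t ∧
        ∀ᶠ s in 𝓝 t, ∀ j : Fin (x s).1, (j : ℕ) = i → arr ((f s).hom j _ rfl) = g s := by
  constructor
  · intro h
    have h1 := ((ArrTop.ofCode_iff _).1 h).2.2
    refine ⟨eventually_fam_card (c := x) (contAt_src (X := Sym X) (x := x) h), fun i => ?_⟩
    obtain ⟨g, hg, hgf⟩ := continuousAt_fam_apply h1 i
    refine ⟨?_, fun s => (g s).2, hg.snd, .of_forall fun s j hj => congrArg Prod.snd (hgf s j hj)⟩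
    have h2 := continuousAt_nat_iff.1 hg.fst
    filter_upwards [h2] with s hs j hj
    have e1 := congrArg Prod.fst (hgf s j hj)
    have e2 := congrArg Prod.fst (hgf t i rfl)
    simp only at e1 e2
    exact e1.trans (hs.trans e2.symm)
  rintro ⟨hn, h⟩
  have hn' := fun s => Sym.hn (f s)
  refine (ArrTop.ofCode_iff _).2 ⟨?_, ?_, ?_⟩
  · refine continuousAt_fam (c := x) hn fun i => ?_
    obtain ⟨-, g, hg, hgf⟩ := h i
    refine ⟨fun s => (g s).src, ArrTop.src_cont.continuousAt.comp hg, ?_⟩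
    filter_upwards [hgf] with s hs j hj
    rw [← hs j hj]; rfl
  · refine continuousAt_fam (c := y) ?_ fun i => ?_
    · filter_upwards [hn] with s hs
      exact (hn' s).trans (hs.trans (hn' t).symm)
    obtain ⟨i, rfl⟩ := (f t).perm.surjective i
    obtain ⟨h1, g, hg, hgf⟩ := h i
    refine ⟨fun s => (g s).tgt, ArrTop.tgt_cont.continuousAt.comp hg, ?_⟩
    filter_upwards [hgf, h1, hn] with s hs hs1 hsn j hj
    obtain ⟨j, rfl⟩ := (f s).perm.surjective j
    obtain ⟨k, hk⟩ : ∃ k : Fin (x s).1, (k : ℕ) = i := ⟨⟨i, by rw [hsn]; exact i.isLt⟩, rfl⟩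
    obtain rfl : j = k := (f s).perm.injective (Fin.ext (hj.trans (hs1 k hk).symm))
    rw [← hs _ hk]; rfl
  · refine continuousAt_fam hn fun i => ?_
    obtain ⟨h1, g, hg, hgf⟩ := h i
    refine ⟨fun s => (((f t).perm i : ℕ), g s), continuousAt_const.prodMk hg, ?_⟩
    filter_upwards [hgf, h1] with s hs hs1 j hj
    exact Prod.ext (hs1 j hj) (hs j hj)

theorem contAt_comp' [TopGpd X] {a b : T → Arr X} (ha : ContinuousAt a t) (hb : ContinuousAt b t)
    (e : ∀ᶠ s in 𝓝 t, (a s).tgt = (b s).src) : ∃ c : T → Arr X, ContinuousAt c t ∧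
      ∀ᶠ s in 𝓝 t, ∀ (x y z : X) (f : x ⟶ y) (g : y ⟶ z), arr f = a s → arr g = b s →
        arr (f ≫ g) = c s := by
  classical
  let p : T → {p : Arr X × Arr X // p.1.tgt = p.2.src} := fun s =>
    if h : (a s).tgt = (b s).src then ⟨(a s, b s), h⟩ else ⟨(a t, b t), e.self_of_nhds⟩
  have hp : ContinuousAt p t := by
    refine Topology.IsInducing.subtypeVal.continuousAt_iff.2
      ((continuousAt_prod_iff.2 ⟨ha, hb⟩).congr ?_)
    filter_upwards [e] with s hs
    simp [p, hs]
  refine ⟨_, TopGpd.comp_cont.continuousAt.comp hp, ?_⟩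
  filter_upwards [e] with s hs x y z f g hf hg
  have h1 : p s = ⟨(a s, b s), hs⟩ := dif_pos hs
  have h2 : p s = ⟨(arr f, arr g), rfl⟩ := h1.trans (Subtype.ext (Prod.ext hf.symm hg.symm))
  change _ = arr ((p s).1.1.hom ≫ eqToHom (p s).2 ≫ (p s).1.2.hom)
  rw [h2]
  exact congrArg arr (congrArg (f ≫ ·) (Category.id_comp g).symm)

theorem Sym.contAt_comp [TopGpd X] {x y z : T → Sym X} {f : ∀ s, x s ⟶ y s} {g : ∀ s, y s ⟶ z s}
    (hf : ContinuousAt (fun s => arr (f s)) t) (hg : ContinuousAt (fun s => arr (g s)) t) :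
    ContinuousAt (fun s => arr (f s ≫ g s)) t := by
  obtain ⟨hn, hf⟩ := Sym.arr_iff.1 hf
  obtain ⟨-, hg⟩ := Sym.arr_iff.1 hg
  refine Sym.arr_iff.2 ⟨hn, fun i => ?_⟩
  obtain ⟨h1, a, ha, haf⟩ := hf i
  obtain ⟨h2, b, hb, hbf⟩ := hg ((f t).perm i)
  have h3 : ∀ᶠ s in 𝓝 t, ∃ j : Fin (x s).1, j.val = i.val := by
    filter_upwards [hn] with s hs
    exact ⟨⟨i, by rw [hs]; exact i.isLt⟩, rfl⟩
  obtain ⟨c, hc, hcf⟩ := contAt_comp' ha hb (by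
    filter_upwards [haf, hbf, h1, h3] with s haf hbf h1 ⟨j, hj⟩
    rw [← haf j hj, ← hbf _ (h1 j hj)]; rfl)
  refine ⟨?_, c, hc, ?_⟩
  · filter_upwards [h1, h2] with s h1 h2 j hj
    exact h2 _ (h1 j hj)
  · filter_upwards [h1, haf, hbf, hcf] with s h1 haf hbf hcf j hj
    exact hcf _ _ _ _ _ (haf j hj) (hbf _ (h1 j hj))

instance [TopGpd X] : TopGpd (Sym X) where
  id_cont := continuous_iff_continuousAt.2 fun x => by
    have h := continuousAt_id (X := Sym X) (x := x)
    refine Sym.arr_iff.2 ⟨eventually_fam_card h, fun i => ⟨.of_forall fun s j hj => hj, ?_⟩⟩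
    obtain ⟨g, hg, hgf⟩ := continuousAt_fam_apply h i
    refine ⟨_, TopGpd.id_cont.continuousAt.comp hg, .of_forall fun s j hj => ?_⟩
    have e := hgf s j hj
    simp only [id_eq] at e
    change _ = arr (𝟙 (g s))
    rw [← e]
    rfl
  inv_cont := continuous_iff_continuousAt.2 fun a => by
    obtain ⟨hn, h⟩ := Sym.arr_iff.1 (continuousAt_id (X := Arr (Sym X)) (x := a))
    refine Sym.arr_iff.2 ⟨?_, fun i => ?_⟩
    · filter_upwards [hn] with s hs
      exact (Sym.hn s.hom).trans (hs.trans (Sym.hn a.hom).symm)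
    obtain ⟨i, rfl⟩ := a.hom.perm.surjective i
    obtain ⟨h1, g, hg, hgf⟩ := h i
    have key : ∀ᶠ s : Arr (Sym X) in 𝓝 a, ∀ j, (s.hom.perm j : ℕ) = a.hom.perm i → (j : ℕ) = i := by
      filter_upwards [h1, hn] with s hs1 hsn j hj
      obtain ⟨k, hk⟩ : ∃ k : Fin s.src.1, (k : ℕ) = i :=
        ⟨⟨i, by rw [show s.src.1 = _ from hsn]; exact i.isLt⟩, rfl⟩
      obtain rfl : j = k := s.hom.perm.injective (Fin.ext (hj.trans (hs1 k hk).symm))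
      exact hk
    refine ⟨?_, _, TopGpd.inv_cont.continuousAt.comp hg, ?_⟩
    · filter_upwards [key] with s hs j hj
      obtain ⟨j, rfl⟩ := s.hom.perm.surjective j
      have e1 : (Groupoid.inv s.hom).perm (s.hom.perm j) = j := s.hom.perm.symm_apply_apply j
      have e2 : (Groupoid.inv a.hom).perm (a.hom.perm i) = i := a.hom.perm.symm_apply_apply i
      rw [e1, e2]
      exact hs j hj
    · filter_upwards [key, hgf] with s hs hs2 j hj
      obtain ⟨j, rfl⟩ := s.hom.perm.surjective j
      have e1 : (Groupoid.inv s.hom).perm (s.hom.perm j) = j := s.hom.perm.symm_apply_apply j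
      simp only [Function.comp_apply]
      rw [← hs2 j (hs j hj), arr_hom_congr (Groupoid.inv s.hom) rfl e1 rfl]
      rfl
  comp_cont := continuous_iff_continuousAt.2 fun p => by
    have h := continuousAt_id (X := {p : Arr (Sym X) × Arr (Sym X) // p.1.tgt = p.2.src}) (x := p)
    have h1 := (continuous_subtype_val.continuousAt (x := p)).fst
    have h2 := (continuous_subtype_val.continuousAt (x := p)).snd
    have := Sym.contAt_comp (t := p) (f := fun s : {p : Arr (Sym X) × Arr (Sym X) // p.1.tgt = p.2.src} =>
      s.1.1.hom ≫ eqToHom s.2) (g := fun s => s.1.2.hom)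
      (h1.congr (.of_forall fun ⟨(⟨x, y, f⟩, ⟨x', y', g⟩), e⟩ => by
        obtain rfl : y = x' := e
        simp [arr])) h2
    simpa only [Category.assoc] using this

end SymTop

/-! ### Orbits of the loop rotation on the symmetric powers -/

/-- The groupoid `Φ(X)`, the coproduct of the `Φₖ(X)` for `k ≥ 1`: the full subgroupoid of the
inertia groupoid of the total symmetric power, on the automorphisms of families of `k` objects whose
underlying permutation is the standard cycle of length `k`. -/
structure Phi (X : Type u) [Groupoid.{u} X] : Type u where
  ob : Inertia (Sym X)
  pos : 0 < ob.pt.1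
  cyc : ob.loop.perm = finRotate ob.pt.1

section Phi

variable {X : Type u} [Groupoid.{u} X]

instance : Groupoid.{u} (Phi X) where
  Hom p q := p.ob ⟶ q.ob
  id p := 𝟙 p.ob
  comp f g := (f ≫ g : _ ⟶ _)
  inv f := Groupoid.inv f
  id_comp f := Category.id_comp _
  comp_id f := Category.comp_id _
  assoc f g h := Category.assoc _ _ _
  inv_comp f := Groupoid.inv_comp _
  comp_inv f := Groupoid.comp_inv _

/-- The underlying family of an object of `Φ(X)`. -/
def Phi.base (p : Phi X) : Sym X := p.ob.pt
def Phi.loop (p : Phi X) : p.base ⟶ p.base := p.ob.loop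
/-- The length `k` of an object of `Φₖ(X)`. -/
def Phi.len (p : Phi X) : ℕ := p.base.1
def Phi.zero (p : Phi X) : Fin p.base.1 := ⟨0, p.pos⟩
def Phi.val {p q : Phi X} (f : p ⟶ q) : p.base ⟶ q.base := f.1

theorem Phi.comm {p q : Phi X} (f : p ⟶ q) : p.loop ≫ Phi.val f = Phi.val f ≫ q.loop := f.2

variable [TopologicalSpace X] [ArrTop X]

instance : TopologicalSpace (Phi X) := TopologicalSpace.induced Phi.ob inferInstance

instance : ArrTop (Phi X) := ArrTop.ofCode fun a : Arr (Phi X) =>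
  (arr (show a.src.ob ⟶ a.tgt.ob from a.hom) : Arr (Inertia (Sym X)))

variable {T : Type*} [TopologicalSpace T] {t : T}

theorem Phi.obj_iff {p : T → Phi X} : ContinuousAt p t ↔ ContinuousAt (fun s => arr (p s).loop) t :=
  (Topology.IsInducing.continuousAt_iff (g := Phi.ob) ⟨rfl⟩).trans Inertia.obj_iff

theorem Phi.arr_iff {p q : T → Phi X} {f : ∀ s, p s ⟶ q s} : ContinuousAt (fun s => arr (f s)) t ↔
    ContinuousAt (fun s => arr (p s).loop) t ∧ ContinuousAt (fun s => arr (q s).loop) t ∧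
      ContinuousAt (fun s => arr (Phi.val (f s))) t := by
  refine (ArrTop.ofCode_iff _).trans ?_
  rw [Phi.obj_iff.symm, Phi.obj_iff.symm]
  refine and_congr_right fun h1 => and_congr_right fun h2 => Inertia.arr_iff.trans ?_
  exact ⟨fun h => h.2.2, fun h => ⟨Phi.obj_iff.1 h1, Phi.obj_iff.1 h2, h⟩⟩

/-- The center element of `Φ(X)` given by the loop. -/
def Phi.cen (X : Type u) [Groupoid.{u} X] [TopologicalSpace X] [ArrTop X] : Cen (Phi X) where
  app p := ⟨p.loop, rfl⟩
  nat f := Subtype.ext f.2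
  cont := continuous_iff_continuousAt.2 fun _ => Phi.arr_iff.2
    ⟨Phi.obj_iff.1 continuousAt_id, Phi.obj_iff.1 continuousAt_id, Phi.obj_iff.1 continuousAt_id⟩

end Phi

/-! ### Products -/

/-- The product of two groupoids. -/
def GProd (X Y : Type u) : Type u := X × Y

/-- The product of the groupoid `pt // Sₙ` with `X`. -/
def BS (_n : ℕ) (X : Type u) : Type u := X

section Products

variable {X Y : Type u} [Groupoid.{u} X] [Groupoid.{u} Y] {n : ℕ}

instance : Groupoid.{u} (GProd X Y) where
  Hom p q := (p.1 ⟶ q.1) × (p.2 ⟶ q.2)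
  id p := (𝟙 p.1, 𝟙 p.2)
  comp f g := (f.1 ≫ g.1, f.2 ≫ g.2)
  inv f := (Groupoid.inv f.1, Groupoid.inv f.2)
  id_comp f := Prod.ext (Category.id_comp _) (Category.id_comp _)
  comp_id f := Prod.ext (Category.comp_id _) (Category.comp_id _)
  assoc f g h := Prod.ext (Category.assoc _ _ _) (Category.assoc _ _ _)
  inv_comp f := Prod.ext (Groupoid.inv_comp _) (Groupoid.inv_comp _)
  comp_inv f := Prod.ext (Groupoid.comp_inv _) (Groupoid.comp_inv _)

/-- The underlying object of an object of `(pt // Sₙ) × X`. -/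
def BS.fst (x : BS n X) : X := x

instance : Groupoid.{u} (BS n X) where
  Hom p q := Equiv.Perm (Fin n) × (p.fst ⟶ q.fst)
  id p := (1, 𝟙 p.fst)
  comp f g := (g.1 * f.1, f.2 ≫ g.2)
  inv f := (f.1⁻¹, Groupoid.inv f.2)
  id_comp f := Prod.ext (mul_one _) (Category.id_comp _)
  comp_id f := Prod.ext (one_mul _) (Category.comp_id _)
  assoc f g h := Prod.ext (mul_assoc _ _ _).symm (Category.assoc _ _ _)
  inv_comp f := Prod.ext (mul_inv_cancel _) (Groupoid.inv_comp _)
  comp_inv f := Prod.ext (inv_mul_cancel _) (Groupoid.comp_inv _)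

variable [TopologicalSpace X] [ArrTop X] [TopologicalSpace Y] [ArrTop Y]

instance : TopologicalSpace (GProd X Y) := inferInstanceAs (TopologicalSpace (X × Y))
instance : TopologicalSpace (BS n X) := inferInstanceAs (TopologicalSpace X)

instance : ArrTop (GProd X Y) := ArrTop.ofCode fun a : Arr (GProd X Y) => (arr a.hom.1, arr a.hom.2)

instance : ArrTop (BS n X) := ArrTop.ofCode fun a : Arr (BS n X) =>
  ((fun i => (a.hom.1 i : ℕ)), arr a.hom.2)

variable {T : Type*} [TopologicalSpace T] {t : T}

theorem GProd.arr_iff {p q : T → GProd X Y} {f : ∀ s, p s ⟶ q s} :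
    ContinuousAt (fun s => arr (f s)) t ↔
      ContinuousAt (fun s => arr (f s).1) t ∧ ContinuousAt (fun s => arr (f s).2) t := by
  refine (ArrTop.ofCode_iff _).trans ⟨fun h => continuousAt_prod_iff.1 h.2.2, fun h =>
    ⟨continuousAt_prod_iff.2 ⟨contAt_src h.1, contAt_src h.2⟩,
    continuousAt_prod_iff.2 ⟨contAt_tgt h.1, contAt_tgt h.2⟩, continuousAt_prod_iff.2 h⟩⟩

theorem BS.arr_iff {p q : T → BS n X} {f : ∀ s, p s ⟶ q s} :
    ContinuousAt (fun s => arr (f s)) t ↔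
      (∀ᶠ s in 𝓝 t, (f s).1 = (f t).1) ∧ ContinuousAt (fun s => arr (f s).2) t := by
  refine (ArrTop.ofCode_iff _).trans ⟨fun h => ?_, fun h =>
    ⟨contAt_src (X := X) (f := fun s => (f s).2) h.2, contAt_tgt (X := X) (f := fun s => (f s).2) h.2,
    continuousAt_prod_iff.2 ⟨continuousAt_pi.2 fun i => continuousAt_nat_iff.2 ?_, h.2⟩⟩⟩
  · have h1 := continuousAt_prod_iff.1 h.2.2
    refine ⟨?_, h1.2⟩
    have h2 := fun i => continuousAt_nat_iff.1 (continuousAt_pi.1 h1.1 i)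
    rw [← eventually_all] at h2
    filter_upwards [h2] with s hs
    exact Equiv.ext fun i => Fin.ext (hs i)
  · filter_upwards [h.1] with s hs
    exact congrArg (fun σ : Equiv.Perm (Fin n) => (σ i : ℕ)) hs

end Products

/-! ### The structure functors -/

section Functors

theorem finSigma_val {n : ℕ} {c d : Fin n → ℕ} (h : c = d) {p : Σ i, Fin (c i)} {q : Σ i, Fin (d i)}
    (h1 : p.1 = q.1) (h2 : p.2.val = q.2.val) :
    (finSigmaFinEquiv p).val = (finSigmaFinEquiv q).val := by
  subst h
  obtain ⟨i, a⟩ := p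
  obtain ⟨j, b⟩ := q
  obtain rfl : i = j := h1
  obtain rfl : a = b := Fin.ext h2
  rfl

variable {X : Type u} [Groupoid.{u} X] {n m l : ℕ}

/-- Concatenation of a family of families. -/
def Sym.cat (x : Fin n → Sym X) : Sym X :=
  ⟨∑ i, (x i).1, (fun p : Σ i, Fin (x i).1 => (x p.1).2 p.2) ∘ finSigmaFinEquiv.symm⟩

/-- Arrows between families of families. -/
def FamHom.join {I J : Type} {x : I → Sym X} {y : J → Sym X} (A : FamHom x y) :
    FamHom (fun p : Σ i, Fin (x i).1 => (x p.1).2 p.2) (fun p : Σ j, Fin (y j).1 => (y p.1).2 p.2) :=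
  ⟨A.perm.sigmaCongr fun i => (A.hom i (A.perm i) rfl).perm, fun p q h =>
    (A.hom p.1 q.1 (congrArg Sigma.fst h)).hom _ _ (by subst h; rfl)⟩

def Sym.catMap {x : Fin n → Sym X} {y : Fin m → Sym X} (A : FamHom x y) : Sym.cat x ⟶ Sym.cat y :=
  A.join.reindex finSigmaFinEquiv finSigmaFinEquiv

theorem FamHom.join_id {I : Type} (x : I → Sym X) : (FamHom.id x).join = FamHom.id _ :=
  FamHom.ext (by ext p; rfl; rfl) fun i j h h' => by
    obtain rfl : i = j := h'
    rfl

theorem FamHom.join_comp {I J K : Type} {x : I → Sym X} {y : J → Sym X} {z : K → Sym X}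
    (A : FamHom x y) (B : FamHom y z) : (A.comp B).join = A.join.comp B.join :=
  FamHom.ext (by ext p; rfl; rfl) fun i j h h' => by
    subst h'
    rfl

theorem Sym.catMap_id (x : Fin n → Sym X) : Sym.catMap (FamHom.id x) = 𝟙 (Sym.cat x) := by
  rw [Sym.catMap, FamHom.join_id, FamHom.reindex_id]; rfl

theorem Sym.catMap_comp {x : Fin n → Sym X} {y : Fin m → Sym X} {z : Fin l → Sym X} (A : FamHom x y)
    (B : FamHom y z) : Sym.catMap (A.comp B) = Sym.catMap A ≫ Sym.catMap B := by
  rw [Sym.catMap, FamHom.join_comp, FamHom.reindex_comp _ _ _ finSigmaFinEquiv]; rfl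

variable [TopologicalSpace X] [ArrTop X] {T : Type*} [TopologicalSpace T] {t : T}

theorem finSigma_eventually {c : T → Fin n → ℕ}
    (h : ∀ i, ∀ᶠ s in 𝓝 t, c s i = c t i) (i : Fin n) (a : Fin (c t i)) :
    ∀ᶠ s in 𝓝 t, ∀ j : Fin (∑ i, c s i), (j : ℕ) =
      finSigmaFinEquiv (n := c t) ⟨i, a⟩ →
      ∃ b : Fin (c s i), (b : ℕ) = a ∧ j = finSigmaFinEquiv (n := c s) ⟨i, b⟩ := by
  rw [← eventually_all] at h
  filter_upwards [h] with s hs j hj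
  exact ⟨⟨a, by rw [hs i]; exact a.isLt⟩, rfl, Fin.ext (hj.trans (finSigma_val (funext hs) rfl rfl).symm)⟩

theorem Sym.catMap_contAt {x y : T → Fin n → Sym X} {A : ∀ s, FamHom (x s) (y s)}
    (hA : ∀ i, (∀ᶠ s in 𝓝 t, (A s).perm i = (A t).perm i) ∧
      ContinuousAt (fun s => arr ((A s).hom i _ rfl)) t) :
    ContinuousAt (fun s => arr (Sym.catMap (A s))) t := by
  have hx : ∀ i, ∀ᶠ s in 𝓝 t, (x s i).1 = (x t i).1 := fun i => (Sym.arr_iff.1 (hA i).2).1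
  have hy : ∀ i, ∀ᶠ s in 𝓝 t, (y s i).1 = (y t i).1 := fun i => by
    obtain ⟨i, rfl⟩ := (A t).perm.surjective i
    filter_upwards [(hA i).1, hx i] with s h1 h2
    rw [← h1, Sym.hn ((A s).hom i _ rfl), h2, ← Sym.hn ((A t).hom i _ rfl), h1]
  refine Sym.arr_iff.2 ⟨?_, fun k => ?_⟩
  · filter_upwards [eventually_all.2 hx] with s hs
    simp [Sym.cat, hs]
  obtain ⟨⟨i, a⟩, rfl⟩ := (finSigmaFinEquiv (n := fun i => (x t i).1)).surjective k
  obtain ⟨h1, g, hg, hgf⟩ := (Sym.arr_iff.1 (hA i).2).2 a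
  have e : ∀ s (b : Fin (x s i).1),
      (Sym.catMap (A s)).perm (finSigmaFinEquiv (n := fun i => (x s i).1) ⟨i, b⟩) =
      finSigmaFinEquiv (n := fun i => (y s i).1) ⟨(A s).perm i, ((A s).hom i _ rfl).perm b⟩ :=
    fun s b => congrArg (fun p => finSigmaFinEquiv (n := fun i => (y s i).1) ((A s).join.perm p))
      (finSigmaFinEquiv.symm_apply_apply _)
  refine ⟨?_, g, hg, ?_⟩
  · filter_upwards [finSigma_eventually hx i a, h1, (hA i).1, eventually_all.2 hy] with s h2 h1 h3 h4 j hj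
    obtain ⟨b, hb, rfl⟩ := h2 j hj
    rw [e, e]
    exact finSigma_val (funext h4) h3 (h1 b hb)
  · filter_upwards [finSigma_eventually hx i a, hgf] with s h2 h1 j hj
    obtain ⟨b, hb, rfl⟩ := h2 j hj
    rw [← h1 b hb]
    exact arr_hom_congr (A s).join (finSigmaFinEquiv.symm_apply_apply _).symm rfl
      (finSigmaFinEquiv.symm_apply_apply _)

/-- The arrows of families of families underlying an arrow of families in `Φ(X)`. -/
def Phi.under {I J : Type} {o : I → Phi X} {o' : J → Phi X} (f : FamHom o o') :
    FamHom (fun i => (o i).base) (fun i => (o' i).base) :=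
  ⟨f.perm, fun i j h => Phi.val (f.hom i j h)⟩

theorem Phi.under_id {I : Type} (o : I → Phi X) : Phi.under (FamHom.id o) = FamHom.id _ :=
  FamHom.ext rfl fun i j h h' => by
    obtain rfl : i = j := h'
    rfl

theorem Phi.under_comp {I J K : Type} {o : I → Phi X} {o' : J → Phi X} {o'' : K → Phi X}
    (f : FamHom o o') (g : FamHom o' o'') : Phi.under (f.comp g) = (Phi.under f).comp (Phi.under g) :=
  rfl

/-- The equivalence `Q` on the component `Sₙ ∫ Φ(X)`: it sends a family of automorphisms of families
to its concatenation. -/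
def catFun (X : Type u) [Groupoid.{u} X] [TopologicalSpace X] [ArrTop X] (n : ℕ) :
    CFun (SymN n (Phi X)) (Inertia (Sym X)) where
  obj o := ⟨Sym.cat fun i => (o i).base, Sym.catMap (.diag fun i => (o i).loop)⟩
  map {o o'} f := ⟨Sym.catMap (Phi.under f), by
      rw [← Sym.catMap_comp, ← Sym.catMap_comp, FamHom.diag_comm]
      exact fun i j e => Phi.comm (f.hom i j e)⟩
  map_id o := Subtype.ext ((congrArg Sym.catMap (Phi.under_id (I := Fin n) o)).trans
    (Sym.catMap_id fun i => (o i).base))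
  map_comp f g := Subtype.ext ((congrArg Sym.catMap (Phi.under_comp f g)).trans
    (Sym.catMap_comp (Phi.under f) (Phi.under g)))
  obj_cont := continuous_iff_continuousAt.2 fun o => Inertia.obj_iff.2 (Sym.catMap_contAt
    (A := fun o : SymN n (Phi X) => .diag fun i => (o i).loop) fun i => ⟨.of_forall fun _ => rfl, by
      have h : ContinuousAt (fun o : SymN n (Phi X) => o i) o := (continuous_apply i).continuousAt
      refine (Phi.obj_iff.1 h).congr (.of_forall fun o => ?_)
      exact congrArg arr (FamHom.diag_hom (fun i => (o i).loop) i rfl).symm⟩)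
  map_cont := continuous_iff_continuousAt.2 fun a => by
    have hl : ∀ {f : Arr (SymN n (Phi X)) → SymN n (Phi X)}, ContinuousAt f a →
        ContinuousAt (fun s => arr (Sym.catMap (.diag fun i => (f s i).loop))) a := fun {f} hf =>
      Sym.catMap_contAt (A := fun s => .diag fun i => (f s i).loop) fun i => ⟨.of_forall fun _ => rfl, by
        have h : ContinuousAt (fun s => f s i) a := (continuous_apply i).continuousAt.comp hf
        refine (Phi.obj_iff.1 h).congr (.of_forall fun s => ?_)
        exact congrArg arr (FamHom.diag_hom (fun i => (f s i).loop) i rfl).symm⟩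
    have h := SymN.arr_iff.1 (continuousAt_id (X := Arr (SymN n (Phi X))) (x := a))
    refine Inertia.arr_iff.2 ⟨hl ArrTop.src_cont.continuousAt, hl ArrTop.tgt_cont.continuousAt,
      Sym.catMap_contAt fun i => ⟨(h i).1, (Phi.arr_iff.1 (h i).2).2.2⟩⟩

variable {Y : Type u} [Groupoid.{u} Y] [TopologicalSpace Y] [ArrTop Y]

/-- The projections of a product. -/
def GProd.fst (X Y : Type u) [Groupoid.{u} X] [TopologicalSpace X] [ArrTop X] [Groupoid.{u} Y]
    [TopologicalSpace Y] [ArrTop Y] : CFun (GProd X Y) X where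
  obj p := p.1
  map f := f.1
  map_id _ := rfl
  map_comp _ _ := rfl
  obj_cont := continuous_fst
  map_cont := continuous_iff_continuousAt.2 fun _ => (GProd.arr_iff.1 continuousAt_id).1

def GProd.snd (X Y : Type u) [Groupoid.{u} X] [TopologicalSpace X] [ArrTop X] [Groupoid.{u} Y]
    [TopologicalSpace Y] [ArrTop Y] : CFun (GProd X Y) Y where
  obj p := p.2
  map f := f.2
  map_id _ := rfl
  map_comp _ _ := rfl
  obj_cont := continuous_snd
  map_cont := continuous_iff_continuousAt.2 fun _ => (GProd.arr_iff.1 continuousAt_id).2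

/-- The projection `(pt // Sₙ) × X ⟶ X`. -/
def BS.proj (n : ℕ) (X : Type u) [Groupoid.{u} X] [TopologicalSpace X] [ArrTop X] :
    CFun (BS n X) X where
  obj p := p.fst
  map f := f.2
  map_id _ := rfl
  map_comp _ _ := rfl
  obj_cont := continuous_id
  map_cont := continuous_iff_continuousAt.2 fun _ => (BS.arr_iff.1 continuousAt_id).2

/-- The diagonal `(pt // Sₙ) × X ⟶ Sₙ ∫ X`. -/
def BS.diag (n : ℕ) (X : Type u) [Groupoid.{u} X] [TopologicalSpace X] [ArrTop X] :
    CFun (BS n X) (SymN n X) where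
  obj p := fun _ => p.fst
  map f := ⟨f.1, fun _ _ _ => f.2⟩
  map_id _ := rfl
  map_comp _ _ := rfl
  obj_cont := continuous_pi fun _ => continuous_id
  map_cont := continuous_iff_continuousAt.2 fun a => by
    have h := BS.arr_iff.1 (continuousAt_id (X := Arr (BS n X)) (x := a))
    exact SymN.arr_iff.2 fun i => ⟨h.1.mono fun s hs => congrArg (fun σ : Equiv.Perm (Fin n) => σ i) hs, h.2⟩

/-- The inclusion of `Sₙ ∫ X` in the total symmetric power. -/
def SymN.incl (n : ℕ) (X : Type u) [Groupoid.{u} X] [TopologicalSpace X] [ArrTop X] :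
    CFun (SymN n X) (Sym X) where
  obj x := ⟨n, x⟩
  map f := f
  map_id _ := rfl
  map_comp _ _ := rfl
  obj_cont := continuous_sigmaMk (σ := fun n => Fin n → X)
  map_cont := continuous_iff_continuousAt.2 fun a => by
    have h := SymN.arr_iff.1 (continuousAt_id (X := Arr (SymN n X)) (x := a))
    refine Sym.arr_iff.2 ⟨.of_forall fun _ => rfl, fun i => ⟨?_, _, (h i).2, .of_forall ?_⟩⟩
    · filter_upwards [(h i).1] with s hs j hj
      obtain rfl := Fin.ext hj
      exact congrArg Fin.val hs
    · intro s j hj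
      obtain rfl := Fin.ext hj
      rfl

/-- Concatenation `Sᵢ ∫ X × Sⱼ ∫ X ⟶ Sₙ ∫ X` for `n = i + j`. -/
def SymN.concat (X : Type u) [Groupoid.{u} X] [TopologicalSpace X] [ArrTop X] {i j n : ℕ}
    (e : Fin i ⊕ Fin j ≃ Fin n) : CFun (GProd (SymN i X) (SymN j X)) (SymN n X) where
  obj p := Sum.elim p.1 p.2 ∘ e.symm
  map f := (FamHom.sum f.1 f.2).reindex e e
  map_id p := (congrArg (fun A => FamHom.reindex A e e) FamHom.sum_id).trans (FamHom.reindex_id e)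
  map_comp f g := (congrArg (fun A => FamHom.reindex A e e) (FamHom.sum_comp f.1 g.1 f.2 g.2)).trans
    (FamHom.reindex_comp _ _ e e e)
  obj_cont := continuous_pi fun k => by
    obtain ⟨p, rfl⟩ := e.surjective k
    rcases p with p | p
    · refine ((continuous_apply p).comp continuous_fst).congr fun q => ?_
      simp; rfl
    · refine ((continuous_apply p).comp continuous_snd).congr fun q => ?_
      simp; rfl
  map_cont := continuous_iff_continuousAt.2 fun a => by
    have h := GProd.arr_iff.1 (continuousAt_id (X := Arr (GProd (SymN i X) (SymN j X))) (x := a))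
    refine SymN.arr_iff.2 fun k => ?_
    obtain ⟨p, rfl⟩ := e.surjective k
    rcases p with p | p
    · have h1 := SymN.arr_iff.1 h.1 p
      refine ⟨?_, h1.2.congr (.of_forall fun s => ?_)⟩
      · filter_upwards [h1.1] with s hs
        simpa [FamHom.reindex, FamHom.sum] using hs
      · exact arr_hom_congr (FamHom.sum s.hom.1 s.hom.2) (i := .inl p) (j := .inl _) rfl _
          (e.symm_apply_apply _).symm
    · have h1 := SymN.arr_iff.1 h.2 p
      refine ⟨?_, h1.2.congr (.of_forall fun s => ?_)⟩
      · filter_upwards [h1.1] with s hs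
        simpa [FamHom.reindex, FamHom.sum] using hs
      · exact arr_hom_congr (FamHom.sum s.hom.1 s.hom.2) (i := .inr p) (j := .inr _) rfl _
          (e.symm_apply_apply _).symm

/-- The center element of `Sₙ ∫ X` induced by a center element of `X`. -/
def Cen.symN (n : ℕ) (ξ : Cen X) : Cen (SymN n X) where
  app x := FamHom.diag fun i => ξ.app (x i)
  nat f := FamHom.diag_comm f fun i j e => ξ.nat _
  cont := continuous_iff_continuousAt.2 fun x => SymN.arr_iff.2 fun i => ⟨.of_forall fun _ => rfl, by
    refine (ξ.cont.comp (continuous_apply i)).continuousAt.congr (.of_forall fun x => ?_)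
    exact congrArg arr (FamHom.diag_hom (fun i => ξ.app (x i)) i rfl).symm⟩

def Cen.prod (ξ : Cen X) (υ : Cen Y) : Cen (GProd X Y) where
  app p := (ξ.app p.1, υ.app p.2)
  nat f := Prod.ext (ξ.nat _) (υ.nat _)
  cont := continuous_iff_continuousAt.2 fun _ => GProd.arr_iff.2
    ⟨(ξ.cont.comp continuous_fst).continuousAt, (υ.cont.comp continuous_snd).continuousAt⟩

def Cen.bs (n : ℕ) (ξ : Cen X) : Cen (BS n X) where
  app p := (1, ξ.app p.fst)
  nat f := Prod.ext ((mul_one _).trans (one_mul _).symm) (ξ.nat _)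
  cont := continuous_iff_continuousAt.2 fun _ => BS.arr_iff.2
    ⟨.of_forall fun _ => rfl, ξ.cont.continuousAt⟩

/-- Compatibility of a functor with center elements. -/
def CFun.Compat (F : CFun X Y) (ξ : Cen X) (υ : Cen Y) : Prop := ∀ x, F.map (ξ.app x) = υ.app (F.obj x)

end Functors

/-! ### Vector bundles on topological groupoids -/

section GB

variable {X : Type u} [Groupoid.{u} X] [TopologicalSpace X] [ArrTop X]

/-- The space of pairs of an arrow and a vector over its source. -/
def ActDom (E : VB X) : Type u := Σ a : Arr X, E.fib a.src

instance (E : VB X) : TopologicalSpace (ActDom E) :=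
  TopologicalSpace.induced (fun p : Σ a : Arr X, E.fib a.src => (p.1, E.pt p.1.src p.2)) inferInstance

variable (X) in
/-- A vector bundle on a topological groupoid: a vector bundle on the space of objects with a
continuous fibrewise linear action of the arrows. -/
structure GB where
  vb : VB X
  act : ∀ {x y : X}, (x ⟶ y) → (vb.fib x →ₗ[ℂ] vb.fib y)
  act_id : ∀ (x : X) (v : vb.fib x), act (𝟙 x) v = v
  act_comp : ∀ {x y z : X} (f : x ⟶ y) (g : y ⟶ z) (v : vb.fib x), act (f ≫ g) v = act g (act f v)
  act_cont : Continuous fun p : ActDom vb => vb.pt p.1.tgt (act p.1.hom p.2)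

variable {T : Type*} [TopologicalSpace T] {t : T}

theorem ActDom.cont (E : VB X) (p : ActDom E) : ContinuousAt (fun p : ActDom E => p.1) p ∧
    ContinuousAt (fun p : ActDom E => E.pt p.1.src p.2) p :=
  continuousAt_prod_iff.1 continuous_induced_dom.continuousAt

theorem GB.contAt (V : GB X) {x y : T → X} {f : ∀ s, x s ⟶ y s} {v : ∀ s, V.vb.fib (x s)}
    (hf : ContinuousAt (fun s => arr (f s)) t)
    (hv : ContinuousAt (fun s => V.vb.pt (x s) (v s)) t) :
    ContinuousAt (fun s => V.vb.pt (y s) (V.act (f s) (v s))) t := by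
  let c : T → ActDom V.vb := fun s => ⟨arr (f s), v s⟩
  have h : ContinuousAt c t :=
    (Topology.IsInducing.continuousAt_iff (f := c)
      (g := fun p : ActDom V.vb => (p.1, V.vb.pt p.1.src p.2)) ⟨rfl⟩).2
      (continuousAt_prod_iff.2 ⟨hf, hv⟩)
  exact V.act_cont.continuousAt.comp h

theorem GB.act_inj (V : GB X) {x y : X} (f : x ⟶ y) : Function.Injective (V.act f) := fun v w h => by
  have := congrArg (V.act (Groupoid.inv f)) h
  rwa [← V.act_comp, ← V.act_comp, Groupoid.comp_inv, V.act_id, V.act_id] at this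

/-- Isomorphism of vector bundles on a topological groupoid. -/
def GB.Iso (V W : GB X) : Prop := ∃ e : ∀ x, V.vb.fib x ≃ₗ[ℂ] W.vb.fib x,
  (∀ (x y : X) (f : x ⟶ y) (v : V.vb.fib x), e y (V.act f v) = W.act f (e x v)) ∧
  Continuous (fun p : V.vb.Tot => W.vb.pt p.1 (e p.1 p.2)) ∧
  Continuous (fun p : W.vb.Tot => V.vb.pt p.1 ((e p.1).symm p.2))

theorem GB.Iso.refl (V : GB X) : V.Iso V :=
  ⟨fun x => .refl ℂ _, fun _ _ _ _ => rfl, continuous_id, continuous_id⟩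

theorem GB.Iso.symm {V W : GB X} : V.Iso W → W.Iso V := fun ⟨e, h1, h2, h3⟩ =>
  ⟨fun x => (e x).symm, fun x y f w => by
    rw [LinearEquiv.symm_apply_eq, h1, LinearEquiv.apply_symm_apply], h3, h2⟩

theorem GB.Iso.trans {U V W : GB X} : U.Iso V → V.Iso W → U.Iso W :=
  fun ⟨e, h1, h2, h3⟩ ⟨e', h1', h2', h3'⟩ =>
  ⟨fun x => (e x).trans (e' x), fun x y f w => by simp [h1, h1'], h2'.comp h2, h3.comp h3'⟩

/-- The pull-back of a vector bundle along a continuous functor. -/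
def GB.pull {Y : Type u} [Groupoid.{u} Y] [TopologicalSpace Y] [ArrTop Y] (F : CFun X Y) (V : GB Y) :
    GB X where
  vb := V.vb.pull F.obj F.obj_cont
  act f := V.act (F.map f)
  act_id x v := by rw [F.map_id]; exact V.act_id _ _
  act_comp f g v := by rw [F.map_comp]; exact V.act_comp _ _ _
  act_cont := continuous_iff_continuousAt.2 fun p => by
    have h := ActDom.cont _ p
    exact (V.vb.pull_iff F.obj F.obj_cont).2 ⟨ArrTop.tgt_cont.continuousAt.comp h.1,
      V.contAt (F.contAt h.1) ((V.vb.pull_iff F.obj F.obj_cont).1 h.2).2⟩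

/-- The direct sum of two vector bundles. -/
def GB.prod (V W : GB X) : GB X where
  vb := V.vb.prod W.vb
  act f := (V.act f).prodMap (W.act f)
  act_id x v := Prod.ext (V.act_id _ _) (W.act_id _ _)
  act_comp f g v := Prod.ext (V.act_comp _ _ _) (W.act_comp _ _ _)
  act_cont := continuous_iff_continuousAt.2 fun p => by
    have h := ActDom.cont _ p
    have h2 := (V.vb.prod_iff W.vb).1 h.2
    exact (V.vb.prod_iff W.vb).2 ⟨V.contAt h.1 h2.1, W.contAt h.1 h2.2⟩

/-- The direct sum of a locally finite family of vector bundles. -/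
def GB.pi {I : Type} (V : I → GB X)
    (hV : ∀ x, ∃ s : Finset I, ∀ᶠ y in 𝓝 x, ∀ i ∉ s, Subsingleton ((V i).vb.fib y)) : GB X where
  vb := VB.pi (fun i => (V i).vb) hV
  act f := LinearMap.pi fun i => (V i).act f ∘ₗ LinearMap.proj i
  act_id x v := funext fun i => (V i).act_id _ _
  act_comp f g v := funext fun i => (V i).act_comp _ _ _
  act_cont := continuous_iff_continuousAt.2 fun p => by
    have h := ActDom.cont _ p
    have h2 := (VB.pi_iff _ hV).1 h.2
    exact (VB.pi_iff _ hV).2 ⟨ArrTop.tgt_cont.continuousAt.comp h.1, fun i => (V i).contAt h.1 (h2.2 i)⟩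

theorem tensor_basis_ext {V W : Type*} [AddCommGroup V] [Module ℂ V] [AddCommGroup W] [Module ℂ W]
    {ι κ : Type} [Fintype ι] [Fintype κ] [DecidableEq ι] [DecidableEq κ] {f : V →ₗ[ℂ] (ι → ℂ)}
    {g : W →ₗ[ℂ] (κ → ℂ)} (hf : Function.Bijective f) (hg : Function.Bijective g) (j : ι × κ) :
    linv (tensorCoord f g) (Pi.single j 1) =
      linv f (Pi.single j.1 1) ⊗ₜ linv g (Pi.single j.2 1) := by
  refine linv_eq (tensorCoord_bij hf hg) ?_
  funext x
  rw [tensorCoord_tmul, linv_right hf, linv_right hg]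
  simp only [Pi.single_apply, Prod.ext_iff, ite_and, mul_ite, mul_one, mul_zero]
  split_ifs <;> rfl

/-- The tensor product of two vector bundles. -/
def GB.tensor (V W : GB X) : GB X where
  vb := V.vb.tensor W.vb
  act f := TensorProduct.map (V.act f) (W.act f)
  act_id x v := by
    rw [show V.act (𝟙 x) = LinearMap.id from LinearMap.ext (V.act_id x),
      show W.act (𝟙 x) = LinearMap.id from LinearMap.ext (W.act_id x), TensorProduct.map_id]
    rfl
  act_comp f g v := by
    rw [show V.act (f ≫ g) = V.act g ∘ₗ V.act f from LinearMap.ext (V.act_comp f g),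
      show W.act (f ≫ g) = W.act g ∘ₗ W.act f from LinearMap.ext (W.act_comp f g),
      TensorProduct.map_comp]
    rfl
  act_cont := continuous_iff_continuousAt.2 fun p => by
    have h := ActDom.cont _ p
    have hs : ContinuousAt (fun p : ActDom (V.vb.tensor W.vb) => p.1.src) p :=
      ArrTop.src_cont.continuousAt.comp h.1
    have hU := V.vb.tensor_isLT W.vb p.1.src
    have hm : p.1.src ∈ V.vb.nbhd p.1.src ∩ W.vb.nbhd p.1.src := ⟨V.vb.mem_nbhd _, W.vb.mem_nbhd _⟩
    refine hU.continuousAt_map (q := fun p : ActDom (V.vb.tensor W.vb) => ⟨p.1.src, p.2⟩) h.2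
      hm (V.vb.tensor W.vb)
      (ArrTop.tgt_cont.continuousAt.comp h.1)
      (fun p => TensorProduct.map (V.act p.1.hom) (W.act p.1.hom)) fun j => ?_
    refine (V.vb.tensor_cont W.vb (g := fun p : ActDom (V.vb.tensor W.vb) => p.1.tgt)
      (V.contAt h.1 (V.vb.frame_cont p.1.src j.1 hs (V.vb.mem_nbhd _)))
      (W.contAt h.1 (W.vb.frame_cont p.1.src j.2 hs (W.vb.mem_nbhd _)))).congr ?_
    filter_upwards [hs.eventually (hU.isOpen.mem_nhds hm)] with q hq
    rw [tensor_basis_ext ((V.vb.isLT _).bij _ hq.1) ((W.vb.isLT _).bij _ hq.2)]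
    exact congrArg ((V.vb.tensor W.vb).pt q.1.tgt) (TensorProduct.map_tmul _ _ _ _).symm

variable (X) in
/-- The trivial line bundle. -/
def GB.triv : GB X where
  vb :=
    { fib := fun _ => ULift.{u} ℂ
      top := TopologicalSpace.induced (fun p : Σ _ : X, ULift.{u} ℂ => (p.1, p.2.down)) inferInstance
      locTriv := locTriv_of_isLT _ fun b => ⟨Unit, inferInstance, Set.univ,
        fun _ => LinearMap.pi fun _ => ULift.moduleEquiv.toLinearMap, trivial,
        isLT_of_induced isOpen_univ (fun y _ => ⟨fun v w h => ULift.ext _ _ (congrFun h ()),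
          fun c => ⟨⟨c ()⟩, rfl⟩⟩) id (fun x => (x.1, fun _ => x.2)) (fun x => (x.1, x.2 ()))
          (fun y _ v => comap_id.symm) (fun y _ v => by fun_prop) (fun y _ v => by fun_prop)
          (fun p => rfl) (fun p _ => rfl)⟩ }
  act _ := LinearMap.id
  act_id _ _ := rfl
  act_comp _ _ _ := rfl
  act_cont := continuous_iff_continuousAt.2 fun p => by
    have h := ActDom.cont _ p
    have h2 : ContinuousAt _ p := continuous_induced_dom.continuousAt.comp h.2
    exact (Topology.IsInducing.continuousAt_iff ⟨rfl⟩).2 (continuousAt_prod_iff.2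
      ⟨ArrTop.tgt_cont.continuousAt.comp h.1, (continuousAt_prod_iff.1 h2).2⟩)

variable (X) in
/-- The zero bundle. -/
def GB.zero : GB X := GB.pi (I := Empty) (fun i => i.elim) fun _ => ⟨∅, .of_forall fun _ i => i.elim⟩

theorem GB.prod_congr {V V' W W' : GB X} : V.Iso V' → W.Iso W' → (V.prod W).Iso (V'.prod W') :=
  fun ⟨e, h1, h2, h3⟩ ⟨e', h1', h2', h3'⟩ =>
  ⟨fun x => (e x).prodCongr (e' x), fun x y f v => Prod.ext (h1 _ _ _ _) (h1' _ _ _ _),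
    continuous_iff_continuousAt.2 fun p => by
      have h := (V.vb.prod_iff W.vb).1 (continuousAt_id (X := (V.prod W).vb.Tot) (x := p))
      exact (V'.vb.prod_iff W'.vb).2 ⟨h2.continuousAt.comp h.1, h2'.continuousAt.comp h.2⟩,
    continuous_iff_continuousAt.2 fun p => by
      have h := (V'.vb.prod_iff W'.vb).1 (continuousAt_id (X := (V'.prod W').vb.Tot) (x := p))
      exact (V.vb.prod_iff W.vb).2 ⟨h3.continuousAt.comp h.1, h3'.continuousAt.comp h.2⟩⟩

theorem GB.prod_comm (V W : GB X) : (V.prod W).Iso (W.prod V) :=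
  ⟨fun x => LinearEquiv.prodComm ℂ _ _, fun x y f v => rfl,
    continuous_iff_continuousAt.2 fun p => by
      have h := (V.vb.prod_iff W.vb).1 (continuousAt_id (X := (V.prod W).vb.Tot) (x := p))
      exact (W.vb.prod_iff V.vb).2 h.symm,
    continuous_iff_continuousAt.2 fun p => by
      have h := (W.vb.prod_iff V.vb).1 (continuousAt_id (X := (W.prod V).vb.Tot) (x := p))
      exact (V.vb.prod_iff W.vb).2 h.symm⟩

theorem GB.prod_assoc (U V W : GB X) : ((U.prod V).prod W).Iso (U.prod (V.prod W)) :=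
  ⟨fun x => LinearEquiv.prodAssoc ℂ _ _ _, fun x y f v => rfl,
    continuous_iff_continuousAt.2 fun p => by
      have h := ((U.vb.prod V.vb).prod_iff W.vb).1
        (continuousAt_id (X := ((U.prod V).prod W).vb.Tot) (x := p))
      have h' := (U.vb.prod_iff V.vb).1 h.1
      exact (U.vb.prod_iff (V.vb.prod W.vb)).2 ⟨h'.1, (V.vb.prod_iff W.vb).2 ⟨h'.2, h.2⟩⟩,
    continuous_iff_continuousAt.2 fun p => by
      have h := (U.vb.prod_iff (V.vb.prod W.vb)).1
        (continuousAt_id (X := (U.prod (V.prod W)).vb.Tot) (x := p))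
      have h' := (V.vb.prod_iff W.vb).1 h.2
      exact ((U.vb.prod V.vb).prod_iff W.vb).2 ⟨(U.vb.prod_iff V.vb).2 ⟨h.1, h'.1⟩, h'.2⟩⟩

theorem GB.zero_prod (V : GB X) : ((GB.zero X).prod V).Iso V :=
  ⟨fun x => { LinearMap.snd ℂ _ _ with
      invFun := fun v => (fun i : Empty => i.elim, v)
      left_inv := fun v => Prod.ext (funext fun i : Empty => i.elim) rfl
      right_inv := fun v => rfl }, fun x y f v => rfl,
    continuous_iff_continuousAt.2 fun p => by
      exact ((GB.zero X).vb.prod_iff V.vb).1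
        (continuousAt_id (X := ((GB.zero X).prod V).vb.Tot) (x := p)) |>.2,
    continuous_iff_continuousAt.2 fun p => by
      have h := continuousAt_id (X := V.vb.Tot) (x := p)
      exact ((GB.zero X).vb.prod_iff V.vb).2 ⟨(VB.pi_iff (I := Empty) (fun i => (i.elim : GB X).vb)
        (fun _ => ⟨∅, .of_forall fun _ i => i.elim⟩) (v := fun _ i => i.elim)).2 ⟨V.vb.contAtFst h, fun i => i.elim⟩, h⟩⟩

end GB

/-! ### Series of vector bundles with the rotation condition -/

/-- The phase `exp (2 π i a)`. -/
def ph (a : ℚ) : ℂ := Complex.exp (2 * Real.pi * Complex.I * a)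

theorem ph_add (a b : ℚ) : ph (a + b) = ph a * ph b := by
  rw [ph, ph, ph, ← Complex.exp_add]; push_cast; ring_nf

theorem ph_zero : ph 0 = 1 := by simp [ph]

theorem ph_nat (n : ℕ) : ph n = 1 := by
  rw [ph]
  have := Complex.exp_nat_mul_two_pi_mul_I n
  rw [← this]; push_cast; ring_nf

section Series

variable {X : Type u} [Groupoid.{u} X] [TopologicalSpace X] [ArrTop X]

/-- A formal power series `∑ Vₐ qᵃ` of vector bundles with nonnegative rational exponents, whose
denominators are locally bounded, and which satisfies the rotation condition: `ξ` acts on `Vₐ` as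
`exp (2 π i a)`. -/
structure Series (ξ : Cen X) where
  coef : ℚ≥0 → GB X
  rot : ∀ (a : ℚ≥0) (x : X) (v : (coef a).vb.fib x), (coef a).act (ξ.app x) v = ph a • v
  locfin : ∀ x, ∃ N : ℕ, 0 < N ∧ ∀ᶠ y in 𝓝 x, ∀ a, Nontrivial ((coef a).vb.fib y) →
    ∃ m : ℕ, a = m / N

variable {ξ : Cen X}

/-- The direct sum of two series. -/
def Series.sum (V W : Series ξ) : Series ξ where
  coef a := (V.coef a).prod (W.coef a)
  rot a x v := Prod.ext (V.rot a x v.1) (W.rot a x v.2)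
  locfin x := by
    obtain ⟨N, hN, h⟩ := V.locfin x
    obtain ⟨M, hM, h'⟩ := W.locfin x
    refine ⟨N * M, Nat.mul_pos hN hM, ?_⟩
    filter_upwards [h, h'] with y h h' a hn
    have hn' : Nontrivial ((V.coef a).vb.fib y) ∨ Nontrivial ((W.coef a).vb.fib y) := by
      by_contra hc
      simp only [not_or, not_nontrivial_iff_subsingleton] at hc
      have := hc.1; have := hc.2
      exact not_subsingleton_iff_nontrivial.2 hn
        (inferInstanceAs (Subsingleton ((V.coef a).vb.fib y × (W.coef a).vb.fib y)))
    have hN' : (N : ℚ≥0) ≠ 0 := by positivity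
    have hM' : (M : ℚ≥0) ≠ 0 := by positivity
    rcases hn' with hn | hn
    · obtain ⟨m, rfl⟩ := h a hn
      exact ⟨m * M, by push_cast; field_simp⟩
    · obtain ⟨m, rfl⟩ := h' a hn
      exact ⟨m * N, by push_cast; field_simp⟩

/-- The zero series. -/
def Series.zero (ξ : Cen X) : Series ξ where
  coef a := GB.zero X
  rot a x v := funext fun i => i.elim
  locfin x := ⟨1, one_pos, .of_forall fun y a hn => absurd hn (not_nontrivial_iff_subsingleton.2
    (inferInstanceAs (Subsingleton (∀ i : Empty, _))))⟩

/-- Two series are isomorphic if their coefficients are. -/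
instance Series.setoid (ξ : Cen X) : Setoid (Series ξ) where
  r V W := ∀ a, (V.coef a).Iso (W.coef a)
  iseqv := ⟨fun V a => .refl _, fun h a => (h a).symm, fun h h' a => (h a).trans (h' a)⟩

/-- Isomorphism classes of series. -/
def Cls (ξ : Cen X) : Type _ := Quotient (Series.setoid ξ)

/-- Isomorphism classes of series form a monoid under direct sum. -/
instance (ξ : Cen X) : Add (Cls ξ) where
  add := Quotient.map₂ Series.sum fun _ _ h _ _ h' a => GB.prod_congr (h a) (h' a)

instance (ξ : Cen X) : Zero (Cls ξ) where
  zero := Quotient.mk _ (Series.zero ξ)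

instance (ξ : Cen X) : AddCommMonoid (Cls ξ) where
  add_assoc := by
    rintro ⟨U⟩ ⟨V⟩ ⟨W⟩; exact Quotient.sound fun a => GB.prod_assoc _ _ _
  add_comm := by
    rintro ⟨V⟩ ⟨W⟩; exact Quotient.sound fun a => GB.prod_comm _ _
  zero_add := by
    rintro ⟨V⟩; exact Quotient.sound fun a => GB.zero_prod _
  add_zero := by
    rintro ⟨V⟩; exact Quotient.sound fun a => (GB.prod_comm _ _).trans (GB.zero_prod _)
  nsmul := nsmulRec

/-- The group `K_rot(X, ξ)`: the Grothendieck group of series satisfying the rotation condition. -/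
abbrev Krot (ξ : Cen X) : Type _ := Algebra.GrothendieckAddGroup (Cls ξ)

/-- The class of a series. -/
def Series.cls (V : Series ξ) : Krot ξ := Algebra.GrothendieckAddGroup.of (Quotient.mk (Series.setoid ξ) V : Cls ξ)

end Series

section SeriesOps

variable {X : Type u} [Groupoid.{u} X] [TopologicalSpace X] [ArrTop X]
  {Y : Type u} [Groupoid.{u} Y] [TopologicalSpace Y] [ArrTop Y] {ξ : Cen X} {υ : Cen Y}

/-- The pull-back of a series. -/
def Series.pull (F : CFun X Y) (hF : F.Compat ξ υ) (V : Series υ) : Series ξ where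
  coef a := (V.coef a).pull F
  rot a x v := by
    change (V.coef a).act (F.map (ξ.app x)) v = _
    rw [hF x]; exact V.rot a _ v
  locfin x := by
    obtain ⟨N, hN, h⟩ := V.locfin (F.obj x)
    exact ⟨N, hN, F.obj_cont.continuousAt.eventually h⟩

/-- The unit series: the trivial line bundle in degree zero. -/
def Series.one (ξ : Cen X) : Series ξ where
  coef a := GB.pi (I := PLift (a = 0)) (fun _ => GB.triv X) fun _ => by
    classical
    by_cases h : a = 0
    · exact ⟨{⟨h⟩}, .of_forall fun y i hi => (hi (by simp)).elim⟩
    · exact ⟨∅, .of_forall fun y i => (h i.down).elim⟩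
  rot a x v := funext fun i => by
    have e : ph a = 1 := by rw [i.down, NNRat.cast_zero, ph_zero]
    change v i = ph a • v i
    rw [e, one_smul]
  locfin x := ⟨1, one_pos, .of_forall fun y a hn => by
    by_cases h : a = 0
    · exact ⟨0, by simp [h]⟩
    · refine absurd hn (not_nontrivial_iff_subsingleton.2 ⟨fun v w => funext fun i => (h i.down).elim⟩)⟩

theorem finite_denom (N : ℕ) (hN : 0 < N) (a : ℚ≥0) : {b : ℚ≥0 | b ≤ a ∧ ∃ m : ℕ, b = m / N}.Finite := by
  refine ((Set.finite_le_nat ⌊a * N⌋₊).image fun m : ℕ => (m : ℚ≥0) / N).subset ?_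
  rintro b ⟨hb, m, rfl⟩
  refine ⟨m, Nat.le_floor ?_, rfl⟩
  have : (0 : ℚ≥0) < N := by positivity
  rwa [div_le_iff₀ this] at hb

theorem tensor_subsingleton_left {V W : Type*} [AddCommGroup V] [Module ℂ V] [AddCommGroup W]
    [Module ℂ W] [Subsingleton V] : Subsingleton (V ⊗[ℂ] W) :=
  subsingleton_of_forall_eq 0 fun z => by
    induction z with
    | zero => rfl
    | tmul v w => rw [Subsingleton.elim v 0, TensorProduct.zero_tmul]
    | add x y hx hy => rw [hx, hy, add_zero]

theorem tensor_subsingleton_right {V W : Type*} [AddCommGroup V] [Module ℂ V] [AddCommGroup W]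
    [Module ℂ W] [Subsingleton W] : Subsingleton (V ⊗[ℂ] W) :=
  subsingleton_of_forall_eq 0 fun z => by
    induction z with
    | zero => rfl
    | tmul v w => rw [Subsingleton.elim w 0, TensorProduct.tmul_zero]
    | add x y hx hy => rw [hx, hy, add_zero]

/-- The tensor product of two series. -/
def Series.tensor (V W : Series ξ) : Series ξ where
  coef a := GB.pi (I := {p : ℚ≥0 × ℚ≥0 // p.1 + p.2 = a})
    (fun p => (V.coef p.1.1).tensor (W.coef p.1.2)) fun x => by
      obtain ⟨N, hN, h⟩ := V.locfin x
      obtain ⟨M, hM, h'⟩ := W.locfin x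
      have hfin := (((finite_denom N hN a).prod (finite_denom M hM a)).preimage
        (f := Subtype.val) (Subtype.val_injective.injOn (s := _))).subset (t := {p : {p : ℚ≥0 × ℚ≥0 // p.1 + p.2 = a} |
          (∃ m : ℕ, p.1.1 = m / N) ∧ ∃ m : ℕ, p.1.2 = m / M}) (by
        rintro ⟨p, rfl⟩ ⟨h1, h2⟩
        exact ⟨⟨le_self_add, h1⟩, le_add_self, h2⟩)
      refine ⟨hfin.toFinset, ?_⟩
      filter_upwards [h, h'] with y h h' p hp
      rw [Set.Finite.mem_toFinset, Set.mem_ofPred_eq, not_and_or] at hp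
      rcases hp with hp | hp
      · have : Subsingleton ((V.coef p.1.1).vb.fib y) :=
          not_nontrivial_iff_subsingleton.1 fun hn => hp (h _ hn)
        exact tensor_subsingleton_left
      · have : Subsingleton ((W.coef p.1.2).vb.fib y) :=
          not_nontrivial_iff_subsingleton.1 fun hn => hp (h' _ hn)
        exact tensor_subsingleton_right
  rot a x v := funext fun p => by
    refine LinearMap.congr_fun (?_ : TensorProduct.map ((V.coef p.1.1).act (ξ.app x))
      ((W.coef p.1.2).act (ξ.app x)) = ph a • LinearMap.id) (v p)
    rw [show (V.coef p.1.1).act (ξ.app x) = ph p.1.1 • LinearMap.id from LinearMap.ext (V.rot _ x),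
      show (W.coef p.1.2).act (ξ.app x) = ph p.1.2 • LinearMap.id from LinearMap.ext (W.rot _ x),
      TensorProduct.map_smul_left, TensorProduct.map_smul_right, TensorProduct.map_id, smul_smul,
      ← ph_add]
    obtain ⟨p, rfl⟩ := p
    rw [NNRat.cast_add]
  locfin x := by
    obtain ⟨N, hN, h⟩ := V.locfin x
    obtain ⟨M, hM, h'⟩ := W.locfin x
    refine ⟨N * M, Nat.mul_pos hN hM, ?_⟩
    filter_upwards [h, h'] with y h h' a hn
    by_contra hc
    refine not_subsingleton_iff_nontrivial.2 hn ⟨fun v w => funext fun p => ?_⟩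
    suffices hs : Subsingleton ((V.coef p.1.1).vb.fib y ⊗[ℂ] (W.coef p.1.2).vb.fib y) from
      hs.elim _ _
    by_contra hc'
    have hN' : (N : ℚ≥0) ≠ 0 := by positivity
    have hM' : (M : ℚ≥0) ≠ 0 := by positivity
    obtain ⟨⟨b, c⟩, rfl⟩ := p
    have h1 : Nontrivial ((V.coef b).vb.fib y) := by
      by_contra h1
      have := not_nontrivial_iff_subsingleton.1 h1
      exact hc' tensor_subsingleton_left
    have h2 : Nontrivial ((W.coef c).vb.fib y) := by
      by_contra h1
      have := not_nontrivial_iff_subsingleton.1 h1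
      exact hc' tensor_subsingleton_right
    obtain ⟨m, rfl⟩ := h b h1
    obtain ⟨m', rfl⟩ := h' c h2
    exact hc ⟨m * M + m' * N, by push_cast; field_simp⟩

/-- The external tensor product of two series. -/
def Series.ext (V : Series ξ) (W : Series υ) : Series (ξ.prod υ) :=
  (V.pull (GProd.fst X Y) fun _ => rfl).tensor (W.pull (GProd.snd X Y) fun _ => rfl)

/-- The projection to an eigenspace of an endomorphism `A`, where `φ j` is the `j`-th power of `A`. -/
def avg {V : Type*} [AddCommGroup V] [Module ℂ V] (φ : ℕ → V →ₗ[ℂ] V) (l : ℂ) (k : ℕ) : V →ₗ[ℂ] V :=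
  ∑ j : Fin k, ((k : ℂ)⁻¹ * l⁻¹ ^ (j : ℕ)) • φ j

theorem avg_eq {V : Type*} [AddCommGroup V] [Module ℂ V] {φ : ℕ → V →ₗ[ℂ] V} {l : ℂ} {k : ℕ} (hl : l ≠ 0)
    (hk : 0 < k) {v : V} (hv : ∀ j, φ j v = l ^ j • v) : avg φ l k v = v := by
  have hk' : (k : ℂ) ≠ 0 := by exact_mod_cast hk.ne'
  have h : ∀ j : ℕ, ((k : ℂ)⁻¹ * l⁻¹ ^ j) • l ^ j • v = (k : ℂ)⁻¹ • v := fun j => by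
    rw [smul_smul, mul_assoc, ← mul_pow, inv_mul_cancel₀ hl, one_pow, mul_one]
  simp only [avg, LinearMap.sum_apply, LinearMap.smul_apply, hv, h, Finset.sum_const, Finset.card_univ,
    Fintype.card_fin]
  rw [← Nat.cast_smul_eq_nsmul ℂ, smul_smul, mul_inv_cancel₀ hk', one_smul]

theorem avg_eigen {V : Type*} [AddCommGroup V] [Module ℂ V] {φ : ℕ → V →ₗ[ℂ] V} {A : V →ₗ[ℂ] V} {l : ℂ}
    {k : ℕ} (hl : l ≠ 0) (v : V) (h0 : φ 0 v = v) (hs : ∀ j, φ (j + 1) v = A (φ j v))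
    (hk : φ k v = l ^ k • v) : A (avg φ l k v) = l • avg φ l k v := by
  have e : avg φ l k v = (k : ℂ)⁻¹ • ∑ j ∈ Finset.range k, l⁻¹ ^ j • φ j v := by
    rw [← Fin.sum_univ_eq_sum_range (fun j => l⁻¹ ^ j • φ j v), Finset.smul_sum]
    simp only [avg, LinearMap.sum_apply, LinearMap.smul_apply, smul_smul]
  have e1 : ∀ j, l⁻¹ ^ j • A (φ j v) = l • l⁻¹ ^ (j + 1) • φ (j + 1) v := fun j => by
    rw [← hs, smul_smul, pow_succ', ← mul_assoc, mul_inv_cancel₀ hl, one_mul]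
  have e2 := (Finset.sum_range_succ' (fun j => l⁻¹ ^ j • φ j v) k).symm.trans
    (Finset.sum_range_succ (fun j => l⁻¹ ^ j • φ j v) k)
  rw [hk, smul_smul (l⁻¹ ^ k), ← mul_pow, inv_mul_cancel₀ hl, one_pow, one_smul, pow_zero, one_smul,
    h0] at e2
  rw [e, map_smul, map_sum, smul_comm l, ← add_right_cancel e2, Finset.smul_sum]
  simp only [map_smul, e1, Finset.smul_sum]

/-- The subbundle on which a center element `ξ` acts as the scalar `l`. -/
def GB.eigen (W : GB X) (ξ : Cen X) (l : ℂ) (hl : l ≠ 0) (k : ℕ) (hk : 0 < k)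
    (h : ∀ (x : X) (v : W.vb.fib x), W.act (iter (ξ.app x) k) v = l ^ k • v) : GB X where
  vb := W.vb.embed (fun x => LinearMap.eqLocus (W.act (ξ.app x)) (l • LinearMap.id))
    (fun x => Submodule.subtype _) (fun x => Subtype.val_injective) (by
      refine ⟨fun x => avg (fun j => W.act (iter (ξ.app x) j)) l k, ?_, ?_, ?_⟩
      · rw [continuous_iff_continuousAt]
        intro p
        have hi : ∀ j, ContinuousAt (fun q : W.vb.Tot => W.vb.pt q.1 (W.act (iter (ξ.app q.1) j) q.2)) p := by
          intro j
          induction j with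
          | zero =>
            refine ContinuousAt.congr (f := id) continuousAt_id (.of_forall fun q => ?_)
            exact congrArg (W.vb.pt q.1) (W.act_id _ _).symm
          | succ j ih =>
            have h1 := ξ.cont.continuousAt.comp (W.vb.contFst.continuousAt (x := p))
            refine (W.contAt h1 ih).congr (.of_forall fun q => ?_)
            exact congrArg (W.vb.pt q.1) (W.act_comp _ _ _).symm
        refine (W.vb.continuousAt_sum (κ := Fin k) (c := fun j _ => (k : ℂ)⁻¹ * (l⁻¹) ^ (j : ℕ))
          W.vb.contFst.continuousAt (fun j => continuousAt_const) (fun j => hi j)).congr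
          (.of_forall fun q => congrArg (W.vb.pt q.1) ?_)
        simp only [avg, LinearMap.sum_apply, LinearMap.smul_apply]
      · rintro x ⟨v, hv⟩
        have hv' : W.act (ξ.app x) v = l • v := hv
        refine avg_eq hl hk fun j => ?_
        induction j with
        | zero => rw [pow_zero, one_smul]; exact W.act_id _ _
        | succ j ih =>
          refine (W.act_comp _ _ _).trans ?_
          change W.act (ξ.app x) (W.act (iter (ξ.app x) j) v) = _
          rw [show W.act (iter (ξ.app x) j) v = l ^ j • v from ih, map_smul, hv', smul_smul, pow_succ]
          rfl
      · exact fun x v => ⟨⟨_, avg_eigen hl v (W.act_id _ _) (fun j => W.act_comp _ _ _) (h x v)⟩, rfl⟩)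
  act {x y} f := (W.act f).restrict fun v hv => by
    have hv' : W.act (ξ.app x) v = l • v := hv
    change W.act (ξ.app y) (W.act f v) = l • W.act f v
    rw [← W.act_comp, ← ξ.nat, W.act_comp, hv', map_smul]
  act_id x v := Subtype.ext (W.act_id _ _)
  act_comp f g v := Subtype.ext (W.act_comp _ _ _)
  act_cont := continuous_iff_continuousAt.2 fun p => by
    have h := ActDom.cont _ p
    exact (W.vb.embed_iff _ _ _ _).2 (W.contAt h.1 ((W.vb.embed_iff _ _ _ _).1 h.2))

theorem iter_val (p : Inertia X) (g : p ⟶ p) (k : ℕ) : (iter g k).1 = iter g.1 k := by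
  induction k with
  | zero => rfl
  | succ k ih => change (iter g k).1 ≫ g.1 = _; rw [ih]; rfl

theorem ph_pow (a : ℚ) (k : ℕ) : ph (k * a) = ph a ^ k := by
  rw [ph, ph, ← Complex.exp_nat_mul]; push_cast; ring_nf

/-- The operator `β_k`: the coefficient of `q ^ a` is the subbundle of the coefficient `V_{k a}` pulled
back along the `k`-th power map, on which the canonical center element acts as `exp (2 π i a)`. -/
def Series.beta [TopGpd X] (k : ℕ) (hk : 0 < k) (V : Series (Inertia.cen X)) :
    Series (Inertia.cen X) where
  coef a := ((V.coef (k * a)).pull (Inertia.powMap X k)).eigen (Inertia.cen X) (ph a)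
    (Complex.exp_ne_zero _) k hk fun p v => by
      have e : (Inertia.powMap X k).map (iter ((Inertia.cen X).app p) k) =
          (Inertia.cen X).app ((Inertia.powMap X k).obj p) :=
        Subtype.ext (iter_val p ((Inertia.cen X).app p) k)
      change (V.coef (k * a)).act ((Inertia.powMap X k).map (iter ((Inertia.cen X).app p) k)) v = _
      rw [e]
      refine (V.rot _ _ _).trans ?_
      rw [← ph_pow]
      push_cast; rfl
  rot a p v := Subtype.ext (show _ = ph a • v.1 from v.2)
  locfin p := by
    obtain ⟨N, hN, h⟩ := V.locfin ((Inertia.powMap X k).obj p)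
    refine ⟨k * N, Nat.mul_pos hk hN, ?_⟩
    filter_upwards [(Inertia.powMap X k).obj_cont.continuousAt.eventually h] with q hq a hn
    have hn' : Nontrivial ((V.coef (k * a)).vb.fib ((Inertia.powMap X k).obj q)) := by
      obtain ⟨v, w, hvw⟩ := hn
      exact ⟨v.1, w.1, fun e => hvw (Subtype.ext e)⟩
    obtain ⟨m, hm⟩ := hq _ hn'
    have hk' : (k : ℚ≥0) ≠ 0 := by positivity
    have hN' : (N : ℚ≥0) ≠ 0 := by positivity
    refine ⟨m, ?_⟩
    push_cast
    field_simp
    field_simp at hm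
    linear_combination hm

end SeriesOps

/-! ### Power operations on series -/

section Power

variable {X : Type u} [Groupoid.{u} X] [TopologicalSpace X] [ArrTop X] {ξ : Cen X} {n : ℕ}

theorem piTensor_subsingleton {I : Type} {V : I → Type*} [∀ i, AddCommGroup (V i)]
    [∀ i, Module ℂ (V i)] (i : I) [Subsingleton (V i)] : Subsingleton (⨂[ℂ] i, V i) :=
  subsingleton_of_forall_eq 0 fun z => by
    classical
    induction z using PiTensorProduct.induction_on with
    | smul_tprod r v =>
      rw [MultilinearMap.map_coord_zero (PiTensorProduct.tprod ℂ) i (Subsingleton.elim (v i) 0), smul_zero]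
    | add x y hx hy => rw [hx, hy, add_zero]

theorem piTensor_basis_ext {I : Type} [Fintype I] {V : I → Type*} [∀ i, AddCommGroup (V i)]
    [∀ i, Module ℂ (V i)] {ι : I → Type} [∀ i, Fintype (ι i)] [∀ i, DecidableEq (ι i)]
    {f : ∀ i, V i →ₗ[ℂ] (ι i → ℂ)} [DecidableEq (∀ i, ι i)]
    (hf : ∀ i, Function.Bijective (f i)) (j : ∀ i, ι i) :
    linv (piCoord f) (Pi.single j 1) = PiTensorProduct.tprod ℂ fun i => linv (f i) (Pi.single (j i) 1) := by
  refine linv_eq (piCoord_bij hf) ?_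
  funext x
  rw [piCoord_tprod]
  simp only [linv_right (hf _), Pi.single_apply]
  rw [Finset.prod_ite_zero]
  simp [funext_iff]

/-- The action of an arrow on the coefficients of a series, with a change of the exponent along an
equality. -/
def Series.tr (V : Series ξ) {a b : ℚ≥0} (h : a = b) {x y : X} (f : x ⟶ y) :
    (V.coef a).vb.fib x →ₗ[ℂ] (V.coef b).vb.fib y :=
  (V.coef b).act f ∘ₗ (VB.castFib (fun a => (V.coef a).vb) h x).toLinearMap

theorem Series.tr_rfl (V : Series ξ) {a : ℚ≥0} {x y : X} (f : x ⟶ y) (v : (V.coef a).vb.fib x) :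
    V.tr rfl f v = (V.coef a).act f v := rfl

theorem Series.tr_comp (V : Series ξ) {a b c : ℚ≥0} (h : a = b) (h' : b = c) {x y z : X} (f : x ⟶ y)
    (g : y ⟶ z) (v : (V.coef a).vb.fib x) : V.tr (h.trans h') (f ≫ g) v = V.tr h' g (V.tr h f v) := by
  subst h; subst h'
  exact (V.coef a).act_comp f g v

theorem Series.tr_cont (V : Series ξ) {a b : ℚ≥0} (h : a = b) {T : Type*} [TopologicalSpace T] {t : T}
    {x y : T → X} {f : ∀ s, x s ⟶ y s} {v : ∀ s, (V.coef a).vb.fib (x s)}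
    (hf : ContinuousAt (fun s => arr (f s)) t)
    (hv : ContinuousAt (fun s => (V.coef a).vb.pt (x s) (v s)) t) :
    ContinuousAt (fun s => (V.coef b).vb.pt (y s) (V.tr h (f s) (v s))) t := by
  subst h
  exact (V.coef a).contAt hf hv

theorem Series.tr_congr (V : Series ξ) {a b : ℚ≥0} (h : a = b) {z z' : Fin n → X} (A : FamHom z z')
    {i k : Fin n} (e : A.perm i = k) (v : (V.coef a).vb.fib (z i)) :
    (V.coef b).vb.pt (z' (A.perm i)) (V.tr h (A.hom i _ rfl) v) =
      (V.coef b).vb.pt (z' k) (V.tr h (A.hom i k e) v) := by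
  subst e; rfl

/-- The map of tensor products induced by an arrow of families: it permutes the tensor factors. -/
def Series.perm (V : Series ξ) {z z' : Fin n → X} (A : FamHom z z') (c c' : Fin n → ℚ≥0)
    (h : ∀ i j, A.perm i = j → c i = c' j) :
    (⨂[ℂ] i, (V.coef (c i)).vb.fib (z i)) →ₗ[ℂ] ⨂[ℂ] j, (V.coef (c' j)).vb.fib (z' j) :=
  PiTensorProduct.map (fun j => V.tr (h (A.perm.symm j) j (Equiv.apply_symm_apply _ _))
      (A.hom (A.perm.symm j) j (Equiv.apply_symm_apply _ _))) ∘ₗ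
    (PiTensorProduct.reindex ℂ (fun i => (V.coef (c i)).vb.fib (z i)) A.perm).toLinearMap

theorem Series.perm_tprod (V : Series ξ) {z z' : Fin n → X} (A : FamHom z z') {c c' : Fin n → ℚ≥0}
    (h : ∀ i j, A.perm i = j → c i = c' j) (v : ∀ i, (V.coef (c i)).vb.fib (z i)) :
    V.perm A c c' h (PiTensorProduct.tprod ℂ v) = PiTensorProduct.tprod ℂ fun j =>
      V.tr (h (A.perm.symm j) j (Equiv.apply_symm_apply _ _))
      (A.hom (A.perm.symm j) j (Equiv.apply_symm_apply _ _)) (v (A.perm.symm j)) := by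
  simp only [Series.perm, LinearMap.comp_apply, LinearEquiv.coe_coe]
  rw [PiTensorProduct.reindex_tprod, PiTensorProduct.map_tprod]

theorem Series.perm_comp (V : Series ξ) {z z' z'' : Fin n → X} (A : FamHom z z') (B : FamHom z' z'')
    {c c' c'' : Fin n → ℚ≥0} (h : ∀ i j, A.perm i = j → c i = c' j)
    (h' : ∀ i j, B.perm i = j → c' i = c'' j) (h'')
    (v : ⨂[ℂ] i, (V.coef (c i)).vb.fib (z i)) :
    V.perm (A.comp B) c c'' h'' v = V.perm B c' c'' h' (V.perm A c c' h v) := by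
  suffices e : V.perm (A.comp B) c c'' h'' = V.perm B c' c'' h' ∘ₗ V.perm A c c' h by rw [e]; rfl
  refine PiTensorProduct.ext (MultilinearMap.ext fun v => ?_)
  simp only [LinearMap.compMultilinearMap_apply, LinearMap.comp_apply, Series.perm_tprod]
  congr 1
  funext j
  rw [← Series.tr_comp]
  have e := FamHom.comp_hom A B (A.perm.symm (B.perm.symm j)) (B.perm.symm j) j
    (Equiv.apply_symm_apply _ _) (Equiv.apply_symm_apply _ _) (by
      change B.perm (A.perm _) = _; simp)
  rw [← e]
  rfl

theorem Series.perm_diag (V : Series ξ) {z : Fin n → X} (g : ∀ i, z i ⟶ z i) (r : Fin n → ℂ)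
    (c : Fin n → ℚ≥0) (hr : ∀ i v, (V.coef (c i)).act (g i) v = r i • v) (h)
    (v : ⨂[ℂ] i, (V.coef (c i)).vb.fib (z i)) :
    V.perm (FamHom.diag g) c c h v = (∏ i, r i) • v := by
  suffices e : V.perm (FamHom.diag g) c c h = (∏ i, r i) • LinearMap.id by rw [e]; rfl
  refine PiTensorProduct.ext (MultilinearMap.ext fun v => ?_)
  simp only [LinearMap.compMultilinearMap_apply, Series.perm_tprod, LinearMap.smul_apply,
    LinearMap.id_apply]
  rw [← MultilinearMap.map_smul_univ]
  congr 1
  funext j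
  rw [← hr, ← FamHom.diag_hom g j rfl]
  rfl

theorem Series.perm_id (V : Series ξ) {z : Fin n → X} (c : Fin n → ℚ≥0) (h)
    (v : ⨂[ℂ] i, (V.coef (c i)).vb.fib (z i)) : V.perm (FamHom.id z) c c h v = v := by
  have e : FamHom.id z = FamHom.diag fun i => 𝟙 (z i) :=
    FamHom.ext rfl fun i j h h' => (Category.id_comp _).symm
  revert h
  rw [e]
  intro h
  have h1 := V.perm_diag (fun i => 𝟙 (z i)) (fun _ => 1) c
    (fun i v => by rw [one_smul]; exact (V.coef _).act_id _ _) h v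
  rw [Finset.prod_const_one] at h1
  exact h1.trans (one_smul ℂ v)

theorem ph_sum {I : Type} [Fintype I] (c : I → ℚ≥0) : ph ((∑ i, c i : ℚ≥0) : ℚ) = ∏ i, ph (c i) := by
  simp only [ph]
  rw [← Complex.exp_sum, ← Finset.mul_sum]
  push_cast; rfl

/-- The space of objects of the symmetric power projects to its factors. -/
theorem SymN.continuous_eval (i : Fin n) : Continuous fun z : SymN n X => z i := continuous_apply i

/-- The tensor product of the coefficients with exponents `c i`, as a bundle on the `n`-fold power. -/
def Series.powVB (V : Series ξ) (c : Fin n → ℚ≥0) : VB (SymN n X) :=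
  VB.piTensor fun i => (V.coef (c i)).vb.pull (fun z : SymN n X => z i) (SymN.continuous_eval i)

theorem Series.powVB_denom (V : Series ξ) (z : SymN n X) : ∃ N : Fin n → ℕ, (∀ i, 0 < N i) ∧
    ∀ᶠ w in 𝓝 z, ∀ c : Fin n → ℚ≥0, Nontrivial ((V.powVB c).fib w) → ∀ i, ∃ m : ℕ, c i = m / N i := by
  choose N hN h using fun i => V.locfin (z i)
  refine ⟨N, hN, ?_⟩
  have h' := fun i => (SymN.continuous_eval i).continuousAt.eventually (h i)
  rw [← eventually_all] at h'
  filter_upwards [h'] with w hw c hc i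
  by_contra hcon
  have : Subsingleton ((V.coef (c i)).vb.fib (w i)) :=
    not_nontrivial_iff_subsingleton.1 fun hn => hcon (hw i _ hn)
  let F : Fin n → Type u := fun i => (V.coef (c i)).vb.fib (w i)
  let _ : ∀ i, AddCommGroup (F i) := fun i => inferInstanceAs (AddCommGroup ((V.coef (c i)).vb.fib (w i)))
  let _ : ∀ i, Module ℂ (F i) := fun i => inferInstanceAs (Module ℂ ((V.coef (c i)).vb.fib (w i)))
  have hF : Subsingleton (F i) := this
  exact not_subsingleton_iff_nontrivial.2 hc (piTensor_subsingleton (V := F) i)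

theorem Series.powVB_finite (V : Series ξ) (a : ℚ≥0) (z : SymN n X) :
    ∃ s : Finset {c : Fin n → ℚ≥0 // ∑ i, c i = a}, ∀ᶠ w in 𝓝 z, ∀ c ∉ s,
      Subsingleton ((V.powVB c.1).fib w) := by
  obtain ⟨N, hN, h⟩ := V.powVB_denom z
  have hfin := ((Set.Finite.pi' fun i => finite_denom (N i) (hN i) a).preimage
    (f := (Subtype.val : {c : Fin n → ℚ≥0 // ∑ i, c i = a} → _))
    (Subtype.val_injective.injOn (s := _))).subset
    (t := {c : {c : Fin n → ℚ≥0 // ∑ i, c i = a} | ∀ i, ∃ m : ℕ, c.1 i = m / N i}) (by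
      rintro ⟨c, rfl⟩ hc i
      exact ⟨Finset.single_le_sum (fun _ _ => zero_le) (Finset.mem_univ i), hc i⟩)
  refine ⟨hfin.toFinset, ?_⟩
  filter_upwards [h] with w hw c hc
  rw [Set.Finite.mem_toFinset] at hc
  exact not_nontrivial_iff_subsingleton.1 fun hn => hc (hw c.1 hn)

theorem Series.perm_cont (V : Series ξ) (c c' : Fin n → ℚ≥0) {T : Type*} [TopologicalSpace T] {t : T}
    {z z' : T → SymN n X} {A : ∀ s, z s ⟶ z' s} (hA : ContinuousAt (fun s => arr (A s)) t)
    (h : ∀ i j, (A t).perm i = j → c i = c' j) {v : ∀ s, (V.powVB c).fib (z s)}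
    (hv : ContinuousAt (fun s => (V.powVB c).pt (z s) (v s)) t)
    {w : ∀ s, (V.powVB c').fib (z' s)}
    (hw : ∀ᶠ s in 𝓝 t, ∀ h : ∀ i j, (A s).perm i = j → c i = c' j, w s = V.perm (A s) c c' h (v s)) :
    ContinuousAt (fun s => (V.powVB c').pt (z' s) (w s)) t := by
  classical
  have hA' := SymN.arr_iff.1 hA
  have hperm : ∀ᶠ s in 𝓝 t, (A s).perm = (A t).perm := by
    filter_upwards [eventually_all.2 fun i => (hA' i).1] with s hs
    exact Equiv.ext hs
  have hz : ContinuousAt z t := contAt_src hA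
  have hz' : ContinuousAt z' t := contAt_tgt hA
  let E : Fin n → VB (SymN n X) := fun i =>
    (V.coef (c i)).vb.pull (fun z : SymN n X => z i) (SymN.continuous_eval i)
  let E' : Fin n → VB (SymN n X) := fun i =>
    (V.coef (c' i)).vb.pull (fun z : SymN n X => z i) (SymN.continuous_eval i)
  have hU := VB.piTensor_isLT E (z t)
  have hm : z t ∈ ⋂ i, (E i).nbhd (z t) := Set.mem_iInter.2 fun i => (E i).mem_nbhd _
  let L : ∀ s, (V.powVB c).fib (z s) →ₗ[ℂ] (V.powVB c').fib (z' s) := fun s =>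
    if h : ∀ i j, (A s).perm i = j → c i = c' j then V.perm (A s) c c' h else 0
  have hL : ∀ᶠ s in 𝓝 t, ∃ h : ∀ i j, (A s).perm i = j → c i = c' j, L s = V.perm (A s) c c' h := by
    filter_upwards [hperm] with s hs
    have h' : ∀ i j, (A s).perm i = j → c i = c' j := fun i j e => h i j (by rw [← hs]; exact e)
    exact ⟨h', dif_pos h'⟩
  have key : ContinuousAt (fun s => (V.powVB c').pt (z' s) (L s (v s))) t := by
    refine hU.continuousAt_map (q := fun s => ⟨z s, v s⟩) hv hm (V.powVB c') hz' L fun j => ?_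
    have h1 : ∀ i, ContinuousAt (fun s => (V.coef (c i)).vb.pt (z s i) ((E i).frame (z t) (j i) (z s))) t :=
      fun i => ((VB.pull_iff _ _ _).1 ((E i).frame_cont (z t) (j i) hz ((E i).mem_nbhd _))).2
    have h2 := VB.piTensor_cont E' (g := z') (t := t) (v := fun s k =>
      if e : (A s).perm ((A t).perm.symm k) = k then
        V.tr (h ((A t).perm.symm k) k (Equiv.apply_symm_apply _ _)) ((A s).hom _ k e)
          ((E ((A t).perm.symm k)).frame (z t) (j ((A t).perm.symm k)) (z s))
      else 0) hz' fun k => by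
        refine (VB.pull_iff _ _ _).2 ⟨hz', ?_⟩
        refine (V.tr_cont (h ((A t).perm.symm k) k (Equiv.apply_symm_apply _ _)) (hA' _).2
          (h1 ((A t).perm.symm k))).congr ?_
        filter_upwards [(hA' ((A t).perm.symm k)).1] with s hs
        have e : (A s).perm ((A t).perm.symm k) = k := hs.trans (Equiv.apply_symm_apply _ _)
        refine (V.tr_congr _ (A s) e _).trans (congrArg ((V.coef (c' k)).vb.pt (z' s k)) ?_)
        symm
        exact dif_pos e
    refine h2.congr ?_
    filter_upwards [hL, hperm, hz.eventually (hU.isOpen.mem_nhds hm)] with s ⟨h', hs⟩ hp hU'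
    refine congrArg ((V.powVB c').pt (z' s)) ?_
    rw [hs, piTensor_basis_ext fun i => ((E i).isLT (z t)).bij _ (Set.mem_iInter.1 hU' i)]
    refine Eq.trans ?_ (V.perm_tprod (A s) h' _).symm
    congr 1
    funext k
    have key : ∀ i i' (hi : (A s).perm i = k) (hi' : (A s).perm i' = k),
        V.tr (h' i k hi) ((A s).hom i k hi) ((E i).frame (z t) (j i) (z s)) =
        V.tr (h' i' k hi') ((A s).hom i' k hi') ((E i').frame (z t) (j i') (z s)) := by
      intro i i' hi hi'
      obtain rfl := (A s).perm.injective (hi.trans hi'.symm)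
      rfl
    have e : (A s).perm ((A t).perm.symm k) = k := by rw [hp, Equiv.apply_symm_apply]
    exact (dif_pos e).trans (key _ _ _ _)
  refine key.congr ?_
  filter_upwards [hw, hL] with s h1 ⟨h2, h3⟩
  rw [h1 h2, h3]
  rfl

/-- The power operation `Pₙ` on series: the coefficient of `q ^ a` of the `n`-th external tensor power,
with the action of the symmetric group which permutes the tensor factors. -/
def Series.pow (n : ℕ) (V : Series ξ) : Series (ξ.symN n) where
  coef a :=
    { vb := VB.pi (I := {c : Fin n → ℚ≥0 // ∑ i, c i = a}) (fun c => V.powVB c.1) (V.powVB_finite a)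
      act := fun {z z'} A => LinearMap.pi fun c' => V.perm A (fun i => c'.1 (A.perm i)) c'.1
          (fun i j h => congrArg c'.1 h) ∘ₗ
        LinearMap.proj (⟨fun i => c'.1 (A.perm i), (Equiv.sum_comp A.perm c'.1).trans c'.2⟩ :
          {c : Fin n → ℚ≥0 // ∑ i, c i = a})
      act_id := fun z v => funext fun c' => V.perm_id c'.1 (fun i j h => congrArg c'.1 h) (v c')
      act_comp := fun A B v => funext fun c'' =>
        V.perm_comp A B (fun i j h => congrArg (fun k => c''.1 (B.perm k)) h)
          (fun i j h => congrArg c''.1 h) (fun i j h => congrArg c''.1 h)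
          (v ⟨fun i => c''.1 (B.perm (A.perm i)), _⟩)
      act_cont := continuous_iff_continuousAt.2 fun p => by
        have h := ActDom.cont _ p
        have h2 := (VB.pi_iff _ _).1 h.2
        have hA' := SymN.arr_iff.1 h.1
        refine (VB.pi_iff _ _).2 ⟨ArrTop.tgt_cont.continuousAt.comp h.1, fun c' => ?_⟩
        refine V.perm_cont (fun i => c'.1 (p.1.hom.perm i)) c'.1 (A := fun q => q.1.hom) h.1
          (fun i j e => congrArg c'.1 e) (h2.2 ⟨fun i => c'.1 (p.1.hom.perm i), (Equiv.sum_comp p.1.hom.perm c'.1).trans c'.2⟩) ?_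
        filter_upwards [eventually_all.2 fun i => (hA' i).1] with s hs h
        have key : ∀ (d d' : {c : Fin n → ℚ≥0 // ∑ i, c i = a}) (e : d = d') (h1 h2),
            V.perm s.1.hom d.1 c'.1 h1 (s.2 d) = V.perm s.1.hom d'.1 c'.1 h2 (s.2 d') := by
          rintro d _ rfl h1 h2; rfl
        exact key ⟨fun i => c'.1 (s.1.hom.perm i), _⟩ ⟨fun i => c'.1 (p.1.hom.perm i), _⟩
          (Subtype.ext (funext fun i => congrArg c'.1 (hs i))) (fun i j e => congrArg c'.1 e) h }
  rot a z v := funext fun c => by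
    have := V.perm_diag (z := z) (fun i => ξ.app (z i)) (fun i => ph (c.1 i)) c.1
      (fun i v => V.rot _ _ _) (fun i j h => congrArg c.1 h) (v c)
    rw [← ph_sum, c.2] at this
    exact this
  locfin z := by
    obtain ⟨N, hN, h⟩ := V.powVB_denom z
    refine ⟨∏ i, N i, Finset.prod_pos fun i _ => hN i, ?_⟩
    filter_upwards [h] with w hw a hn
    by_contra hc
    refine not_subsingleton_iff_nontrivial.2 hn ⟨fun v v' => funext fun c => ?_⟩
    suffices hs : Subsingleton ((V.powVB c.1).fib w) from hs.elim _ _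
    by_contra hns
    choose m hm using hw c.1 (not_subsingleton_iff_nontrivial.1 hns)
    refine hc ⟨∑ i, m i * ∏ j ∈ Finset.univ.erase i, N j, ?_⟩
    have hN' : ∀ i, (N i : ℚ≥0) ≠ 0 := fun i => by exact_mod_cast (hN i).ne'
    rw [← c.2]
    push_cast
    rw [Finset.sum_div]
    refine Finset.sum_congr rfl fun i _ => ?_
    rw [hm i, ← Finset.mul_prod_erase _ _ (Finset.mem_univ i)]
    have : (∏ j ∈ Finset.univ.erase i, (N j : ℚ≥0)) ≠ 0 := Finset.prod_ne_zero_iff.2 fun j _ => hN' j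
    have := hN' i
    field_simp

end Power

/-! ### Transfers -/

section Transfer

variable {X : Type u} [Groupoid.{u} X] [TopologicalSpace X] [ArrTop X]
  {Y : Type u} [Groupoid.{u} Y] [TopologicalSpace Y] [ArrTop Y]

/-- A presentation of a functor `f` with finite homotopy fibres: it identifies the homotopy fibre of
`f` over `y`, whose objects are the arrows `y ⟶ f x`, continuously in `y`, with the action groupoid
of a finite group `G` on a finite set `J`. The element `j` of `J` is presented by the arrow
`iso j y : y ⟶ f (sec j y)`, and `γ` in `G` is presented by the arrows `move γ`. The action of the
arrows of `Y` on the homotopy fibres is presented by `idx` and `lift`. -/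
structure Cover (f : CFun X Y) where
  J : Type
  G : Type
  [finJ : Finite J]
  [finG : Fintype G]
  [group : Group G]
  [smul : MulAction G J]
  sec : J → Y → X
  sec_cont : ∀ j, Continuous (sec j)
  iso : ∀ j y, y ⟶ f.obj (sec j y)
  surj : ∀ (y : Y) (x : X) (g : y ⟶ f.obj x), ∃ (j : J) (h : sec j y ⟶ x), iso j y ≫ f.map h = g
  move : ∀ (γ : G) (j j' : J), γ • j = j' → ∀ y, sec j y ⟶ sec j' y
  move_cont : ∀ γ j j' h, Continuous fun y => arr (move γ j j' h y)
  move_one : ∀ j h y, move 1 j j h y = 𝟙 _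
  move_mul : ∀ γ γ' j j' j'' h h' h'' y,
    move (γ' * γ) j j'' h'' y = move γ j j' h y ≫ move γ' j' j'' h' y
  iso_move : ∀ γ j j' h y, iso j y ≫ f.map (move γ j j' h y) = iso j' y
  full : ∀ (j j' : J) (y : Y) (g : sec j y ⟶ sec j' y), iso j y ≫ f.map g = iso j' y →
    ∃! γ : G, ∃ h, g = move γ j j' h y
  idx : ∀ {y y' : Y}, (y ⟶ y') → J → J
  idx_cont : ∀ (a : Arr Y) (j' : J), ∀ᶠ b in 𝓝 a, idx (Arr.hom b) j' = idx (Arr.hom a) j'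
  idx_id : ∀ (y : Y) (j : J), idx (𝟙 y) j = j
  idx_comp : ∀ {y y' y'' : Y} (k : y ⟶ y') (l : y' ⟶ y'') (j : J), idx (k ≫ l) j = idx k (idx l j)
  idx_smul : ∀ {y y' : Y} (k : y ⟶ y') (γ : G) (j : J), idx k (γ • j) = γ • idx k j
  lift : ∀ {y y' : Y} (k : y ⟶ y') (j j' : J), idx k j' = j → (sec j y ⟶ sec j' y')
  lift_cont : ∀ j', Continuous fun a : Arr Y => arr (lift a.hom _ j' rfl)
  lift_id : ∀ (y : Y) (j : J) h, lift (𝟙 y) j j h = 𝟙 _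
  lift_comp : ∀ {y y' y'' : Y} (k : y ⟶ y') (l : y' ⟶ y'') (j j' j'' : J) h h' h'',
    lift (k ≫ l) j j'' h'' = lift k j j' h ≫ lift l j' j'' h'
  lift_move : ∀ {y y' : Y} (k : y ⟶ y') (γ : G) (i i' j j' : J) h h' hi hj,
    move γ i i' hi y ≫ lift k i' j' h' = lift k i j h ≫ move γ j j' hj y'
  iso_lift : ∀ {y y' : Y} (k : y ⟶ y') (j j' : J) h, iso j y ≫ f.map (lift k j j' h) = k ≫ iso j' y'

attribute [instance] Cover.finJ Cover.finG Cover.group Cover.smul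

variable {f : CFun X Y} (C : Cover f) (V : GB X)

/-- The sum of the bundle over the elements of the homotopy fibres. -/
def Cover.total : VB Y :=
  VB.pi (I := C.J) (fun j => V.vb.pull (C.sec j) (C.sec_cont j))
    fun _ => ⟨(Set.toFinite (Set.univ : Set C.J)).toFinset, .of_forall fun _ i hi => by simp at hi⟩

/-- The sections over the homotopy fibre of `y`: the `G`-invariants of the sum over `J`. -/
def Cover.inv (y : Y) : Submodule ℂ (∀ j, V.vb.fib (C.sec j y)) where
  carrier := {v | ∀ γ j j' h, V.act (C.move γ j j' h y) (v j) = v j'}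
  add_mem' {v w} hv hw γ j j' h := by rw [Pi.add_apply, map_add, hv γ j j' h, hw γ j j' h]; rfl
  zero_mem' γ j j' h := map_zero _
  smul_mem' c v hv γ j j' h := by rw [Pi.smul_apply, map_smul, hv γ j j' h]; rfl

/-- The average over `G`. -/
def Cover.mean (y : Y) : (∀ j, V.vb.fib (C.sec j y)) →ₗ[ℂ] ∀ j, V.vb.fib (C.sec j y) :=
  LinearMap.pi fun j => ∑ γ : C.G, ((Fintype.card C.G : ℂ)⁻¹) •
    (V.act (C.move γ (γ⁻¹ • j) j (smul_inv_smul γ j) y) ∘ₗ LinearMap.proj (γ⁻¹ • j))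

theorem Cover.mean_apply (y : Y) (v) (j) : C.mean V y v j = ∑ γ : C.G, ((Fintype.card C.G : ℂ)⁻¹) •
    V.act (C.move γ (γ⁻¹ • j) j (smul_inv_smul γ j) y) (v (γ⁻¹ • j)) := by
  simp [Cover.mean]

theorem Cover.card_ne : (Fintype.card C.G : ℂ) ≠ 0 := by
  exact_mod_cast Fintype.card_ne_zero

theorem Cover.mean_of_mem (y : Y) {v} (hv : v ∈ C.inv V y) : C.mean V y v = v := by
  funext j
  rw [C.mean_apply]
  have : ∀ γ : C.G, V.act (C.move γ (γ⁻¹ • j) j (smul_inv_smul γ j) y) (v (γ⁻¹ • j)) = v j :=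
    fun γ => hv _ _ _ _
  simp only [this, Finset.sum_const, Finset.card_univ]
  rw [← Nat.cast_smul_eq_nsmul ℂ, smul_smul, mul_inv_cancel₀ C.card_ne, one_smul]

theorem Cover.mean_mem (y : Y) (v) : C.mean V y v ∈ C.inv V y := by
  intro γ j j' h
  rw [C.mean_apply, C.mean_apply, map_sum]
  refine Fintype.sum_equiv (Equiv.mulLeft γ) _ _ fun δ => ?_
  rw [map_smul, ← V.act_comp]
  congr 1
  have key : ∀ i (e : δ • i = j) i' (e' : (γ * δ) • i' = j'),
      V.act (C.move δ i j e y ≫ C.move γ j j' h y) (v i) = V.act (C.move (γ * δ) i' j' e' y) (v i') := by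
    intro i e i' e'
    obtain rfl : i = i' := by
      rw [mul_smul, ← h, smul_left_cancel_iff, ← e, smul_left_cancel_iff] at e'
      exact e'.symm
    rw [C.move_mul δ γ i j j' e h e']
  exact key _ _ _ _

/-- The bundle of invariants. -/
def Cover.pushVB : VB Y := (C.total V).embed (fun y => C.inv V y) (fun y => Submodule.subtype _)
    (fun y => Subtype.val_injective) (by
      refine ⟨C.mean V, ?_, fun y v => C.mean_of_mem V y v.2, fun y v => ⟨⟨_, C.mean_mem V y v⟩, rfl⟩⟩
      rw [continuous_iff_continuousAt]
      intro q
      have h1 := (VB.pi_iff _ _).1 (continuousAt_id (X := (C.total V).Tot) (x := q))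
      refine (VB.pi_iff _ _).2 ⟨(C.total V).contFst.continuousAt, fun j => ?_⟩
      refine (VB.pull_iff _ _ _).2 ⟨(C.total V).contFst.continuousAt, ?_⟩
      refine (V.vb.continuousAt_sum (κ := C.G) (c := fun _ _ => (Fintype.card C.G : ℂ)⁻¹)
        ((C.sec_cont j).continuousAt.comp (C.total V).contFst.continuousAt)
        (fun _ => continuousAt_const) fun γ => V.contAt
          ((C.move_cont γ (γ⁻¹ • j) j (smul_inv_smul γ j)).continuousAt.comp
            (C.total V).contFst.continuousAt) ((VB.pull_iff _ _ _).1 (h1.2 (γ⁻¹ • j))).2).congr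
          (.of_forall fun q => ?_)
      exact congrArg (V.vb.pt _) (C.mean_apply V q.1 q.2 j).symm)
/-- The transfer (push-forward) of a vector bundle: its fibre over `y` is the space of sections over
the homotopy fibre. -/
def GB.push : GB Y where
  vb := C.pushVB V
  act {y y'} k := LinearMap.restrict (LinearMap.pi fun j' =>
      V.act (C.lift k _ j' rfl) ∘ₗ LinearMap.proj (C.idx k j')) (p := C.inv V y) (q := C.inv V y') (by
    intro v hv γ j j' h
    change V.act _ (V.act _ _) = V.act _ _
    have e : γ • C.idx k j = C.idx k j' := by rw [← C.idx_smul, h]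
    rw [← V.act_comp, ← C.lift_move k γ _ _ _ _ rfl rfl e h, V.act_comp]
    exact congrArg _ (hv γ _ _ e))
  act_id y v := Subtype.ext (funext fun j => by
    have key : ∀ i (e : C.idx (𝟙 y) j = i), V.act (C.lift (𝟙 y) i j e) (v.1 i) = v.1 j := by
      intro i e
      obtain rfl : i = j := e.symm.trans (C.idx_id y j)
      rw [C.lift_id, V.act_id]
    exact key _ rfl)
  act_comp {y y' y''} k l v := Subtype.ext (funext fun j => by
    have key : ∀ i (e : C.idx (k ≫ l) j = i) i' (e' : C.idx k (C.idx l j) = i'),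
        V.act (C.lift (k ≫ l) i j e) (v.1 i) =
          V.act (C.lift l _ j rfl) (V.act (C.lift k i' (C.idx l j) e') (v.1 i')) := by
      intro i e i' e'
      obtain rfl : i = i' := e.symm.trans ((C.idx_comp k l j).trans e')
      rw [← V.act_comp, ← C.lift_comp k l]
    exact key _ rfl _ rfl)
  act_cont := continuous_iff_continuousAt.2 fun p => by
    have h := ActDom.cont _ p
    have h1 := (VB.pi_iff _ _).1 (((C.total V).embed_iff _ _ _ _).1 h.2)
    refine ((C.total V).embed_iff _ _ _ _).2 ((VB.pi_iff _ _).2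
      ⟨ArrTop.tgt_cont.continuousAt.comp h.1, fun j => (VB.pull_iff _ _ _).2
        ⟨ArrTop.tgt_cont.continuousAt.comp h.1, ?_⟩⟩)
    have h2 : ContinuousAt (fun q : ActDom (C.pushVB V) => V.vb.pt (C.sec (C.idx q.1.hom j) q.1.src)
        (q.2.1 (C.idx q.1.hom j))) p := by
      refine ((VB.pull_iff _ _ _).1 (h1.2 (C.idx p.1.hom j))).2.congr ?_
      filter_upwards [h.1.eventually (C.idx_cont p.1 j)] with q hq
      rw [hq]
      rfl
    exact V.contAt ((C.lift_cont j).continuousAt.comp h.1) h2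

/-- Compatibility of a presentation with center elements. -/
def Cover.Compat (C : Cover f) (υ : Cen X) (ξ : Cen Y) : Prop :=
  ∀ y j, ∃ (h : C.idx (ξ.app y) j = j) (γ : C.G) (hγ : γ • j = j),
    υ.app (C.sec j y) = C.lift (ξ.app y) j j h ≫ C.move γ j j hγ y

/-- The transfer of a series. -/
def Series.push (C : Cover f) {υ : Cen X} {ξ : Cen Y} (hC : C.Compat υ ξ) (V : Series υ) : Series ξ where
  coef a := GB.push C (V.coef a)
  rot a y v := Subtype.ext (funext fun j => by
    obtain ⟨h, γ, hγ, e⟩ := hC y j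
    have h1 := V.rot a _ (v.1 j)
    rw [e, (V.coef a).act_comp] at h1
    refine Eq.trans ?_ h1
    have h2 := ((GB.push C (V.coef a)).act (ξ.app y) v).2 γ j j hγ
    refine h2.symm.trans (congrArg _ ?_)
    have key : ∀ i (e : C.idx (ξ.app y) j = i), (V.coef a).act (C.lift (ξ.app y) i j e) (v.1 i) =
        (V.coef a).act (C.lift (ξ.app y) j j h) (v.1 j) := by
      intro i e
      obtain rfl : i = j := e.symm.trans h
      rfl
    exact key _ rfl)
  locfin y := by
    have _ := Fintype.ofFinite C.J
    choose N hN h using fun j => V.locfin (C.sec j y)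
    refine ⟨∏ j, N j, Finset.prod_pos fun j _ => hN j, ?_⟩
    filter_upwards [eventually_all.2 fun j => (C.sec_cont j).continuousAt.eventually (h j)] with z hz a hn
    by_contra hc
    refine not_subsingleton_iff_nontrivial.2 hn ⟨fun v w => Subtype.ext (funext fun j => ?_)⟩
    suffices hs : Subsingleton ((V.coef a).vb.fib (C.sec j z)) from hs.elim _ _
    by_contra hs
    classical
    obtain ⟨m, hm⟩ := hz j a (not_subsingleton_iff_nontrivial.1 hs)
    refine hc ⟨m * ∏ i ∈ Finset.univ.erase j, N i, ?_⟩
    have hN' : ∀ i, (N i : ℚ≥0) ≠ 0 := fun i => by exact_mod_cast (hN i).ne'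
    rw [hm, ← Finset.mul_prod_erase _ _ (Finset.mem_univ j)]
    push_cast
    have : (∏ i ∈ Finset.univ.erase j, (N i : ℚ≥0)) ≠ 0 := Finset.prod_ne_zero_iff.2 fun i _ => hN' i
    have := hN' j
    field_simp

end Transfer

section Covers

variable {X : Type u} [Groupoid.{u} X] [TopologicalSpace X] [ArrTop X]

/-- The presentation of the projection `(pt // Sₙ) × X ⟶ X`: the homotopy fibres are `pt // Sₙ`. -/
def BS.cover (n : ℕ) (hid : Continuous fun x : X => arr (𝟙 x)) : Cover (BS.proj n X) where
  J := Unit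
  G := Equiv.Perm (Fin n)
  smul :=
    { smul := fun _ j => j
      one_smul := fun _ => rfl
      mul_smul := fun _ _ _ => rfl }
  sec _ x := x
  sec_cont _ := continuous_id
  iso _ x := 𝟙 x
  surj y x g := ⟨(), ((1, g) : Equiv.Perm (Fin n) × _), Category.id_comp _⟩
  move γ _ _ _ x := ((γ, 𝟙 x) : Equiv.Perm (Fin n) × _)
  move_cont γ _ _ _ := continuous_iff_continuousAt.2 fun x =>
    BS.arr_iff.2 ⟨.of_forall fun _ => rfl, hid.continuousAt⟩
  move_one _ _ _ := rfl
  move_mul γ γ' _ _ _ _ _ _ x := Prod.ext rfl (Category.id_comp _).symm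
  iso_move _ _ _ _ _ := Category.id_comp _
  full _ _ x g hg := by
    obtain ⟨σ, g⟩ := g
    have hg' : g = 𝟙 x := (Category.id_comp g).symm.trans hg
    exact ⟨σ, ⟨rfl, Prod.ext rfl hg'⟩, fun γ h => (congrArg Prod.fst h.2).symm⟩
  idx _ j := j
  idx_cont _ _ := .of_forall fun _ => rfl
  idx_id _ _ := rfl
  idx_comp _ _ _ := rfl
  idx_smul _ _ _ := rfl
  lift k _ _ _ := ((1, k) : Equiv.Perm (Fin n) × _)
  lift_cont _ := continuous_iff_continuousAt.2 fun a =>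
    BS.arr_iff.2 ⟨.of_forall fun _ => rfl, continuousAt_id⟩
  lift_id _ _ _ := rfl
  lift_comp _ _ _ _ _ _ _ _ := rfl
  lift_move k γ _ _ _ _ _ _ _ _ := Prod.ext ((one_mul _).trans (mul_one _).symm)
    ((Category.id_comp _).trans (Category.comp_id _).symm)
  iso_lift _ _ _ _ := (Category.id_comp _).trans (Category.comp_id _).symm

theorem BS.cover_compat (n : ℕ) (hid : Continuous fun x : X => arr (𝟙 x)) (ξ : Cen X) :
    (BS.cover n hid).Compat (Cen.bs n ξ) ξ := fun y _ =>
  ⟨rfl, (1 : Equiv.Perm (Fin n)), rfl, Prod.ext rfl (Category.comp_id _).symm⟩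

/-- The presentation of the functor on inertia groupoids induced by `(pt // Sₙ) × X ⟶ X`: the homotopy
fibres are the action groupoids of `Sₙ` acting on itself by conjugation. -/
def BS.inertiaCover (n : ℕ) (hid : Continuous fun x : X => arr (𝟙 x)) :
    Cover (Inertia.map (BS.proj n X)) where
  J := Equiv.Perm (Fin n)
  G := Equiv.Perm (Fin n)
  smul :=
    { smul := fun γ σ => γ * σ * γ⁻¹
      one_smul := fun σ => by change 1 * σ * 1⁻¹ = σ; group
      mul_smul := fun γ δ σ => by change γ * δ * σ * (γ * δ)⁻¹ = γ * (δ * σ * δ⁻¹) * γ⁻¹; group }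
  sec σ p := ⟨p.pt, ((σ, p.loop) : Equiv.Perm (Fin n) × _)⟩
  sec_cont σ := continuous_iff_continuousAt.2 fun p => Inertia.obj_iff.2 (BS.arr_iff.2
    ⟨.of_forall fun _ => rfl, Inertia.obj_iff.1 continuousAt_id⟩)
  iso _ p := 𝟙 p
  surj y x g := ⟨x.loop.1, ⟨((1, g.1) : Equiv.Perm (Fin n) × _), Prod.ext
    ((one_mul _).trans (mul_one _).symm) g.2⟩, Category.id_comp _⟩
  move γ σ σ' h p := ⟨((γ, 𝟙 p.pt) : Equiv.Perm (Fin n) × _), Prod.ext (by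
    change γ * σ = σ' * γ
    rw [← h]
    change _ = γ * σ * γ⁻¹ * γ
    group) ((Category.comp_id _).trans (Category.id_comp _).symm)⟩
  move_cont γ σ σ' h := continuous_iff_continuousAt.2 fun p => by
    have hp : ContinuousAt (fun p : Inertia X => arr p.loop) p := Inertia.obj_iff.1 continuousAt_id
    exact Inertia.arr_iff.2 ⟨BS.arr_iff.2 ⟨.of_forall fun _ => rfl, hp⟩,
      BS.arr_iff.2 ⟨.of_forall fun _ => rfl, hp⟩, BS.arr_iff.2 ⟨.of_forall fun _ => rfl,
      hid.continuousAt.comp (contAt_src hp)⟩⟩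
  move_one _ _ _ := rfl
  move_mul γ γ' _ _ _ _ _ _ x := Subtype.ext (Prod.ext rfl (Category.id_comp _).symm)
  iso_move _ _ _ _ _ := Subtype.ext (Category.id_comp _)
  full σ σ' p g hg := by
    obtain ⟨⟨γ, g⟩, e⟩ := g
    have hg' : g = 𝟙 p.pt := (Category.id_comp g).symm.trans (congrArg Subtype.val hg)
    have e' : γ * σ = σ' * γ := congrArg Prod.fst e
    refine ⟨γ, ⟨?_, Subtype.ext (Prod.ext rfl hg')⟩, fun δ h => ?_⟩
    · change γ * σ * γ⁻¹ = σ'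
      rw [e']; group
    · obtain ⟨_, h⟩ := h
      exact (congrArg (fun q => q.1.1) h).symm
  idx _ j := j
  idx_cont _ _ := .of_forall fun _ => rfl
  idx_id _ _ := rfl
  idx_comp _ _ _ := rfl
  idx_smul _ _ _ := rfl
  lift k σ σ' h := ⟨((1, k.1) : Equiv.Perm (Fin n) × _), Prod.ext (by
    obtain rfl : σ' = σ := h
    exact (one_mul _).trans (mul_one _).symm) k.2⟩
  lift_cont σ := continuous_iff_continuousAt.2 fun a => by
    have h := Inertia.arr_iff.1 (continuousAt_id (X := Arr (Inertia X)) (x := a))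
    exact Inertia.arr_iff.2 ⟨BS.arr_iff.2 ⟨.of_forall fun _ => rfl, h.1⟩,
      BS.arr_iff.2 ⟨.of_forall fun _ => rfl, h.2.1⟩, BS.arr_iff.2 ⟨.of_forall fun _ => rfl, h.2.2⟩⟩
  lift_id _ _ _ := rfl
  lift_comp _ _ _ _ _ _ _ _ := rfl
  lift_move k γ _ _ _ _ _ _ _ _ := Subtype.ext (Prod.ext ((one_mul _).trans (mul_one _).symm)
    ((Category.id_comp _).trans (Category.comp_id _).symm))
  iso_lift _ _ _ _ := (Category.id_comp _).trans (Category.comp_id _).symm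

theorem BS.inertiaCover_compat (n : ℕ) (hid : Continuous fun x : X => arr (𝟙 x)) :
    (BS.inertiaCover n hid).Compat (Inertia.cen (BS n X)) (Inertia.cen X) := fun p σ =>
  ⟨rfl, σ, mul_inv_cancel_right (G := Equiv.Perm (Fin n)) σ σ, Subtype.ext (Prod.ext (mul_one _).symm (Category.comp_id _).symm)⟩

variable {i j n : ℕ}

theorem contAt_eqToHom (hid : Continuous fun x : X => arr (𝟙 x)) {T : Type*} [TopologicalSpace T]
    {t : T} {x y : T → X} (h : ∀ s, x s = y s) (hx : ContinuousAt x t) :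
    ContinuousAt (fun s => arr (eqToHom (h s))) t := by
  obtain rfl : x = y := funext h
  exact hid.continuousAt.comp hx

theorem arr_inj {x y : X} {f g : x ⟶ y} (h : arr f = arr g) : f = g := by
  cases h; rfl

theorem arr_eqToHom {x y : X} (h : x = y) : arr (eqToHom h) = arr (𝟙 x) := by subst h; rfl

theorem arr_eqToHom_comp {x y z : X} (h : x = y) (f : y ⟶ z) : arr (eqToHom h ≫ f) = arr f := by
  subst h; simp

theorem arr_comp_eqToHom {x y z : X} (f : x ⟶ y) (h : y = z) : arr (f ≫ eqToHom h) = arr f := by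
  subst h; simp

theorem arr_comp_congr {x y z x' y' z' : X} {f : x ⟶ y} {g : y ⟶ z} {f' : x' ⟶ y'} {g' : y' ⟶ z'}
    (h : arr f = arr f') (h' : arr g = arr g') : arr (f ≫ g) = arr (f' ≫ g') := by
  injection h with h1 h2 h3
  subst h1; subst h2
  injection h' with h4 h5 h6
  subst h5
  rw [eq_of_heq h3, eq_of_heq h6]

theorem FamHom.ext_arr {I K : Type} {x : I → X} {y : K → X} {A B : FamHom x y} (hp : A.perm = B.perm)
    (h : ∀ k, arr (A.hom k _ rfl) = arr (B.hom k _ rfl)) : A = B :=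
  FamHom.ext hp fun k l e e' => arr_inj
    ((arr_hom_congr A e rfl rfl).trans ((h k).trans (arr_hom_congr B rfl e' rfl)))

/-- The arrow of families of identities over a bijection of the index sets. -/
def FamHom.ofEq {I K : Type} {x : I → X} {y : K → X} (σ : I ≃ K) (h : ∀ k, x k = y (σ k)) : FamHom x y :=
  ⟨σ, fun k l e => eqToHom (e ▸ h k)⟩

theorem FamHom.ofEq_comp {I K L : Type} {x : I → X} {y : K → X} {z : L → X} (σ : I ≃ K) (τ : K ≃ L)
    (h : ∀ k, x k = y (σ k)) (h' : ∀ k, y k = z (τ k)) (h'' : ∀ k, x k = z (τ (σ k))) :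
    FamHom.ofEq (σ.trans τ) h'' = (FamHom.ofEq (y := y) σ h).comp (FamHom.ofEq τ h') :=
  FamHom.ext rfl fun _ _ _ _ => by simp [FamHom.ofEq, FamHom.comp]

/-- The components of a family under a bijection `Fin i ⊕ Fin j ≃ Fin n`. -/
def SymN.split (ρ : Fin i ⊕ Fin j ≃ Fin n) (z : SymN n X) : GProd (SymN i X) (SymN j X) :=
  (fun a => z (ρ (.inl a)), fun b => z (ρ (.inr b)))

theorem SymN.split_eq (e ρ : Fin i ⊕ Fin j ≃ Fin n) (z : SymN n X) (k : Fin n) :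
    z k = (SymN.concat X e).obj (SymN.split ρ z) (e (ρ.symm k)) := by
  obtain ⟨p, rfl⟩ := ρ.surjective k
  rcases p with p | p <;> simp [SymN.concat, SymN.split]

def SymN.splitIso (e ρ : Fin i ⊕ Fin j ≃ Fin n) (z : SymN n X) :
    z ⟶ (SymN.concat X e).obj (SymN.split ρ z) :=
  FamHom.ofEq (ρ.symm.trans e) (SymN.split_eq e ρ z)

theorem SymN.splitIso_perm (e ρ : Fin i ⊕ Fin j ≃ Fin n) {z : SymN n X} {q} (g : SymN.split ρ z ⟶ q) :
    (SymN.splitIso e ρ z ≫ (SymN.concat X e).map g).perm =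
      (ρ.symm.trans (g.1.perm.sumCongr g.2.perm)).trans e :=
  Equiv.ext fun k => congrArg (fun p => e ((g.1.perm.sumCongr g.2.perm) p)) (e.symm_apply_apply _)

theorem SymN.splitIso_arr (e ρ : Fin i ⊕ Fin j ≃ Fin n) {z : SymN n X} {q} (g : SymN.split ρ z ⟶ q) (p) :
    arr ((SymN.splitIso e ρ z ≫ (SymN.concat X e).map g).hom (ρ p) _ rfl) =
      arr ((FamHom.sum g.1 g.2).hom p _ rfl) :=
  (arr_eqToHom_comp (SymN.split_eq e ρ z (ρ p)) _).trans (arr_hom_congr (FamHom.sum g.1 g.2) _ rfl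
    ((e.symm_apply_apply _).trans (ρ.symm_apply_apply p)))

theorem SymN.split_left {ρ ρ' : Fin i ⊕ Fin j ≃ Fin n} (γ : Equiv.Perm (Fin i) × Equiv.Perm (Fin j))
    (h : (Equiv.sumCongr γ.1 γ.2).symm.trans ρ = ρ') (a : Fin i) : ρ (.inl a) = ρ' (.inl (γ.1 a)) := by
  subst h; exact congrArg (fun b => ρ (.inl b)) (γ.1.symm_apply_apply a).symm

theorem SymN.split_right {ρ ρ' : Fin i ⊕ Fin j ≃ Fin n} (γ : Equiv.Perm (Fin i) × Equiv.Perm (Fin j))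
    (h : (Equiv.sumCongr γ.1 γ.2).symm.trans ρ = ρ') (a : Fin j) : ρ (.inr a) = ρ' (.inr (γ.2 a)) := by
  subst h; exact congrArg (fun b => ρ (.inr b)) (γ.2.symm_apply_apply a).symm

/-- The presentation of the concatenation `Sᵢ ∫ X × Sⱼ ∫ X ⟶ Sₙ ∫ X` for `n = i + j`: the homotopy
fibre is the set of bijections `Fin i ⊕ Fin j ≃ Fin n` with the free action of `Sᵢ × Sⱼ`. -/
def SymN.cover (e : Fin i ⊕ Fin j ≃ Fin n) (hid : Continuous fun x : X => arr (𝟙 x)) :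
    Cover (SymN.concat X e) where
  J := Fin i ⊕ Fin j ≃ Fin n
  G := Equiv.Perm (Fin i) × Equiv.Perm (Fin j)
  smul :=
    { smul := fun γ ρ => (Equiv.sumCongr γ.1 γ.2).symm.trans ρ
      one_smul := fun ρ => by ext p; rcases p with p | p <;> rfl
      mul_smul := fun γ δ ρ => by ext p; rcases p with p | p <;> rfl }
  sec ρ z := SymN.split ρ z
  sec_cont ρ := (continuous_pi fun a => continuous_apply (ρ (.inl a))).prodMk
    (continuous_pi fun b => continuous_apply (ρ (.inr b)))
  iso ρ z := SymN.splitIso e ρ z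
  surj z q g := by
    have hg : ∀ p, g.perm ((e.trans g.perm.symm) p) = e p := fun p => g.perm.apply_symm_apply _
    let h : SymN.split (e.trans g.perm.symm) z ⟶ q :=
      ((⟨.refl _, fun a b hb => g.hom _ (e (.inl b)) (by subst hb; exact hg _) ≫ eqToHom (by
        simp [SymN.concat]; rfl)⟩,
        ⟨.refl _, fun a b hb => g.hom _ (e (.inr b)) (by subst hb; exact hg _) ≫ eqToHom (by
        simp [SymN.concat]; rfl)⟩) : FamHom _ _ × FamHom _ _)
    refine ⟨e.trans g.perm.symm, h, FamHom.ext_arr ?_ fun k => ?_⟩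
    · refine (SymN.splitIso_perm e _ h).trans (Equiv.ext fun k => ?_)
      change e ((Equiv.sumCongr (.refl _) (.refl _)) (e.symm (g.perm k))) = g.perm k
      rw [Equiv.sumCongr_refl]
      exact e.apply_symm_apply _
    · obtain ⟨p, rfl⟩ := (e.trans g.perm.symm).surjective k
      refine (SymN.splitIso_arr e _ h p).trans ?_
      rcases p with p | p
      · exact (arr_comp_eqToHom _ _).trans (arr_hom_congr g _ _ rfl)
      · exact (arr_comp_eqToHom _ _).trans (arr_hom_congr g _ _ rfl)
  move γ ρ ρ' h z := ((.ofEq γ.1 fun a => congrArg z (SymN.split_left γ h a),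
    .ofEq γ.2 fun a => congrArg z (SymN.split_right γ h a)) : FamHom _ _ × FamHom _ _)
  move_cont γ ρ ρ' h := continuous_iff_continuousAt.2 fun z => GProd.arr_iff.2
    ⟨SymN.arr_iff.2 fun a => ⟨.of_forall fun _ => rfl, contAt_eqToHom hid
      (fun z => congrArg z (SymN.split_left γ h a)) (continuous_apply _).continuousAt⟩,
      SymN.arr_iff.2 fun a => ⟨.of_forall fun _ => rfl, contAt_eqToHom hid
      (fun z => congrArg z (SymN.split_right γ h a)) (continuous_apply _).continuousAt⟩⟩
  move_one ρ h z := Prod.ext (FamHom.ext rfl fun _ _ _ _ => rfl) (FamHom.ext rfl fun _ _ _ _ => rfl)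
  move_mul γ γ' _ _ _ h h' h'' z := Prod.ext
    (FamHom.ofEq_comp γ.1 γ'.1 (fun a => congrArg z (SymN.split_left γ h a))
      (fun a => congrArg z (SymN.split_left γ' h' a)) (fun a => congrArg z (SymN.split_left (γ' * γ) h'' a)))
    (FamHom.ofEq_comp γ.2 γ'.2 (fun a => congrArg z (SymN.split_right γ h a))
      (fun a => congrArg z (SymN.split_right γ' h' a)) (fun a => congrArg z (SymN.split_right (γ' * γ) h'' a)))
  iso_move γ ρ ρ' h z := by
    refine FamHom.ext_arr ?_ fun k => ?_
    · refine (SymN.splitIso_perm e ρ _).trans ?_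
      subst h
      rfl
    · obtain ⟨p, rfl⟩ := ρ.surjective k
      refine (SymN.splitIso_arr e _ _ p).trans ?_
      rcases p with p | p
      · exact (arr_eqToHom (congrArg z (SymN.split_left γ h p))).trans
          (arr_eqToHom (SymN.split_eq e ρ' z (ρ (.inl p)))).symm
      · exact (arr_eqToHom (congrArg z (SymN.split_right γ h p))).trans
          (arr_eqToHom (SymN.split_eq e ρ' z (ρ (.inr p)))).symm
  full ρ ρ' z g hg := by
    have hp := congrArg FamHom.perm hg
    have hp' : ∀ q, ρ' ((g.1.perm.sumCongr g.2.perm) q) = ρ q := fun q => by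
      have h1 := congrArg (fun σ : Fin n ≃ Fin n => σ (ρ q)) ((SymN.splitIso_perm e ρ g).symm.trans hp)
      have h2 : e ((g.1.perm.sumCongr g.2.perm) (ρ.symm (ρ q))) = e (ρ'.symm (ρ q)) := h1
      rw [e.apply_eq_iff_eq, Equiv.symm_apply_apply] at h2
      rw [h2, Equiv.apply_symm_apply]
    have ha : ∀ p, arr ((FamHom.sum g.1 g.2).hom p _ rfl) = arr (𝟙 (z (ρ p))) := fun p => by
      refine (SymN.splitIso_arr e ρ g p).symm.trans ?_
      have h1 : ∀ B : z ⟶ (SymN.concat X e).obj (SymN.split ρ' z),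
          SymN.splitIso e ρ z ≫ (SymN.concat X e).map g = B →
          arr ((SymN.splitIso e ρ z ≫ (SymN.concat X e).map g).hom (ρ p) _ rfl) =
            arr (B.hom (ρ p) _ rfl) := by
        rintro _ rfl; rfl
      exact (h1 _ hg).trans (arr_eqToHom (SymN.split_eq e ρ' z (ρ p)))
    refine ⟨(g.1.perm, g.2.perm), ⟨?_, ?_⟩, fun γ h => ?_⟩
    · refine Equiv.ext fun p => ?_
      obtain ⟨q, rfl⟩ := (g.1.perm.sumCongr g.2.perm).surjective p
      refine Eq.trans ?_ (hp' q).symm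
      exact congrArg ρ ((g.1.perm.sumCongr g.2.perm).symm_apply_apply q)
    · exact Prod.ext (FamHom.ext_arr rfl fun a => (ha (.inl a)).trans
          (arr_eqToHom (congrArg z (hp' (.inl a)).symm)).symm)
        (FamHom.ext_arr rfl fun a => (ha (.inr a)).trans
          (arr_eqToHom (congrArg z (hp' (.inr a)).symm)).symm)
    · obtain ⟨_, h⟩ := h
      exact Prod.ext (congrArg (fun q => q.1.perm) h).symm (congrArg (fun q => q.2.perm) h).symm
  idx k ρ := ρ.trans k.perm.symm
  idx_cont a ρ := by
    have h := SymN.arr_iff.1 (continuousAt_id (X := Arr (SymN n X)) (x := a))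
    filter_upwards [eventually_all.2 fun i => (h i).1] with b hb
    have e : b.hom.perm = a.hom.perm := Equiv.ext hb
    exact congrArg (fun σ : Equiv.Perm (Fin n) => ρ.trans σ.symm) e
  idx_id _ _ := rfl
  idx_comp _ _ _ := rfl
  idx_smul _ _ _ := rfl
  lift k ρ ρ' h := ((⟨.refl _, fun a b hb => k.hom _ _ (by subst h; subst hb; exact k.perm.apply_symm_apply _)⟩,
    ⟨.refl _, fun a b hb => k.hom _ _ (by subst h; subst hb; exact k.perm.apply_symm_apply _)⟩) : FamHom _ _ × FamHom _ _)
  lift_cont ρ := by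
    refine continuous_iff_continuousAt.2 fun a => ?_
    have h := SymN.arr_iff.1 (continuousAt_id (X := Arr (SymN n X)) (x := a))
    have key : ∀ k, ContinuousAt (fun b : Arr (SymN n X) => arr (b.hom.hom (b.hom.perm.symm (ρ k)) (ρ k)
        (b.hom.perm.apply_symm_apply _))) a := by
      intro k
      refine (h (a.hom.perm.symm (ρ k))).2.congr ?_
      filter_upwards [eventually_all.2 fun i => (h i).1] with b hb
      have e : b.hom.perm = a.hom.perm := Equiv.ext hb
      exact arr_hom_congr b.hom _ _ (congrArg (fun σ : Equiv.Perm (Fin n) => σ.symm (ρ k)) e.symm)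
    exact GProd.arr_iff.2 ⟨SymN.arr_iff.2 fun i => ⟨.of_forall fun _ => rfl, key _⟩,
      SymN.arr_iff.2 fun i => ⟨.of_forall fun _ => rfl, key _⟩⟩
  lift_id z ρ h := Prod.ext (FamHom.ext rfl fun _ _ _ _ => rfl) (FamHom.ext rfl fun _ _ _ _ => rfl)
  lift_comp k l _ _ _ _ _ _ := Prod.ext
    (FamHom.ext rfl fun _ _ h h' => FamHom.comp_hom k l _ _ _ _ _ _)
    (FamHom.ext rfl fun _ _ h h' => FamHom.comp_hom k l _ _ _ _ _ _)
  lift_move {z z'} k γ ρ ρ' τ τ' _ _ h h' := Prod.ext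
    (FamHom.ext_arr (Equiv.ext fun _ => rfl) fun a =>
      (arr_eqToHom_comp (congrArg z (SymN.split_left γ h a)) _).trans
        ((arr_hom_congr k _ _ (SymN.split_left γ h a).symm).trans
          (arr_comp_eqToHom _ (congrArg z' (SymN.split_left γ h' a))).symm))
    (FamHom.ext_arr (Equiv.ext fun _ => rfl) fun a =>
      (arr_eqToHom_comp (congrArg z (SymN.split_right γ h a)) _).trans
        ((arr_hom_congr k _ _ (SymN.split_right γ h a).symm).trans
          (arr_comp_eqToHom _ (congrArg z' (SymN.split_right γ h' a))).symm))
  iso_lift {z z'} k ρ ρ' h := by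
    refine FamHom.ext_arr ?_ fun q => ?_
    · refine (SymN.splitIso_perm e ρ _).trans ?_
      subst h
      refine Equiv.ext fun q => congrArg e ?_
      exact congrArg (fun σ : Equiv.Perm (Fin i ⊕ Fin j) => σ (ρ'.symm (k.perm q))) Equiv.sumCongr_refl
    · obtain ⟨p, rfl⟩ := ρ.surjective q
      refine (SymN.splitIso_arr e _ _ p).trans ?_
      rcases p with p | p
      · exact (arr_hom_congr k _ rfl rfl).trans
          (arr_comp_eqToHom _ (SymN.split_eq e ρ' z' (k.perm (ρ (.inl p))))).symm
      · exact (arr_hom_congr k _ rfl rfl).trans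
          (arr_comp_eqToHom _ (SymN.split_eq e ρ' z' (k.perm (ρ (.inr p))))).symm

theorem SymN.cover_compat (e : Fin i ⊕ Fin j ≃ Fin n) (hid : Continuous fun x : X => arr (𝟙 x))
    (ξ : Cen X) : (SymN.cover e hid).Compat ((ξ.symN i).prod (ξ.symN j)) (ξ.symN n) := fun z ρ => by
  refine ⟨rfl, (1 : Equiv.Perm (Fin i) × Equiv.Perm (Fin j)), one_smul _ ρ, ?_⟩
  have h1 := (SymN.cover e hid).move_one ρ (one_smul _ ρ) z
  refine Eq.trans ?_ (congrArg (fun q => (SymN.cover e hid).lift ((ξ.symN n).app z) ρ ρ rfl ≫ q) h1).symm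
  refine Eq.trans ?_ (Category.comp_id _).symm
  exact Prod.ext (FamHom.ext_arr rfl fun a => (arr_comp_eqToHom _ _).trans (arr_comp_eqToHom _ _).symm)
    (FamHom.ext_arr rfl fun a => (arr_comp_eqToHom _ _).trans (arr_comp_eqToHom _ _).symm)

end Covers

/-! ### The operator `θ` -/

section Theta

variable {X : Type u} [Groupoid.{u} X] [TopologicalSpace X] [ArrTop X]

theorem FamHom.hom_congr {I J : Type} {x : I → X} {y : J → X} {A B : FamHom x y} (e : A = B) {i j} (h h') :
    A.hom i j h = B.hom i j h' := by subst e; rfl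

theorem finRotate_val {n : ℕ} (i : Fin n) : (finRotate n i : ℕ) = (i + 1) % n := by
  cases n with
  | zero => exact i.elim0
  | succ n => simp [Fin.val_add]

theorem Phi.iter_perm (o : Phi X) (r : ℕ) (i : Fin o.base.1) :
    ((iter o.loop r).perm i : ℕ) = (i + r) % o.len := by
  induction r with
  | zero => exact (Nat.mod_eq_of_lt i.isLt).symm
  | succ r ih =>
    have e : (iter o.loop (r + 1)).perm i = finRotate o.base.1 ((iter o.loop r).perm i) :=
      congrArg (fun σ : Equiv.Perm (Fin o.base.1) => σ ((iter o.loop r).perm i)) o.cyc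
    rw [e, finRotate_val, ih]
    change ((i + r) % o.len + 1) % o.len = _
    rw [Nat.mod_add_mod, add_assoc]

theorem Phi.len_eq {o o' : Phi X} (B : o ⟶ o') : o.len = o'.len := (Sym.hn (Phi.val B)).symm

theorem Phi.iter_zero (o : Phi X) : (iter o.loop o.len).perm o.zero = o.zero :=
  Fin.ext ((o.iter_perm _ _).trans (by
    change (0 + o.len) % o.len = 0
    rw [zero_add, Nat.mod_self]))

/-- The object of the inertia groupoid obtained by composing the arrows of an object of `Φ(X)` around
its cycle, starting at the index `0`. -/
def Phi.zeta (o : Phi X) : Inertia X :=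
  ⟨o.base.2 o.zero, (iter o.loop o.len).hom o.zero o.zero o.iter_zero⟩

/-- The arrow at the index `0` of an arrow in `Φ(X)` which fixes the index `0`. -/
def Phi.zetaMap {o o' : Phi X} (B : o ⟶ o') (h : (Phi.val B).perm o.zero = o'.zero) :
    o.zeta ⟶ o'.zeta :=
  ⟨(Phi.val B).hom o.zero o'.zero h, by
    have e := iter_comm (Phi.comm B) o.len
    have e1 : (iter o.loop o.len ≫ Phi.val B).perm o.zero = o'.zero :=
      (congrArg (Phi.val B).perm o.iter_zero).trans h
    have h1 := FamHom.comp_hom (iter o.loop o.len) (Phi.val B) o.zero o.zero o'.zero o.iter_zero h e1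
    have h2 := FamHom.comp_hom (Phi.val B) (iter o'.loop o'.len) o.zero o'.zero o'.zero h o'.iter_zero
      ((congrArg (iter o'.loop o'.len).perm h).trans o'.iter_zero)
    refine h1.symm.trans (Eq.trans (FamHom.hom_congr ?_ _ _) h2)
    rw [← Phi.len_eq B]
    exact e⟩

/-- Powers of the canonical center element of `Φ(X)`. -/
def Phi.rot (o : Phi X) (r : ℕ) : o ⟶ o := iter ((Phi.cen X).app o) r

theorem Phi.rot_val (o : Phi X) (r : ℕ) : Phi.val (o.rot r) = iter o.loop r := by
  induction r with
  | zero => rfl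
  | succ r ih =>
    change Phi.val (o.rot r) ≫ o.loop = iter o.loop r ≫ o.loop
    rw [ih]

theorem Phi.rot_add (o : Phi X) (r s : ℕ) : o.rot (r + s) = o.rot r ≫ o.rot s := by
  induction s with
  | zero => exact (Category.comp_id _).symm
  | succ s ih =>
    change o.rot (r + s) ≫ _ = o.rot r ≫ (o.rot s ≫ _)
    rw [ih, Category.assoc]

theorem Phi.rot_nat {o o' : Phi X} (A : o ⟶ o') (r : ℕ) : o.rot r ≫ A = A ≫ o'.rot r :=
  iter_comm ((Phi.cen X).nat A) r

/-- The condition that `A` followed by the `r`-th power of the rotation fixes the index `0`. -/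
def Phi.Fix {o o' : Phi X} (A : o ⟶ o') (r : ℕ) : Prop :=
  (Phi.val (A ≫ o'.rot r)).perm o.zero = o'.zero

theorem Phi.fix_iff {o o' : Phi X} {A : o ⟶ o'} {r : ℕ} :
    Phi.Fix A r ↔ (((Phi.val A).perm o.zero : ℕ) + r) % o'.len = 0 := by
  have e : (Phi.val (A ≫ o'.rot r)).perm o.zero = (iter o'.loop r).perm ((Phi.val A).perm o.zero) := by
    rw [← Phi.rot_val]; rfl
  rw [Phi.Fix, e, Fin.ext_iff, Phi.iter_perm]
  rfl

/-- The smallest power of the rotation which moves the image of the index `0` to `0`. -/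
def Phi.defect {o o' : Phi X} (A : o ⟶ o') : ℕ := o'.len - (Phi.val A).perm o.zero

theorem Phi.fix_defect {o o' : Phi X} (A : o ⟶ o') : Phi.Fix A (Phi.defect A) := by
  rw [Phi.fix_iff]
  exact (congrArg (· % o'.len) (Nat.add_sub_cancel' ((Phi.val A).perm o.zero).isLt.le)).trans
    (Nat.mod_self _)

theorem Phi.fix_comp {o o' o'' : Phi X} {A : o ⟶ o'} {B : o' ⟶ o''} {r s : ℕ} (h : Phi.Fix A r)
    (h' : Phi.Fix B s) : Phi.Fix (A ≫ B) (r + s) ∧ ∀ h'',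
      Phi.zetaMap ((A ≫ B) ≫ o''.rot (r + s)) h'' =
        Phi.zetaMap (A ≫ o'.rot r) h ≫ Phi.zetaMap (B ≫ o''.rot s) h' := by
  have e : (A ≫ B) ≫ o''.rot (r + s) = (A ≫ o'.rot r) ≫ (B ≫ o''.rot s) := by
    rw [Phi.rot_add, Category.assoc, Category.assoc, ← Category.assoc (o'.rot r) B, Phi.rot_nat B r,
      Category.assoc]
  have h1 : (Phi.val ((A ≫ o'.rot r) ≫ (B ≫ o''.rot s))).perm o.zero = o''.zero :=
    (congrArg (Phi.val (B ≫ o''.rot s)).perm h).trans h'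
  refine ⟨by rw [Phi.Fix, e]; exact h1, fun h'' => Subtype.ext ?_⟩
  refine Eq.trans (FamHom.hom_congr (congrArg Phi.val e) h'' h1) ?_
  exact FamHom.comp_hom (Phi.val (A ≫ o'.rot r)) (Phi.val (B ≫ o''.rot s)) _ _ _ h h' _

variable (V : Series (Inertia.cen X)) (a : ℚ≥0)

/-- The action of an arrow `A` of `Φ(X)` by means of a power of the rotation; the rotation acts as a
`k`-th root of the canonical center element of the inertia groupoid, where `k` is the length. -/
def Series.thetaAct {o o' : Phi X} (A : o ⟶ o') (r : ℕ) (h : Phi.Fix A r) :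
    (V.coef (o.len * a)).vb.fib o.zeta →ₗ[ℂ] (V.coef (o'.len * a)).vb.fib o'.zeta :=
  ph (-(r * a)) • V.tr (by rw [Phi.len_eq A]) (Phi.zetaMap (A ≫ o'.rot r) h)

theorem Series.thetaAct_comp {o o' o'' : Phi X} (A : o ⟶ o') (B : o' ⟶ o'') (r s : ℕ) (h : Phi.Fix A r)
    (h' : Phi.Fix B s) (h'') (v) : V.thetaAct a (A ≫ B) (r + s) h'' v =
      V.thetaAct a B s h' (V.thetaAct a A r h v) := by
  simp only [Series.thetaAct, LinearMap.smul_apply, map_smul, smul_smul]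
  rw [(Phi.fix_comp h h').2 h'', ← ph_add, ← V.tr_comp]
  congr 2
  push_cast; ring

theorem Phi.fix_id (o : Phi X) : Phi.Fix (𝟙 o) 0 := rfl

theorem Phi.fix_id_len (o : Phi X) : Phi.Fix (𝟙 o) o.len := by
  rw [Phi.fix_iff]
  change (0 + o.len) % o.len = 0
  rw [zero_add, Nat.mod_self]

theorem Series.thetaAct_id (o : Phi X) (v) : V.thetaAct a (𝟙 o) 0 o.fix_id v = v := by
  have e : Phi.zetaMap (𝟙 o ≫ o.rot 0) o.fix_id = 𝟙 o.zeta :=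
    Subtype.ext ((FamHom.hom_congr (A := Phi.val (𝟙 o ≫ o.rot 0)) (B := FamHom.id o.base.2) (i := o.zero)
      (j := o.zero) (congrArg Phi.val (Category.comp_id (𝟙 o))) o.fix_id rfl).trans rfl)
  simp only [Series.thetaAct, LinearMap.smul_apply]
  rw [e, V.tr_rfl, (V.coef _).act_id]
  simp [ph_zero]

theorem Series.thetaAct_id_len (o : Phi X) (v) : V.thetaAct a (𝟙 o) o.len o.fix_id_len v = v := by
  have e : Phi.zetaMap (𝟙 o ≫ o.rot o.len) o.fix_id_len = (Inertia.cen X).app o.zeta :=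
    Subtype.ext (FamHom.hom_congr ((congrArg Phi.val (Category.id_comp _)).trans (o.rot_val _)) _ _)
  simp only [Series.thetaAct, LinearMap.smul_apply]
  rw [e, V.tr_rfl, V.rot, smul_smul, ← ph_add]
  push_cast
  rw [neg_add_cancel, ph_zero, one_smul]

theorem Series.thetaAct_eq {o o' : Phi X} (A : o ⟶ o') {r s : ℕ} (h : Phi.Fix A r) (h' : Phi.Fix A s) :
    V.thetaAct a A r h = V.thetaAct a A s h' := by
  have key : ∀ m r s, s = r + m * o'.len → ∀ (h : Phi.Fix A r) (h' : Phi.Fix A s),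
      V.thetaAct a A r h = V.thetaAct a A s h' := by
    intro m
    induction m with
    | zero => intro r s e h h'; obtain rfl : s = r := by simpa using e
              rfl
    | succ m ih =>
      intro r s e h h'
      have h1 : Phi.Fix A (r + m * o'.len) := by
        rw [Phi.fix_iff] at h ⊢
        rw [← add_assoc, Nat.add_mul_mod_self_right, h]
      rw [ih r _ rfl h h1]
      obtain rfl : s = (r + m * o'.len) + o'.len := by rw [e]; ring
      ext v
      have h2 : Phi.Fix (A ≫ 𝟙 o') ((r + m * o'.len) + o'.len) := by rwa [Category.comp_id]
      have e1 := V.thetaAct_comp a A (𝟙 o') _ _ h1 o'.fix_id_len h2 v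
      rw [V.thetaAct_id_len] at e1
      rw [← e1]
      simp only [Category.comp_id]
  have h1 := Phi.fix_iff.1 h
  have h2 := Phi.fix_iff.1 h'
  have h3 : r ≡ s [MOD o'.len] := Nat.ModEq.add_left_cancel' _ (h1.trans h2.symm)
  rcases le_total r s with hl | hl
  · obtain ⟨m, hm⟩ := (Nat.modEq_iff_dvd' hl).1 h3
    exact key m r s (by rw [mul_comm, ← hm]; omega) h h'
  · obtain ⟨m, hm⟩ := (Nat.modEq_iff_dvd' hl).1 h3.symm
    exact (key m s r (by rw [mul_comm, ← hm]; omega) h' h).symm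

variable {T : Type*} [TopologicalSpace T] {t : T}

/-- The component at the index `0` of a continuous family of arrows. -/
theorem Phi.contAt_zero {o o' : T → Phi X} {f : ∀ s, (o s).base ⟶ (o' s).base}
    (hf : ContinuousAt (fun s => arr (f s)) t) (h : ∀ s, (f s).perm (o s).zero = (o' s).zero) :
    ContinuousAt (fun s => arr ((f s).hom (o s).zero (o' s).zero (h s))) t := by
  obtain ⟨-, g, hg, hgf⟩ := (Sym.arr_iff.1 hf).2 (o t).zero
  refine hg.congr ?_
  filter_upwards [hgf] with s hs
  rw [← hs (o s).zero rfl]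
  exact arr_hom_congr (f s) _ _ rfl

theorem Phi.len_eventually {o : T → Phi X} (h : ContinuousAt o t) : ∀ᶠ s in 𝓝 t, (o s).len = (o t).len :=
  (Sym.arr_iff.1 (Phi.obj_iff.1 h)).1

theorem Phi.len_const : IsLocallyConstant fun o : Phi X => o.len :=
  (IsLocallyConstant.iff_eventually_eq _).2 fun _ => Phi.len_eventually continuousAt_id

theorem Phi.contAt_iter [TopGpd X] {o : T → Phi X} (h : ContinuousAt o t) (r : T → ℕ)
    (hr : ∀ᶠ s in 𝓝 t, r s = r t) : ContinuousAt (fun s => arr (iter (o s).loop (r s))) t := by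
  refine (OrbTate.contAt_iter (Phi.obj_iff.1 h) (r t)).congr ?_
  filter_upwards [hr] with s hs
  rw [hs]

theorem Phi.zeta_cont [TopGpd X] : Continuous fun o : Phi X => o.zeta :=
  continuous_iff_continuousAt.2 fun o => Inertia.obj_iff.2
    (Phi.contAt_zero (o := fun o => o) (o' := fun o => o) (f := fun o : Phi X => iter o.loop o.len)
      (Phi.contAt_iter continuousAt_id _ (Phi.len_eventually continuousAt_id)) fun o => o.iter_zero)

/-- The underlying bundle of the coefficient of `q ^ a` of `θ(V)`. -/
def Series.thetaVB [TopGpd X] : VB (Phi X) :=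
  VB.lpull (fun b => (V.coef b).vb) (fun o => o.len * a) (Phi.len_const.comp fun n : ℕ => n * a)
    Phi.zeta Phi.zeta_cont

theorem Series.thetaVB_iff [TopGpd X] {o : T → Phi X} (ho : ContinuousAt o t)
    {v : ∀ s, (V.coef ((o s).len * a)).vb.fib (o s).zeta} (n : ℕ) (hn : ∀ᶠ s in 𝓝 t, (o s).len = n)
    (v' : ∀ s, (V.coef (n * a)).vb.fib (o s).zeta)
    (hv : ∀ᶠ s in 𝓝 t, ∀ h, v' s = V.tr (a := (o s).len * a) (b := n * a) h (𝟙 _) (v s)) :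
    ContinuousAt (fun s => (V.thetaVB a).pt (o s) (v s)) t ↔
      ContinuousAt (fun s => (V.coef (n * a)).vb.pt (o s).zeta (v' s)) t := by
  classical
  have h1 := VB.lpull_iff (fun b => (V.coef b).vb) (fun o : Phi X => o.len * a)
    (Phi.len_const.comp fun n : ℕ => n * a) Phi.zeta Phi.zeta_cont (g := o) (v := v) (t := t)
    (i := n * a) (by filter_upwards [hn] with s hs; rw [hs])
    (fun s => if h : (o s).len * a = n * a then VB.castFib (fun b => (V.coef b).vb) h _ (v s) else 0)
    (fun s h => dif_pos h)
  refine h1.trans ((and_iff_right ho).trans (continuousAt_congr ?_))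
  filter_upwards [hv, hn] with s h2 h3
  have h4 : (o s).len * a = n * a := by rw [h3]
  refine congrArg ((V.coef (n * a)).vb.pt (o s).zeta) ((dif_pos h4).trans ?_)
  rw [h2 h4]
  exact ((V.coef (n * a)).act_id _ _).symm

theorem Phi.fix_cen {o : Phi X} {m : ℕ} (hm : o.len = m + 1) : Phi.Fix ((Phi.cen X).app o) m := by
  rw [Phi.fix_iff]
  have e : (((Phi.val ((Phi.cen X).app o)).perm o.zero : ℕ)) = 1 % o.len := by
    refine Eq.trans (congrArg (fun σ : Equiv.Perm (Fin o.base.1) => (σ o.zero : ℕ)) o.cyc) ?_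
    exact (finRotate_val _).trans (congrArg (· % o.len) (zero_add 1))
  rw [e, Nat.mod_add_mod, hm, add_comm 1 m, Nat.mod_self]

theorem Series.thetaAct_cen {o : Phi X} {m : ℕ} (hm : o.len = m + 1) (v) :
    V.thetaAct a ((Phi.cen X).app o) m (Phi.fix_cen hm) v = ph a • v := by
  have e0 : (Phi.cen X).app o ≫ o.rot m = o.rot o.len := by
    rw [hm, add_comm m 1, Phi.rot_add]
    exact congrArg (· ≫ o.rot m) (Category.id_comp ((Phi.cen X).app o)).symm
  have e : Phi.zetaMap ((Phi.cen X).app o ≫ o.rot m) (Phi.fix_cen hm) = (Inertia.cen X).app o.zeta :=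
    Subtype.ext (FamHom.hom_congr ((congrArg Phi.val e0).trans (o.rot_val _)) _ _)
  simp only [Series.thetaAct, LinearMap.smul_apply]
  rw [e, V.tr_rfl, V.rot, smul_smul, ← ph_add]
  congr 2
  rw [hm]
  push_cast
  ring

theorem Series.theta_cont [TopGpd X] {o o' : T → Phi X} {f : ∀ s, o s ⟶ o' s}
    (hf : ContinuousAt (fun s => arr (f s)) t) {v : ∀ s, (V.coef ((o s).len * a)).vb.fib (o s).zeta}
    (hv : ContinuousAt (fun s => (V.thetaVB a).pt (o s) (v s)) t) :
    ContinuousAt (fun s => (V.thetaVB a).pt (o' s)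
      (V.thetaAct a (f s) (Phi.defect (f s)) (Phi.fix_defect (f s)) (v s))) t := by
  classical
  have ho : ContinuousAt o t := contAt_src hf
  have ho' : ContinuousAt o' t := contAt_tgt hf
  have hf' := (Phi.arr_iff.1 hf).2.2
  have hl := Phi.len_eventually ho
  have hl' := Phi.len_eventually ho'
  have hd : ∀ᶠ s in 𝓝 t, Phi.defect (f s) = Phi.defect (f t) := by
    filter_upwards [((Sym.arr_iff.1 hf').2 (o t).zero).1, hl'] with s h1 h2
    rw [Phi.defect, Phi.defect, h2, h1 (o s).zero rfl]
  have hn : ∀ᶠ s in 𝓝 t, (o' s).len = (o t).len := by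
    filter_upwards [hl'] with s hs
    rw [hs, Phi.len_eq (f t)]
  let v1 : ∀ s, (V.coef ((o t).len * a)).vb.fib (o s).zeta := fun s =>
    if h : (o s).len * a = (o t).len * a then V.tr h (𝟙 _) (v s) else 0
  have h1 := (V.thetaVB_iff a ho _ hl v1 (.of_forall fun s h => dif_pos h)).1 hv
  let g : ∀ s, (o s).zeta ⟶ (o' s).zeta := fun s => Phi.zetaMap (f s ≫ (o' s).rot (Phi.defect (f s)))
    (Phi.fix_defect (f s))
  have hg : ContinuousAt (fun s => arr (g s)) t := by
    refine Inertia.arr_iff.2 ⟨Inertia.obj_iff.1 (Phi.zeta_cont.continuousAt.comp ho),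
      Inertia.obj_iff.1 (Phi.zeta_cont.continuousAt.comp ho'), ?_⟩
    refine Phi.contAt_zero (f := fun s => Phi.val (f s ≫ (o' s).rot (Phi.defect (f s)))) ?_ _
    refine (Sym.contAt_comp hf' (Phi.contAt_iter ho' _ hd)).congr (.of_forall fun s => ?_)
    exact congrArg (fun q => arr (Phi.val (f s) ≫ q)) (Phi.rot_val _ _).symm
  have hc : ContinuousAt (fun s => ph (-(Phi.defect (f s) * a))) t := by
    refine ContinuousAt.congr (f := fun _ => ph (-(Phi.defect (f t) * a))) continuousAt_const ?_
    filter_upwards [hd] with s hs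
    rw [hs]
  have h2 := (V.coef ((o t).len * a)).vb.continuousAt_sum (κ := Unit)
    (c := fun _ s => ph (-(Phi.defect (f s) * a))) (Phi.zeta_cont.continuousAt.comp ho')
    (fun _ => hc) fun _ => (V.coef ((o t).len * a)).contAt hg h1
  refine (V.thetaVB_iff a ho' _ hn _ ?_).2 h2
  filter_upwards [hl] with s hs h
  have hs' : (o s).len * a = (o t).len * a := by rw [hs]
  rw [Fintype.sum_unique]
  simp only [Series.thetaAct, LinearMap.smul_apply, map_smul]
  rw [← V.tr_comp, Category.comp_id]
  congr 1
  refine (congrArg _ (dif_pos hs')).trans ?_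
  refine (V.tr_rfl _ _).symm.trans ?_
  rw [← V.tr_comp, Category.id_comp]

/-- The operator `θ`: the coefficient of `q ^ a` over the component of automorphisms of length `k` is
the pull-back of the coefficient `V_{k a}`, with the action of the arrows which makes the loop act as
`exp (2 π i a)`. -/
def Series.theta [TopGpd X] (V : Series (Inertia.cen X)) : Series (Phi.cen X) where
  coef a :=
    { vb := V.thetaVB a
      act := fun A => V.thetaAct a A (Phi.defect A) (Phi.fix_defect A)
      act_id := fun o v => by
        rw [V.thetaAct_eq a (𝟙 o) _ o.fix_id]
        exact V.thetaAct_id a o v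
      act_comp := fun A B v => by
        have h := (Phi.fix_comp (Phi.fix_defect A) (Phi.fix_defect B)).1
        rw [V.thetaAct_eq a (A ≫ B) _ h]
        exact V.thetaAct_comp a A B _ _ _ _ h v
      act_cont := continuous_iff_continuousAt.2 fun p => by
        have h := ActDom.cont _ p
        exact V.theta_cont a h.1 h.2 }
  rot a o v := by
    obtain ⟨m, hm⟩ : ∃ m, o.len = m + 1 := ⟨o.len - 1, (Nat.sub_add_cancel o.pos).symm⟩
    refine Eq.trans (LinearMap.congr_fun (V.thetaAct_eq a _ _ (Phi.fix_cen hm)) v) ?_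
    exact V.thetaAct_cen a hm v
  locfin o := by
    obtain ⟨N, hN, h⟩ := V.locfin o.zeta
    have ho : 0 < o.len := o.pos
    refine ⟨o.len * N, Nat.mul_pos ho hN, ?_⟩
    filter_upwards [Phi.zeta_cont.continuousAt.eventually h,
      Phi.len_eventually (continuousAt_id (X := Phi X) (x := o))] with o' h1 h2 a hn
    obtain ⟨m, hm⟩ := h1 (o'.len * a) hn
    have h3 : o'.len = o.len := h2
    rw [h3] at hm
    have hk' : (o.len : ℚ≥0) ≠ 0 := by exact_mod_cast ho.ne'
    have hN' : (N : ℚ≥0) ≠ 0 := by positivity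
    refine ⟨m, ?_⟩
    push_cast
    field_simp
    field_simp at hm
    linear_combination hm

end Theta

/-! ### Operations on virtual series -/

section Virtual

variable {X : Type u} [Groupoid.{u} X] [TopologicalSpace X] [ArrTop X]
  {Y : Type u} [Groupoid.{u} Y] [TopologicalSpace Y] [ArrTop Y]
  {Z : Type u} [Groupoid.{u} Z] [TopologicalSpace Z] [ArrTop Z]
  {ξ : Cen X} {υ : Cen Y} {ζ : Cen Z}

theorem mk_eq_of_sub {M : Type*} [AddCommMonoid M] (a b : M) (hb : b ∈ (⊤ : AddSubmonoid M)) :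
    (AddLocalization.mk a ⟨b, hb⟩ : Algebra.GrothendieckAddGroup M) =
      Algebra.GrothendieckAddGroup.of a - Algebra.GrothendieckAddGroup.of b := by
  have h (c : M) : Algebra.GrothendieckAddGroup.of c =
      (AddLocalization.mk c 0 : Algebra.GrothendieckAddGroup M) :=
    (AddLocalization.mk_zero_eq_addMonoidOf_mk c).symm
  rw [h, h, Algebra.GrothendieckAddGroup.mk_sub_mk]
  congr 1
  · simp
  · exact Subtype.ext (by simp)

theorem Krot.exists_rep (x : Krot ξ) : ∃ p : Series ξ × Series ξ, x = p.1.cls - p.2.cls := by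
  induction x using AddLocalization.ind with
  | H y =>
    obtain ⟨a, b, hb⟩ := y
    obtain ⟨V, rfl⟩ := Quotient.exists_rep a
    obtain ⟨W, rfl⟩ := Quotient.exists_rep b
    refine ⟨(V, W), ?_⟩
    exact mk_eq_of_sub _ _ hb

/-- A presentation of an element of `K_rot` as a difference of classes of series. -/
def Krot.rep (x : Krot ξ) : Series ξ × Series ξ := x.exists_rep.choose

theorem Krot.rep_spec (x : Krot ξ) : x = x.rep.1.cls - x.rep.2.cls := x.exists_rep.choose_spec

/-- The extension of an additive operation `φ` on series to differences of series. -/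
def Krot.map (φ : Series ξ → Series υ) (x : Krot ξ) : Krot υ :=
  (φ x.rep.1).cls - (φ x.rep.2).cls

/-- The extension of a biadditive operation `φ` on series to differences of series. -/
def Krot.map₂ (φ : Series ξ → Series υ → Series ζ) (x : Krot ξ) (y : Krot υ) : Krot ζ :=
  (φ x.rep.1 y.rep.1).cls - (φ x.rep.1 y.rep.2).cls - (φ x.rep.2 y.rep.1).cls + (φ x.rep.2 y.rep.2).cls

/-- The pull-back along a functor which is compatible with the center elements. -/
def Krot.pull (F : CFun X Y) (hF : F.Compat ξ υ) : Krot υ → Krot ξ := Krot.map (Series.pull F hF)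

/-- The transfer along a functor with finite homotopy fibres. -/
def Krot.transfer {f : CFun X Y} (C : Cover f) (hC : C.Compat ξ υ) : Krot ξ → Krot υ :=
  Krot.map (Series.push C hC)

/-- The product. -/
def Krot.mul : Krot ξ → Krot ξ → Krot ξ := Krot.map₂ Series.tensor

variable (hid : Continuous fun x : X => arr (𝟙 x))

/-- The product `•`: the external product followed by the transfer along concatenation. -/
def Krot.star {i j n : ℕ} (e : Fin i ⊕ Fin j ≃ Fin n) (x : Krot (ξ.symN i)) (y : Krot (ξ.symN j)) :
    Krot (ξ.symN n) :=
  Krot.transfer (SymN.cover e hid) (SymN.cover_compat e hid ξ) (Krot.map₂ Series.ext x y)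

/-- The Atiyah power operations on differences of series. They are determined by the power operations
on series and by `P([V]) = P([V] - [W]) • P([W])`, that is,
`Pₙ([V]) = ∑ᵢ Pᵢ([V] - [W]) • Pₙ₋ᵢ([W])`. -/
def Krot.powDiff (V W : Series ξ) : ∀ n, Krot (ξ.symN n)
  | n => (V.pow n).cls - ∑ i : Fin n, Krot.star hid
      (finSumFinEquiv.trans (finCongr (Nat.add_sub_cancel' i.isLt.le))) (Krot.powDiff V W i)
      (W.pow (n - i)).cls

/-- The Atiyah power operation `Pₙ` on `K_rot`. -/
def Krot.pow (n : ℕ) (x : Krot ξ) : Krot (ξ.symN n) := Krot.powDiff hid x.rep.1 x.rep.2 n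

theorem BS.diag_compat (n : ℕ) (ξ : Cen X) : (BS.diag n X).Compat (ξ.bs n) (ξ.symN n) := fun x =>
  FamHom.ext_arr rfl fun _ => (arr_comp_eqToHom _ _).symm

/-- The Atiyah symmetric power: the transfer along `(pt // Sₙ) × X ⟶ X` of the restriction of the
power operation along the diagonal, i.e. the invariants of the symmetric group. -/
def Krot.symPow (n : ℕ) (x : Krot ξ) : Krot ξ :=
  Krot.transfer (BS.cover n hid) (BS.cover_compat n hid ξ)
    (Krot.pull (BS.diag n X) (BS.diag_compat n ξ) (x.pow hid n))

end Virtual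

/-! ### Tate K-theory -/

section Tate

/-- Composition of continuous functors. -/
def CFun.comp {X Y Z : Type u} [Groupoid.{u} X] [TopologicalSpace X] [ArrTop X]
    [Groupoid.{u} Y] [TopologicalSpace Y] [ArrTop Y] [Groupoid.{u} Z] [TopologicalSpace Z] [ArrTop Z]
    (F : CFun X Y) (G : CFun Y Z) : CFun X Z where
  obj x := G.obj (F.obj x)
  map f := G.map (F.map f)
  map_id x := by rw [F.map_id, G.map_id]
  map_comp f g := by rw [F.map_comp, G.map_comp]
  obj_cont := G.obj_cont.comp F.obj_cont
  map_cont := G.map_cont.comp F.map_cont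

/-- The orbifold Tate K-theory of a topological groupoid. -/
abbrev KTate (X : Type u) [Groupoid.{u} X] [TopologicalSpace X] [ArrTop X] : Type _ :=
  Krot (Inertia.cen X)

variable {X : Type u} [Groupoid.{u} X] [TopologicalSpace X] [ArrTop X] [TopGpd X]

theorem Inertia.id_cont : Continuous fun p : Inertia X => arr (𝟙 p) :=
  continuous_iff_continuousAt.2 fun p => by
    have h : ContinuousAt (fun p : Inertia X => arr p.loop) p := Inertia.obj_iff.1 continuousAt_id
    exact Inertia.arr_iff.2 ⟨h, h, TopGpd.id_cont.continuousAt.comp (contAt_src h)⟩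

theorem Phi.id_cont : Continuous fun p : Phi X => arr (𝟙 p) :=
  continuous_iff_continuousAt.2 fun p => by
    have h : ContinuousAt (fun p : Phi X => arr p.loop) p := Phi.obj_iff.1 continuousAt_id
    exact Phi.arr_iff.2 ⟨h, h, TopGpd.id_cont.continuousAt.comp (contAt_src h)⟩

/-- The operators `β_k` on Tate K-theory. -/
def KTate.beta (k : ℕ) (hk : 0 < k) : KTate X → KTate X := Krot.map (Series.beta k hk)

/-- The additive operation `θ`. -/
def KTate.theta : KTate X → Krot (Phi.cen X) := Krot.map Series.theta

theorem catFun_compat (X : Type u) [Groupoid.{u} X] [TopologicalSpace X] [ArrTop X] (n : ℕ) :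
    (catFun X n).Compat ((Phi.cen X).symN n) (Inertia.cen (Sym X)) := fun o => by
  have e : Phi.under (FamHom.diag fun i => (Phi.cen X).app (o i)) =
      FamHom.diag fun i => (o i).loop := FamHom.ext rfl fun i j h h' => by
    cases (show i = j from h')
    refine (congrArg Phi.val (FamHom.diag_hom (fun i => (Phi.cen X).app (o i)) i h)).trans ?_
    exact (FamHom.diag_hom (fun i => (o i).loop) i _).symm
  exact Subtype.ext (congrArg Sym.catMap e)

/-- The pull-back `Q^*` from the Tate K-theory of the total symmetric power of `X` to `K_rot` of the
total symmetric power of `Φ(X)`, the latter being decomposed into the `Sₙ ∫ Φ(X)`. -/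
def KTate.pullQ (X : Type u) [Groupoid.{u} X] [TopologicalSpace X] [ArrTop X] (x : KTate (Sym X)) (n : ℕ) :
    Krot ((Phi.cen X).symN n) :=
  Krot.pull (catFun X n) (catFun_compat X n) x

/-- The total power operation `(Q^*)⁻¹ ∘ P ∘ θ` of Tate K-theory. -/
def KTate.pow (F : KTate X) : KTate (Sym X) :=
  Function.invFun (KTate.pullQ X) fun n => (KTate.theta F).pow Phi.id_cont n

theorem Inertia.map_compat {Y : Type u} [Groupoid.{u} Y] [TopologicalSpace Y] [ArrTop Y] (F : CFun X Y) :
    (Inertia.map F).Compat (Inertia.cen X) (Inertia.cen Y) := fun _ => rfl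

/-- The coefficient of `t ^ n` of the total symmetric power in Tate K-theory: the transfer along
`(pt // Sₙ) × X ⟶ X` of the restriction of the total power operation along the diagonal
`(pt // Sₙ) × X ⟶ S(X)`, all taken in Tate K-theory. -/
def KTate.symTate (F : KTate X) (n : ℕ) : KTate X :=
  Krot.transfer (BS.inertiaCover n TopGpd.id_cont) (BS.inertiaCover_compat n TopGpd.id_cont)
    (Krot.pull (Inertia.map ((BS.diag n X).comp (SymN.incl n X))) (fun _ => rfl) F.pow)

/-- The coefficients of `S_{t ^ k}(G)`, where `S_t` is the total Atiyah symmetric power. -/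
def KTate.symAtiyah (k : ℕ) (G : KTate X) (n : ℕ) : KTate X :=
  if k ∣ n then G.symPow Inertia.id_cont (n / k) else 0

/-- The product of formal power series in `t` with coefficients in Tate K-theory. -/
def KTate.mulSeries (f g : ℕ → KTate X) (n : ℕ) : KTate X :=
  ∑ p ∈ Finset.HasAntidiagonal.antidiagonal n, Krot.mul (f p.1) (g p.2)

/-- The coefficients of the partial product of the `S_{t ^ k}(β_k(F))` for `1 ≤ k ≤ M`. -/
def KTate.partialProd (F : KTate X) : ℕ → ℕ → KTate X
  | 0 => fun n => if n = 0 then (Series.one (Inertia.cen X)).cls else 0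
  | M + 1 => KTate.mulSeries (KTate.partialProd F M)
      (KTate.symAtiyah (M + 1) (KTate.beta (M + 1) M.succ_pos F))

end Tate

end OrbTate

end

/-!
The power operation of Tate K-theory is computed by cutting permutations into cycles.

An automorphism of a family of objects is, up to isomorphism, the concatenation of its restrictions to the
cycles of its permutation, and each of these restrictions is isomorphic to an automorphism whose permutation
is a standard cycle. Arrows between such concatenations permute the cycles. Hence `Q : S(Φ(X)) ⟶ Λ(S(X))`
is full and faithful (`Phi.exists_cat`, `Phi.cat_injective`). The permutation of an automorphism is locally
constant, so the cycles can be chosen continuously (`partsFunctor`), and `Q` is an equivalence of topological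
groupoids. A bundle on `S(Φ(X))` is a sequence of bundles on its summands (`GB.glue`). Therefore `Q^*` is
bijective (`KTate.pullQ_bijective`); two classes with the same pull-back are compared by gluing the series
which stabilise the isomorphisms over the summands.

The transfers involved are limits over finite groupoids. A `Diag Z Y K` is a family of functors `Z ⟶ Y`
indexed by a groupoid `K`, and `GB.lim` is the limit of the pull-backs of a bundle along them. If the objects
of `K` have lengths, the limits over the families of total length `n` in `K`, applied to the tensor powers of
`x`, are the coefficients of a power series, `Krot.total`. For a series `V ⊕ W` the tensor power decomposes by
the subsets of the index set into transfers of external products (`Series.pow_sum`), and limits are compatible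
with transfers and external products (`GB.lim_push`, `GB.lim_tensor`). So the power series is multiplicative
(`Series.total_sum`), also for virtual elements (`Krot.totalPow_mul`).

With `K` the point, it is the total Atiyah symmetric power (`Krot.coeff_totalPow`). With `K` the groupoid of
standard cycles, applied to `θ(F)`, it is `S_t^Tate(F)`: the transfer from `Λ((pt // Sₙ) × X)` is a limit over
all permutations of `n` elements, which are the families of standard cycles of total length `n`
(`KTate.transfer_eq_sum`, `KTate.symTate_eq`).

Since arrows preserve the length of a cycle, `θ(V)` is the sum of its restrictions to the lengths, and
multiplicativity gives a product over the lengths `k` (`Series.cycleTotal_theta`). For one length `k`, only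
families of `m` cycles of length `k` contribute, to the coefficient of `t ^ (k * m)`. The automorphism group of
such a family is the wreath product of `Sₘ` and the cyclic group generated by the rotation, and its invariants
in the tensor power are the `m`-th symmetric power of the invariants of the cyclic group (`Series.lim_pow`,
`Series.total_eq_expand`). On a constant cycle at `g`, the center element `φ` is the rotation times `g`, and it
acts on the coefficient of `q ^ a` in `θ(V)` by `exp (2 π i a)`. So the rotation acts trivially exactly on the
eigenspace of `g` which defines `β_k(V)` (`Series.fix_theta`). Cycles longer than `M` do not contribute to the
coefficients up to `t ^ M`, and the formula for series extends to virtual elements because the total power of a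
series is a unit (`KTate.symTate_eq_partialProd`).

Isomorphisms of bundles are mostly obtained from `GB.iso_of_joint`: two bundles with jointly injective families
of maps to the same bundles are isomorphic if these families have the same image in each fibre.
-/

open Filter Topology CategoryTheory
open scoped TensorProduct NNRat
noncomputable section
namespace OrbTate
set_option linter.unusedSectionVars false
set_option linter.unusedVariables false

/-! ### Jointly injective families of bundle maps -/

section Joint

variable {B : Type u} [TopologicalSpace B] {T : Type*} [TopologicalSpace T] {t : T}

/-- A family of subspaces of a finite dimensional space with intersection zero has a finite
subfamily with intersection zero. -/
theorem exists_finset_joint {V : Type*} [AddCommGroup V] [Module ℂ V] [FiniteDimensional ℂ V]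
    {I : Type*} (K : I → Submodule ℂ V) (h : ∀ v, (∀ i, v ∈ K i) → v = 0) :
    ∃ s : Finset I, ∀ v, (∀ i ∈ s, v ∈ K i) → v = 0 := by
  classical
  obtain ⟨m, ⟨s, rfl⟩, hm⟩ := IsArtinian.set_has_minimal
    (Set.range fun s : Finset I => ⨅ i ∈ s, K i) ⟨_, ∅, rfl⟩
  refine ⟨s, fun v hv => h v fun i => ?_⟩
  by_contra hi
  refine hm _ ⟨insert i s, rfl⟩ (lt_of_le_of_ne ?_ ?_)
  · exact biInf_mono fun j hj => Finset.mem_insert_of_mem hj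
  · intro he
    have hv' : v ∈ ⨅ i ∈ s, K i := by simpa [Submodule.mem_iInf] using hv
    have he' : ⨅ j ∈ insert i s, K j = ⨅ j ∈ s, K j := he
    rw [← he'] at hv'
    simp only [Submodule.mem_iInf, Finset.mem_insert] at hv'
    exact hi (hv' i (Or.inl rfl))

/-- Jointly injective bundle maps are jointly inducing: a family of vectors of a vector bundle over
a continuous family of base points is continuous as soon as its images are. -/
theorem VB.continuousAt_of_joint (E : VB B) {I : Type*} {B' : I → Type u}
    [∀ i, TopologicalSpace (B' i)] (F : ∀ i, VB (B' i)) (φ : ∀ i, B → B' i)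
    (f : ∀ i b, E.fib b →ₗ[ℂ] (F i).fib (φ i b))
    (hf : ∀ i, Continuous fun p : E.Tot => (F i).pt (φ i p.1) (f i p.1 p.2))
    {g : T → B} {v : ∀ s, E.fib (g s)} (hg : ContinuousAt g t)
    (hinj : ∀ v, (∀ i, f i (g t) v = 0) → v = 0)
    (hv : ∀ i, ContinuousAt (fun s => (F i).pt (φ i (g s)) (f i (g s) (v s))) t) :
    ContinuousAt (fun s => E.pt (g s) (v s)) t := by
  classical
  -- In a local frame of `E` at `b`, finitely many coordinates of the maps `f i`, collected in `L`, are
  -- jointly injective at `b`; `N` is a left inverse of `L` there.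
  set b := g t with hb
  have hE := E.isLT b
  have hEb := E.mem_nbhd b
  let J : Type _ := Σ i, Fin ((F i).rk (φ i b))
  let lam : J → B → (Fin (E.rk b) → ℂ) →ₗ[ℂ] ℂ := fun j y =>
    LinearMap.proj j.2 ∘ₗ (F j.1).coord (φ j.1 b) (φ j.1 y) ∘ₗ f j.1 y ∘ₗ linv (E.coord b y)
  obtain ⟨s, hs⟩ := exists_finset_joint (fun j : J => LinearMap.ker (lam j b)) (by
    intro c hc
    have h1 : linv (E.coord b b) c = 0 := by
      refine hinj _ fun i => ?_
      refine (((F i).isLT (φ i b)).bij _ ((F i).mem_nbhd _)).1 ?_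
      rw [map_zero]
      funext k
      exact hc ⟨i, k⟩
    have := linv_right (hE.bij b hEb) c
    rw [h1, map_zero] at this
    exact this.symm)
  let L : B → (Fin (E.rk b) → ℂ) →ₗ[ℂ] (s → ℂ) := fun y => LinearMap.pi fun j => lam j.1 y
  have hLinj : LinearMap.ker (L b) = ⊥ := by
    rw [LinearMap.ker_eq_bot']
    intro c hc
    exact hs c fun j hj => congrFun hc ⟨j, hj⟩
  obtain ⟨N, hN⟩ := (L b).exists_leftInverse_of_injective hLinj
  let A : B → ((Fin (E.rk b) → ℂ) →L[ℂ] (Fin (E.rk b) → ℂ)) := fun y =>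
    LinearMap.toContinuousLinearMap (N ∘ₗ L y)
  -- The matrix `A y = N ∘ L y` is continuous along `g` and the identity at `b`, hence invertible near `t`.
  have hNc : Continuous N := N.continuous_of_finiteDimensional
  have hlam : ∀ j : J, ∀ {w : ∀ y, E.fib y} {h : T → B}, ContinuousAt h t → h t = b →
      ContinuousAt (fun s => (F j.1).pt (φ j.1 (h s)) (f j.1 (h s) (w (h s)))) t → 
      ContinuousAt (fun s => (F j.1).coord (φ j.1 b) (φ j.1 (h s)) (f j.1 (h s) (w (h s))) j.2) t := by
    intro j w h hh htb hw
    have h1 := ((F j.1).isLT (φ j.1 b)).continuousAt_iff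
      (F := fun s => (F j.1).pt (φ j.1 (h s)) (f j.1 (h s) (w (h s)))) (t := t)
      (by change φ j.1 (h t) ∈ _; rw [htb]; exact (F j.1).mem_nbhd _)
    exact continuousAt_pi.1 (h1.1 hw).2 j.2
  have hAc : ContinuousAt (fun s => A (g s)) t := by
    rw [continuousAt_clm_apply]
    intro c
    change ContinuousAt (fun s => N (L (g s) c)) t
    refine hNc.continuousAt.comp (continuousAt_pi.2 fun j => ?_)
    have h1 := hE.frame hg hEb (c := fun _ => c) continuousAt_const
    exact hlam j.1 (w := fun y => linv (E.coord b y) c) hg rfl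
      ((hf j.1.1).continuousAt.comp h1)
  have hA1 : A b = 1 := by
    ext c : 1
    change (N ∘ₗ L b) c = c
    rw [hN]; rfl
  have hunit : ∀ᶠ s in 𝓝 t, IsUnit (A (g s)) :=
    hAc.eventually (Units.isOpen.mem_nhds (by change IsUnit (A b); rw [hA1]; exact isUnit_one))
  have hinv : ContinuousAt (fun s => Ring.inverse (A (g s))) t := by
    have h1 := NormedRing.inverse_continuousAt (1 : ((Fin (E.rk b) → ℂ) →L[ℂ] (Fin (E.rk b) → ℂ))ˣ)
    refine ContinuousAt.comp (g := Ring.inverse) (f := fun s => A (g s)) ?_ hAc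
    change ContinuousAt Ring.inverse (A b)
    rw [hA1]; exact h1
  -- The coordinates of `v` are obtained by applying the inverse matrix to the continuous family `N (L v)`.
  have hLv : ContinuousAt (fun s => N (L (g s) (E.coord b (g s) (v s)))) t := by
    refine hNc.continuousAt.comp (continuousAt_pi.2 fun j => ?_)
    have h1 := ((F j.1.1).isLT (φ j.1.1 b)).continuousAt_iff
      (F := fun s => (F j.1.1).pt (φ j.1.1 (g s)) (f j.1.1 (g s) (v s))) (t := t)
      ((F j.1.1).mem_nbhd _)
    refine (continuousAt_pi.1 (h1.1 (hv j.1.1)).2 j.1.2).congr ?_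
    filter_upwards [hg.eventually (hE.isOpen.mem_nhds hEb)] with r hr
    change _ = (F j.1.1).coord (φ j.1.1 b) (φ j.1.1 (g r)) (f j.1.1 (g r) (linv (E.coord b (g r))
      (E.coord b (g r) (v r)))) j.1.2
    rw [linv_left (hE.bij _ hr)]
    rfl
  refine (hE.continuousAt_iff (F := fun s => E.pt (g s) (v s)) hEb).2 ⟨hg, ?_⟩
  refine (hinv.clm_apply hLv).congr ?_
  filter_upwards [hunit] with r hr
  change (Ring.inverse (A (g r))) (A (g r) (E.coord b (g r) (v r))) = E.coord b (g r) (v r)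
  have := Ring.inverse_mul_cancel _ hr
  exact congrArg (fun C => C (E.coord b (g r) (v r))) this

/-- A linear map out of a tensor product of bundles is continuous if it is so on pure tensors of
continuous sections. -/
theorem VB.tensor_contAt (E E' : VB B) {g : T → B} {v : ∀ s, E.fib (g s) ⊗[ℂ] E'.fib (g s)}
    (hv : ContinuousAt (fun s => (E.tensor E').pt (g s) (v s)) t) {B' : Type u} [TopologicalSpace B']
    (F : VB B') {g' : T → B'} (hg' : ContinuousAt g' t)
    (L : ∀ s, E.fib (g s) ⊗[ℂ] E'.fib (g s) →ₗ[ℂ] F.fib (g' s))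
    (hL : ∀ (a : ∀ s, E.fib (g s)) (b : ∀ s, E'.fib (g s)),
      ContinuousAt (fun s => E.pt (g s) (a s)) t → ContinuousAt (fun s => E'.pt (g s) (b s)) t →
      ContinuousAt (fun s => F.pt (g' s) (L s (a s ⊗ₜ b s))) t) :
    ContinuousAt (fun s => F.pt (g' s) (L s (v s))) t := by
  have hg := (E.tensor E').contAtFst hv
  have hU := E.tensor_isLT E' (g t)
  have hm : g t ∈ E.nbhd (g t) ∩ E'.nbhd (g t) := ⟨E.mem_nbhd _, E'.mem_nbhd _⟩
  refine hU.continuousAt_map (q := fun s => ⟨g s, v s⟩) hv hm F hg' L fun j => ?_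
  refine (hL _ _ (E.frame_cont (g t) j.1 hg (E.mem_nbhd _))
    (E'.frame_cont (g t) j.2 hg (E'.mem_nbhd _))).congr ?_
  filter_upwards [hg.eventually (hU.isOpen.mem_nhds hm)] with s hs
  rw [tensor_basis_ext ((E.isLT _).bij _ hs.1) ((E'.isLT _).bij _ hs.2)]
  rfl

/-- A linear map out of a finite tensor product of bundles is continuous if it is so on pure tensors
of continuous sections. -/
theorem VB.piTensor_contAt {I : Type} [Fintype I] [DecidableEq I] (E : I → VB B) {g : T → B}
    {v : ∀ s, ⨂[ℂ] i, (E i).fib (g s)}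
    (hv : ContinuousAt (fun s => (VB.piTensor E).pt (g s) (v s)) t) {B' : Type u}
    [TopologicalSpace B'] (F : VB B') {g' : T → B'} (hg' : ContinuousAt g' t)
    (L : ∀ s, (⨂[ℂ] i, (E i).fib (g s)) →ₗ[ℂ] F.fib (g' s))
    (hL : ∀ (a : ∀ s i, (E i).fib (g s)),
      (∀ i, ContinuousAt (fun s => (E i).pt (g s) (a s i)) t) →
      ContinuousAt (fun s => F.pt (g' s) (L s (PiTensorProduct.tprod ℂ (a s)))) t) :
    ContinuousAt (fun s => F.pt (g' s) (L s (v s))) t := by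
  classical
  have hg := (VB.piTensor E).contAtFst hv
  have hU := VB.piTensor_isLT E (g t)
  have hm := Set.mem_iInter.2 fun i => (E i).mem_nbhd (g t)
  refine hU.continuousAt_map (q := fun s => ⟨g s, v s⟩) hv hm F hg' L fun j => ?_
  refine (hL _ fun i => (E i).frame_cont (g t) (j i) hg ((E i).mem_nbhd _)).congr ?_
  filter_upwards [hg.eventually (hU.isOpen.mem_nhds hm)] with s hs
  rw [piTensor_basis_ext (fun i => ((E i).isLT _).bij _ (Set.mem_iInter.1 hs i))]
  rfl

end Joint

section IsoJoint

variable {X : Type u} [Groupoid.{u} X] [TopologicalSpace X] [ArrTop X]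

/-- Two vector bundles which inject, by continuous bundle maps, into a common family of bundles are
isomorphic if they have the same image and the actions of arrows correspond. -/
theorem GB.iso_of_joint {V W : GB X} {I : Type*} {B' : I → Type u} [∀ i, TopologicalSpace (B' i)]
    (F : ∀ i, VB (B' i)) (φ : ∀ i, X → B' i)
    (f : ∀ i x, V.vb.fib x →ₗ[ℂ] (F i).fib (φ i x)) (g : ∀ i x, W.vb.fib x →ₗ[ℂ] (F i).fib (φ i x))
    (hf : ∀ i, Continuous fun p : V.vb.Tot => (F i).pt (φ i p.1) (f i p.1 p.2))
    (hg : ∀ i, Continuous fun p : W.vb.Tot => (F i).pt (φ i p.1) (g i p.1 p.2))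
    (hfi : ∀ x v, (∀ i, f i x v = 0) → v = 0) (hgi : ∀ x w, (∀ i, g i x w = 0) → w = 0)
    (h1 : ∀ x v, ∃ w, ∀ i, f i x v = g i x w) (h2 : ∀ x w, ∃ v, ∀ i, f i x v = g i x w)
    (hact : ∀ x y (k : x ⟶ y) v w, (∀ i, f i x v = g i x w) →
      ∀ i, f i y (V.act k v) = g i y (W.act k w)) : V.Iso W := by
  choose p hp using h1
  choose q hq using h2
  have hfi' : ∀ x v v', (∀ i, f i x v = f i x v') → v = v' := fun x v v' h =>
    sub_eq_zero.1 (hfi x _ fun i => by rw [map_sub, h i, sub_self])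
  have hgi' : ∀ x v v', (∀ i, g i x v = g i x v') → v = v' := fun x v v' h =>
    sub_eq_zero.1 (hgi x _ fun i => by rw [map_sub, h i, sub_self])
  refine ⟨fun x => ⟨⟨⟨p x, fun v v' => ?_⟩, fun c v => ?_⟩, q x, fun v => ?_, fun w => ?_⟩,
    fun x y k v => ?_, ?_, ?_⟩
  · exact hgi' x _ _ fun i => by rw [← hp, map_add, map_add, hp, hp]
  · exact hgi' x _ _ fun i => by simp only [RingHom.id_apply]; rw [← hp, map_smul, map_smul, hp]
  · exact hfi' x _ _ fun i => (hq x _ i).trans (hp x v i).symm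
  · exact hgi' x _ _ fun i => ((hp x _ i).symm.trans (hq x w i))
  · exact hgi' y _ _ fun i => (hp y _ i).symm.trans (hact x y k v _ (hp x v) i)
  · rw [continuous_iff_continuousAt]
    intro z
    refine W.vb.continuousAt_of_joint F φ g hg (V.vb.contFst.continuousAt) (hgi _) fun i => ?_
    exact ((hf i).continuousAt (x := z)).congr (.of_forall fun s =>
      congrArg ((F i).pt (φ i s.1)) (hp s.1 s.2 i))
  · rw [continuous_iff_continuousAt]
    intro z
    refine V.vb.continuousAt_of_joint F φ f hf (W.vb.contFst.continuousAt) (hfi _) fun i => ?_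
    exact ((hg i).continuousAt (x := z)).congr (.of_forall fun s =>
      congrArg ((F i).pt (φ i s.1)) (hq s.1 s.2 i).symm)

/-- A continuous equivariant fibrewise bijection is an isomorphism. -/
theorem GB.iso_of_bij {V W : GB X} (f : ∀ x, V.vb.fib x →ₗ[ℂ] W.vb.fib x)
    (hf : Continuous fun p : V.vb.Tot => W.vb.pt p.1 (f p.1 p.2))
    (hb : ∀ x, Function.Bijective (f x))
    (hact : ∀ x y (k : x ⟶ y) v, f y (V.act k v) = W.act k (f x v)) : V.Iso W :=
  GB.iso_of_joint (I := Unit) (fun _ => W.vb) (fun _ x => x) (fun _ => f) (fun _ _ => LinearMap.id)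
    (fun _ => hf) (fun _ => continuous_id) (fun x v h => (hb x).1 ((h ()).trans (map_zero _).symm))
    (fun x w h => h ()) (fun x v => ⟨f x v, fun _ => rfl⟩)
    (fun x w => (hb x).2 w |>.imp fun v hv _ => hv)
    (fun x y k v w h _ => by rw [hact, h ()]; rfl)

end IsoJoint

/-! ### Direct sums and tensor products of bundles on a groupoid -/

section Alg

variable {B : Type u} [TopologicalSpace B] {T : Type*} [TopologicalSpace T] {t : T}

instance VB.finiteDimensional (E : VB B) (b : B) : FiniteDimensional ℂ (E.fib b) := by
  obtain ⟨n, U, τ, hb, h⟩ := E.exists_lt b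
  exact (LinearEquiv.ofBijective (τ b) (h.bij b hb)).symm.finiteDimensional

/-- The tensor product of two continuous maps of bundles is continuous. -/
theorem VB.tensorMap_contAt (E E' : VB B) {B' : Type u} [TopologicalSpace B'] (F F' : VB B')
    {g : T → B} {g' : T → B'} (hg' : ContinuousAt g' t) {v : ∀ s, E.fib (g s) ⊗[ℂ] E'.fib (g s)}
    (hv : ContinuousAt (fun s => (E.tensor E').pt (g s) (v s)) t)
    (f : ∀ s, E.fib (g s) →ₗ[ℂ] F.fib (g' s)) (f' : ∀ s, E'.fib (g s) →ₗ[ℂ] F'.fib (g' s))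
    (hf : ∀ a : ∀ s, E.fib (g s), ContinuousAt (fun s => E.pt (g s) (a s)) t →
      ContinuousAt (fun s => F.pt (g' s) (f s (a s))) t)
    (hf' : ∀ a : ∀ s, E'.fib (g s), ContinuousAt (fun s => E'.pt (g s) (a s)) t →
      ContinuousAt (fun s => F'.pt (g' s) (f' s (a s))) t) :
    ContinuousAt (fun s => (F.tensor F').pt (g' s) (TensorProduct.map (f s) (f' s) (v s))) t :=
  VB.tensor_contAt E E' hv (F.tensor F') hg' (fun s => TensorProduct.map (f s) (f' s))
    fun a b ha hb => F.tensor_cont F' (hf a ha) (hf' b hb)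

/-- The canonical map from the tensor product of a product with a finite dimensional space. -/
def piTensorLeft {I : Type*} (V : I → Type*) [∀ i, AddCommGroup (V i)] [∀ i, Module ℂ (V i)]
    (U : Type*) [AddCommGroup U] [Module ℂ U] : (∀ i, V i) ⊗[ℂ] U →ₗ[ℂ] ∀ i, V i ⊗[ℂ] U :=
  LinearMap.pi fun i => TensorProduct.map (LinearMap.proj i) LinearMap.id

/-- Tensoring with a finite dimensional space commutes with arbitrary products. -/
theorem piTensorLeft_bijective {I : Type*} (V : I → Type*) [∀ i, AddCommGroup (V i)]
    [∀ i, Module ℂ (V i)] (U : Type*) [AddCommGroup U] [Module ℂ U] [FiniteDimensional ℂ U] :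
    Function.Bijective (piTensorLeft V U) := by
  classical
  let b := Module.finBasis ℂ U
  constructor
  · rw [← LinearMap.ker_eq_bot, LinearMap.ker_eq_bot']
    intro x hx
    obtain ⟨c, rfl⟩ := TensorProduct.eq_repr_basis_right b x
    have hc : c = 0 := by
      ext k i
      have h1 := congrFun hx i
      let c' : Fin _ →₀ V i := c.mapRange (fun m => m i) rfl
      have h2 : c'.sum (fun k m => m ⊗ₜ[ℂ] b k) = 0 := by
        rw [Finsupp.sum_mapRange_index (by simp)]
        simpa [piTensorLeft, Finsupp.sum] using h1
      have := TensorProduct.sum_tmul_basis_right_eq_zero b c' h2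
      exact DFunLike.congr_fun this k
    rw [hc]; simp
  · intro y
    choose c hc using fun i => TensorProduct.eq_repr_basis_right b (y i)
    refine ⟨∑ k, (fun i => c i k) ⊗ₜ b k, funext fun i => ?_⟩
    rw [← hc i]
    simp only [piTensorLeft, map_sum, LinearMap.pi_apply, TensorProduct.map_tmul,
      LinearMap.proj_apply, LinearMap.id_apply]
    rw [Finsupp.sum_fintype _ _ (by simp)]

end Alg

section GBAlg

variable {X : Type u} [Groupoid.{u} X] [TopologicalSpace X] [ArrTop X]

theorem GB.tensor_congr {V V' W W' : GB X} (h : V.Iso V') (h' : W.Iso W') :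
    (V.tensor W).Iso (V'.tensor W') := by
  obtain ⟨e, he, hc, -⟩ := h
  obtain ⟨e', he', hc', -⟩ := h'
  refine GB.iso_of_bij (fun x => TensorProduct.map (e x).toLinearMap (e' x).toLinearMap) ?_
    (fun x => (TensorProduct.congr (e x) (e' x)).bijective) fun x y k v => ?_
  · rw [continuous_iff_continuousAt]
    intro p
    exact VB.tensorMap_contAt V.vb W.vb V'.vb W'.vb ((V.vb.tensor W.vb).contFst.continuousAt)
      continuousAt_id _ _ (fun a ha => hc.continuousAt.comp ha) fun a ha => hc'.continuousAt.comp ha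
  · change (TensorProduct.map _ _ ∘ₗ TensorProduct.map (V.act k) (W.act k)) v =
      (TensorProduct.map (V'.act k) (W'.act k) ∘ₗ TensorProduct.map _ _) v
    rw [← TensorProduct.map_comp, ← TensorProduct.map_comp]
    congr 2 <;> ext a
    · exact he _ _ _ _
    · exact he' _ _ _ _

theorem GB.tensor_comm (V W : GB X) : (V.tensor W).Iso (W.tensor V) := by
  refine GB.iso_of_bij (fun x => (TensorProduct.comm ℂ (V.vb.fib x) (W.vb.fib x)).toLinearMap) ?_
    (fun x => (TensorProduct.comm ℂ _ _).bijective) fun x y k v => ?_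
  · rw [continuous_iff_continuousAt]
    intro p
    exact VB.tensor_contAt V.vb W.vb (v := fun s : (V.vb.tensor W.vb).Tot => s.2) continuousAt_id
      (W.vb.tensor V.vb) ((V.vb.tensor W.vb).contFst.continuousAt)
      (fun s => (TensorProduct.comm ℂ _ _).toLinearMap) fun a b ha hb => W.vb.tensor_cont V.vb hb ha
  · exact (TensorProduct.map_comm _ _ _).symm

theorem GB.tensor_assoc (U V W : GB X) :
    ((U.tensor V).tensor W).Iso (U.tensor (V.tensor W)) := by
  refine GB.iso_of_bij
    (fun x => (TensorProduct.assoc ℂ (U.vb.fib x) (V.vb.fib x) (W.vb.fib x)).toLinearMap) ?_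
    (fun x => (TensorProduct.assoc ℂ _ _ _).bijective) fun x y k v => ?_
  · rw [continuous_iff_continuousAt]
    intro p
    refine VB.tensor_contAt (U.tensor V).vb W.vb (v := fun s : ((U.tensor V).tensor W).vb.Tot => s.2)
      continuousAt_id (U.tensor (V.tensor W)).vb
      (((U.tensor V).tensor W).vb.contFst.continuousAt)
      (fun s => (TensorProduct.assoc ℂ (U.vb.fib s.1) (V.vb.fib s.1) (W.vb.fib s.1)).toLinearMap)
      fun a b ha hb => ?_
    refine VB.tensor_contAt U.vb V.vb ha (U.tensor (V.tensor W)).vb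
      (((U.tensor V).tensor W).vb.contFst.continuousAt)
      (fun s => (TensorProduct.assoc ℂ (U.vb.fib s.1) (V.vb.fib s.1) (W.vb.fib s.1)).toLinearMap ∘ₗ
        (TensorProduct.mk ℂ (U.vb.fib s.1 ⊗[ℂ] V.vb.fib s.1) (W.vb.fib s.1)).flip (b s))
      fun a' b' ha' hb' => ?_
    exact U.vb.tensor_cont (V.tensor W).vb ha' (V.vb.tensor_cont W.vb hb' hb)
  · refine LinearMap.congr_fun (f := (TensorProduct.assoc ℂ _ _ _).toLinearMap ∘ₗ
      TensorProduct.map (TensorProduct.map (U.act k) (V.act k)) (W.act k))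
      (g := TensorProduct.map (U.act k) (TensorProduct.map (V.act k) (W.act k)) ∘ₗ
      (TensorProduct.assoc ℂ _ _ _).toLinearMap) ?_ v
    exact TensorProduct.ext_threefold fun a b c => rfl

theorem GB.tensor_triv (V : GB X) : ((GB.triv X).tensor V).Iso V := by
  let e : ∀ x, ULift.{u} ℂ ⊗[ℂ] V.vb.fib x →ₗ[ℂ] V.vb.fib x := fun x =>
    (TensorProduct.lid ℂ (V.vb.fib x)).toLinearMap ∘ₗ
      TensorProduct.map (ULift.moduleEquiv (R := ℂ) (M := ℂ)).toLinearMap LinearMap.id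
  have hb : ∀ x, Function.Bijective (e x) := fun x =>
    ((TensorProduct.congr (ULift.moduleEquiv (R := ℂ) (M := ℂ)) (LinearEquiv.refl ℂ _)).trans
      (TensorProduct.lid ℂ (V.vb.fib x))).bijective
  refine GB.iso_of_bij e ?_ hb fun x y k v => ?_
  · rw [continuous_iff_continuousAt]
    intro p
    refine VB.tensor_contAt (GB.triv X).vb V.vb (v := fun s : ((GB.triv X).tensor V).vb.Tot => s.2)
      continuousAt_id V.vb (((GB.triv X).tensor V).vb.contFst.continuousAt)
      (fun s => e s.1) fun a b ha hb => ?_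
    have h1 := continuousAt_prod_iff.1 ((Topology.IsInducing.continuousAt_iff
      (f := fun s => (GB.triv X).vb.pt s.1 (a s)) (g := fun p => (p.1, p.2.down)) ⟨rfl⟩).1 ha)
    refine (V.vb.continuousAt_sum (κ := Unit) (c := fun _ s => (a s).down) (u := fun _ => b)
      (((GB.triv X).tensor V).vb.contFst.continuousAt) (fun _ => h1.2) fun _ => hb).congr
      (.of_forall fun s => ?_)
    simp only [Finset.univ_unique, Finset.sum_singleton]
    rfl
  · refine LinearMap.congr_fun (f := e y ∘ₗ TensorProduct.map LinearMap.id (V.act k))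
      (g := V.act k ∘ₗ e x) ?_ v
    refine TensorProduct.ext' fun a b => ?_
    change a.down • V.act k b = V.act k (a.down • b)
    rw [map_smul]

theorem GB.tensor_prod (U V W : GB X) :
    (U.tensor (V.prod W)).Iso ((U.tensor V).prod (U.tensor W)) := by
  have hb : ∀ x, (TensorProduct.map LinearMap.id (LinearMap.fst ℂ _ _)).prod
      (TensorProduct.map LinearMap.id (LinearMap.snd ℂ _ _)) =
      (TensorProduct.prodRight ℂ ℂ (U.vb.fib x) (V.vb.fib x) (W.vb.fib x)).toLinearMap := fun x =>
    TensorProduct.ext' fun a b => rfl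
  refine GB.iso_of_bij (fun x => (TensorProduct.map LinearMap.id (LinearMap.fst ℂ _ _)).prod
    (TensorProduct.map LinearMap.id (LinearMap.snd ℂ _ _))) ?_ (fun x => ?_) fun x y k v => ?_
  · rw [continuous_iff_continuousAt]
    intro p
    refine (VB.prod_iff _ _).2 ⟨?_, ?_⟩
    · exact VB.tensorMap_contAt U.vb (V.prod W).vb U.vb V.vb
        ((U.tensor (V.prod W)).vb.contFst.continuousAt) continuousAt_id _ _ (fun a ha => ha)
        fun a ha => ((VB.prod_iff _ _).1 ha).1
    · exact VB.tensorMap_contAt U.vb (V.prod W).vb U.vb W.vb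
        ((U.tensor (V.prod W)).vb.contFst.continuousAt) continuousAt_id _ _ (fun a ha => ha)
        fun a ha => ((VB.prod_iff _ _).1 ha).2
  · exact (congrArg (fun f : _ →ₗ[ℂ] _ => Function.Bijective f) (hb x)).mpr (LinearEquiv.bijective _)
  · refine LinearMap.congr_fun (f := ((TensorProduct.map LinearMap.id (LinearMap.fst ℂ _ _)).prod
      (TensorProduct.map LinearMap.id (LinearMap.snd ℂ _ _))) ∘ₗ
        TensorProduct.map (U.act k) ((V.act k).prodMap (W.act k)))
      (g := ((TensorProduct.map (U.act k) (V.act k)).prodMap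
        (TensorProduct.map (U.act k) (W.act k))) ∘ₗ _) ?_ v
    exact TensorProduct.ext' fun a b => rfl

/-- Local finiteness of a family of bundles. -/
abbrev GB.LocFin {I : Type} (V : I → GB X) : Prop :=
  ∀ x, ∃ s : Finset I, ∀ᶠ y in 𝓝 x, ∀ i ∉ s, Subsingleton ((V i).vb.fib y)

theorem GB.pi_congr {I : Type} {V W : I → GB X} (hV : GB.LocFin V) (hW : GB.LocFin W)
    (h : ∀ i, (V i).Iso (W i)) : (GB.pi V hV).Iso (GB.pi W hW) := by
  choose e h1 h2 h3 using h
  refine GB.iso_of_bij (fun x => LinearMap.pi fun i => (e i x).toLinearMap ∘ₗ LinearMap.proj i) ?_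
    (fun x => (LinearEquiv.piCongrRight fun i => e i x).bijective)
    fun x y k v => funext fun i => h1 i _ _ _ _
  rw [continuous_iff_continuousAt]
  intro p
  have h := (VB.pi_iff _ hV).1 (continuousAt_id (X := (GB.pi V hV).vb.Tot) (x := p))
  exact (VB.pi_iff _ hW).2 ⟨h.1, fun i => (h2 i).continuousAt.comp (h.2 i)⟩

theorem GB.pi_reindex {I J : Type} (e : J ≃ I) {V : I → GB X} (hV : GB.LocFin V)
    (hW : GB.LocFin fun j => V (e j)) : (GB.pi V hV).Iso (GB.pi (fun j => V (e j)) hW) := by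
  refine GB.iso_of_bij (fun x => LinearMap.pi fun j => LinearMap.proj (e j)) ?_
    (fun x => ⟨fun v w h => funext fun i => ?_, fun v => ⟨Equiv.piCongrLeft (fun i => (V i).vb.fib x) e v,
      funext fun j => Equiv.piCongrLeft_apply_apply (fun i => (V i).vb.fib x) e v j⟩⟩) fun x y k v => rfl
  · rw [continuous_iff_continuousAt]
    intro p
    have h := (VB.pi_iff _ hV).1 (continuousAt_id (X := (GB.pi V hV).vb.Tot) (x := p))
    exact (VB.pi_iff _ hW).2 ⟨h.1, fun i => h.2 (e i)⟩
  · obtain ⟨j, rfl⟩ := e.surjective i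
    exact congrFun h j

theorem GB.pi_prod {I : Type} {V W : I → GB X} (hV : GB.LocFin V) (hW : GB.LocFin W)
    (hVW : GB.LocFin fun i => (V i).prod (W i)) :
    (GB.pi (fun i => (V i).prod (W i)) hVW).Iso ((GB.pi V hV).prod (GB.pi W hW)) := by
  refine GB.iso_of_bij (fun x => (LinearMap.pi fun i => LinearMap.fst ℂ _ _ ∘ₗ LinearMap.proj i).prod
    (LinearMap.pi fun i => LinearMap.snd ℂ _ _ ∘ₗ LinearMap.proj i)) ?_
    (fun x => ⟨fun v w h => funext fun i => Prod.ext (congrFun (congrArg Prod.fst h) i)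
      (congrFun (congrArg Prod.snd h) i), fun v => ⟨fun i => (v.1 i, v.2 i), rfl⟩⟩) fun x y k v => rfl
  rw [continuous_iff_continuousAt]
  intro p
  have h := (VB.pi_iff _ hVW).1 (continuousAt_id (X := (GB.pi _ hVW).vb.Tot) (x := p))
  exact (VB.prod_iff _ _).2 ⟨(VB.pi_iff _ hV).2 ⟨h.1, fun i => ((VB.prod_iff _ _).1 (h.2 i)).1⟩,
    (VB.pi_iff _ hW).2 ⟨h.1, fun i => ((VB.prod_iff _ _).1 (h.2 i)).2⟩⟩

theorem GB.pi_sigma {I : Type} {J : I → Type} {V : ∀ i, J i → GB X} (hV : ∀ i, GB.LocFin (V i))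
    (hp : GB.LocFin fun i => GB.pi (V i) (hV i)) (hs : GB.LocFin fun p : Σ i, J i => V p.1 p.2) :
    (GB.pi (fun i => GB.pi (V i) (hV i)) hp).Iso (GB.pi (fun p : Σ i, J i => V p.1 p.2) hs) := by
  refine GB.iso_of_bij (fun x => LinearMap.pi fun p =>
      LinearMap.proj (φ := fun j => (V p.1 j).vb.fib x) p.2 ∘ₗ
        LinearMap.proj (φ := fun i => ∀ j, (V i j).vb.fib x) p.1) ?_
    (fun x => ⟨fun v w h => funext fun i => funext fun j => congrFun h ⟨i, j⟩,
      fun v => ⟨fun i j => v ⟨i, j⟩, rfl⟩⟩) fun x y k v => rfl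
  rw [continuous_iff_continuousAt]
  intro p
  have h := (VB.pi_iff _ hp).1 (continuousAt_id (X := (GB.pi _ hp).vb.Tot) (x := p))
  exact (VB.pi_iff _ hs).2 ⟨h.1, fun i => ((VB.pi_iff _ (hV i.1)).1 (h.2 i.1)).2 i.2⟩

theorem GB.pi_tensor {I : Type} {V : I → GB X} (U : GB X) (hV : GB.LocFin V)
    (hVU : GB.LocFin fun i => (V i).tensor U) :
    ((GB.pi V hV).tensor U).Iso (GB.pi (fun i => (V i).tensor U) hVU) := by
  refine GB.iso_of_bij (fun x => piTensorLeft (fun i => (V i).vb.fib x) (U.vb.fib x)) ?_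
    (fun x => piTensorLeft_bijective _ _) fun x y k v => ?_
  · rw [continuous_iff_continuousAt]
    intro p
    have hb := ((GB.pi V hV).tensor U).vb.contFst.continuousAt (x := p)
    refine (VB.pi_iff _ hVU).2 ⟨hb, fun i => ?_⟩
    exact VB.tensorMap_contAt (GB.pi V hV).vb U.vb (V i).vb U.vb hb continuousAt_id
      (fun s => LinearMap.proj i) _ (fun a ha => ((VB.pi_iff _ hV).1 ha).2 i) fun a ha => ha
  · refine funext fun i => LinearMap.congr_fun (f := TensorProduct.map (LinearMap.proj i)
      LinearMap.id ∘ₗ TensorProduct.map (LinearMap.pi fun i => (V i).act k ∘ₗ LinearMap.proj i)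
      (U.act k)) (g := TensorProduct.map ((V i).act k) (U.act k) ∘ₗ
      TensorProduct.map (LinearMap.proj i) LinearMap.id) ?_ v
    exact TensorProduct.ext' fun a b => rfl

theorem GB.pi_unique {I : Type} [Unique I] {V : I → GB X} (hV : GB.LocFin V) :
    (GB.pi V hV).Iso (V default) := by
  refine GB.iso_of_bij (fun x => LinearMap.proj default) ?_
    (fun x => (LinearEquiv.piUnique ℂ fun i => (V i).vb.fib x).bijective) fun x y k v => rfl
  rw [continuous_iff_continuousAt]
  intro p
  exact ((VB.pi_iff _ hV).1 (continuousAt_id (X := (GB.pi _ hV).vb.Tot) (x := p))).2 default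

/-- Summands which vanish can be dropped. -/
theorem GB.pi_drop {I J : Type} (e : J → I) (he : Function.Injective e) {V : I → GB X}
    (hV : GB.LocFin V) (hW : GB.LocFin fun j => V (e j))
    (h0 : ∀ i, i ∉ Set.range e → ∀ x, Subsingleton ((V i).vb.fib x)) :
    (GB.pi V hV).Iso (GB.pi (fun j => V (e j)) hW) := by
  classical
  refine GB.iso_of_bij (fun x => LinearMap.pi fun j => LinearMap.proj (e j)) ?_
    (fun x => ⟨fun v w h => funext fun i => ?_, fun v => ⟨fun i => if h : ∃ j, e j = i then
      cast (congrArg (fun i => (V i).vb.fib x) h.choose_spec) (v h.choose) else 0, funext fun j => ?_⟩⟩) fun x y k v => rfl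
  · rw [continuous_iff_continuousAt]
    intro p
    have h := (VB.pi_iff _ hV).1 (continuousAt_id (X := (GB.pi V hV).vb.Tot) (x := p))
    exact (VB.pi_iff _ hW).2 ⟨h.1, fun i => h.2 (e i)⟩
  · by_cases hi : i ∈ Set.range e
    · obtain ⟨j, rfl⟩ := hi
      exact congrFun h j
    · exact (h0 i hi x).elim _ _
  · have h : ∃ j', e j' = e j := ⟨j, rfl⟩
    change (if h : ∃ j', e j' = e j then cast (congrArg (fun i => (V i).vb.fib x) h.choose_spec) (v h.choose) else 0) = v j
    rw [dif_pos h]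
    have key : ∀ j' (hj : e j' = e j),
        cast (congrArg (fun i => (V i).vb.fib x) hj) (v j') = v j := by
      intro j' hj
      obtain rfl := he hj
      rfl
    exact key _ h.choose_spec

end GBAlg

/-! ### The ring `K_rot` and additive operations -/

section LocFin

variable {X : Type u} [Groupoid.{u} X] [TopologicalSpace X] [ArrTop X]

theorem GB.Iso.subsingleton {V W : GB X} (h : V.Iso W) (x : X) [Subsingleton (V.vb.fib x)] :
    Subsingleton (W.vb.fib x) := by
  obtain ⟨e, -⟩ := h
  exact (e x).symm.injective.subsingleton

theorem GB.LocFin.congr {I : Type} {V W : I → GB X} (h : GB.LocFin V) (e : ∀ i, (V i).Iso (W i)) :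
    GB.LocFin W := fun x => by
  obtain ⟨s, hs⟩ := h x
  refine ⟨s, hs.mono fun y hy i hi => ?_⟩
  have := hy i hi
  exact (e i).subsingleton y

theorem GB.LocFin.reindex {I J : Type} {V : I → GB X} (h : GB.LocFin V) {e : J → I}
    (he : Function.Injective e) : GB.LocFin fun j => V (e j) := fun x => by
  classical
  obtain ⟨s, hs⟩ := h x
  exact ⟨s.preimage e he.injOn, hs.mono fun y hy j hj => hy _ (by simpa using hj)⟩

theorem GB.LocFin.tensor {I : Type} {V : I → GB X} (h : GB.LocFin V) (U : GB X) :
    GB.LocFin fun i => (V i).tensor U := fun x => by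
  obtain ⟨s, hs⟩ := h x
  refine ⟨s, hs.mono fun y hy i hi => ?_⟩
  have := hy i hi
  exact tensor_subsingleton_left

theorem GB.LocFin.sigma {I : Type} {J : I → Type} {V : ∀ i, J i → GB X} (hV : ∀ i, GB.LocFin (V i))
    (hp : GB.LocFin fun i => GB.pi (V i) (hV i)) : GB.LocFin fun p : Σ i, J i => V p.1 p.2 := fun x => by
  classical
  obtain ⟨s, hs⟩ := hp x
  choose t ht using fun i => hV i x
  refine ⟨s.sigma t, ?_⟩
  filter_upwards [hs, (Filter.eventually_all_finset s).2 fun i _ => ht i] with y h1 h2 p hp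
  by_cases hps : p.1 ∈ s
  · exact h2 _ hps _ fun h => hp (Finset.mem_sigma.2 ⟨hps, h⟩)
  · have := h1 _ hps
    refine ⟨fun v w => ?_⟩
    let F (v : (V p.1 p.2).vb.fib y) : ∀ j, (V p.1 j).vb.fib y := Function.update 0 p.2 v
    have e : F v = F w := this.elim _ _
    simpa [F] using congrFun e p.2

theorem GB.LocFin.of_finite {I : Type} [Finite I] (V : I → GB X) : GB.LocFin V := fun x => by
  cases nonempty_fintype I
  exact ⟨Finset.univ, .of_forall fun y i hi => absurd (Finset.mem_univ i) hi⟩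

end LocFin

section Ops

variable {X : Type u} [Groupoid.{u} X] [TopologicalSpace X] [ArrTop X]
  {Y : Type u} [Groupoid.{u} Y] [TopologicalSpace Y] [ArrTop Y]
  {Z : Type u} [Groupoid.{u} Z] [TopologicalSpace Z] [ArrTop Z]
  {ξ : Cen X} {υ : Cen Y} {ζ : Cen Z}

/-- The isomorphism class of a series. -/
def Series.toCls (V : Series ξ) : Cls ξ := Quotient.mk (Series.setoid ξ) V

theorem Series.cls_eq {V W : Series ξ} (h : V ≈ W) : V.cls = W.cls :=
  congrArg Algebra.GrothendieckAddGroup.of (Quotient.sound h)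

theorem Series.cls_sum (V W : Series ξ) : (V.sum W).cls = V.cls + W.cls :=
  map_add (Algebra.GrothendieckAddGroup.of (M := Cls ξ)) V.toCls W.toCls

theorem Series.sum_congr {V V' W W' : Series ξ} (h : V ≈ V') (h' : W ≈ W') :
    V.sum W ≈ V'.sum W' := fun a => GB.prod_congr (h a) (h' a)

/-- Classes in `K_rot` agree if and only if the series are stably isomorphic. -/
theorem Series.cls_eq_iff {V W : Series ξ} : V.cls = W.cls ↔ ∃ U : Series ξ, V.sum U ≈ W.sum U := by
  constructor
  · intro h
    obtain ⟨c, hc⟩ := (AddLocalization.addMonoidOf (⊤ : AddSubmonoid (Cls ξ))).exists_of_eq h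
    obtain ⟨⟨U⟩, hU⟩ := c
    exact ⟨U, Setoid.trans (b := U.sum V) (fun a => GB.prod_comm _ _) (Setoid.trans (b := U.sum W)
      (Quotient.exact hc) (fun a => GB.prod_comm _ _))⟩
  · rintro ⟨U, h⟩
    have := Series.cls_eq h
    rwa [Series.cls_sum, Series.cls_sum, add_left_inj] at this

theorem Krot.induction {P : Krot ξ → Prop} (h : ∀ V : Series ξ, P V.cls)
    (hs : ∀ x y, P x → P y → P (x - y)) (x : Krot ξ) : P x := by
  rw [x.rep_spec]
  exact hs _ _ (h _) (h _)

theorem Krot.hom_ext {A : Type*} [AddCommGroup A] {f g : Krot ξ →+ A}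
    (h : ∀ V : Series ξ, f V.cls = g V.cls) : f = g :=
  AddMonoidHom.ext fun x => Krot.induction (P := fun x => f x = g x) h
    (fun x y hx hy => by rw [map_sub, map_sub, hx, hy]) x

/-- An additive operation with values in an abelian group extends to `K_rot`. -/
def Krot.lift {A : Type*} [AddCommGroup A] (f : Series ξ → A) (hc : ∀ V W, V ≈ W → f V = f W)
    (hs : ∀ V W, f (V.sum W) = f V + f W) : Krot ξ →+ A :=
  Algebra.GrothendieckAddGroup.lift
    { toFun := Quotient.lift f hc
      map_add' := by rintro ⟨V⟩ ⟨W⟩; exact hs V W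
      map_zero' := by
        have h := hs (Series.zero ξ) (Series.zero ξ)
        rw [hc _ (Series.zero ξ) fun a => GB.zero_prod _] at h
        exact (left_eq_add.1 h) }

theorem Krot.lift_cls {A : Type*} [AddCommGroup A] (f : Series ξ → A) (hc) (hs) (V : Series ξ) :
    Krot.lift f hc hs V.cls = f V :=
  DFunLike.congr_fun (Algebra.GrothendieckAddGroup.lift.symm_apply_apply _) V.toCls

/-- An operation on series which respects isomorphisms and direct sums. -/
structure AddOp (φ : Series ξ → Series υ) : Prop where
  congr : ∀ V W, V ≈ W → φ V ≈ φ W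
  add : ∀ V W, φ (V.sum W) ≈ (φ V).sum (φ W)

/-- The homomorphism induced by an additive operation. -/
def AddOp.hom {φ : Series ξ → Series υ} (h : AddOp φ) : Krot ξ →+ Krot υ :=
  Krot.lift (fun V => (φ V).cls) (fun V W e => Series.cls_eq (h.congr V W e))
    (fun V W => (Series.cls_eq (h.add V W)).trans (Series.cls_sum _ _))

theorem AddOp.hom_cls {φ : Series ξ → Series υ} (h : AddOp φ) (V : Series ξ) :
    h.hom V.cls = (φ V).cls := Krot.lift_cls _ _ _ V

theorem AddOp.map_eq {φ : Series ξ → Series υ} (h : AddOp φ) (x : Krot ξ) :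
    Krot.map φ x = h.hom x := by
  conv_rhs => rw [x.rep_spec, map_sub, h.hom_cls, h.hom_cls]
  rfl

theorem AddOp.map_cls {φ : Series ξ → Series υ} (h : AddOp φ) (V : Series ξ) :
    Krot.map φ V.cls = (φ V).cls := by rw [h.map_eq, h.hom_cls]

theorem AddOp.comp {φ : Series ξ → Series υ} {ψ : Series υ → Series ζ} (h : AddOp ψ) (h' : AddOp φ) :
    AddOp fun V => ψ (φ V) :=
  ⟨fun V W e => h.congr _ _ (h'.congr _ _ e), fun V W =>
    Setoid.trans (h.congr _ _ (h'.add V W)) (h.add _ _)⟩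

/-- A biadditive operation on series. -/
structure BiAddOp (φ : Series ξ → Series υ → Series ζ) : Prop where
  left : ∀ W, AddOp fun V => φ V W
  right : ∀ V, AddOp (φ V)

/-- The biadditive map induced by a biadditive operation. -/
def BiAddOp.hom {φ : Series ξ → Series υ → Series ζ} (h : BiAddOp φ) :
    Krot ξ →+ Krot υ →+ Krot ζ :=
  Krot.lift (fun V => (h.right V).hom)
    (fun V W e => Krot.hom_ext fun U => by
      rw [AddOp.hom_cls, AddOp.hom_cls]; exact Series.cls_eq ((h.left U).congr _ _ e))
    (fun V W => Krot.hom_ext fun U => by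
      rw [AddMonoidHom.add_apply, AddOp.hom_cls, AddOp.hom_cls, AddOp.hom_cls, ← Series.cls_sum]
      exact Series.cls_eq ((h.left U).add _ _))

theorem BiAddOp.hom_cls {φ : Series ξ → Series υ → Series ζ} (h : BiAddOp φ) (V W) :
    h.hom V.cls W.cls = (φ V W).cls := by
  rw [BiAddOp.hom, Krot.lift_cls, AddOp.hom_cls]

theorem BiAddOp.map_eq {φ : Series ξ → Series υ → Series ζ} (h : BiAddOp φ) (x y) :
    Krot.map₂ φ x y = h.hom x y := by
  conv_rhs => rw [x.rep_spec, y.rep_spec]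
  simp only [map_sub, AddMonoidHom.sub_apply, h.hom_cls]
  rw [Krot.map₂]
  abel

theorem Series.pull_addOp (F : CFun X Y) (hF : F.Compat ξ υ) : AddOp (Series.pull F hF) where
  congr V W h a := by
    obtain ⟨e, h1, h2, h3⟩ := h a
    refine ⟨fun x => e (F.obj x), fun x y f v => h1 _ _ _ _, ?_, ?_⟩
    · rw [continuous_iff_continuousAt]
      intro p
      have h := (VB.pull_iff _ F.obj F.obj_cont).1
        (continuousAt_id (X := ((V.pull F hF).coef a).vb.Tot) (x := p))
      exact (VB.pull_iff _ F.obj F.obj_cont).2 ⟨h.1, h2.continuousAt.comp h.2⟩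
    · rw [continuous_iff_continuousAt]
      intro p
      have h := (VB.pull_iff _ F.obj F.obj_cont).1
        (continuousAt_id (X := ((W.pull F hF).coef a).vb.Tot) (x := p))
      exact (VB.pull_iff _ F.obj F.obj_cont).2 ⟨h.1, h3.continuousAt.comp h.2⟩
  add V W a := by
    refine GB.iso_of_bij (fun x => LinearMap.id) ?_ (fun x => Function.bijective_id)
      fun x y k v => rfl
    rw [continuous_iff_continuousAt]
    intro p
    have h := (VB.pull_iff _ F.obj F.obj_cont).1
      (continuousAt_id (X := (((V.sum W).pull F hF).coef a).vb.Tot) (x := p))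
    have h2 := (VB.prod_iff _ _).1 h.2
    exact (VB.prod_iff _ _).2 ⟨(VB.pull_iff _ F.obj F.obj_cont).2 ⟨h.1, h2.1⟩,
      (VB.pull_iff _ F.obj F.obj_cont).2 ⟨h.1, h2.2⟩⟩

theorem GB.push_congr {f : CFun X Y} (C : Cover f) {V W : GB X} (h : V.Iso W) :
    (GB.push C V).Iso (GB.push C W) := by
  obtain ⟨e, h1, h2, h3⟩ := h
  have key : ∀ y j, Function.Bijective (e (C.sec j y)) := fun y j => (e _).bijective
  refine GB.iso_of_joint (I := C.J) (fun j => W.vb) (fun j => C.sec j)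
    (fun j y => (e (C.sec j y)).toLinearMap ∘ₗ LinearMap.proj j ∘ₗ (C.inv V y).subtype)
    (fun j y => LinearMap.proj j ∘ₗ (C.inv W y).subtype) (fun j => ?_) (fun j => ?_)
    (fun y v h => Subtype.ext (funext fun j => (key y j).1 ((h j).trans (map_zero _).symm)))
    (fun y v h => Subtype.ext (funext h))
    (fun y v => ⟨⟨fun j => e _ (v.1 j), fun γ j j' hj => ?_⟩, fun j => rfl⟩)
    (fun y v => ⟨⟨fun j => (e _).symm (v.1 j), fun γ j j' hj => ?_⟩,
      fun j => (e _).apply_symm_apply _⟩) (fun y y' k v w h j => ?_)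
  · rw [continuous_iff_continuousAt]
    intro p
    have hp := (VB.pi_iff _ _).1 ((VB.embed_iff (C.total V) _ _ _ _).1
      (continuousAt_id (X := (GB.push C V).vb.Tot) (x := p)))
    exact h2.continuousAt.comp ((VB.pull_iff _ _ _).1 (hp.2 j)).2
  · rw [continuous_iff_continuousAt]
    intro p
    have hp := (VB.pi_iff _ _).1 ((VB.embed_iff (C.total W) _ _ _ _).1
      (continuousAt_id (X := (GB.push C W).vb.Tot) (x := p)))
    exact ((VB.pull_iff _ _ _).1 (hp.2 j)).2
  · rw [← h1, v.2]
  · rw [LinearEquiv.eq_symm_apply, h1, LinearEquiv.apply_symm_apply, v.2]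
  · refine (h1 _ _ _ _).trans ?_
    exact congrArg _ (h _)

theorem GB.push_prod {f : CFun X Y} (C : Cover f) (V W : GB X) :
    (GB.push C (V.prod W)).Iso ((GB.push C V).prod (GB.push C W)) := by
  refine GB.iso_of_bij (fun y =>
    { toFun := fun v => (⟨fun j => (v.1 j).1, fun γ j j' h => congrArg Prod.fst (v.2 γ j j' h)⟩,
        ⟨fun j => (v.1 j).2, fun γ j j' h => congrArg Prod.snd (v.2 γ j j' h)⟩)
      map_add' := fun _ _ => rfl
      map_smul' := fun _ _ => rfl })
    ?_ (fun y => ⟨fun v w h => Subtype.ext (funext fun j => Prod.ext ?_ ?_), fun v =>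
      ⟨⟨fun j => (v.1.1 j, v.2.1 j), fun γ j j' h => Prod.ext (v.1.2 γ j j' h) (v.2.2 γ j j' h)⟩, rfl⟩⟩)
    fun y y' k v => rfl
  · rw [continuous_iff_continuousAt]
    intro p
    have hp := (VB.pi_iff _ _).1 ((VB.embed_iff (C.total (V.prod W)) _ _ _ _).1
      (continuousAt_id (X := (GB.push C (V.prod W)).vb.Tot) (x := p)))
    have hp2 := fun j => (VB.prod_iff _ _).1 ((VB.pull_iff _ _ _).1 (hp.2 j)).2
    exact (VB.prod_iff _ _).2 ⟨(VB.embed_iff _ _ _ _ _).2 ((VB.pi_iff _ _).2 ⟨hp.1, fun j =>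
      (VB.pull_iff _ _ _).2 ⟨hp.1, (hp2 j).1⟩⟩), (VB.embed_iff _ _ _ _ _).2 ((VB.pi_iff _ _).2
      ⟨hp.1, fun j => (VB.pull_iff _ _ _).2 ⟨hp.1, (hp2 j).2⟩⟩)⟩
  · exact congrFun (congrArg Subtype.val (congrArg Prod.fst h)) j
  · exact congrFun (congrArg Subtype.val (congrArg Prod.snd h)) j

theorem Series.push_addOp {f : CFun X Y} (C : Cover f) (hC : C.Compat ξ υ) :
    AddOp (Series.push C hC) :=
  ⟨fun V W h a => GB.push_congr C (h a), fun V W a => GB.push_prod C _ _⟩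

theorem Series.tensor_congr {V V' W W' : Series ξ} (h : V ≈ V') (h' : W ≈ W') :
    V.tensor W ≈ V'.tensor W' := fun a =>
  GB.pi_congr _ _ fun p => GB.tensor_congr (h p.1.1) (h' p.1.2)

/-- Families indexed by the decompositions of `a` as a sum. -/
theorem Series.tensor_locFin (V W : Series ξ) (a : ℚ≥0) :
    GB.LocFin fun p : {p : ℚ≥0 × ℚ≥0 // p.1 + p.2 = a} => (V.coef p.1.1).tensor (W.coef p.1.2) :=
  fun x => by
    obtain ⟨N, hN, h⟩ := V.locfin x
    obtain ⟨M, hM, h'⟩ := W.locfin x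
    have hfin := (((finite_denom N hN a).prod (finite_denom M hM a)).preimage
      (f := Subtype.val) (Subtype.val_injective.injOn (s := _))).subset
      (t := {p : {p : ℚ≥0 × ℚ≥0 // p.1 + p.2 = a} |
        (∃ m : ℕ, p.1.1 = m / N) ∧ ∃ m : ℕ, p.1.2 = m / M}) (by
      rintro ⟨p, rfl⟩ ⟨h1, h2⟩
      exact ⟨⟨le_self_add, h1⟩, le_add_self, h2⟩)
    refine ⟨hfin.toFinset, ?_⟩
    filter_upwards [h, h'] with y h h' p hp
    rw [Set.Finite.mem_toFinset, Set.mem_ofPred_eq, not_and_or] at hp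
    rcases hp with hp | hp
    · have : Subsingleton ((V.coef p.1.1).vb.fib y) :=
        not_nontrivial_iff_subsingleton.1 fun hn => hp (h _ hn)
      exact tensor_subsingleton_left
    · have : Subsingleton ((W.coef p.1.2).vb.fib y) :=
        not_nontrivial_iff_subsingleton.1 fun hn => hp (h' _ hn)
      exact tensor_subsingleton_right

theorem Series.tensor_sum (U V W : Series ξ) :
    U.tensor (V.sum W) ≈ (U.tensor V).sum (U.tensor W) := fun a => by
  have h := Series.tensor_locFin U (V.sum W) a
  have h' := h.congr fun i => GB.tensor_prod _ _ _
  exact (GB.pi_congr _ h' fun i => GB.tensor_prod _ _ _).trans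
    (GB.pi_prod (Series.tensor_locFin U V a) (Series.tensor_locFin U W a) h')

theorem Series.tensor_comm (V W : Series ξ) : V.tensor W ≈ W.tensor V := fun a => by
  have h := Series.tensor_locFin V W a
  have h' := h.congr fun i => GB.tensor_comm _ _
  let e : {p : ℚ≥0 × ℚ≥0 // p.1 + p.2 = a} ≃ {p : ℚ≥0 × ℚ≥0 // p.1 + p.2 = a} :=
    (Equiv.prodComm _ _).subtypeEquiv fun p => by simp [add_comm]
  exact (GB.pi_congr _ h' fun i => GB.tensor_comm _ _).trans
    (GB.pi_reindex e (V := fun i => (W.coef i.1.2).tensor (V.coef i.1.1)) h' (h'.reindex e.injective))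

/-- Both sides are sums over the triples of exponents with sum `a`. -/
theorem Series.tensor_assoc (U V W : Series ξ) :
    (U.tensor V).tensor W ≈ U.tensor (V.tensor W) := fun a => by
  let I := {p : ℚ≥0 × ℚ≥0 // p.1 + p.2 = a}
  let J (b : ℚ≥0) := {q : ℚ≥0 × ℚ≥0 // q.1 + q.2 = b}
  have h1 := Series.tensor_locFin (U.tensor V) W a
  have h2 : ∀ i : I, GB.LocFin fun q : J i.1.1 =>
    ((U.coef q.1.1).tensor (V.coef q.1.2)).tensor (W.coef i.1.2) := fun i =>
    (Series.tensor_locFin U V i.1.1).tensor _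
  have e1 : ∀ i : I, _ := fun i => GB.pi_tensor (W.coef i.1.2) (Series.tensor_locFin U V i.1.1) (h2 i)
  have h3 := h1.congr e1
  have h4 := GB.LocFin.sigma h2 h3
  have k1 := Series.tensor_locFin U (V.tensor W) a
  have k2 : ∀ i : I, GB.LocFin fun q : J i.1.2 =>
    ((V.coef q.1.1).tensor (W.coef q.1.2)).tensor (U.coef i.1.1) := fun i =>
    (Series.tensor_locFin V W i.1.2).tensor _
  have f1 : ∀ i : I, _ := fun i => (GB.tensor_comm _ _).trans
    (GB.pi_tensor (U.coef i.1.1) (Series.tensor_locFin V W i.1.2) (k2 i))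
  have k3 := k1.congr f1
  have k4 := GB.LocFin.sigma k2 k3
  let e : (Σ i : I, J i.1.1) ≃ (Σ i : I, J i.1.2) :=
    { toFun := fun p => ⟨⟨(p.2.1.1, p.2.1.2 + p.1.1.2), by
        rw [← add_assoc, p.2.2, p.1.2]⟩, ⟨(p.2.1.2, p.1.1.2), rfl⟩⟩
      invFun := fun p => ⟨⟨(p.1.1.1 + p.2.1.1, p.2.1.2), by
        rw [add_assoc, p.2.2, p.1.2]⟩, ⟨(p.1.1.1, p.2.1.1), rfl⟩⟩
      left_inv := by
        rintro ⟨⟨⟨d, c⟩, rfl⟩, ⟨⟨b, e⟩, hd⟩⟩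
        dsimp only at hd
        subst hd; rfl
      right_inv := by
        rintro ⟨⟨⟨d, c⟩, rfl⟩, ⟨⟨b, e⟩, hd⟩⟩
        dsimp only at hd
        subst hd; rfl }
  have k5 := k4.reindex e.injective
  refine ((GB.pi_congr _ h3 e1).trans (GB.pi_sigma h2 h3 h4)).trans (GB.Iso.trans ?_
    ((GB.pi_congr _ k3 f1).trans ((GB.pi_sigma k2 k3 k4).trans (GB.pi_reindex e k4 k5))).symm)
  exact GB.pi_congr h4 k5 fun p => (GB.tensor_assoc _ _ _).trans (GB.tensor_comm _ _)

theorem Series.one_tensor (V : Series ξ) : (Series.one ξ).tensor V ≈ V := fun a => by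
  let e : Unit → {p : ℚ≥0 × ℚ≥0 // p.1 + p.2 = a} := fun _ => ⟨(0, a), zero_add a⟩
  refine (GB.pi_drop e (fun _ _ _ => rfl) (Series.tensor_locFin _ V a) (.of_finite _)
    (fun i hi x => ?_)).trans ((GB.pi_unique (.of_finite _)).trans ?_)
  · have : Subsingleton (((Series.one ξ).coef i.1.1).vb.fib x) :=
      ⟨fun v w => funext fun h => (hi ⟨(), Subtype.ext (Prod.ext h.down.symm (by
        have := i.2; rw [h.down, zero_add] at this; exact this.symm))⟩).elim⟩
    exact tensor_subsingleton_left
  · have : Unique (PLift ((0 : ℚ≥0) = 0)) := ⟨⟨⟨rfl⟩⟩, fun _ => rfl⟩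
    exact (GB.tensor_congr (GB.pi_unique (.of_finite _)) (.refl _)).trans (GB.tensor_triv _)

theorem Series.tensor_biAddOp : BiAddOp (Series.tensor (ξ := ξ)) where
  right U := ⟨fun V W h => Series.tensor_congr (Setoid.refl U) h, Series.tensor_sum U⟩
  left U := ⟨fun V W h => Series.tensor_congr h (Setoid.refl U), fun V W =>
    Setoid.trans (Series.tensor_comm _ _) (Setoid.trans (Series.tensor_sum U V W)
      (Series.sum_congr (Series.tensor_comm _ _) (Series.tensor_comm _ _)))⟩

/-- The ring structure of `K_rot`, given by the tensor product. -/
instance Krot.commRing : CommRing (Krot ξ) :=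
  { (inferInstance : AddCommGroup (Krot ξ)) with
    mul := fun x y => Series.tensor_biAddOp.hom x y
    one := (Series.one ξ).cls
    zero_mul := fun x => by change Series.tensor_biAddOp.hom 0 x = 0; simp
    mul_zero := fun x => by change Series.tensor_biAddOp.hom x 0 = 0; simp
    left_distrib := fun x y z => map_add _ _ _
    right_distrib := fun x y z => by
      change Series.tensor_biAddOp.hom (x + y) z = _
      rw [map_add]; rfl
    mul_comm := fun x y => by
      change Series.tensor_biAddOp.hom x y = Series.tensor_biAddOp.hom y x
      refine DFunLike.congr_fun (DFunLike.congr_fun (f := Series.tensor_biAddOp.hom)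
        (g := Series.tensor_biAddOp.hom.flip) ?_ x) y
      exact Krot.hom_ext fun V => Krot.hom_ext fun W => by
        rw [AddMonoidHom.flip_apply, BiAddOp.hom_cls, BiAddOp.hom_cls]
        exact Series.cls_eq (Series.tensor_comm _ _)
    mul_assoc := fun x y z => by
      change Series.tensor_biAddOp.hom (Series.tensor_biAddOp.hom x y) z =
        Series.tensor_biAddOp.hom x (Series.tensor_biAddOp.hom y z)
      induction x using Krot.induction with
      | hs x x' h h' => simp only [map_sub, AddMonoidHom.sub_apply, h, h']
      | h U =>
        induction y using Krot.induction with
        | hs x x' h h' => simp only [map_sub, AddMonoidHom.sub_apply, h, h']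
        | h V =>
          induction z using Krot.induction with
          | hs x x' h h' => simp only [map_sub, h, h']
          | h W =>
            simp only [BiAddOp.hom_cls]
            exact Series.cls_eq (Series.tensor_assoc U V W)
    one_mul := fun x => by
      change Series.tensor_biAddOp.hom (Series.one ξ).cls x = x
      induction x using Krot.induction with
      | hs x x' h h' => simp only [map_sub, h, h']
      | h U => rw [BiAddOp.hom_cls]; exact Series.cls_eq (Series.one_tensor U)
    mul_one := fun x => by
      change Series.tensor_biAddOp.hom x (Series.one ξ).cls = x
      induction x using Krot.induction with
      | hs x x' h h' => simp only [map_sub, AddMonoidHom.sub_apply, h, h']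
      | h U =>
        rw [BiAddOp.hom_cls]
        exact Series.cls_eq (Setoid.trans (Series.tensor_comm _ _) (Series.one_tensor U)) }

theorem Krot.mul_eq (x y : Krot ξ) : Krot.mul x y = x * y := Series.tensor_biAddOp.map_eq x y

theorem Series.cls_mul (V W : Series ξ) : V.cls * W.cls = (V.tensor W).cls :=
  Series.tensor_biAddOp.hom_cls V W

theorem Series.cls_one : (Series.one ξ).cls = 1 := rfl

theorem Series.ext_biAddOp : BiAddOp (Series.ext (ξ := ξ) (υ := υ)) where
  left W := (Series.tensor_biAddOp.left _).comp (Series.pull_addOp _ _)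
  right V := (Series.tensor_biAddOp.right _).comp (Series.pull_addOp _ _)

end Ops

/-! ### Finite sums of series -/

section PiFin

variable {X : Type u} [Groupoid.{u} X] [TopologicalSpace X] [ArrTop X]
  {Y : Type u} [Groupoid.{u} Y] [TopologicalSpace Y] [ArrTop Y] {ξ : Cen X} {υ : Cen Y}

/-- Denominators are locally bounded if the fibres vanish together with the fibres of finitely many
series. -/
theorem locfin_of_finite {Z : Type u} [TopologicalSpace Z] {I : Type*} [Finite I]
    {V : I → Series υ} {φ : I → Z → Y} (hφ : ∀ i, Continuous (φ i)) {fib : ℚ≥0 → Z → Type*}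
    (h : ∀ a z, (∀ i, Subsingleton (((V i).coef a).vb.fib (φ i z))) → Subsingleton (fib a z)) (z : Z) :
    ∃ N : ℕ, 0 < N ∧ ∀ᶠ y in 𝓝 z, ∀ a, Nontrivial (fib a y) → ∃ m : ℕ, a = m / N := by
  classical
  have _ := Fintype.ofFinite I
  choose N hN hl using fun i => (V i).locfin (φ i z)
  refine ⟨∏ i, N i, Finset.prod_pos fun i _ => hN i, ?_⟩
  filter_upwards [eventually_all.2 fun i => (hφ i).continuousAt.eventually (hl i)] with y hy a hn
  by_contra hc
  refine not_subsingleton_iff_nontrivial.2 hn (h a y fun i => ?_)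
  by_contra hs
  obtain ⟨m, hm⟩ := hy i a (not_subsingleton_iff_nontrivial.1 hs)
  refine hc ⟨m * ∏ j ∈ Finset.univ.erase i, N j, ?_⟩
  have hN' : ∀ i, (N i : ℚ≥0) ≠ 0 := fun i => by exact_mod_cast (hN i).ne'
  rw [hm, ← Finset.mul_prod_erase _ _ (Finset.mem_univ i)]
  push_cast
  have : (∏ j ∈ Finset.univ.erase i, (N j : ℚ≥0)) ≠ 0 := Finset.prod_ne_zero_iff.2 fun j _ => hN' j
  have := hN' i
  field_simp

/-- The direct sum of finitely many series. -/
def Series.piFin {I : Type} [Finite I] (V : I → Series ξ) : Series ξ where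
  coef a := GB.pi (fun i => (V i).coef a) (GB.LocFin.of_finite _)
  rot a x v := funext fun i => (V i).rot a x (v i)
  locfin x := locfin_of_finite (φ := fun _ x => x) (fun _ => continuous_id)
    (fun a z h => ⟨fun v w => funext fun i => (h i).elim _ _⟩) x

theorem Series.cls_zero : (Series.zero ξ).cls = 0 :=
  map_zero (Algebra.GrothendieckAddGroup.of (M := Cls ξ))

theorem Series.cls_piFin {I : Type} [Fintype I] (V : I → Series ξ) :
    (Series.piFin V).cls = ∑ i, (V i).cls := by
  classical
  refine Fintype.induction_empty_option
    (P := fun I _ => ∀ V : I → Series ξ, (Series.piFin V).cls = ∑ i, (V i).cls)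
    (fun I J _ e ih V => ?_) (fun V => ?_) (fun I _ ih V => ?_) I V
  · have := Fintype.ofEquiv J e.symm
    rw [Series.cls_eq (W := Series.piFin fun j => V (e j)) fun a =>
      GB.pi_reindex e (V := fun i => (V i).coef a) (.of_finite _) (.of_finite _), ih,
      ← Equiv.sum_comp e]
    exact Finset.sum_congr (Finset.ext fun _ => by simp) fun _ _ => rfl
  · rw [Finset.univ_eq_empty, Finset.sum_empty, ← Series.cls_zero]
    exact Series.cls_eq fun a => GB.pi_reindex (Equiv.equivOfIsEmpty Empty PEmpty)
      (V := fun i => (V i).coef a) (.of_finite _) (.of_finite _) |>.trans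
      (GB.pi_congr _ _ fun i => i.elim)
  · rw [Fintype.sum_option, ← ih fun i => V (some i), ← Series.cls_sum]
    refine Series.cls_eq fun a => GB.iso_of_bij (fun x => LinearMap.prod
      (LinearMap.proj (φ := fun i => ((V i).coef a).vb.fib x) none)
      (LinearMap.pi fun i => LinearMap.proj (φ := fun i => ((V i).coef a).vb.fib x) (some i)))
      ?_ (fun x => ⟨fun v w h => funext fun i => ?_,
        fun v => ⟨fun i => match i with | none => v.1 | some i => v.2 i, rfl⟩⟩) fun x y k v => rfl
    · rw [continuous_iff_continuousAt]
      intro p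
      have h := (VB.pi_iff (fun i => ((V i).coef a).vb) (GB.LocFin.of_finite _)).1
        (continuousAt_id (X := ((Series.piFin V).coef a).vb.Tot) (x := p))
      exact (VB.prod_iff _ _).2 ⟨h.2 none, (VB.pi_iff (fun i => ((V (some i)).coef a).vb)
        (GB.LocFin.of_finite _)).2 ⟨h.1, fun i => h.2 (some i)⟩⟩
    · match i with
      | none => exact congrArg Prod.fst h
      | some i => exact congrFun (congrArg Prod.snd h) i

variable {T : Type*} [TopologicalSpace T] {t : T}

theorem GB.push_iff {f : CFun X Y} (C : Cover f) (V : GB X) {g : T → Y}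
    {v : ∀ s, (GB.push C V).vb.fib (g s)} :
    ContinuousAt (fun s => (GB.push C V).vb.pt (g s) (v s)) t ↔ ContinuousAt g t ∧
      ∀ j, ContinuousAt (fun s => V.vb.pt (C.sec j (g s)) ((v s).1 j)) t :=
  ((Topology.IsInducing.continuousAt_iff (f := fun s => (GB.push C V).vb.pt (g s) (v s))
    (g := fun q => (C.total V).pt q.1 ((C.inv V q.1).subtype q.2)) ⟨rfl⟩).trans (VB.pi_iff _ _)).trans (and_congr_right fun h =>
    forall_congr' fun j => (VB.pull_iff _ _ _).trans (and_iff_right h))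

end PiFin

/-! ### Limits over finite groupoids -/

section Diag

variable {Z : Type u} [Groupoid.{u} Z] [TopologicalSpace Z] [ArrTop Z]
  {Y : Type u} [Groupoid.{u} Y] [TopologicalSpace Y] [ArrTop Y] {ξ : Cen Z} {υ : Cen Y}
  {K : Type} [Groupoid.{0} K]

variable (Z Y K) in
/-- A continuous functor from the product of a discrete groupoid `K` with `Z` to `Y`. -/
structure Diag where
  obj : K → Z → Y
  map : ∀ {k k' : K} {z z' : Z}, (k ⟶ k') → (z ⟶ z') → (obj k z ⟶ obj k' z')
  map_id : ∀ k z, map (𝟙 k) (𝟙 z) = 𝟙 (obj k z)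
  map_comp : ∀ {k k' k'' : K} {z z' z'' : Z} (α : k ⟶ k') (α' : k' ⟶ k'') (f : z ⟶ z') (f' : z' ⟶ z''),
    map (α ≫ α') (f ≫ f') = map α f ≫ map α' f'
  obj_cont : ∀ k, Continuous (obj k)
  map_cont : ∀ {k k' : K} (α : k ⟶ k'), Continuous fun a : Arr Z => arr (map α a.hom)

/-- Compatibility with center elements, up to automorphisms in the discrete direction. -/
def Diag.Compat (D : Diag Z Y K) (ξ : Cen Z) (υ : Cen Y) : Prop :=
  ∀ k z, ∃ r : k ⟶ k, υ.app (D.obj k z) = D.map r (ξ.app z)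

theorem Diag.map_right (D : Diag Z Y K) {k k' : K} (α : k ⟶ k') {z z' : Z} (f : z ⟶ z') :
    D.map α f = D.map α (𝟙 z) ≫ D.map (𝟙 k') f := by
  rw [← D.map_comp, Category.comp_id, Category.id_comp]

theorem Diag.map_left (D : Diag Z Y K) {k k' : K} (α : k ⟶ k') {z z' : Z} (f : z ⟶ z') :
    D.map α f = D.map (𝟙 k) f ≫ D.map α (𝟙 z') := by
  rw [← D.map_comp, Category.comp_id, Category.id_comp]

variable (D : Diag Z Y K) {I : Type} (o : I → K) (V : GB Y)

/-- Compatible families of vectors over the full subgroupoid of `K` on the objects `o i`. -/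
def Diag.limSub (z : Z) : Submodule ℂ (∀ i, V.vb.fib (D.obj (o i) z)) where
  carrier := {v | ∀ i i' (α : o i ⟶ o i'), V.act (D.map α (𝟙 z)) (v i) = v i'}
  add_mem' {v w} hv hw i i' α := by rw [Pi.add_apply, map_add, hv i i' α, hw i i' α]; rfl
  zero_mem' i i' α := map_zero _
  smul_mem' c v hv i i' α := by rw [Pi.smul_apply, map_smul, hv i i' α]; rfl

variable [Finite I] [∀ k k' : K, Finite (k ⟶ k')]
  (hid : Continuous fun z : Z => arr (𝟙 z))

/-- The average over the finite groupoid. -/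
def Diag.mean (z : Z) : (∀ i, V.vb.fib (D.obj (o i) z)) →ₗ[ℂ] ∀ i, V.vb.fib (D.obj (o i) z) :=
  let _ := fun i => Fintype.ofFinite (Σ i', (o i' ⟶ o i))
  LinearMap.pi fun i => ∑ p : Σ i', (o i' ⟶ o i), ((Nat.card (Σ i', (o i' ⟶ o i)) : ℂ)⁻¹) •
    (V.act (D.map p.2 (𝟙 z)) ∘ₗ LinearMap.proj p.1)

theorem Diag.mean_apply (z : Z) [∀ i, Fintype (Σ i', (o i' ⟶ o i))] (v) (i) :
    D.mean o V z v i = ∑ p : Σ i', (o i' ⟶ o i),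
      ((Nat.card (Σ i', (o i' ⟶ o i)) : ℂ)⁻¹) • V.act (D.map p.2 (𝟙 z)) (v p.1) := by
  simp only [Diag.mean, LinearMap.pi_apply, LinearMap.sum_apply, LinearMap.smul_apply]
  refine Finset.sum_congr (Finset.ext fun p => by simp) fun p _ => rfl

theorem Diag.mean_of_mem (z : Z) {v} (hv : v ∈ D.limSub o V z) : D.mean o V z v = v := by
  let _ := fun i => Fintype.ofFinite (Σ i', (o i' ⟶ o i))
  funext i
  rw [D.mean_apply]
  have : ∀ p : Σ i', (o i' ⟶ o i), V.act (D.map p.2 (𝟙 z)) (v p.1) = v i := fun p => hv _ _ _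
  have hne : (Nat.card (Σ i', (o i' ⟶ o i)) : ℂ) ≠ 0 := by
    have : Nonempty (Σ i', (o i' ⟶ o i)) := ⟨⟨i, 𝟙 _⟩⟩
    exact_mod_cast Nat.card_pos.ne'
  simp only [this, Finset.sum_const, Finset.card_univ]
  rw [← Nat.cast_smul_eq_nsmul ℂ, smul_smul, ← Nat.card_eq_fintype_card, mul_inv_cancel₀ hne,
    one_smul]

theorem Diag.mean_mem (z : Z) (v) : D.mean o V z v ∈ D.limSub o V z := by
  let _ := fun i => Fintype.ofFinite (Σ i', (o i' ⟶ o i))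
  intro i i' α
  rw [D.mean_apply, D.mean_apply, map_sum]
  let e : (Σ j, (o j ⟶ o i)) ≃ (Σ j, (o j ⟶ o i')) := Equiv.sigmaCongrRight fun j =>
    { toFun := fun β => β ≫ α
      invFun := fun β => β ≫ Groupoid.inv α
      left_inv := fun β => by simp
      right_inv := fun β => by simp }
  refine Fintype.sum_equiv e _ _ fun p => ?_
  rw [map_smul, ← V.act_comp, ← D.map_comp, Category.comp_id, Nat.card_congr e]
  rfl

theorem Diag.locFin (z : Z) : ∃ s : Finset I, ∀ᶠ y in 𝓝 z, ∀ i ∉ s,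
    Subsingleton ((V.vb.pull (D.obj (o i)) (D.obj_cont _)).fib y) :=
  ⟨(Set.toFinite (Set.univ : Set I)).toFinset, .of_forall fun _ i hi => by simp at hi⟩

/-- The bundle of compatible families. -/
def Diag.limVB : VB Z :=
  (VB.pi (fun i => V.vb.pull (D.obj (o i)) (D.obj_cont _)) (D.locFin o V)).embed
    (fun z => D.limSub o V z) (fun z => Submodule.subtype _) (fun z => Subtype.val_injective) (by
      let _ := fun i => Fintype.ofFinite (Σ i', (o i' ⟶ o i))
      refine ⟨D.mean o V, ?_, fun y v => D.mean_of_mem o V y v.2,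
        fun y v => ⟨⟨_, D.mean_mem o V y v⟩, rfl⟩⟩
      rw [continuous_iff_continuousAt]
      intro q
      have h1 := (VB.pi_iff _ _).1 (continuousAt_id (X := (VB.pi _ _).Tot) (x := q))
      refine (VB.pi_iff _ _).2 ⟨h1.1, fun i => (VB.pull_iff _ _ _).2 ⟨h1.1, ?_⟩⟩
      exact (V.vb.continuousAt_sum (κ := Σ i', (o i' ⟶ o i))
        (c := fun _ _ => (Nat.card (Σ i', (o i' ⟶ o i)) : ℂ)⁻¹)
        ((D.obj_cont _).continuousAt.comp h1.1) (fun _ => continuousAt_const) fun p => V.contAt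
          ((D.map_cont p.2).continuousAt.comp (hid.continuousAt.comp h1.1))
          ((VB.pull_iff _ _ _).1 (h1.2 p.1)).2).congr
          (.of_forall fun q => congrArg (V.vb.pt _) (D.mean_apply o V q.1 q.2 i).symm))

/-- The limit of a bundle along a finite diagram. -/
def GB.lim : GB Z where
  vb := D.limVB o V hid
  act {z z'} f := LinearMap.restrict (LinearMap.pi fun i =>
      V.act (D.map (𝟙 (o i)) f) ∘ₗ LinearMap.proj i) (p := D.limSub o V z) (q := D.limSub o V z') (by
    intro v hv i i' α
    change V.act _ (V.act _ (v i)) = V.act _ (v i')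
    rw [← V.act_comp, ← D.map_left, D.map_right, V.act_comp, hv i i' α])
  act_id z v := Subtype.ext (funext fun i => by
    change V.act (D.map (𝟙 (o i)) (𝟙 z)) (v.1 i) = v.1 i
    rw [D.map_id, V.act_id])
  act_comp f g v := Subtype.ext (funext fun i => by
    change V.act (D.map (𝟙 (o i)) (f ≫ g)) _ = V.act _ (V.act _ _)
    rw [← V.act_comp, ← D.map_comp, Category.comp_id])
  act_cont := continuous_iff_continuousAt.2 fun p => by
    have h := ActDom.cont _ p
    have h1 := (VB.pi_iff _ _).1 ((VB.embed_iff _ _ _ _ _).1 h.2)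
    exact (VB.embed_iff _ _ _ _ _).2 ((VB.pi_iff _ _).2
      ⟨ArrTop.tgt_cont.continuousAt.comp h.1, fun i => (VB.pull_iff _ _ _).2
        ⟨ArrTop.tgt_cont.continuousAt.comp h.1, V.contAt ((D.map_cont _).continuousAt.comp h.1)
          ((VB.pull_iff _ _ _).1 (h1.2 i)).2⟩⟩)

theorem GB.lim_iff {T : Type*} [TopologicalSpace T] {t : T} {g : T → Z}
    {v : ∀ s, (GB.lim D o V hid).vb.fib (g s)} :
    ContinuousAt (fun s => (GB.lim D o V hid).vb.pt (g s) (v s)) t ↔ ContinuousAt g t ∧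
      ∀ i, ContinuousAt (fun s => V.vb.pt (D.obj (o i) (g s)) ((v s).1 i)) t :=
  ((Topology.IsInducing.continuousAt_iff (f := fun s => (GB.lim D o V hid).vb.pt (g s) (v s))
    (g := fun q => (VB.pi (fun i => V.vb.pull (D.obj (o i)) (D.obj_cont _))
      (Diag.locFin D o V)).pt q.1 ((D.limSub o V q.1).subtype q.2)) ⟨rfl⟩).trans (VB.pi_iff _ _)).trans (and_congr_right fun h =>
    forall_congr' fun j => (VB.pull_iff _ _ _).trans (and_iff_right h))

/-- The value of a compatible family at an object of the diagram. -/
def GB.limEv (i : I) (z : Z) : (GB.lim D o V hid).vb.fib z →ₗ[ℂ] V.vb.fib (D.obj (o i) z) :=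
  LinearMap.proj i ∘ₗ (D.limSub o V z).subtype

theorem GB.limEv_cont (i : I) : Continuous fun p : (GB.lim D o V hid).vb.Tot =>
    V.vb.pt (D.obj (o i) p.1) (GB.limEv D o V hid i p.1 p.2) :=
  continuous_iff_continuousAt.2 fun p => ((GB.lim_iff D o V hid).1
    (continuousAt_id (X := (GB.lim D o V hid).vb.Tot) (x := p))).2 i

theorem GB.lim_ext {z : Z} {v w : (GB.lim D o V hid).vb.fib z}
    (h : ∀ i, GB.limEv D o V hid i z v = GB.limEv D o V hid i z w) : v = w :=
  Subtype.ext (funext h)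

theorem GB.limEv_act (i : I) {z z' : Z} (f : z ⟶ z') (v : (GB.lim D o V hid).vb.fib z) :
    GB.limEv D o V hid i z' ((GB.lim D o V hid).act f v) =
      V.act (D.map (𝟙 (o i)) f) (GB.limEv D o V hid i z v) := rfl

theorem GB.lim_congr {V W : GB Y} (h : V.Iso W) : (GB.lim D o V hid).Iso (GB.lim D o W hid) := by
  obtain ⟨e, h1, h2, h3⟩ := h
  refine GB.iso_of_joint (I := I) (fun i => W.vb) (fun i => D.obj (o i))
    (fun i z => (e _).toLinearMap ∘ₗ GB.limEv D o V hid i z) (fun i => GB.limEv D o W hid i)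
    (fun i => h2.comp (GB.limEv_cont D o V hid i)) (GB.limEv_cont D o W hid)
    (fun z v h => GB.lim_ext D o V hid fun i => (e _).injective ((h i).trans (by simp)))
    (fun z v h => GB.lim_ext D o W hid fun i => (h i).trans (map_zero _).symm)
    (fun z v => ⟨⟨fun i => e _ (v.1 i), fun i i' α => ?_⟩, fun i => rfl⟩)
    (fun z v => ⟨⟨fun i => (e _).symm (v.1 i), fun i i' α => ?_⟩,
      fun j => (e _).apply_symm_apply _⟩) (fun y y' k v w h j => ?_)
  · rw [← h1, v.2]
  · rw [LinearEquiv.eq_symm_apply, h1, LinearEquiv.apply_symm_apply, v.2]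
  · exact (h1 _ _ _ _).trans (congrArg _ (h _))

theorem GB.lim_prod (V W : GB Y) :
    (GB.lim D o (V.prod W) hid).Iso ((GB.lim D o V hid).prod (GB.lim D o W hid)) := by
  refine GB.iso_of_bij (fun z =>
    { toFun := fun v => (⟨fun j => (v.1 j).1, fun i i' h => congrArg Prod.fst (v.2 i i' h)⟩,
        ⟨fun j => (v.1 j).2, fun i i' h => congrArg Prod.snd (v.2 i i' h)⟩)
      map_add' := fun _ _ => rfl
      map_smul' := fun _ _ => rfl })
    ?_ (fun y => ⟨fun v w h => Subtype.ext (funext fun j => Prod.ext ?_ ?_), fun v =>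
      ⟨⟨fun j => (v.1.1 j, v.2.1 j), fun i i' h => Prod.ext (v.1.2 i i' h) (v.2.2 i i' h)⟩, rfl⟩⟩)
    fun y y' k v => rfl
  · rw [continuous_iff_continuousAt]
    intro p
    have hp := (GB.lim_iff D o (V.prod W) hid).1 (continuousAt_id (x := p))
    have hp2 := fun j => (VB.prod_iff _ _).1 (hp.2 j)
    exact (VB.prod_iff _ _).2 ⟨(GB.lim_iff D o V hid).2 ⟨hp.1, fun j => (hp2 j).1⟩,
      (GB.lim_iff D o W hid).2 ⟨hp.1, fun j => (hp2 j).2⟩⟩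
  · exact congrFun (congrArg Subtype.val (congrArg Prod.fst h)) j
  · exact congrFun (congrArg Subtype.val (congrArg Prod.snd h)) j

/-- The limit of a series along a finite diagram. -/
def Series.lim (hD : D.Compat ξ υ) (V : Series υ) : Series ξ where
  coef a := GB.lim D o (V.coef a) hid
  rot a z v := Subtype.ext (funext fun i => by
    obtain ⟨r, hr⟩ := hD (o i) z
    have h1 := V.rot a _ (v.1 i)
    rw [hr, D.map_right, (V.coef a).act_comp, v.2 i i r] at h1
    exact h1)
  locfin := locfin_of_finite (fun i => D.obj_cont (o i)) fun a z h =>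
    ⟨fun v w => Subtype.ext (funext fun i => (h i).elim _ _)⟩

theorem Series.lim_addOp (hD : D.Compat ξ υ) : AddOp (Series.lim D o hid hD) :=
  ⟨fun V W h a => GB.lim_congr D o hid (h a), fun V W a => GB.lim_prod D o hid _ _⟩


end Diag

/-! ### Tensor products of limits -/

section LimTensor

variable {Z : Type u} [Groupoid.{u} Z] [TopologicalSpace Z] [ArrTop Z]
  {Y : Type u} [Groupoid.{u} Y] [TopologicalSpace Y] [ArrTop Y]
  {Y' : Type u} [Groupoid.{u} Y'] [TopologicalSpace Y'] [ArrTop Y']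
  {K K' : Type} [Groupoid.{0} K] [Groupoid.{0} K']
  (D : Diag Z Y K) {I : Type} (o : I → K) (V : GB Y) (D' : Diag Z Y' K') {I' : Type} (o' : I' → K')
  (W : GB Y') [Finite I] [Finite I'] [∀ k k' : K, Finite (k ⟶ k')] [∀ k k' : K', Finite (k ⟶ k')]
  (hid : Continuous fun z : Z => arr (𝟙 z))

/-- The components of an element of a tensor product of two products. -/
theorem exists_tensor_of_components {I I' : Type*} {V : I → Type*}
    {W : I' → Type*} [∀ i, AddCommGroup (V i)] [∀ i, Module ℂ (V i)] [∀ i, AddCommGroup (W i)]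
    [∀ i, Module ℂ (W i)] [∀ i, FiniteDimensional ℂ (V i)] [FiniteDimensional ℂ (∀ i, W i)]
    (u : ∀ i i', V i ⊗[ℂ] W i') : ∃! y : (∀ i, V i) ⊗[ℂ] (∀ i', W i'),
      ∀ i i', TensorProduct.map (LinearMap.proj i) (LinearMap.proj i') y = u i i' := by
  have h2 : ∀ i, Function.Bijective (LinearMap.pi fun i' : I' => TensorProduct.map
      (LinearMap.id (R := ℂ) (M := V i)) (LinearMap.proj (φ := W) i')) := fun i => by
    have h3 := (piTensorLeft_bijective W (V i)).comp (TensorProduct.comm ℂ (V i) (∀ i', W i')).bijective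
    have h4 := (LinearEquiv.piCongrRight fun i' => TensorProduct.comm ℂ (W i') (V i)).bijective.comp h3
    refine (congrArg (fun f : _ →ₗ[ℂ] _ => Function.Bijective f) (?_ :
      (LinearEquiv.piCongrRight fun i' => TensorProduct.comm ℂ (W i') (V i)).toLinearMap ∘ₗ
      piTensorLeft W (V i) ∘ₗ (TensorProduct.comm ℂ (V i) (∀ i', W i')).toLinearMap = _)).mp h4
    exact TensorProduct.ext' fun a b => rfl
  have h1 := piTensorLeft_bijective V (∀ i', W i')
  have key : ∀ y i i', TensorProduct.map (LinearMap.proj i) (LinearMap.proj i') y =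
      (LinearMap.pi fun i' : I' => TensorProduct.map
      (LinearMap.id (R := ℂ) (M := V i)) (LinearMap.proj (φ := W) i')) (piTensorLeft V _ y i) i' := by
    intro y i i'
    change _ = (TensorProduct.map _ _ ∘ₗ TensorProduct.map _ _) y
    rw [← TensorProduct.map_comp]
    rfl
  choose x hx using fun i => (h2 i).2 (u i)
  obtain ⟨y, hy⟩ := h1.2 x
  refine ⟨y, fun i i' => ?_, fun y' hy' => h1.1 (funext fun i => (h2 i).1 (funext fun i' => ?_))⟩
  · rw [key, hy, hx]
  · rw [← key, hy', hy, hx]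

/-- The average as a map to the space of compatible families. -/
def Diag.meanLim (z : Z) : (∀ i, V.vb.fib (D.obj (o i) z)) →ₗ[ℂ] (GB.lim D o V hid).vb.fib z :=
  (D.mean o V z).codRestrict (D.limSub o V z) (D.mean_mem o V z)

theorem Diag.meanLim_of_mem (z : Z) (v : (GB.lim D o V hid).vb.fib z) :
    D.meanLim o V hid z v.1 = v := Subtype.ext (D.mean_of_mem o V z v.2)

theorem Diag.limEv_meanLim (z : Z) [∀ i, Fintype (Σ i', (o i' ⟶ o i))] (i) :
    GB.limEv D o V hid i z ∘ₗ D.meanLim o V hid z = ∑ p : Σ i', (o i' ⟶ o i),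
      ((Nat.card (Σ i', (o i' ⟶ o i)) : ℂ)⁻¹) • (V.act (D.map p.2 (𝟙 z)) ∘ₗ LinearMap.proj p.1) := by
  refine LinearMap.ext fun v => (D.mean_apply o V z v i).trans ?_
  simp

/-- The limits are direct summands of the products, by averaging, so that vectors of their tensor product
are determined by their components. -/
theorem GB.lim_tensor_inj (z : Z)
    (x : (GB.lim D o V hid).vb.fib z ⊗[ℂ] (GB.lim D' o' W hid).vb.fib z)
    (h : ∀ i i', TensorProduct.map (GB.limEv D o V hid i z) (GB.limEv D' o' W hid i' z) x = 0) :
    x = 0 := by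
  let s : (GB.lim D o V hid).vb.fib z →ₗ[ℂ] _ := (D.limSub o V z).subtype
  let s' : (GB.lim D' o' W hid).vb.fib z →ₗ[ℂ] _ := (D'.limSub o' W z).subtype
  have h1 : TensorProduct.map (D.meanLim o V hid z) (D'.meanLim o' W hid z)
      (TensorProduct.map s s' x) = x := by
    change (TensorProduct.map _ _ ∘ₗ TensorProduct.map _ _) x = x
    rw [← TensorProduct.map_comp, show D.meanLim o V hid z ∘ₗ s = LinearMap.id from
      LinearMap.ext (D.meanLim_of_mem o V hid z), show D'.meanLim o' W hid z ∘ₗ s' = LinearMap.id from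
      LinearMap.ext (D'.meanLim_of_mem o' W hid z), TensorProduct.map_id]
    rfl
  obtain ⟨y, hy, hu⟩ := exists_tensor_of_components (V := fun i => V.vb.fib (D.obj (o i) z))
    (W := fun i => W.vb.fib (D'.obj (o' i) z)) (fun i i' => 0)
  have h2 : TensorProduct.map s s' x = 0 := (hu _ fun i i' => by
    refine Eq.trans ?_ (h i i')
    change (TensorProduct.map _ _ ∘ₗ TensorProduct.map _ _) x = _
    rw [← TensorProduct.map_comp]; rfl).trans (hu _ fun i i' => map_zero _).symm
  rw [← h1, h2, map_zero]

/-- A compatible family of vectors in the tensor products comes from the tensor product of the limits: it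
is the image of an element of the tensor product of the products, which can be averaged in both
factors. -/
theorem GB.lim_tensor_surj (z : Z) (u : ∀ i i', V.vb.fib (D.obj (o i) z) ⊗[ℂ] W.vb.fib (D'.obj (o' i') z))
    (h : ∀ i₁ i₂ j₁ j₂ (α : o i₁ ⟶ o i₂) (β : o' j₁ ⟶ o' j₂),
      TensorProduct.map (V.act (D.map α (𝟙 z))) (W.act (D'.map β (𝟙 z))) (u i₁ j₁) = u i₂ j₂) :
    ∃ x : (GB.lim D o V hid).vb.fib z ⊗[ℂ] (GB.lim D' o' W hid).vb.fib z,
      ∀ i i', TensorProduct.map (GB.limEv D o V hid i z) (GB.limEv D' o' W hid i' z) x = u i i' := by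
  let _ := fun i => Fintype.ofFinite (Σ i', (o i' ⟶ o i))
  let _ := fun i => Fintype.ofFinite (Σ i', (o' i' ⟶ o' i))
  obtain ⟨y, hy, hu⟩ := exists_tensor_of_components u
  refine ⟨TensorProduct.map (D.meanLim o V hid z) (D'.meanLim o' W hid z) y, fun i i' => ?_⟩
  change (TensorProduct.map _ _ ∘ₗ TensorProduct.map _ _) y = _
  rw [← TensorProduct.map_comp, D.limEv_meanLim, D'.limEv_meanLim]
  change TensorProduct.mapBilinear _ _ _ _ _ _ _ y = _
  have hne : (Nat.card (Σ i', (o i' ⟶ o i)) : ℂ) ≠ 0 := by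
    have : Nonempty (Σ i', (o i' ⟶ o i)) := ⟨⟨i, 𝟙 _⟩⟩
    exact_mod_cast Nat.card_pos.ne'
  have hne' : (Nat.card (Σ j, (o' j ⟶ o' i')) : ℂ) ≠ 0 := by
    have : Nonempty (Σ j, (o' j ⟶ o' i')) := ⟨⟨i', 𝟙 _⟩⟩
    exact_mod_cast Nat.card_pos.ne'
  have key : ∀ (p : Σ j, (o j ⟶ o i)) (q : Σ j, (o' j ⟶ o' i')),
      TensorProduct.mapBilinear (RingHom.id ℂ) _ _ _ _
        (V.act (D.map p.2 (𝟙 z)) ∘ₗ LinearMap.proj p.1)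
        (W.act (D'.map q.2 (𝟙 z)) ∘ₗ LinearMap.proj q.1) y = u i i' := by
    intro p q
    rw [TensorProduct.mapBilinear_apply, TensorProduct.map_comp, LinearMap.comp_apply, hy, h]
  simp only [map_sum, LinearMap.sum_apply, map_smul, LinearMap.smul_apply, key, Finset.sum_const,
    Finset.card_univ]
  simp only [← Nat.cast_smul_eq_nsmul ℂ, smul_smul, ← Nat.card_eq_fintype_card]
  field_simp
  simp
end LimTensor

/-! ### Families over a discrete groupoid -/

section Shape

/-- A groupoid with finite sets of arrows, the objects of which have a positive size such that
there are finitely many objects of each size. -/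
class Sized (K : Type) [Groupoid.{0} K] where
  len : K → ℕ
  len_pos : ∀ k, 0 < len k
  fin_len : ∀ n, Finite {k // len k ≤ n}
  fin_hom : ∀ k k' : K, Finite (k ⟶ k')
  len_eq : ∀ {k k' : K}, (k ⟶ k') → len k = len k'

attribute [instance] Sized.fin_hom

variable {K : Type} [Groupoid.{0} K]

/-- The total size of a family. -/
def SymN.size [Sized K] {m : ℕ} (κ : SymN m K) : ℕ := ∑ i, Sized.len (κ i)

/-- The families of `m` objects of total size `n`. -/
def Ix (K : Type) [Groupoid.{0} K] [Sized K] (n m : ℕ) : Type := {κ : SymN m K // κ.size = n}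

/-- The underlying family. -/
def Ix.fam [Sized K] {n m : ℕ} (κ : Ix K n m) : SymN m K := κ.1

theorem SymN.size_eq [Sized K] {m : ℕ} {κ κ' : SymN m K} (A : κ ⟶ κ') : κ.size = κ'.size :=
  Fintype.sum_equiv A.perm _ _ fun i => Sized.len_eq (A.hom i _ rfl)

instance [Sized K] (n m : ℕ) : Finite (Ix K n m) := by
  have := Sized.fin_len (K := K) n
  refine Finite.of_injective (β := Fin m → {k : K // Sized.len k ≤ n})
    (fun κ i => ⟨κ.1 i, ?_⟩) fun κ κ' h => Subtype.ext (funext fun i => ?_)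
  · refine le_of_le_of_eq ?_ κ.2
    exact Finset.single_le_sum (f := fun i => Sized.len (κ.1 i)) (fun _ _ => Nat.zero_le _)
      (Finset.mem_univ i)
  · exact congrArg Subtype.val (congrFun h i)

instance [Sized K] (m : ℕ) (κ κ' : SymN m K) : Finite (κ ⟶ κ') := by
  have h : ∀ i j, Finite (κ i ⟶ κ' j) := fun i j => Sized.fin_hom (K := K) _ _
  have : Finite (Σ σ : Equiv.Perm (Fin m), ∀ i, (κ i ⟶ κ' (σ i))) := inferInstance
  refine Finite.of_injective (β := Σ σ : Equiv.Perm (Fin m), ∀ i, (κ i ⟶ κ' (σ i)))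
    (fun A => ⟨A.perm, fun i => A.hom i _ rfl⟩) fun A B h => ?_
  obtain ⟨σ, a⟩ := A
  obtain ⟨τ, b⟩ := B
  injection h with h1 h2
  subst h1
  refine FamHom.ext rfl fun i j h h' => ?_
  subst h
  exact congrFun (eq_of_heq h2) i

theorem Ix.le [Sized K] {n m : ℕ} (κ : Ix K n m) : m ≤ n := by
  rw [← κ.2]
  calc m = ∑ _i : Fin m, 1 := by simp
    _ ≤ _ := Finset.sum_le_sum fun i _ => Sized.len_pos _

variable {Z : Type u} [Groupoid.{u} Z] [TopologicalSpace Z] [ArrTop Z]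
  {Y : Type u} [Groupoid.{u} Y] [TopologicalSpace Y] [ArrTop Y] {ξ : Cen Z} {υ : Cen Y}

theorem Diag.map_eqToHom (D : Diag Z Y K) {k k' : K} (h : k = k') (z : Z) :
    D.map (eqToHom h) (𝟙 z) = eqToHom (by rw [h]) := by
  subst h; exact D.map_id k z

/-- A functor `K × Z ⟶ Y` induces a functor from families in `K` and objects of `Z` to families
in `Y`. -/
def Diag.symN (D : Diag Z Y K) (m : ℕ) : Diag Z (SymN m Y) (SymN m K) where
  obj κ z i := D.obj (κ i) z
  map A f := ⟨A.perm, fun i j h => D.map (A.hom i j h) f⟩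
  map_id κ z := FamHom.ext rfl fun i j h h' => by
    cases (show i = j from h')
    exact D.map_eqToHom rfl z
  map_comp A B f g := FamHom.ext rfl fun i j h h' => D.map_comp _ _ f g
  obj_cont κ := continuous_pi fun i => D.obj_cont _
  map_cont A := continuous_iff_continuousAt.2 fun a => SymN.arr_iff.2 fun i =>
    ⟨.of_forall fun _ => rfl, (D.map_cont _).continuousAt⟩

theorem Diag.Compat.symN {D : Diag Z Y K} (hD : D.Compat ξ υ) (m : ℕ) :
    (D.symN m).Compat ξ (υ.symN m) := fun κ z => by
  choose r hr using fun k => hD k z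
  refine ⟨FamHom.diag fun i => r (κ i), FamHom.ext rfl fun i j h h' => ?_⟩
  cases (show i = j from h')
  refine (FamHom.diag_hom _ i h).trans ((hr (κ i)).trans ?_)
  exact congrArg (fun q => D.map q (ξ.app z)) (FamHom.diag_hom (fun i => r (κ i)) i h').symm

/-- The invariant sections of a series on `Sₘ ∫ Y` over the families in `K` of `m` objects and of
size `n`. -/
def Series.inv [Sized K] (D : Diag Z Y K) (hD : D.Compat ξ υ)
    (hid : Continuous fun z : Z => arr (𝟙 z)) (n m : ℕ) : Series (υ.symN m) → Series ξ :=
  Series.lim (D.symN m) (Ix.fam (K := K) (n := n)) hid (hD.symN m)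

end Shape

/-! ### Restriction of families along a decomposition of the index set -/

section Mackey

variable {K : Type} [Groupoid.{0} K] {i j m n : ℕ}

theorem arr_left_eqToHom {X : Type u} [Groupoid.{u} X] {x y z : X} (h : x = y) (f : y ⟶ z) : arr (eqToHom h ≫ f) = arr f := by
  subst h; simp

theorem arr_right_eqToHom {X : Type u} [Groupoid.{u} X] {x y z : X} (f : x ⟶ y) (h : y = z) : arr (f ≫ eqToHom h) = arr f := by
  subst h; simp

theorem FamHom.ext_of_arr {X : Type u} [Groupoid.{u} X] {I J : Type} {x : I → X} {y : J → X} {A B : FamHom x y}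
    (hp : A.perm = B.perm) (h : ∀ k, arr (A.hom k _ rfl) = arr (B.hom k _ rfl)) : A = B :=
  FamHom.ext hp fun k l e e' => by
    have h1 := (arr_hom_congr A e rfl rfl).trans ((h k).trans (arr_hom_congr B rfl e' rfl))
    injection h1

/-- The first part of a family. -/
def SymN.left (ρ : Fin i ⊕ Fin j ≃ Fin m) (κ : SymN m K) : SymN i K := fun a => κ (ρ (.inl a))

/-- The second part of a family. -/
def SymN.right (ρ : Fin i ⊕ Fin j ≃ Fin m) (κ : SymN m K) : SymN j K := fun a => κ (ρ (.inr a))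

/-- The restriction of an arrow of families to the first parts. -/
def SymN.leftHom {κ κ' : SymN m K} (A : κ ⟶ κ') (ρ ρ' : Fin i ⊕ Fin j ≃ Fin m)
    (h : ρ'.trans A.perm.symm = ρ) : SymN.left ρ κ ⟶ SymN.left ρ' κ' :=
  ⟨.refl _, fun a b hb => A.hom _ _ (by subst h; subst hb; exact A.perm.apply_symm_apply _)⟩

/-- The restriction of an arrow of families to the second parts. -/
def SymN.rightHom {κ κ' : SymN m K} (A : κ ⟶ κ') (ρ ρ' : Fin i ⊕ Fin j ≃ Fin m)
    (h : ρ'.trans A.perm.symm = ρ) : SymN.right ρ κ ⟶ SymN.right ρ' κ' :=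
  ⟨.refl _, fun a b hb => A.hom _ _ (by subst h; subst hb; exact A.perm.apply_symm_apply _)⟩

/-- The permutation of the first part which relates two decompositions with the same parts. -/
def SymN.leftMove (γ : Equiv.Perm (Fin i) × Equiv.Perm (Fin j)) (ρ ρ' : Fin i ⊕ Fin j ≃ Fin m)
    (h : (Equiv.sumCongr γ.1 γ.2).symm.trans ρ = ρ') (κ : SymN m K) :
    SymN.left ρ κ ⟶ SymN.left ρ' κ := FamHom.ofEq γ.1 fun a => congrArg κ (SymN.split_left γ h a)

/-- The permutation of the second part which relates two decompositions with the same parts. -/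
def SymN.rightMove (γ : Equiv.Perm (Fin i) × Equiv.Perm (Fin j)) (ρ ρ' : Fin i ⊕ Fin j ≃ Fin m)
    (h : (Equiv.sumCongr γ.1 γ.2).symm.trans ρ = ρ') (κ : SymN m K) :
    SymN.right ρ κ ⟶ SymN.right ρ' κ := FamHom.ofEq γ.2 fun a => congrArg κ (SymN.split_right γ h a)

theorem SymN.size_split [Sized K] (ρ : Fin i ⊕ Fin j ≃ Fin m) (κ : SymN m K) :
    (SymN.left ρ κ).size + (SymN.right ρ κ).size = κ.size := by
  unfold SymN.size
  rw [← Equiv.sum_comp ρ, Fintype.sum_sum_type]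
  rfl

/-- Two arrows of the parts of a family form an arrow of families. -/
def SymN.joinHom {κ κ' : SymN m K} {ρ ρ' : Fin i ⊕ Fin j ≃ Fin m}
    (β : SymN.left ρ κ ⟶ SymN.left ρ' κ') (β' : SymN.right ρ κ ⟶ SymN.right ρ' κ') : κ ⟶ κ' :=
  let B : FamHom (I := Fin i ⊕ Fin j) (J := Fin i ⊕ Fin j) (fun p => κ (ρ p)) (fun p => κ' (ρ' p)) :=
    ⟨β.perm.sumCongr β'.perm, fun p q h => match p, q, h with
      | .inl _, .inl _, h => β.hom _ _ (Sum.inl_injective h)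
      | .inr _, .inr _, h => β'.hom _ _ (Sum.inr_injective h)
      | .inl _, .inr _, h => (Sum.inl_ne_inr h).elim
      | .inr _, .inl _, h => (Sum.inr_ne_inl h).elim⟩
  ⟨ρ.symm.trans (B.perm.trans ρ'), fun k l h => eqToHom (by rw [ρ.apply_symm_apply]) ≫
    B.hom (ρ.symm k) (ρ'.symm l) (by rw [← h]; simp) ≫ eqToHom (by rw [ρ'.apply_symm_apply])⟩

theorem SymN.joinHom_idx {κ κ' : SymN m K} {ρ ρ' : Fin i ⊕ Fin j ≃ Fin m}
    (β : SymN.left ρ κ ⟶ SymN.left ρ' κ') (β' : SymN.right ρ κ ⟶ SymN.right ρ' κ') :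
    (Equiv.sumCongr β.perm β'.perm).symm.trans ρ = ρ'.trans (SymN.joinHom β β').perm.symm :=
  Equiv.ext fun p => by
    change _ = ρ ((Equiv.sumCongr β.perm β'.perm).symm (ρ'.symm (ρ' p)))
    rw [ρ'.symm_apply_apply]; rfl

theorem SymN.joinHom_arr_left {κ κ' : SymN m K} {ρ ρ' : Fin i ⊕ Fin j ≃ Fin m}
    (β : SymN.left ρ κ ⟶ SymN.left ρ' κ') (β' : SymN.right ρ κ ⟶ SymN.right ρ' κ') (a : Fin i) (k l h)
    (hk : k = ρ (.inl a)) :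
    arr ((SymN.joinHom β β').hom k l h) = arr (β.hom a _ rfl) := by
  subst hk
  subst h
  refine (arr_left_eqToHom _ _).trans ((arr_right_eqToHom _ _).trans ?_)
  have key : ∀ (p q : Fin i ⊕ Fin j) h, p = .inl a →
      arr (FamHom.hom (x := fun p => κ (ρ p)) (y := fun p => κ' (ρ' p))
        ⟨β.perm.sumCongr β'.perm, fun p q h => match p, q, h with
      | .inl _, .inl _, h => β.hom _ _ (Sum.inl_injective h)
      | .inr _, .inr _, h => β'.hom _ _ (Sum.inr_injective h)
      | .inl _, .inr _, h => (Sum.inl_ne_inr h).elim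
      | .inr _, .inl _, h => (Sum.inr_ne_inl h).elim⟩ p q h) = arr (β.hom a _ rfl) := by
    rintro _ q h rfl
    subst h
    rfl
  exact key _ _ _ (ρ.symm_apply_apply _)

theorem SymN.joinHom_arr_right {κ κ' : SymN m K} {ρ ρ' : Fin i ⊕ Fin j ≃ Fin m}
    (β : SymN.left ρ κ ⟶ SymN.left ρ' κ') (β' : SymN.right ρ κ ⟶ SymN.right ρ' κ') (a : Fin j) (k l h)
    (hk : k = ρ (.inr a)) :
    arr ((SymN.joinHom β β').hom k l h) = arr (β'.hom a _ rfl) := by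
  subst hk
  subst h
  refine (arr_left_eqToHom _ _).trans ((arr_right_eqToHom _ _).trans ?_)
  have key : ∀ (p q : Fin i ⊕ Fin j) h, p = .inr a →
      arr (FamHom.hom (x := fun p => κ (ρ p)) (y := fun p => κ' (ρ' p))
        ⟨β.perm.sumCongr β'.perm, fun p q h => match p, q, h with
      | .inl _, .inl _, h => β.hom _ _ (Sum.inl_injective h)
      | .inr _, .inr _, h => β'.hom _ _ (Sum.inr_injective h)
      | .inl _, .inr _, h => (Sum.inl_ne_inr h).elim
      | .inr _, .inl _, h => (Sum.inr_ne_inl h).elim⟩ p q h) = arr (β'.hom a _ rfl) := by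
    rintro _ q h rfl
    subst h
    rfl
  exact key _ _ _ (ρ.symm_apply_apply _)

theorem SymN.leftMove_joinHom {κ κ' : SymN m K} {ρ ρ' : Fin i ⊕ Fin j ≃ Fin m}
    (β : SymN.left ρ κ ⟶ SymN.left ρ' κ') (β' : SymN.right ρ κ ⟶ SymN.right ρ' κ') :
    SymN.leftMove (β.perm, β'.perm) ρ _ (SymN.joinHom_idx β β') κ ≫
      SymN.leftHom (SymN.joinHom β β') _ ρ' rfl = β :=
  FamHom.ext_of_arr rfl fun a => (arr_left_eqToHom
    (congrArg κ (SymN.split_left (β.perm, β'.perm) (SymN.joinHom_idx β β') a)) _).trans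
    (SymN.joinHom_arr_left β β' a _ _ ((SymN.joinHom β β').perm.apply_symm_apply _)
      (SymN.split_left (β.perm, β'.perm) (SymN.joinHom_idx β β') a).symm)

theorem SymN.rightMove_joinHom {κ κ' : SymN m K} {ρ ρ' : Fin i ⊕ Fin j ≃ Fin m}
    (β : SymN.left ρ κ ⟶ SymN.left ρ' κ') (β' : SymN.right ρ κ ⟶ SymN.right ρ' κ') :
    SymN.rightMove (β.perm, β'.perm) ρ _ (SymN.joinHom_idx β β') κ ≫
      SymN.rightHom (SymN.joinHom β β') _ ρ' rfl = β' :=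
  FamHom.ext_of_arr rfl fun a => (arr_left_eqToHom
    (congrArg κ (SymN.split_right (β.perm, β'.perm) (SymN.joinHom_idx β β') a)) _).trans
    (SymN.joinHom_arr_right β β' a _ _ ((SymN.joinHom β β').perm.apply_symm_apply _)
      (SymN.split_right (β.perm, β'.perm) (SymN.joinHom_idx β β') a).symm)

variable {Z : Type u} [Groupoid.{u} Z] [TopologicalSpace Z] [ArrTop Z]
  {Y : Type u} [Groupoid.{u} Y] [TopologicalSpace Y] [ArrTop Y]

/-- The product of two diagrams. -/
def Diag.prod {Y' : Type u} [Groupoid.{u} Y'] [TopologicalSpace Y'] [ArrTop Y'] {K' : Type}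
    [Groupoid.{0} K'] (D : Diag Z Y K) (D' : Diag Z Y' K') : Diag Z (GProd Y Y') (GProd K K') where
  obj k z := (D.obj k.1 z, D'.obj k.2 z)
  map α f := (D.map α.1 f, D'.map α.2 f)
  map_id k z := Prod.ext (D.map_id _ _) (D'.map_id _ _)
  map_comp α β f g := Prod.ext (D.map_comp _ _ _ _) (D'.map_comp _ _ _ _)
  obj_cont k := (D.obj_cont _).prodMk (D'.obj_cont _)
  map_cont α := continuous_iff_continuousAt.2 fun a => GProd.arr_iff.2
    ⟨(D.map_cont _).continuousAt, (D'.map_cont _).continuousAt⟩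

/-- The arrow of pairs of families given by arrows in the discrete direction. -/
def Diag.pair (D : Diag Z Y K) {κ κ' : SymN i K} {l l' : SymN j K} (β : κ ⟶ κ') (β' : l ⟶ l') (z : Z) :
    ((D.symN i).prod (D.symN j)).obj (κ, l) z ⟶ ((D.symN i).prod (D.symN j)).obj (κ', l') z :=
  ((D.symN i).prod (D.symN j)).map (k := (κ, l)) (k' := (κ', l')) (β, β') (𝟙 z)

theorem Diag.move_eq (D : Diag Z Y K) (e : Fin i ⊕ Fin j ≃ Fin m)
    (hY : Continuous fun y : Y => arr (𝟙 y)) (κ : SymN m K) (z : Z)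
    (γ : Equiv.Perm (Fin i) × Equiv.Perm (Fin j)) (ρ ρ' : Fin i ⊕ Fin j ≃ Fin m)
    (h : (Equiv.sumCongr γ.1 γ.2).symm.trans ρ = ρ') :
    (SymN.cover e hY).move γ ρ ρ' h ((D.symN m).obj κ z) =
      D.pair (SymN.leftMove γ ρ ρ' h κ) (SymN.rightMove γ ρ ρ' h κ) z := by
  refine Prod.ext (FamHom.ext rfl fun a b h1 _ => ?_) (FamHom.ext rfl fun a b h1 _ => ?_)
  · have h2 : γ.1 a = b := h1
    subst h2
    exact (D.map_eqToHom (congrArg κ (SymN.split_left γ h a)) z).symm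
  · have h2 : γ.2 a = b := h1
    subst h2
    exact (D.map_eqToHom (congrArg κ (SymN.split_right γ h a)) z).symm

variable [Sized K] (D : Diag Z Y K) (hid : Continuous fun z : Z => arr (𝟙 z))
  (hY : Continuous fun y : Y => arr (𝟙 y)) (e : Fin i ⊕ Fin j ≃ Fin m)

/-- The pairs of families of `i` and `j` objects of total size `n`. -/
def Ix.pairs (K : Type) [Groupoid.{0} K] [Sized K] (n i j : ℕ)
    (s : Σ q : {q : ℕ × ℕ // q ∈ Finset.HasAntidiagonal.antidiagonal n}, Ix K q.1.1 i × Ix K q.1.2 j) :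
    GProd (SymN i K) (SymN j K) := (s.2.1.fam, s.2.2.fam)

/-- The two parts of a family. -/
def Ix.cut (ρ : Fin i ⊕ Fin j ≃ Fin m) (κ : Ix K n m) :
    Σ q : {q : ℕ × ℕ // q ∈ Finset.HasAntidiagonal.antidiagonal n}, Ix K q.1.1 i × Ix K q.1.2 j :=
  ⟨⟨((SymN.left ρ κ.1).size, (SymN.right ρ κ.1).size), Finset.HasAntidiagonal.mem_antidiagonal.2
    ((SymN.size_split ρ κ.1).trans κ.2)⟩, ⟨SymN.left ρ κ.1, rfl⟩, ⟨SymN.right ρ κ.1, rfl⟩⟩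

theorem Ix.exists_cut (s : Σ q : {q : ℕ × ℕ // q ∈ Finset.HasAntidiagonal.antidiagonal n},
    Ix K q.1.1 i × Ix K q.1.2 j) : ∃ κ : Ix K n m, s = Ix.cut e κ := by
  obtain ⟨⟨⟨a, b⟩, hq⟩, ⟨κ, h1⟩, ⟨l, h2⟩⟩ := s
  change κ.size = a at h1
  change l.size = b at h2
  subst h1 h2
  have key : ∀ τ : SymN m K, κ = SymN.left e τ → l = SymN.right e τ → ∃ κ' : Ix K n m,
      (⟨⟨(κ.size, l.size), hq⟩, ⟨κ, rfl⟩, ⟨l, rfl⟩⟩ : Σ q : {q : ℕ × ℕ //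
        q ∈ Finset.HasAntidiagonal.antidiagonal n}, Ix K q.1.1 i × Ix K q.1.2 j) = Ix.cut e κ' := by
    rintro τ rfl rfl
    exact ⟨⟨τ, (SymN.size_split e τ).symm.trans (Finset.HasAntidiagonal.mem_antidiagonal.1 hq)⟩, rfl⟩
  exact key (fun k => Sum.elim κ l (e.symm k))
    (funext fun k => (congrArg (Sum.elim κ l) (e.symm_apply_apply (.inl k))).symm)
    (funext fun k => (congrArg (Sum.elim κ l) (e.symm_apply_apply (.inr k))).symm)

theorem Diag.act_map {K' : Type} [Groupoid.{0} K'] (D : Diag Z Y K') (U : GB Y) {k k' k'' : K'}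
    (α : k ⟶ k') (β : k' ⟶ k'') (z : Z) (v : U.vb.fib (D.obj k z)) :
    U.act (D.map β (𝟙 z)) (U.act (D.map α (𝟙 z)) v) = U.act (D.map (α ≫ β) (𝟙 z)) v := by
  rw [← U.act_comp, ← D.map_comp, Category.comp_id]

instance [∀ k k' : K, Finite (k ⟶ k')] {K' : Type} [Groupoid.{0} K'] [∀ k k' : K', Finite (k ⟶ k')]
    (p q : GProd K K') : Finite (p ⟶ q) :=
  inferInstanceAs (Finite ((p.1 ⟶ q.1) × (p.2 ⟶ q.2)))

/-- A compatible family in a transfer along concatenation is invariant under all arrows between the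
two parts of the families. -/
theorem Diag.inv_pair (U : GB (GProd (SymN i Y) (SymN j Y))) (z : Z)
    (v : (GB.lim (D.symN m) (Ix.fam (K := K) (n := n)) (GB.push (SymN.cover e hY) U) hid).vb.fib z)
    (κ κ' : Ix K n m) (ρ ρ' : Fin i ⊕ Fin j ≃ Fin m)
    (β : SymN.left ρ κ.1 ⟶ SymN.left ρ' κ'.1) (β' : SymN.right ρ κ.1 ⟶ SymN.right ρ' κ'.1) :
    U.act (D.pair β β' z) ((v.1 κ).1 ρ) = (v.1 κ').1 ρ' := by
  have h1 := congrFun (congrArg Subtype.val (v.2 κ κ' (SymN.joinHom β β'))) ρ'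
  have h2 := (v.1 κ).2 (β.perm, β'.perm) ρ _ (SymN.joinHom_idx β β')
  have h3 := (congrArg (fun f => U.act f ((v.1 κ).1 ρ)) (D.move_eq e hY κ.1 z (β.perm, β'.perm) ρ _
    (SymN.joinHom_idx β β'))).symm.trans h2
  have h4 : U.act (D.pair (SymN.leftHom (SymN.joinHom β β') _ ρ' rfl)
    (SymN.rightHom (SymN.joinHom β β') _ ρ' rfl) z)
    ((v.1 κ).1 (ρ'.trans (SymN.joinHom β β').perm.symm)) = (v.1 κ').1 ρ' := h1
  refine Eq.trans ?_ ((congrArg _ h3).trans h4)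
  refine Eq.trans ?_ (((D.symN i).prod (D.symN j)).act_map U _ _ z _).symm
  exact congrArg (fun f => U.act f ((v.1 κ).1 ρ)) (congrArg₂ (fun a b => D.pair a b z)
    (SymN.leftMove_joinHom β β').symm (SymN.rightMove_joinHom β β').symm)

/-- The limit over families of a transfer along concatenation is a limit over pairs of families. -/
theorem GB.lim_push (U : GB (GProd (SymN i Y) (SymN j Y))) :
    (GB.lim ((D.symN i).prod (D.symN j)) (Ix.pairs K n i j) U hid).Iso
      (GB.lim (D.symN m) (Ix.fam (K := K) (n := n)) (GB.push (SymN.cover e hY) U) hid) := by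
  refine GB.iso_of_bij (fun z =>
    { toFun := fun w => ⟨fun κ => ⟨fun ρ => w.1 (Ix.cut ρ κ), fun γ ρ ρ' h => ?_⟩, fun κ κ' A => ?_⟩
      map_add' := fun _ _ => rfl
      map_smul' := fun _ _ => rfl }) ?_ (fun z => ⟨fun w w' h => ?_, fun v => ?_⟩) fun z z' f w => rfl
  · exact (congrArg (fun f => U.act f (w.1 (Ix.cut ρ κ))) (D.move_eq e hY κ.1 z γ ρ ρ' h)).trans
      (w.2 (Ix.cut ρ κ) (Ix.cut ρ' κ) (SymN.leftMove γ ρ ρ' h κ.1, SymN.rightMove γ ρ ρ' h κ.1))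
  · exact Subtype.ext (funext fun ρ' => w.2 (Ix.cut (ρ'.trans A.perm.symm) κ) (Ix.cut ρ' κ')
      (SymN.leftHom A _ ρ' rfl, SymN.rightHom A _ ρ' rfl))
  · rw [continuous_iff_continuousAt]
    intro p
    have hp := (GB.lim_iff _ _ U hid).1 (continuousAt_id (x := p))
    exact (GB.lim_iff _ _ _ hid).2 ⟨hp.1, fun κ => (GB.push_iff _ _).2
      ⟨((D.symN m).obj_cont _).continuousAt.comp hp.1, fun ρ => hp.2 (Ix.cut ρ κ)⟩⟩
  · refine Subtype.ext (funext fun s => ?_)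
    obtain ⟨κ, rfl⟩ := Ix.exists_cut e s
    exact congrFun (congrArg Subtype.val (congrFun (congrArg Subtype.val h) κ)) e
  -- Every pair of families is, for the decomposition `e`, the pair of parts of its concatenation; this
  -- determines the preimage of a compatible family.
  · choose c hc using Ix.exists_cut (K := K) (n := n) e
    have hc1 := fun s => congrArg (Ix.pairs K n i j) (hc s)
    let w := fun s => U.act (((D.symN i).prod (D.symN j)).map (eqToHom (hc1 s).symm) (𝟙 z)) ((v.1 (c s)).1 e)
    have key : ∀ s κ ρ (β : Ix.pairs K n i j s ⟶ Ix.pairs K n i j (Ix.cut ρ κ)),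
        U.act (((D.symN i).prod (D.symN j)).map β (𝟙 z)) (w s) = (v.1 κ).1 ρ := by
      intro s κ ρ β
      have h := D.inv_pair hid hY e U z v (c s) κ e ρ (eqToHom (hc1 s).symm ≫ β).1
        (eqToHom (hc1 s).symm ≫ β).2
      exact (((D.symN i).prod (D.symN j)).act_map U _ _ z _).trans h
    refine ⟨⟨w, fun s s' β => ?_⟩, Subtype.ext (funext fun κ => Subtype.ext (funext fun ρ => ?_))⟩
    · have h1 := key s (c s') e (β ≫ eqToHom (hc1 s'))
      refine Eq.trans ?_ (congrArg (U.act (((D.symN i).prod (D.symN j)).map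
        (eqToHom (hc1 s').symm) (𝟙 z))) h1)
      refine Eq.trans ?_ (((D.symN i).prod (D.symN j)).act_map U _ _ z _).symm
      rw [Category.assoc, eqToHom_trans, eqToHom_refl, Category.comp_id]
    · refine Eq.trans ?_ (key (Ix.cut ρ κ) κ ρ (𝟙 _))
      exact (congrArg (fun f => U.act f (w (Ix.cut ρ κ))) (Diag.map_id _ _ z)).trans
        (U.act_id _ _) |>.symm

end Mackey

section LimOps

variable {Z : Type u} [Groupoid.{u} Z] [TopologicalSpace Z] [ArrTop Z]
  {Y : Type u} [Groupoid.{u} Y] [TopologicalSpace Y] [ArrTop Y]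
  {Y' : Type u} [Groupoid.{u} Y'] [TopologicalSpace Y'] [ArrTop Y']
  {K K' : Type} [Groupoid.{0} K] [Groupoid.{0} K'] {ξ : Cen Z} {υ : Cen Y} {υ' : Cen Y'}
  (D : Diag Z Y K) {I : Type} (o : I → K) (D' : Diag Z Y' K') {I' : Type} (o' : I' → K')
  [Finite I] [Finite I'] [∀ k k' : K, Finite (k ⟶ k')] [∀ k k' : K', Finite (k ⟶ k')]
  (hid : Continuous fun z : Z => arr (𝟙 z))

theorem GB.lim_pi {P : Type} {V : P → GB Y} (hV : GB.LocFin V)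
    (hW : GB.LocFin fun p => GB.lim D o (V p) hid) :
    (GB.lim D o (GB.pi V hV) hid).Iso (GB.pi (fun p => GB.lim D o (V p) hid) hW) := by
  refine GB.iso_of_bij (fun z =>
    { toFun := fun v p => ⟨fun i => v.1 i p, fun i i' α => congrFun (v.2 i i' α) p⟩
      map_add' := fun _ _ => rfl
      map_smul' := fun _ _ => rfl }) ?_ (fun z => ⟨fun v w h => Subtype.ext (funext fun i =>
        funext fun p => ?_), fun v => ⟨⟨fun i p => (v p).1 i, fun i i' α => funext fun p =>
          (v p).2 i i' α⟩, rfl⟩⟩) fun z z' f v => rfl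
  · rw [continuous_iff_continuousAt]
    intro q
    have hq := (GB.lim_iff D o (GB.pi V hV) hid).1 (continuousAt_id (x := q))
    have hq2 := fun i => (VB.pi_iff (fun p => (V p).vb) hV).1 (hq.2 i)
    exact (VB.pi_iff (fun p => (GB.lim D o (V p) hid).vb) hW).2
      ⟨hq.1, fun p => (GB.lim_iff D o (V p) hid).2 ⟨hq.1, fun i => (hq2 i).2 p⟩⟩
  · exact congrFun (congrArg Subtype.val (congrFun h p)) i

/-- The limit over a disjoint union of diagrams. -/
theorem GB.lim_sigma {P : Type} [Finite P] {J : P → Type} [∀ p, Finite (J p)] (o : ∀ p, J p → K)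
    (h : ∀ p q i j, (o p i ⟶ o q j) → p = q) (V : GB Y) :
    (GB.lim D (fun s : Σ p, J p => o s.1 s.2) V hid).Iso
      (GB.pi (fun p => GB.lim D (o p) V hid) (GB.LocFin.of_finite _)) := by
  refine GB.iso_of_bij (fun z =>
    { toFun := fun v p => ⟨fun i => v.1 ⟨p, i⟩, fun i i' α => v.2 ⟨p, i⟩ ⟨p, i'⟩ α⟩
      map_add' := fun _ _ => rfl
      map_smul' := fun _ _ => rfl }) ?_ (fun z => ⟨fun v w h => Subtype.ext (funext fun s => ?_),
        fun v => ⟨⟨fun s => (v s.1).1 s.2, fun s s' α => ?_⟩, rfl⟩⟩) fun z z' f v => rfl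
  · rw [continuous_iff_continuousAt]
    intro q
    have hq := (GB.lim_iff D _ V hid).1 (continuousAt_id (x := q))
    exact (VB.pi_iff (fun p => (GB.lim D (o p) V hid).vb) (GB.LocFin.of_finite _)).2
      ⟨hq.1, fun p => (GB.lim_iff D (o p) V hid).2 ⟨hq.1, fun i => hq.2 ⟨p, i⟩⟩⟩
  · exact congrFun (congrArg Subtype.val (congrFun h s.1)) s.2
  · obtain ⟨p, i⟩ := s
    obtain ⟨q, j⟩ := s'
    obtain rfl := h p q i j α
    exact (v p).2 i j α

theorem GB.limEv_inv (V : GB Y) (i i' : I) (α : o i ⟶ o i') (z : Z) :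
    V.act (D.map α (𝟙 z)) ∘ₗ GB.limEv D o V hid i z = GB.limEv D o V hid i' z :=
  LinearMap.ext fun v => v.2 i i' α

/-- The limit of an external tensor product is the tensor product of the limits. -/
theorem GB.lim_tensor (V : GB Y) (W : GB Y') :
    ((GB.lim D o V hid).tensor (GB.lim D' o' W hid)).Iso
    (GB.lim (D.prod D') (fun p : I × I' => ((o p.1, o' p.2) : GProd K K'))
      ((V.pull (GProd.fst Y Y')).tensor (W.pull (GProd.snd Y Y'))) hid) := by
  refine GB.iso_of_bij (fun z =>
    { toFun := fun x => ⟨fun p => TensorProduct.map (GB.limEv D o V hid p.1 z)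
        (GB.limEv D' o' W hid p.2 z) x, fun p p' α => ?_⟩
      map_add' := fun x y => Subtype.ext (funext fun p => map_add _ x y)
      map_smul' := fun c x => Subtype.ext (funext fun p => map_smul _ c x) })
    ?_ (fun z => ⟨?_, fun v => ?_⟩) fun z z' f v => Subtype.ext (funext fun p => ?_)
  · change (TensorProduct.map (V.act (D.map α.1 (𝟙 z))) (W.act (D'.map α.2 (𝟙 z))) ∘ₗ
      TensorProduct.map _ _) x = _
    rw [← TensorProduct.map_comp]
    exact congrFun (congrArg DFunLike.coe (congrArg₂ TensorProduct.map
      (GB.limEv_inv D o hid V p.1 p'.1 α.1 z) (GB.limEv_inv D' o' hid W p.2 p'.2 α.2 z))) x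
  · rw [continuous_iff_continuousAt]
    intro q
    have hq := continuousAt_id (X := ((GB.lim D o V hid).tensor (GB.lim D' o' W hid)).vb.Tot) (x := q)
    exact (GB.lim_iff _ _ _ hid).2 ⟨((GB.lim D o V hid).tensor (GB.lim D' o' W hid)).vb.contFst.continuousAt, fun p => VB.tensorMap_contAt (GB.lim D o V hid).vb (GB.lim D' o' W hid).vb
        (V.pull (GProd.fst Y Y')).vb (W.pull (GProd.snd Y Y')).vb
        (g := fun s : ((GB.lim D o V hid).tensor (GB.lim D' o' W hid)).vb.Tot => s.1)
        (g' := fun s => (D.prod D').obj (o p.1, o' p.2) s.1)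
        (((D.prod D').obj_cont _).continuousAt.comp
          ((GB.lim D o V hid).tensor (GB.lim D' o' W hid)).vb.contFst.continuousAt) hq
        (fun s => GB.limEv D o V hid p.1 s.1) (fun s => GB.limEv D' o' W hid p.2 s.1)
        (fun a ha => (VB.pull_iff V.vb (GProd.fst Y Y').obj (GProd.fst Y Y').obj_cont).2
          ⟨((D.prod D').obj_cont (o p.1, o' p.2)).continuousAt.comp
          ((GB.lim D o V hid).tensor (GB.lim D' o' W hid)).vb.contFst.continuousAt,
          ((GB.lim_iff D o V hid).1 ha).2 p.1⟩)
        (fun a ha => (VB.pull_iff W.vb (GProd.snd Y Y').obj (GProd.snd Y Y').obj_cont).2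
          ⟨((D.prod D').obj_cont (o p.1, o' p.2)).continuousAt.comp
          ((GB.lim D o V hid).tensor (GB.lim D' o' W hid)).vb.contFst.continuousAt,
          ((GB.lim_iff D' o' W hid).1 ha).2 p.2⟩)⟩
  · exact (injective_iff_map_eq_zero _).2 fun x hx => GB.lim_tensor_inj D o V D' o' W hid z x fun i i' =>
      congrFun (congrArg Subtype.val hx) (i, i')
  · obtain ⟨x, hx⟩ := GB.lim_tensor_surj D o V D' o' W hid z (fun i i' => v.1 (i, i'))
      fun i₁ i₂ j₁ j₂ α β => v.2 (i₁, j₁) (i₂, j₂) (α, β)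
    exact ⟨x, Subtype.ext (funext fun p => hx p.1 p.2)⟩
  · exact LinearMap.congr_fun (f := TensorProduct.map (GB.limEv D o V hid p.1 z')
      (GB.limEv D' o' W hid p.2 z') ∘ₗ TensorProduct.map ((GB.lim D o V hid).act f)
      ((GB.lim D' o' W hid).act f)) (g := TensorProduct.map (V.act (D.map (𝟙 (o p.1)) f))
      (W.act (D'.map (𝟙 (o' p.2)) f)) ∘ₗ TensorProduct.map (GB.limEv D o V hid p.1 z)
      (GB.limEv D' o' W hid p.2 z)) (TensorProduct.ext' fun a b => rfl) v

end LimOps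

section InvStar

variable {Z : Type u} [Groupoid.{u} Z] [TopologicalSpace Z] [ArrTop Z]
  {Y : Type u} [Groupoid.{u} Y] [TopologicalSpace Y] [ArrTop Y] {K : Type} [Groupoid.{0} K] [Sized K]
  {ξ : Cen Z} {υ : Cen Y} (D : Diag Z Y K) (hD : D.Compat ξ υ)
  (hid : Continuous fun z : Z => arr (𝟙 z)) (hY : Continuous fun y : Y => arr (𝟙 y))

/-- The sum runs over the sizes of the two parts of a family: between pairs of families with different
sizes there are no arrows, and for fixed sizes the limit of a tensor product is a tensor product. -/
theorem Series.inv_push_ext {i j m : ℕ} (e : Fin i ⊕ Fin j ≃ Fin m) (n : ℕ)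
    (V : Series (υ.symN i)) (W : Series (υ.symN j)) :
    (Series.inv D hD hid n m (Series.push (SymN.cover e hY) (SymN.cover_compat e hY υ)
      (Series.ext V W))).cls = ∑ q ∈ Finset.HasAntidiagonal.antidiagonal n,
        (Series.inv D hD hid q.1 i V).cls * (Series.inv D hD hid q.2 j W).cls := by
  have h1 := Series.cls_piFin fun q : {q : ℕ × ℕ // q ∈ Finset.HasAntidiagonal.antidiagonal n} =>
    (Series.inv D hD hid q.1.1 i V).tensor (Series.inv D hD hid q.1.2 j W)
  simp only [← Series.cls_mul] at h1
  rw [Finset.sum_coe_sort (Finset.HasAntidiagonal.antidiagonal n) fun q =>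
    (Series.inv D hD hid q.1 i V).cls * (Series.inv D hD hid q.2 j W).cls] at h1
  rw [← h1]
  refine Series.cls_eq fun a => (GB.lim_push D hid hY e _).symm.trans ?_
  refine (GB.lim_sigma ((D.symN i).prod (D.symN j)) hid
    (J := fun q : {q : ℕ × ℕ // q ∈ Finset.HasAntidiagonal.antidiagonal n} =>
      Ix K q.1.1 i × Ix K q.1.2 j) (fun q s => (s.1.fam, s.2.fam)) ?_ _).trans
    (GB.pi_congr _ _ fun q => ?_)
  · intro p q s t α
    exact Subtype.ext (Prod.ext (s.1.2.symm.trans ((SymN.size_eq α.1).trans t.1.2))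
      (s.2.2.symm.trans ((SymN.size_eq α.2).trans t.2.2)))
  · have h2 := fun p : {p : ℚ≥0 × ℚ≥0 // p.1 + p.2 = a} => GB.lim_tensor (D.symN i)
      (Ix.fam (K := K) (n := q.1.1)) (D.symN j) (Ix.fam (K := K) (n := q.1.2)) hid
      (V.coef p.1.1) (W.coef p.1.2)
    have h3 := Series.tensor_locFin (Series.inv D hD hid q.1.1 i V) (Series.inv D hD hid q.1.2 j W) a
    have h4 := GB.LocFin.congr (W := fun p : {p : ℚ≥0 × ℚ≥0 // p.1 + p.2 = a} =>
      GB.lim ((D.symN i).prod (D.symN j)) (fun s : Ix K q.1.1 i × Ix K q.1.2 j => (s.1.fam, s.2.fam))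
        (((V.coef p.1.1).pull (GProd.fst _ _)).tensor ((W.coef p.1.2).pull (GProd.snd _ _))) hid) h3 h2
    exact (GB.lim_pi ((D.symN i).prod (D.symN j)) _ hid (Series.tensor_locFin
      (V.pull (GProd.fst (SymN i Y) (SymN j Y)) fun _ => rfl)
      (W.pull (GProd.snd (SymN i Y) (SymN j Y)) fun _ => rfl) a) h4).trans (GB.pi_congr _ _ fun p => (h2 p).symm)

/-- The invariant sections over the families in `K` of `m` objects and of size `n`, as a homomorphism
of Grothendieck groups. -/
def Krot.inv (n m : ℕ) : Krot (υ.symN m) →+ Krot ξ :=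
  (Series.lim_addOp (D.symN m) (Ix.fam (K := K) (n := n)) hid (hD.symN m)).hom

theorem Krot.inv_cls (n m : ℕ) (V : Series (υ.symN m)) :
    Krot.inv D hD hid n m V.cls = (Series.inv D hD hid n m V).cls := AddOp.hom_cls _ _

/-- Invariant sections turn the product `•` into the product of formal power series. -/
theorem Krot.inv_star {i j m : ℕ} (e : Fin i ⊕ Fin j ≃ Fin m) (n : ℕ) (x : Krot (υ.symN i))
    (y : Krot (υ.symN j)) : Krot.inv D hD hid n m (Krot.star hY e x y) =
      ∑ q ∈ Finset.HasAntidiagonal.antidiagonal n,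
        Krot.inv D hD hid q.1 i x * Krot.inv D hD hid q.2 j y := by
  obtain ⟨p, rfl⟩ := x.exists_rep
  obtain ⟨p', rfl⟩ := y.exists_rep
  have h : ∀ x y, Krot.star (ξ := υ) hY e x y = (Series.push_addOp (SymN.cover e hY)
      (SymN.cover_compat e hY υ)).hom (Series.ext_biAddOp.hom x y) := fun x y => by
    rw [← BiAddOp.map_eq, ← AddOp.map_eq]; rfl
  simp only [h, map_sub, AddMonoidHom.sub_apply, BiAddOp.hom_cls, AddOp.hom_cls, Krot.inv_cls,
    Series.inv_push_ext D hD hid hY e, sub_mul, mul_sub, Finset.sum_sub_distrib]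

end InvStar

/-! ### Tensor powers of direct sums -/

section SplitTensor

variable {m i j : ℕ} {A B : Fin m → Type*} [∀ k, AddCommGroup (A k)] [∀ k, Module ℂ (A k)]
  [∀ k, AddCommGroup (B k)] [∀ k, Module ℂ (B k)]

/-- The image of the first summand. -/
def side (ρ : Fin i ⊕ Fin j ≃ Fin m) : Finset (Fin m) :=
  Finset.univ.filter fun k => (ρ.symm k).isLeft = true

theorem mem_side {ρ : Fin i ⊕ Fin j ≃ Fin m} (p : Fin i ⊕ Fin j) : ρ p ∈ side ρ ↔ p.isLeft = true := by
  simp [side]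

theorem card_side (ρ : Fin i ⊕ Fin j ≃ Fin m) : (side ρ).card = i := by
  have h : side ρ = Finset.univ.image fun a => ρ (.inl a) := by
    ext k
    obtain ⟨p, rfl⟩ := ρ.surjective k
    rw [mem_side]
    rcases p with p | p <;> simp
  rw [h, Finset.card_image_of_injective _ fun a b h => by simpa using h]
  simp

/-- Every subset of the index set comes from a decomposition into two parts. -/
theorem exists_side (m : ℕ) : ∃ (Q : Finset (Fin m) → {q : ℕ × ℕ // q ∈ Finset.HasAntidiagonal.antidiagonal m})
    (R : ∀ S, Fin (Q S).1.1 ⊕ Fin (Q S).1.2 ≃ Fin m), ∀ S, side (R S) = S := by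
  have h : ∀ S : Finset (Fin m), ∃ (q : {q : ℕ × ℕ // q ∈ Finset.HasAntidiagonal.antidiagonal m})
      (ρ : Fin q.1.1 ⊕ Fin q.1.2 ≃ Fin m), side ρ = S := fun S => by
    have hc : S.card + (m - S.card) = m := by
      have := S.card_le_univ
      simp at this
      omega
    have h1 : Fintype.card {k // k ∈ S} = S.card := by simp
    have h2 : Fintype.card {k // k ∉ S} = m - S.card := by
      rw [Fintype.card_subtype_compl]; simp
    refine ⟨⟨(S.card, m - S.card), Finset.HasAntidiagonal.mem_antidiagonal.2 hc⟩,
      ((Fintype.equivFinOfCardEq h1).symm.sumCongr (Fintype.equivFinOfCardEq h2).symm).trans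
        (Equiv.sumCompl (· ∈ S)), ?_⟩
    ext k
    obtain ⟨p, rfl⟩ := (((Fintype.equivFinOfCardEq h1).symm.sumCongr
      (Fintype.equivFinOfCardEq h2).symm).trans (Equiv.sumCompl (· ∈ S))).surjective k
    rw [mem_side]
    rcases p with p | p
    · simp
    · simpa using ((Fintype.equivFinOfCardEq h2).symm p).2
  choose Q R hR using h
  exact ⟨Q, R, hR⟩

/-- Decompositions with the same first part differ by permutations of the two parts. -/
theorem exists_smul_of_side {ρ ρ' : Fin i ⊕ Fin j ≃ Fin m} (h : side ρ = side ρ') :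
    ∃ γ : Equiv.Perm (Fin i) × Equiv.Perm (Fin j), (Equiv.sumCongr γ.1 γ.2).symm.trans ρ = ρ' := by
  have h1 : ρ.trans ρ'.symm ∈ (Equiv.Perm.sumCongrHom (Fin i) (Fin j)).range := by
    refine Equiv.Perm.mem_sumCongrHom_range_of_perm_mapsTo_inl ?_
    rintro _ ⟨a, rfl⟩
    have h2 : ρ (.inl a) ∈ side ρ := (mem_side _).2 rfl
    rw [h, ← ρ'.apply_symm_apply (ρ (.inl a)), mem_side] at h2
    obtain ⟨b, hb⟩ := Sum.isLeft_iff.1 h2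
    exact ⟨b, hb.symm⟩
  obtain ⟨γ, hγ⟩ := h1
  refine ⟨γ, Equiv.ext fun p => ?_⟩
  have h2 := congrArg (fun σ : Equiv.Perm (Fin i ⊕ Fin j) => ρ' (σ ((Equiv.sumCongr γ.1 γ.2).symm p))) hγ
  change ρ' ((Equiv.sumCongr γ.1 γ.2) ((Equiv.sumCongr γ.1 γ.2).symm p)) = ρ' (ρ'.symm (ρ _)) at h2
  rw [Equiv.apply_symm_apply, Equiv.apply_symm_apply] at h2
  exact h2.symm

/-- The component of a tensor power of direct sums given by a decomposition of the index set. -/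
def splitMap (A B : Fin m → Type*) [∀ k, AddCommGroup (A k)] [∀ k, Module ℂ (A k)]
    [∀ k, AddCommGroup (B k)] [∀ k, Module ℂ (B k)] (ρ : Fin i ⊕ Fin j ≃ Fin m) :
    (⨂[ℂ] k, (A k × B k)) →ₗ[ℂ] (⨂[ℂ] a, A (ρ (.inl a))) ⊗[ℂ] (⨂[ℂ] b, B (ρ (.inr b))) :=
  TensorProduct.map (PiTensorProduct.map fun a => LinearMap.fst ℂ (A (ρ (.inl a))) (B (ρ (.inl a))))
    (PiTensorProduct.map fun b => LinearMap.snd ℂ (A (ρ (.inr b))) (B (ρ (.inr b)))) ∘ₗ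
  (PiTensorProduct.tmulEquivDep ℂ (fun p => A (ρ p) × B (ρ p))).symm.toLinearMap ∘ₗ
  (PiTensorProduct.reindex ℂ (fun k => A k × B k) ρ.symm).toLinearMap

theorem splitMap_tprod (ρ : Fin i ⊕ Fin j ≃ Fin m) (v : ∀ k, A k × B k) :
    splitMap A B ρ (PiTensorProduct.tprod ℂ v) = (PiTensorProduct.tprod ℂ fun a => (v (ρ (.inl a))).1) ⊗ₜ
      (PiTensorProduct.tprod ℂ fun b => (v (ρ (.inr b))).2) := by
  unfold splitMap
  rw [LinearMap.comp_apply, LinearMap.comp_apply, LinearEquiv.coe_coe, LinearEquiv.coe_coe,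
    PiTensorProduct.reindex_tprod]
  refine (congrArg _ (PiTensorProduct.tmulEquivDep_symm_apply ℂ (fun p => A (ρ p) × B (ρ p))
    (fun p => v (ρ p)))).trans ?_
  rw [TensorProduct.map_tmul, PiTensorProduct.map_tprod, PiTensorProduct.map_tprod]
  rfl

/-- The inclusion of the component of a tensor power of direct sums. -/
def joinMap (A B : Fin m → Type*) [∀ k, AddCommGroup (A k)] [∀ k, Module ℂ (A k)]
    [∀ k, AddCommGroup (B k)] [∀ k, Module ℂ (B k)] (ρ : Fin i ⊕ Fin j ≃ Fin m) :
    (⨂[ℂ] a, A (ρ (.inl a))) ⊗[ℂ] (⨂[ℂ] b, B (ρ (.inr b))) →ₗ[ℂ] (⨂[ℂ] k, (A k × B k)) :=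
  (PiTensorProduct.reindex ℂ (fun k => A k × B k) ρ.symm).symm.toLinearMap ∘ₗ
  (PiTensorProduct.tmulEquivDep ℂ (fun p => A (ρ p) × B (ρ p))).toLinearMap ∘ₗ
  TensorProduct.map (PiTensorProduct.map fun a => LinearMap.inl ℂ (A (ρ (.inl a))) (B (ρ (.inl a))))
    (PiTensorProduct.map fun b => LinearMap.inr ℂ (A (ρ (.inr b))) (B (ρ (.inr b))))

theorem splitMap_joinMap (ρ : Fin i ⊕ Fin j ≃ Fin m) (y) : splitMap A B ρ (joinMap A B ρ y) = y := by
  unfold splitMap joinMap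
  simp only [LinearMap.comp_apply, LinearEquiv.coe_coe, LinearEquiv.apply_symm_apply]
  refine (congrArg _ (LinearEquiv.symm_apply_apply _ _)).trans ?_
  refine (LinearMap.comp_apply _ _ _).symm.trans ?_
  rw [← TensorProduct.map_comp, ← PiTensorProduct.map_comp, ← PiTensorProduct.map_comp]
  simp only [LinearMap.fst_comp_inl, LinearMap.snd_comp_inr, PiTensorProduct.map_id,
    TensorProduct.map_id, LinearMap.id_apply]

/-- The projection to the component given by a subset of the index set. -/
def sideProj (A B : Fin m → Type*) [∀ k, AddCommGroup (A k)] [∀ k, Module ℂ (A k)]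
    [∀ k, AddCommGroup (B k)] [∀ k, Module ℂ (B k)] (S : Finset (Fin m)) :
    (⨂[ℂ] k, (A k × B k)) →ₗ[ℂ] (⨂[ℂ] k, (A k × B k)) :=
  PiTensorProduct.map fun k => if k ∈ S then LinearMap.inl ℂ (A k) (B k) ∘ₗ LinearMap.fst ℂ _ _ else
    LinearMap.inr ℂ (A k) (B k) ∘ₗ LinearMap.snd ℂ _ _

theorem sum_sideProj (x : ⨂[ℂ] k, (A k × B k)) : ∑ S, sideProj A B S x = x := by
  suffices h : ∑ S, sideProj A B S = LinearMap.id by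
    have := LinearMap.congr_fun h x
    rwa [LinearMap.sum_apply] at this
  refine PiTensorProduct.ext (MultilinearMap.ext fun v => ?_)
  simp only [LinearMap.compMultilinearMap_apply, LinearMap.sum_apply, LinearMap.id_apply]
  have h : v = (fun k => (((v k).1, 0) : A k × B k)) + fun k => (0, (v k).2) := by
    funext k; simp
  conv_rhs => rw [h, MultilinearMap.map_add_univ]
  refine Finset.sum_congr rfl fun S _ => ?_
  refine (PiTensorProduct.map_tprod _ _).trans ?_
  congr 1
  funext k
  by_cases hk : k ∈ S <;> simp [hk, Finset.piecewise]

theorem joinMap_splitMap (ρ : Fin i ⊕ Fin j ≃ Fin m) (x) :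
    joinMap A B ρ (splitMap A B ρ x) = sideProj A B (side ρ) x := by
  suffices h : joinMap A B ρ ∘ₗ splitMap A B ρ = sideProj A B (side ρ) from LinearMap.congr_fun h x
  refine PiTensorProduct.ext (MultilinearMap.ext fun v => ?_)
  simp only [LinearMap.compMultilinearMap_apply, LinearMap.comp_apply, splitMap_tprod]
  refine (LinearEquiv.symm_apply_eq _).2 ?_
  rw [sideProj, PiTensorProduct.map_tprod, PiTensorProduct.reindex_tprod, LinearMap.comp_apply,
    TensorProduct.map_tmul, PiTensorProduct.map_tprod, PiTensorProduct.map_tprod]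
  refine (PiTensorProduct.tmulEquivDep_apply ℂ (fun p => A (ρ p) × B (ρ p)) _ _).trans ?_
  congr 1
  funext p
  rcases p with p | p
  · have h : ρ (.inl p) ∈ side ρ := (mem_side _).2 rfl
    change _ = (if ρ (.inl p) ∈ side ρ then LinearMap.inl ℂ (A _) (B _) ∘ₗ LinearMap.fst ℂ _ _ else
      LinearMap.inr ℂ (A _) (B _) ∘ₗ LinearMap.snd ℂ _ _) (v (ρ (.inl p)))
    rw [if_pos h]; rfl
  · have h : ρ (.inr p) ∉ side ρ := fun h => by simpa using (mem_side _).1 h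
    change _ = (if ρ (.inr p) ∈ side ρ then LinearMap.inl ℂ (A _) (B _) ∘ₗ LinearMap.fst ℂ _ _ else
      LinearMap.inr ℂ (A _) (B _) ∘ₗ LinearMap.snd ℂ _ _) (v (ρ (.inr p)))
    rw [if_neg h]; rfl

theorem splitMap_sideProj (ρ : Fin i ⊕ Fin j ≃ Fin m) {S : Finset (Fin m)} (h : side ρ ≠ S) (x) :
    splitMap A B ρ (sideProj A B S x) = 0 := by
  suffices h : splitMap A B ρ ∘ₗ sideProj A B S = 0 from LinearMap.congr_fun h x
  refine PiTensorProduct.ext (MultilinearMap.ext fun v => ?_)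
  simp only [LinearMap.compMultilinearMap_apply, LinearMap.comp_apply, LinearMap.zero_apply]
  rw [sideProj, PiTensorProduct.map_tprod, splitMap_tprod]
  obtain ⟨k, hk⟩ : ∃ k, ¬ (k ∈ side ρ ↔ k ∈ S) := by
    by_contra hc
    push Not at hc
    exact h (Finset.ext hc)
  obtain ⟨p, rfl⟩ := ρ.surjective k
  rw [mem_side] at hk
  rcases p with p | p
  · have hk' : ρ (.inl p) ∉ S := fun h => hk (by simp [h])
    rw [MultilinearMap.map_coord_zero (PiTensorProduct.tprod ℂ) p (by simp [hk']), TensorProduct.zero_tmul]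
  · have hk' : ρ (.inr p) ∈ S := by by_contra h; exact hk (by simp [h])
    rw [MultilinearMap.map_coord_zero (PiTensorProduct.tprod ℂ) p (by simp [hk']), TensorProduct.tmul_zero]

theorem splitMap_joinMap_of_ne {i' j' : ℕ} (ρ : Fin i ⊕ Fin j ≃ Fin m) (ρ' : Fin i' ⊕ Fin j' ≃ Fin m)
    (h : side ρ ≠ side ρ') (y) : splitMap A B ρ (joinMap A B ρ' y) = 0 := by
  rw [← splitMap_joinMap ρ' y, joinMap_splitMap, splitMap_sideProj ρ h]

end SplitTensor

/-! ### Power operations on direct sums -/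

section PowSum

variable {X : Type u} [Groupoid.{u} X] [TopologicalSpace X] [ArrTop X] {ξ : Cen X} {i j m : ℕ}

theorem Series.tr_id (V : Series ξ) {a : ℚ≥0} (x : X) :
    V.tr (rfl : a = a) (𝟙 x) = LinearMap.id := LinearMap.ext fun v => (V.coef a).act_id x v

theorem Series.sum_tr_fst (V W : Series ξ) {a b : ℚ≥0} (h : a = b) {x y : X} (f : x ⟶ y)
    (v : ((V.sum W).coef a).vb.fib x) : ((V.sum W).tr h f v).1 = V.tr h f v.1 := by subst h; rfl

theorem Series.sum_tr_snd (V W : Series ξ) {a b : ℚ≥0} (h : a = b) {x y : X} (f : x ⟶ y)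
    (v : ((V.sum W).coef a).vb.fib x) : ((V.sum W).tr h f v).2 = W.tr h f v.2 := by subst h; rfl

/-- The component of a tensor power of `V ⊕ W` which takes `V` in the first and `W` in the second
part of a family, with a change of the exponents along equalities. -/
def Series.splitFib (V W : Series ξ) (ρ : Fin i ⊕ Fin j ≃ Fin m) (z : Fin m → X) {c : Fin m → ℚ≥0}
    {c₁ : Fin i → ℚ≥0} {c₂ : Fin j → ℚ≥0} (h₁ : ∀ a, c (ρ (.inl a)) = c₁ a)
    (h₂ : ∀ b, c (ρ (.inr b)) = c₂ b) :
    (⨂[ℂ] k, ((V.sum W).coef (c k)).vb.fib (z k)) →ₗ[ℂ]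
      (⨂[ℂ] a, (V.coef (c₁ a)).vb.fib (z (ρ (.inl a)))) ⊗[ℂ]
      (⨂[ℂ] b, (W.coef (c₂ b)).vb.fib (z (ρ (.inr b)))) :=
  TensorProduct.map (PiTensorProduct.map fun a => V.tr (h₁ a) (𝟙 _))
    (PiTensorProduct.map fun b => W.tr (h₂ b) (𝟙 _)) ∘ₗ
  splitMap (fun k => (V.coef (c k)).vb.fib (z k)) (fun k => (W.coef (c k)).vb.fib (z k)) ρ

theorem Series.splitFib_tprod (V W : Series ξ) (ρ : Fin i ⊕ Fin j ≃ Fin m) (z : Fin m → X)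
    {c : Fin m → ℚ≥0} {c₁ : Fin i → ℚ≥0} {c₂ : Fin j → ℚ≥0} (h₁ : ∀ a, c (ρ (.inl a)) = c₁ a)
    (h₂ : ∀ b, c (ρ (.inr b)) = c₂ b) (v : ∀ k, ((V.sum W).coef (c k)).vb.fib (z k)) :
    V.splitFib W ρ z h₁ h₂ (PiTensorProduct.tprod ℂ v) =
      (PiTensorProduct.tprod ℂ fun a => V.tr (h₁ a) (𝟙 _) (v (ρ (.inl a))).1) ⊗ₜ
      (PiTensorProduct.tprod ℂ fun b => W.tr (h₂ b) (𝟙 _) (v (ρ (.inr b))).2) := by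
  refine (congrArg (TensorProduct.map _ _) (splitMap_tprod ρ v)).trans ?_
  rw [TensorProduct.map_tmul, PiTensorProduct.map_tprod, PiTensorProduct.map_tprod]

theorem Series.splitFib_rfl (V W : Series ξ) (ρ : Fin i ⊕ Fin j ≃ Fin m) (z : Fin m → X)
    {c : Fin m → ℚ≥0} : V.splitFib W ρ z (c := c) (fun _ => rfl) (fun _ => rfl) =
      splitMap (fun k => (V.coef (c k)).vb.fib (z k)) (fun k => (W.coef (c k)).vb.fib (z k)) ρ := by
  unfold Series.splitFib
  simp only [Series.tr_id, PiTensorProduct.map_id, TensorProduct.map_id]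
  exact LinearMap.id_comp _

/-- The components of a tensor power of `V ⊕ W` are compatible with an arrow `A` of families which
restricts to arrows `β` and `β'` of the two parts. -/
theorem Series.splitFib_perm (V W : Series ξ) {z z' : Fin m → X} (A : FamHom z z')
    {ρ ρ' : Fin i ⊕ Fin j ≃ Fin m} (β : FamHom (fun a => z (ρ (.inl a))) fun a => z' (ρ' (.inl a)))
    (β' : FamHom (fun a => z (ρ (.inr a))) fun a => z' (ρ' (.inr a)))
    (hp : ∀ a, A.perm (ρ (.inl a)) = ρ' (.inl (β.perm a)))
    (hp' : ∀ a, A.perm (ρ (.inr a)) = ρ' (.inr (β'.perm a)))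
    (hβ : ∀ a b h h', A.hom (ρ (.inl a)) (ρ' (.inl b)) h' = β.hom a b h)
    (hβ' : ∀ a b h h', A.hom (ρ (.inr a)) (ρ' (.inr b)) h' = β'.hom a b h)
    {c c' : Fin m → ℚ≥0} {c₁ c₁' : Fin i → ℚ≥0} {c₂ c₂' : Fin j → ℚ≥0}
    (h₁ : ∀ a, c (ρ (.inl a)) = c₁ a) (h₂ : ∀ b, c (ρ (.inr b)) = c₂ b)
    (h₁' : ∀ a, c' (ρ' (.inl a)) = c₁' a) (h₂' : ∀ b, c' (ρ' (.inr b)) = c₂' b) (k₁ k₂ k)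
    (x : ⨂[ℂ] k, ((V.sum W).coef (c k)).vb.fib (z k)) :
    TensorProduct.map (V.perm β c₁ c₁' k₁) (W.perm β' c₂ c₂' k₂) (V.splitFib W ρ z h₁ h₂ x) =
      V.splitFib W ρ' z' h₁' h₂' ((V.sum W).perm A c c' k x) := by
  suffices h : TensorProduct.map (V.perm β c₁ c₁' k₁) (W.perm β' c₂ c₂' k₂) ∘ₗ V.splitFib W ρ z h₁ h₂ =
      V.splitFib W ρ' z' h₁' h₂' ∘ₗ (V.sum W).perm A c c' k from LinearMap.congr_fun h x
  refine PiTensorProduct.ext (MultilinearMap.ext fun v => ?_)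
  simp only [LinearMap.compMultilinearMap_apply, LinearMap.comp_apply, Series.splitFib_tprod,
    Series.perm_tprod, TensorProduct.map_tmul]
  congr 2
  · funext b
    obtain ⟨a, rfl⟩ := β.perm.surjective b
    have key : ∀ l (hl : A.perm l = ρ' (.inl (β.perm a))) q (hq : β.perm q = β.perm a),
        V.tr (k₁ q _ hq) (β.hom q _ hq) (V.tr (h₁ q) (𝟙 _) (v (ρ (.inl q))).1) =
        V.tr (h₁' (β.perm a)) (𝟙 _) ((V.sum W).tr (k l _ hl) (A.hom l _ hl) (v l)).1 := by
      intro l hl q hq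
      obtain rfl := β.perm.injective hq
      obtain rfl : ρ (.inl q) = l := A.perm.injective ((hp q).trans hl.symm)
      rw [Series.sum_tr_fst, ← Series.tr_comp, ← Series.tr_comp, hβ q _ rfl hl, Category.comp_id,
        Category.id_comp]
    exact key _ _ _ _
  · funext b
    obtain ⟨a, rfl⟩ := β'.perm.surjective b
    have key : ∀ l (hl : A.perm l = ρ' (.inr (β'.perm a))) q (hq : β'.perm q = β'.perm a),
        W.tr (k₂ q _ hq) (β'.hom q _ hq) (W.tr (h₂ q) (𝟙 _) (v (ρ (.inr q))).2) =
        W.tr (h₂' (β'.perm a)) (𝟙 _) ((V.sum W).tr (k l _ hl) (A.hom l _ hl) (v l)).2 := by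
      intro l hl q hq
      obtain rfl := β'.perm.injective hq
      obtain rfl : ρ (.inr q) = l := A.perm.injective ((hp' q).trans hl.symm)
      rw [Series.sum_tr_snd, ← Series.tr_comp, ← Series.tr_comp, hβ' q _ rfl hl, Category.comp_id,
        Category.id_comp]
    exact key _ _ _ _

variable (V W : Series ξ) {a : ℚ≥0} (p : {p : ℚ≥0 × ℚ≥0 // p.1 + p.2 = a})
  (c₁ c₁' : {c : Fin i → ℚ≥0 // ∑ k, c k = p.1.1}) (c₂ c₂' : {c : Fin j → ℚ≥0 // ∑ k, c k = p.1.2})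

/-- The bundle of tensor products with given exponents. -/
def Series.pairVB (c₁ : Fin i → ℚ≥0) (c₂ : Fin j → ℚ≥0) : VB (GProd (SymN i X) (SymN j X)) :=
  ((V.powVB c₁).pull (GProd.fst _ _).obj (GProd.fst _ _).obj_cont).tensor
    ((W.powVB c₂).pull (GProd.snd _ _).obj (GProd.snd _ _).obj_cont)

/-- The component with given exponents of the external product of two powers. -/
def Series.extEv (y : GProd (SymN i X) (SymN j X)) :
    (((V.pow i).ext (W.pow j)).coef a).vb.fib y →ₗ[ℂ] (V.pairVB W c₁.1 c₂.1).fib y :=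
  TensorProduct.map (LinearMap.proj (φ := fun c : {c : Fin i → ℚ≥0 // ∑ k, c k = p.1.1} =>
      (V.powVB c.1).fib y.1) c₁) (LinearMap.proj
      (φ := fun c : {c : Fin j → ℚ≥0 // ∑ k, c k = p.1.2} => (W.powVB c.1).fib y.2) c₂) ∘ₗ
    LinearMap.proj (φ := fun p : {p : ℚ≥0 × ℚ≥0 // p.1 + p.2 = a} =>
      ((V.pow i).coef p.1.1).vb.fib y.1 ⊗[ℂ] ((W.pow j).coef p.1.2).vb.fib y.2) p

theorem Series.extEv_act {y y' : GProd (SymN i X) (SymN j X)} (β : y ⟶ y')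
    (h₁ : ∀ k l, β.1.perm k = l → c₁.1 k = c₁'.1 l) (h₂ : ∀ k l, β.2.perm k = l → c₂.1 k = c₂'.1 l)
    (u : (((V.pow i).ext (W.pow j)).coef a).vb.fib y) :
    V.extEv W p c₁' c₂' y' ((((V.pow i).ext (W.pow j)).coef a).act β u) =
      TensorProduct.map (V.perm β.1 c₁.1 c₁'.1 h₁) (W.perm β.2 c₂.1 c₂'.1 h₂) (V.extEv W p c₁ c₂ y u) := by
  obtain rfl : c₁ = ⟨fun k => c₁'.1 (β.1.perm k), (Equiv.sum_comp β.1.perm c₁'.1).trans c₁'.2⟩ :=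
    Subtype.ext (funext fun k => h₁ k _ rfl)
  obtain rfl : c₂ = ⟨fun k => c₂'.1 (β.2.perm k), (Equiv.sum_comp β.2.perm c₂'.1).trans c₂'.2⟩ :=
    Subtype.ext (funext fun k => h₂ k _ rfl)
  exact LinearMap.congr_fun (f := TensorProduct.map (LinearMap.proj (φ := fun c : {c : Fin i → ℚ≥0 // ∑ k, c k = p.1.1} =>
      (V.powVB c.1).fib y'.1) c₁') (LinearMap.proj
      (φ := fun c : {c : Fin j → ℚ≥0 // ∑ k, c k = p.1.2} => (W.powVB c.1).fib y'.2) c₂') ∘ₗ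
      TensorProduct.map (((V.pow i).coef p.1.1).act β.1) (((W.pow j).coef p.1.2).act β.2))
    (g := TensorProduct.map (V.perm β.1 _ c₁'.1 h₁) (W.perm β.2 _ c₂'.1 h₂) ∘ₗ
      TensorProduct.map (LinearMap.proj (φ := fun c : {c : Fin i → ℚ≥0 // ∑ k, c k = p.1.1} =>
      (V.powVB c.1).fib y.1) _) (LinearMap.proj
      (φ := fun c : {c : Fin j → ℚ≥0 // ∑ k, c k = p.1.2} => (W.powVB c.1).fib y.2) _))
    (TensorProduct.ext' fun _ _ => rfl) (u p)

/-- An element of the external product of two powers is given by arbitrary components. -/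
theorem Series.extEv_exists (y : GProd (SymN i X) (SymN j X))
    (u : ∀ (p : {p : ℚ≥0 × ℚ≥0 // p.1 + p.2 = a}) (c₁ : {c : Fin i → ℚ≥0 // ∑ k, c k = p.1.1})
      (c₂ : {c : Fin j → ℚ≥0 // ∑ k, c k = p.1.2}), (V.pairVB W c₁.1 c₂.1).fib y) :
    ∃! w : (((V.pow i).ext (W.pow j)).coef a).vb.fib y, ∀ p c₁ c₂, V.extEv W p c₁ c₂ y w = u p c₁ c₂ := by
  have h : ∀ p : {p : ℚ≥0 × ℚ≥0 // p.1 + p.2 = a}, ∃! w : ((V.pow i).coef p.1.1).vb.fib y.1 ⊗[ℂ] ((W.pow j).coef p.1.2).vb.fib y.2,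
      ∀ c₁ c₂, TensorProduct.map (LinearMap.proj (φ := fun c : {c : Fin i → ℚ≥0 // ∑ k, c k = p.1.1} =>
      (V.powVB c.1).fib y.1) c₁) (LinearMap.proj
      (φ := fun c : {c : Fin j → ℚ≥0 // ∑ k, c k = p.1.2} => (W.powVB c.1).fib y.2) c₂) w = u p c₁ c₂ := fun p => by
    have : FiniteDimensional ℂ (∀ c : {c : Fin j → ℚ≥0 // ∑ k, c k = p.1.2}, (W.powVB c.1).fib y.2) :=
      VB.finiteDimensional ((W.pow j).coef p.1.2).vb y.2
    exact exists_tensor_of_components (V := fun c : {c : Fin i → ℚ≥0 // ∑ k, c k = p.1.1} =>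
      (V.powVB c.1).fib y.1) (W := fun c : {c : Fin j → ℚ≥0 // ∑ k, c k = p.1.2} => (W.powVB c.1).fib y.2) (u p)
  choose w hw hu using h
  exact ⟨w, hw, fun w' hw' => funext fun p => hu p _ (hw' p)⟩

theorem Series.extEv_cont : Continuous fun q : (((V.pow i).ext (W.pow j)).coef a).vb.Tot =>
    (V.pairVB W c₁.1 c₂.1).pt q.1 (V.extEv W p c₁ c₂ q.1 q.2) := by
  rw [continuous_iff_continuousAt]
  intro q
  have hq := (VB.pi_iff _ (Series.tensor_locFin _ _ a)).1
    (continuousAt_id (X := (((V.pow i).ext (W.pow j)).coef a).vb.Tot) (x := q))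
  exact VB.tensorMap_contAt _ _ ((V.powVB c₁.1).pull (GProd.fst _ _).obj (GProd.fst _ _).obj_cont)
    ((W.powVB c₂.1).pull (GProd.snd _ _).obj (GProd.snd _ _).obj_cont) hq.1 (hq.2 p) _ _
    (fun b hb => (VB.pull_iff _ _ _).2 ⟨hq.1, ((VB.pi_iff _ (V.powVB_finite _)).1
      ((VB.pull_iff _ (GProd.fst (SymN i X) (SymN j X)).obj (GProd.fst _ _).obj_cont).1 hb).2).2 c₁⟩)
    (fun b hb => (VB.pull_iff _ _ _).2 ⟨hq.1, ((VB.pi_iff _ (W.powVB_finite _)).1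
      ((VB.pull_iff _ (GProd.snd (SymN i X) (SymN j X)).obj (GProd.snd _ _).obj_cont).1 hb).2).2 c₂⟩)

end PowSum

section PowSum

variable {X : Type u} [Groupoid.{u} X] [TopologicalSpace X] [ArrTop X] {ξ : Cen X} {i j m : ℕ}
  (V W : Series ξ) {a : ℚ≥0} (ρ : Fin i ⊕ Fin j ≃ Fin m) (p : {p : ℚ≥0 × ℚ≥0 // p.1 + p.2 = a})
  (c₁ c₁' : {c : Fin i → ℚ≥0 // ∑ k, c k = p.1.1}) (c₂ c₂' : {c : Fin j → ℚ≥0 // ∑ k, c k = p.1.2})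

theorem Series.tr_id_cont {a b : ℚ≥0} (h : a = b) {T : Type*} [TopologicalSpace T] {t : T} {x : T → X}
    {v : ∀ s, (V.coef a).vb.fib (x s)} (hv : ContinuousAt (fun s => (V.coef a).vb.pt (x s) (v s)) t) :
    ContinuousAt (fun s => (V.coef b).vb.pt (x s) (V.tr h (𝟙 (x s)) (v s))) t := by
  subst h
  exact hv.congr (.of_forall fun s => congrArg _ ((V.coef a).act_id _ _).symm)

/-- The exponents of a family composed from the exponents of its parts. -/
def joinExp : {c : Fin m → ℚ≥0 // ∑ k, c k = a} :=
  ⟨fun k => Sum.elim c₁.1 c₂.1 (ρ.symm k), by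
    rw [← Equiv.sum_comp ρ, Fintype.sum_sum_type]
    simp [c₁.2, c₂.2, p.2]⟩

theorem joinExp_left (k : Fin i) : (joinExp ρ p c₁ c₂).1 (ρ (.inl k)) = c₁.1 k := by simp [joinExp]

theorem joinExp_right (k : Fin j) : (joinExp ρ p c₁ c₂).1 (ρ (.inr k)) = c₂.1 k := by simp [joinExp]

/-- The component of a power of `V ⊕ W` given by a decomposition of the index set and exponents. -/
def Series.sumEv (z : SymN m X) : (((V.sum W).pow m).coef a).vb.fib z →ₗ[ℂ]
    (V.pairVB W c₁.1 c₂.1).fib (SymN.split ρ z) :=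
  V.splitFib W ρ z (joinExp_left ρ p c₁ c₂) (joinExp_right ρ p c₁ c₂) ∘ₗ
    LinearMap.proj (φ := fun c : {c : Fin m → ℚ≥0 // ∑ k, c k = a} => ((V.sum W).powVB c.1).fib z)
      (joinExp ρ p c₁ c₂)

/-- The exponents of the component can be prescribed on the index set instead of on its parts. -/
theorem Series.sumEv_eq (z : SymN m X) (x : (((V.sum W).pow m).coef a).vb.fib z)
    (c : {c : Fin m → ℚ≥0 // ∑ k, c k = a}) (h₁ : ∀ k, c.1 (ρ (.inl k)) = c₁.1 k)
    (h₂ : ∀ k, c.1 (ρ (.inr k)) = c₂.1 k) :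
    V.sumEv W ρ p c₁ c₂ z x = V.splitFib W ρ z h₁ h₂ (x c) := by
  obtain rfl : c = joinExp ρ p c₁ c₂ := Subtype.ext (funext fun k => by
    obtain ⟨q, rfl⟩ := ρ.surjective k
    rcases q with q | q
    · rw [h₁, joinExp_left]
    · rw [h₂, joinExp_right])
  rfl

/-- The components for two decompositions with the same parts correspond under the permutations of the
parts. -/
theorem Series.sumEv_move (hid : Continuous fun x : X => arr (𝟙 x)) (e : Fin i ⊕ Fin j ≃ Fin m)
    {ρ ρ' : Fin i ⊕ Fin j ≃ Fin m} (γ : Equiv.Perm (Fin i) × Equiv.Perm (Fin j))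
    (h : (Equiv.sumCongr γ.1 γ.2).symm.trans ρ = ρ') (z : SymN m X)
    (x : (((V.sum W).pow m).coef a).vb.fib z) (h₁ : ∀ k l, γ.1 k = l → c₁.1 k = c₁'.1 l)
    (h₂ : ∀ k l, γ.2 k = l → c₂.1 k = c₂'.1 l) :
    TensorProduct.map (V.perm ((SymN.cover e hid).move γ ρ ρ' h z).1 c₁.1 c₁'.1 h₁)
      (W.perm ((SymN.cover e hid).move γ ρ ρ' h z).2 c₂.1 c₂'.1 h₂) (V.sumEv W ρ p c₁ c₂ z x) =
      V.sumEv W ρ' p c₁' c₂' z x := by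
  let c := joinExp ρ' p c₁' c₂'
  have h3 : ∀ k, c.1 (ρ (.inl k)) = c₁.1 k := fun k => by
    rw [SymN.split_left γ h, joinExp_left]; exact (h₁ k _ rfl).symm
  have h4 : ∀ k, c.1 (ρ (.inr k)) = c₂.1 k := fun k => by
    rw [SymN.split_right γ h, joinExp_right]; exact (h₂ k _ rfl).symm
  rw [V.sumEv_eq W ρ p c₁ c₂ z x c h3 h4]
  have hc : ∀ i j, (FamHom.id z).perm i = j → c.1 i = c.1 j := fun i j h => congrArg c.1 h
  refine (V.splitFib_perm W (FamHom.id z) (ρ := ρ) (ρ' := ρ')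
    ((SymN.cover e hid).move γ ρ ρ' h z).1 ((SymN.cover e hid).move γ ρ ρ' h z).2
    (fun k => SymN.split_left γ h k) (fun k => SymN.split_right γ h k)
    (fun _ _ _ _ => rfl) (fun _ _ _ _ => rfl) h3 h4 (joinExp_left ρ' p c₁' c₂')
    (joinExp_right ρ' p c₁' c₂') h₁ h₂ hc (x c)).trans ?_
  exact congrArg (V.splitFib W ρ' z (joinExp_left ρ' p c₁' c₂') (joinExp_right ρ' p c₁' c₂'))
    ((V.sum W).perm_id (z := z) c.1 hc (x c))

/-- The action of an arrow of families on a power of `V ⊕ W` permutes the components. -/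
theorem Series.sumEv_act (hid : Continuous fun x : X => arr (𝟙 x)) (e : Fin i ⊕ Fin j ≃ Fin m)
    {ρ ρ' : Fin i ⊕ Fin j ≃ Fin m} {z z' : SymN m X} (A : z ⟶ z') (h : ρ'.trans A.perm.symm = ρ)
    (x : (((V.sum W).pow m).coef a).vb.fib z) :
    TensorProduct.map (V.perm ((SymN.cover e hid).lift A ρ ρ' h).1 c₁.1 c₁.1 fun _ _ h => congrArg c₁.1 h)
      (W.perm ((SymN.cover e hid).lift A ρ ρ' h).2 c₂.1 c₂.1 fun _ _ h => congrArg c₂.1 h)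
      (V.sumEv W ρ p c₁ c₂ z x) =
      V.sumEv W ρ' p c₁ c₂ z' ((((V.sum W).pow m).coef a).act A x) := by
  let c := joinExp ρ' p c₁ c₂
  have hA : ∀ q, A.perm (ρ q) = ρ' q := fun q => by subst h; exact A.perm.apply_symm_apply _
  have h3 : ∀ k, c.1 (A.perm (ρ (.inl k))) = c₁.1 k := fun k => by
    rw [hA]; exact joinExp_left ρ' p c₁ c₂ k
  have h4 : ∀ k, c.1 (A.perm (ρ (.inr k))) = c₂.1 k := fun k => by
    rw [hA]; exact joinExp_right ρ' p c₁ c₂ k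
  rw [V.sumEv_eq W ρ p c₁ c₂ z x ⟨fun k => c.1 (A.perm k), (Equiv.sum_comp A.perm c.1).trans c.2⟩ h3 h4]
  exact V.splitFib_perm W A (ρ := ρ) (ρ' := ρ')
    ((SymN.cover e hid).lift A ρ ρ' h).1 ((SymN.cover e hid).lift A ρ ρ' h).2
    (fun k => hA _) (fun k => hA _) (fun _ _ h _ => by cases h; rfl) (fun _ _ h _ => by cases h; rfl)
    h3 h4 (joinExp_left ρ' p c₁ c₂)
    (joinExp_right ρ' p c₁ c₂) (fun _ _ h => congrArg c₁.1 h) (fun _ _ h => congrArg c₂.1 h)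
    (fun i j h => congrArg c.1 h) (x ⟨fun k => c.1 (A.perm k), _⟩)

theorem Series.sumEv_cont : Continuous fun q : (((V.sum W).pow m).coef a).vb.Tot =>
    (V.pairVB W c₁.1 c₂.1).pt (SymN.split ρ q.1) (V.sumEv W ρ p c₁ c₂ q.1 q.2) := by
  rw [continuous_iff_continuousAt]
  intro q
  have hq := (VB.pi_iff _ ((V.sum W).powVB_finite a)).1
    (continuousAt_id (X := (((V.sum W).pow m).coef a).vb.Tot) (x := q))
  have hs : ContinuousAt (fun q : (((V.sum W).pow m).coef a).vb.Tot =>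
      (SymN.split ρ q.1 : GProd (SymN i X) (SymN j X))) q :=
    ((continuous_pi fun a => continuous_apply (ρ (.inl a))).prodMk
      (continuous_pi fun b => continuous_apply (ρ (.inr b)))).continuousAt.comp hq.1
  refine VB.piTensor_contAt _ (hq.2 (joinExp ρ p c₁ c₂)) (V.pairVB W c₁.1 c₂.1) hs
    (fun s => V.splitFib W ρ s.1 (joinExp_left ρ p c₁ c₂) (joinExp_right ρ p c₁ c₂)) fun v hv => ?_
  have hv' := fun k => (VB.prod_iff _ _).1
    ((VB.pull_iff _ (fun z : SymN m X => z k) (SymN.continuous_eval k)).1 (hv k)).2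
  have hid' : ∀ k, ContinuousAt (fun q : (((V.sum W).pow m).coef a).vb.Tot => q.1 k) q := fun k =>
    (SymN.continuous_eval k).continuousAt.comp hq.1
  have h1 := VB.piTensor_cont (fun a => (V.coef (c₁.1 a)).vb.pull (fun z : SymN i X => z a)
    (SymN.continuous_eval a)) (g := fun s => (SymN.split ρ s.1).1)
    (v := fun (s : (((V.sum W).pow m).coef a).vb.Tot) a => V.tr (joinExp_left ρ p c₁ c₂ a)
      (𝟙 (s.1 (ρ (.inl a)))) (v s (ρ (.inl a))).1) hs.fst fun a => (VB.pull_iff _ _ _).2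
      ⟨hs.fst, V.tr_id_cont _ (hv' _).1⟩
  have h2 := VB.piTensor_cont (fun a => (W.coef (c₂.1 a)).vb.pull (fun z : SymN j X => z a)
    (SymN.continuous_eval a)) (g := fun s => (SymN.split ρ s.1).2)
    (v := fun (s : (((V.sum W).pow m).coef a).vb.Tot) a => W.tr (joinExp_right ρ p c₁ c₂ a)
      (𝟙 (s.1 (ρ (.inr a)))) (v s (ρ (.inr a))).2) hs.snd fun a => (VB.pull_iff _ _ _).2
      ⟨hs.snd, W.tr_id_cont _ (hv' _).2⟩
  exact ContinuousAt.congr (VB.tensor_cont _ _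
    ((VB.pull_iff (V.powVB c₁.1) (GProd.fst (SymN i X) (SymN j X)).obj (GProd.fst _ _).obj_cont).2 ⟨hs, h1⟩)
    ((VB.pull_iff (W.powVB c₂.1) (GProd.snd (SymN i X) (SymN j X)).obj (GProd.snd _ _).obj_cont).2 ⟨hs, h2⟩))
    (.of_forall fun s => congrArg (VB.pt _ _) (V.splitFib_tprod W ρ s.1 _ _ (v s)).symm)

theorem Series.sumEv_side (ρ : Fin i ⊕ Fin j ≃ Fin m) (z : Fin m → X)
    (x : (((V.sum W).pow m).coef a).vb.fib z) (c : {c : Fin m → ℚ≥0 // ∑ k, c k = a})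
    (h₁ : ∑ k, c.1 (ρ (.inl k)) = p.1.1) (h₂ : ∑ k, c.1 (ρ (.inr k)) = p.1.2) :
    V.sumEv W ρ p ⟨fun k => c.1 (ρ (.inl k)), h₁⟩ ⟨fun k => c.1 (ρ (.inr k)), h₂⟩ z x =
      splitMap (fun k => (V.coef (c.1 k)).vb.fib (z k)) (fun k => (W.coef (c.1 k)).vb.fib (z k)) ρ (x c) :=
  (V.sumEv_eq W ρ p _ _ z x c (fun _ => rfl) fun _ => rfl).trans
    (LinearMap.congr_fun (V.splitFib_rfl W ρ z) (x c))

/-- A vector is the sum of its projections to the components given by the subsets of the index set. -/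
theorem Series.sumEv_inj (z : Fin m → X) (x : (((V.sum W).pow m).coef a).vb.fib z)
    (h : ∀ (q : {q : ℕ × ℕ // q ∈ Finset.HasAntidiagonal.antidiagonal m})
      (ρ : Fin q.1.1 ⊕ Fin q.1.2 ≃ Fin m) p c₁ c₂, V.sumEv W ρ p c₁ c₂ z x = 0) (c : {c : Fin m → ℚ≥0 // ∑ k, c k = a}) :
    x c = (0 : ⨂[ℂ] k, ((V.coef (c.1 k)).vb.fib (z k) × (W.coef (c.1 k)).vb.fib (z k))) := by
  obtain ⟨Q, R, hR⟩ := exists_side m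
  refine (sum_sideProj (x c)).symm.trans (Finset.sum_eq_zero fun S _ => ?_)
  have hp : (∑ k, c.1 (R S (.inl k))) + ∑ k, c.1 (R S (.inr k)) = a := by
    rw [← Fintype.sum_sum_type fun k => c.1 (R S k), Equiv.sum_comp]; exact c.2
  have h1 := (V.sumEv_side W ⟨(_, _), hp⟩ (R S) z x c rfl rfl).symm.trans (h (Q S) (R S) _ _ _)
  have h2 := joinMap_splitMap (A := fun k => (V.coef (c.1 k)).vb.fib (z k))
    (B := fun k => (W.coef (c.1 k)).vb.fib (z k)) (R S) (x c)
  rw [hR S] at h2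
  refine h2.symm.trans ?_
  exact (congrArg (joinMap (fun k => (V.coef (c.1 k)).vb.fib (z k))
    (fun k => (W.coef (c.1 k)).vb.fib (z k)) (R S)) h1).trans (map_zero _)

/-- The components for one decomposition per subset of the index set can be prescribed arbitrarily. -/
theorem Series.sumEv_exists (z : Fin m → X) (u : ∀ (q : {q : ℕ × ℕ // q ∈ Finset.HasAntidiagonal.antidiagonal m})
      (ρ : Fin q.1.1 ⊕ Fin q.1.2 ≃ Fin m) (p : {p : ℚ≥0 × ℚ≥0 // p.1 + p.2 = a})
      (c₁ : {c : Fin q.1.1 → ℚ≥0 // ∑ k, c k = p.1.1}) (c₂ : {c : Fin q.1.2 → ℚ≥0 // ∑ k, c k = p.1.2}),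
      (V.pairVB W c₁.1 c₂.1).fib (SymN.split ρ z))
    (Q : Finset (Fin m) → {q : ℕ × ℕ // q ∈ Finset.HasAntidiagonal.antidiagonal m})
    (R : ∀ S, Fin (Q S).1.1 ⊕ Fin (Q S).1.2 ≃ Fin m) (hR : ∀ S, side (R S) = S) :
    ∃ x : (((V.sum W).pow m).coef a).vb.fib z, ∀ S p c₁ c₂,
      V.sumEv W (R S) p c₁ c₂ z x = u (Q S) (R S) p c₁ c₂ := by
  have hp : ∀ (c : {c : Fin m → ℚ≥0 // ∑ k, c k = a}) S,
      (∑ k, c.1 (R S (.inl k))) + ∑ k, c.1 (R S (.inr k)) = a := fun c S => by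
    rw [← Fintype.sum_sum_type fun k => c.1 (R S k), Equiv.sum_comp]; exact c.2
  let D : ∀ (c : {c : Fin m → ℚ≥0 // ∑ k, c k = a}) (S : Finset (Fin m)), _ := fun c S =>
    u (Q S) (R S) ⟨(∑ k, c.1 (R S (.inl k)), ∑ k, c.1 (R S (.inr k))), hp c S⟩
       ⟨fun k => c.1 (R S (.inl k)), rfl⟩ ⟨fun k => c.1 (R S (.inr k)), rfl⟩
  let x' : ∀ c : {c : Fin m → ℚ≥0 // ∑ k, c k = a},
      ⨂[ℂ] k, ((V.coef (c.1 k)).vb.fib (z k) × (W.coef (c.1 k)).vb.fib (z k)) := fun c =>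
    ∑ S, joinMap (fun k => (V.coef (c.1 k)).vb.fib (z k)) (fun k => (W.coef (c.1 k)).vb.fib (z k)) (R S) (D c S)
  let x : (((V.sum W).pow m).coef a).vb.fib z := x'
  have hx : ∀ c S, splitMap (fun k => (V.coef (c.1 k)).vb.fib (z k)) (fun k => (W.coef (c.1 k)).vb.fib (z k))
      (R S) (x' c) = D c S := fun c S =>
    (map_sum _ _ _).trans ((Finset.sum_eq_single S (fun T _ hT =>
      splitMap_joinMap_of_ne _ _ (by rw [hR, hR]; exact hT.symm) _) fun h =>
        (h (Finset.mem_univ _)).elim).trans (splitMap_joinMap _ _))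
  refine ⟨x, ?_⟩
  rintro S ⟨⟨p₁, p₂⟩, hp'⟩ ⟨c₁, h₁⟩ ⟨c₂, h₂⟩
  obtain ⟨c, rfl, rfl⟩ : ∃ c : Fin m → ℚ≥0, c₁ = (fun k => c (R S (.inl k))) ∧
      c₂ = fun k => c (R S (.inr k)) :=
    ⟨fun k => Sum.elim c₁ c₂ ((R S).symm k), by simp, by simp⟩
  change ∑ k, c (R S (.inl k)) = p₁ at h₁
  change ∑ k, c (R S (.inr k)) = p₂ at h₂
  subst h₁ h₂
  have hc : ∑ k, c k = a := by
    rw [← Equiv.sum_comp (R S), Fintype.sum_sum_type]; exact hp'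
  exact (V.sumEv_side W _ (R S) z x ⟨c, hc⟩ rfl rfl).trans (hx ⟨c, hc⟩ S)

/-- The component with given exponents of an external product of powers, transferred along
concatenation. -/
def Series.pushEv (hid : Continuous fun x : X => arr (𝟙 x)) (e ρ : Fin i ⊕ Fin j ≃ Fin m) (z : SymN m X) :
    (GB.push (SymN.cover e hid) (((V.pow i).ext (W.pow j)).coef a)).vb.fib z →ₗ[ℂ]
      (V.pairVB W c₁.1 c₂.1).fib (SymN.split ρ z) :=
  V.extEv W p c₁ c₂ (SymN.split ρ z) ∘ₗ
    LinearMap.proj (φ := fun ρ : Fin i ⊕ Fin j ≃ Fin m => (((V.pow i).ext (W.pow j)).coef a).vb.fib (SymN.split ρ z)) ρ ∘ₗ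
      ((SymN.cover e hid).inv (((V.pow i).ext (W.pow j)).coef a) z).subtype

theorem Series.pushEv_act (hid : Continuous fun x : X => arr (𝟙 x)) (e : Fin i ⊕ Fin j ≃ Fin m)
    {z z' : SymN m X} (A : z ⟶ z') (w : (GB.push (SymN.cover e hid) (((V.pow i).ext (W.pow j)).coef a)).vb.fib z)
    (ρ : Fin i ⊕ Fin j ≃ Fin m) :
    V.pushEv W p c₁ c₂ hid e ρ z' ((GB.push (SymN.cover e hid) (((V.pow i).ext (W.pow j)).coef a)).act A w) =
    TensorProduct.map (V.perm ((SymN.cover e hid).lift A (ρ.trans A.perm.symm) ρ rfl).1 c₁.1 c₁.1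
        fun _ _ h => congrArg c₁.1 h)
      (W.perm ((SymN.cover e hid).lift A (ρ.trans A.perm.symm) ρ rfl).2 c₂.1 c₂.1 fun _ _ h => congrArg c₂.1 h)
      (V.pushEv W p c₁ c₂ hid e (ρ.trans A.perm.symm) z w) :=
  V.extEv_act W p c₁ c₁ c₂ c₂ ((SymN.cover e hid).lift A (ρ.trans A.perm.symm) ρ rfl)
      (fun _ _ h => congrArg c₁.1 h) (fun _ _ h => congrArg c₂.1 h) (w.1 (ρ.trans A.perm.symm))

theorem Series.pushEv_inj (hid : Continuous fun x : X => arr (𝟙 x)) (e : Fin i ⊕ Fin j ≃ Fin m)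
    {z : SymN m X} (w : (GB.push (SymN.cover e hid) (((V.pow i).ext (W.pow j)).coef a)).vb.fib z)
    (h : ∀ ρ p c₁ c₂, V.pushEv W p c₁ c₂ hid e ρ z w = 0) : w = 0 := by
  refine Subtype.ext (funext fun ρ => ?_)
  obtain ⟨y, hy, hu⟩ := V.extEv_exists W (a := a) (SymN.split ρ z) fun p c₁ c₂ => 0
  exact (hu _ fun p c₁ c₂ => h ρ p c₁ c₂).trans (hu _ fun p c₁ c₂ => map_zero _).symm

/-- The invariance of the vectors of a transfer, in components. -/
theorem Series.pushEv_move (hid : Continuous fun x : X => arr (𝟙 x)) (e : Fin i ⊕ Fin j ≃ Fin m)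
    {z : SymN m X} (w : (GB.push (SymN.cover e hid) (((V.pow i).ext (W.pow j)).coef a)).vb.fib z)
    (γ : Equiv.Perm (Fin i) × Equiv.Perm (Fin j)) {ρ ρ' : Fin i ⊕ Fin j ≃ Fin m}
    (h : (Equiv.sumCongr γ.1 γ.2).symm.trans ρ = ρ') (h₁ : ∀ k l, γ.1 k = l → c₁.1 k = c₁'.1 l)
    (h₂ : ∀ k l, γ.2 k = l → c₂.1 k = c₂'.1 l) :
    TensorProduct.map (V.perm ((SymN.cover e hid).move γ ρ ρ' h z).1 c₁.1 c₁'.1 h₁)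
      (W.perm ((SymN.cover e hid).move γ ρ ρ' h z).2 c₂.1 c₂'.1 h₂) (V.pushEv W p c₁ c₂ hid e ρ z w) =
      V.pushEv W p c₁' c₂' hid e ρ' z w :=
  (V.extEv_act W p c₁ c₁' c₂ c₂' ((SymN.cover e hid).move γ ρ ρ' h z) h₁ h₂ (w.1 ρ)).symm.trans
    (congrArg (V.extEv W p c₁' c₂' (SymN.split ρ' z)) (w.2 γ ρ ρ' h))

theorem Series.pushEv_cont (hid : Continuous fun x : X => arr (𝟙 x)) (e ρ : Fin i ⊕ Fin j ≃ Fin m) :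
    Continuous fun q : (GB.push (SymN.cover e hid) (((V.pow i).ext (W.pow j)).coef a)).vb.Tot =>
      (V.pairVB W c₁.1 c₂.1).pt (SymN.split ρ q.1) (V.pushEv W p c₁ c₂ hid e ρ q.1 q.2) := by
  rw [continuous_iff_continuousAt]
  intro t
  exact (V.extEv_cont W p c₁ c₂).continuousAt.comp (((GB.push_iff (SymN.cover e hid) _).1
    (continuousAt_id (X := (GB.push (SymN.cover e hid) _).vb.Tot) (x := t))).2 ρ)

/-- The components of a vector of a power of `V ⊕ W` form a vector of the transfer. -/
theorem Series.pushEv_exists (hid : Continuous fun x : X => arr (𝟙 x)) (e : Fin i ⊕ Fin j ≃ Fin m)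
    (z : SymN m X) (x : (((V.sum W).pow m).coef a).vb.fib z) :
    ∃ w : (GB.push (SymN.cover e hid) (((V.pow i).ext (W.pow j)).coef a)).vb.fib z,
      ∀ ρ p c₁ c₂, V.pushEv W p c₁ c₂ hid e ρ z w = V.sumEv W ρ p c₁ c₂ z x := by
  choose w hw hu using fun ρ : Fin i ⊕ Fin j ≃ Fin m => V.extEv_exists W (a := a) (SymN.split ρ z)
        fun p c₁ c₂ => V.sumEv W ρ p c₁ c₂ z x
  refine ⟨⟨w, fun γ ρ ρ' h => ?_⟩, hw⟩
  refine hu ρ' _ fun p c₁' c₂' => ?_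
  exact (V.extEv_act W p ⟨fun k => c₁'.1 (γ.1 k), (Equiv.sum_comp γ.1 c₁'.1).trans c₁'.2⟩ c₁'
      ⟨fun k => c₂'.1 (γ.2 k), (Equiv.sum_comp γ.2 c₂'.1).trans c₂'.2⟩ c₂'
      ((SymN.cover e hid).move γ ρ ρ' h z)
      (fun k l h => congrArg c₁'.1 h) (fun k l h => congrArg c₂'.1 h) (w ρ)).trans
    ((congrArg (TensorProduct.map (V.perm ((SymN.cover e hid).move γ ρ ρ' h z).1 _ c₁'.1 _)
      (W.perm ((SymN.cover e hid).move γ ρ ρ' h z).2 _ c₂'.1 _)) (hw ρ p _ _)).trans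
    (V.sumEv_move W p _ c₁' _ c₂' hid e γ h z x _ _))

/-- The power operation on a direct sum. -/
theorem Series.pow_sum (hid : Continuous fun x : X => arr (𝟙 x)) (m : ℕ)
    (e : ∀ q : {q : ℕ × ℕ // q ∈ Finset.HasAntidiagonal.antidiagonal m}, Fin q.1.1 ⊕ Fin q.1.2 ≃ Fin m) :
    (V.sum W).pow m ≈ Series.piFin fun q => Series.push (SymN.cover (e q) hid)
      (SymN.cover_compat (e q) hid ξ) ((V.pow q.1.1).ext (W.pow q.1.2)) := by
  intro a
  -- Both sides are embedded, by `sumEv` and `pushEv`, in the bundles of tensor products indexed by the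
  -- decompositions of the index set and the exponents; the images agree.
  let I := Σ (q : {q : ℕ × ℕ // q ∈ Finset.HasAntidiagonal.antidiagonal m})
    (_ : Fin q.1.1 ⊕ Fin q.1.2 ≃ Fin m) (p : {p : ℚ≥0 × ℚ≥0 // p.1 + p.2 = a}),
    {c : Fin q.1.1 → ℚ≥0 // ∑ k, c k = p.1.1} × {c : Fin q.1.2 → ℚ≥0 // ∑ k, c k = p.1.2}
  let U := fun q : {q : ℕ × ℕ // q ∈ Finset.HasAntidiagonal.antidiagonal m} =>
    GB.push (SymN.cover (e q) hid) (((V.pow q.1.1).ext (W.pow q.1.2)).coef a)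
  refine GB.iso_of_joint (W := GB.pi U (GB.LocFin.of_finite _)) (I := I)
    (fun s => V.pairVB W s.2.2.2.1.1 s.2.2.2.2.1)
    (fun s z => SymN.split s.2.1 z) (fun s z => V.sumEv W s.2.1 s.2.2.1 s.2.2.2.1 s.2.2.2.2 z)
    (fun s z => V.pushEv W s.2.2.1 s.2.2.2.1 s.2.2.2.2 hid (e s.1) s.2.1 z ∘ₗ
      LinearMap.proj (φ := fun q => (U q).vb.fib z) s.1)
    (fun s => V.sumEv_cont W _ _ _ _) (fun s => ?_)
    (fun z x hx => funext (V.sumEv_inj W z x fun q ρ p c₁ c₂ => hx ⟨q, ρ, p, c₁, c₂⟩))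
    (fun z w hw => funext fun q => V.pushEv_inj W hid (e q) _ fun ρ p c₁ c₂ => hw ⟨q, ρ, p, c₁, c₂⟩)
    (fun z x => ?_) (fun z w => ?_) (fun z z' A x w h s => ?_)
  · rw [continuous_iff_continuousAt]
    intro t
    have h1 := (VB.pi_iff (fun q => (U q).vb) (GB.LocFin.of_finite _)).1
      (continuousAt_id (X := (GB.pi U (GB.LocFin.of_finite _)).vb.Tot) (x := t))
    exact (V.pushEv_cont W s.2.2.1 s.2.2.2.1 s.2.2.2.2 hid (e s.1) s.2.1).continuousAt.comp (h1.2 s.1)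
  · choose w hw using fun q => V.pushEv_exists W hid (e q) z x
    exact ⟨w, fun s => (hw s.1 s.2.1 s.2.2.1 s.2.2.2.1 s.2.2.2.2).symm⟩
  · obtain ⟨Q, R, hR⟩ := exists_side m
    obtain ⟨x, h1⟩ := V.sumEv_exists W z (fun q ρ p c₁ c₂ => V.pushEv W p c₁ c₂ hid (e q) ρ z (w q)) Q R hR
    -- The components agree for the chosen decomposition of each subset, hence for all decompositions, as
    -- these differ by permutations of the parts.
    have h2 : ∀ S q (ρ : Fin q.1.1 ⊕ Fin q.1.2 ≃ Fin m), side ρ = S → q = Q S → ∀ p c₁ c₂,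
        V.sumEv W ρ p c₁ c₂ z x = V.pushEv W p c₁ c₂ hid (e q) ρ z (w q) := by
      rintro S _ ρ hS rfl p c₁' c₂'
      obtain ⟨γ, h⟩ := exists_smul_of_side ((hR S).trans hS.symm)
      have h3 := V.sumEv_move W p ⟨fun k => c₁'.1 (γ.1 k), (Equiv.sum_comp γ.1 c₁'.1).trans c₁'.2⟩ c₁'
        ⟨fun k => c₂'.1 (γ.2 k), (Equiv.sum_comp γ.2 c₂'.1).trans c₂'.2⟩ c₂' hid (e (Q S)) γ h z x
        (fun k l h => congrArg c₁'.1 h) (fun k l h => congrArg c₂'.1 h)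
      rw [h1] at h3
      exact h3.symm.trans (V.pushEv_move W p _ c₁' _ c₂' hid (e (Q S)) (w (Q S)) γ h _ _)
    refine ⟨x, fun s => h2 (side s.2.1) s.1 s.2.1 rfl ?_ _ _ _⟩
    have hc := (card_side s.2.1).symm.trans ((congrArg Finset.card (hR _)).symm.trans (card_side (R (side s.2.1))))
    have h3 := Finset.HasAntidiagonal.mem_antidiagonal.1 s.1.2
    have h4 := Finset.HasAntidiagonal.mem_antidiagonal.1 (Q (side s.2.1)).2
    exact Subtype.ext (Prod.ext hc (by omega))
  · obtain ⟨q, ρ, p, c₁, c₂⟩ := s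
    have h1 := V.sumEv_act W p c₁ c₂ hid (e q) A rfl x (ρ' := ρ)
    have h2 := h ⟨q, ρ.trans A.perm.symm, p, c₁, c₂⟩
    have h3 := V.pushEv_act W p c₁ c₂ hid (e q) A (w q) ρ
    exact h1.symm.trans ((congrArg _ h2).trans h3.symm)

end PowSum

section PowCongr

variable {X : Type u} [Groupoid.{u} X] [TopologicalSpace X] [ArrTop X] {ξ : Cen X} {n : ℕ}

theorem Series.tr_equiv {V W : Series ξ} (e : ∀ a x, (V.coef a).vb.fib x ≃ₗ[ℂ] (W.coef a).vb.fib x)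
    (h : ∀ a {x y} (f : x ⟶ y) v, e a y ((V.coef a).act f v) = (W.coef a).act f (e a x v))
    {a b : ℚ≥0} (hab : a = b) {x y : X} (f : x ⟶ y) (v : (V.coef a).vb.fib x) :
    e b y (V.tr hab f v) = W.tr hab f (e a x v) := by
  subst hab
  exact h a f v

/-- The isomorphism of tensor powers induced by isomorphisms of the coefficients. -/
def Series.powEquiv {V W : Series ξ} (e : ∀ a x, (V.coef a).vb.fib x ≃ₗ[ℂ] (W.coef a).vb.fib x)
    (c : Fin n → ℚ≥0) (z : Fin n → X) :
    (⨂[ℂ] k, (V.coef (c k)).vb.fib (z k)) ≃ₗ[ℂ] ⨂[ℂ] k, (W.coef (c k)).vb.fib (z k) :=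
  PiTensorProduct.congr fun k => e (c k) (z k)

theorem Series.powEquiv_tprod {V W : Series ξ} (e : ∀ a x, (V.coef a).vb.fib x ≃ₗ[ℂ] (W.coef a).vb.fib x)
    (c : Fin n → ℚ≥0) (z : Fin n → X) (v : ∀ k, (V.coef (c k)).vb.fib (z k)) :
    Series.powEquiv e c z (PiTensorProduct.tprod ℂ v) = PiTensorProduct.tprod ℂ fun k => e (c k) (z k) (v k) :=
  PiTensorProduct.map_tprod _ _

theorem Series.powEquiv_perm {V W : Series ξ} (e : ∀ a x, (V.coef a).vb.fib x ≃ₗ[ℂ] (W.coef a).vb.fib x)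
    (h : ∀ a {x y} (f : x ⟶ y) v, e a y ((V.coef a).act f v) = (W.coef a).act f (e a x v))
    {z z' : Fin n → X} (A : FamHom z z') (c c' : Fin n → ℚ≥0) (hc) (v) :
    Series.powEquiv e c' z' (V.perm A c c' hc v) = W.perm A c c' hc (Series.powEquiv e c z v) := by
  suffices h : (Series.powEquiv e c' z').toLinearMap ∘ₗ V.perm A c c' hc =
      W.perm A c c' hc ∘ₗ (Series.powEquiv e c z).toLinearMap from LinearMap.congr_fun h v
  refine PiTensorProduct.ext (MultilinearMap.ext fun v => ?_)
  simp only [LinearMap.compMultilinearMap_apply, LinearMap.comp_apply, Series.perm_tprod,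
    Series.powEquiv_tprod, LinearEquiv.coe_coe]
  congr 1
  funext k
  exact Series.tr_equiv e h _ _ _

theorem Series.pow_congr {V W : Series ξ} (h : V ≈ W) (n : ℕ) : V.pow n ≈ W.pow n := by
  intro a
  choose e h1 h2 h3 using h
  refine GB.iso_of_bij (fun z =>
    { toFun := fun v c => Series.powEquiv e c.1 z (v c)
      map_add' := fun v w => funext fun c => map_add _ _ _
      map_smul' := fun r v => funext fun c => map_smul (Series.powEquiv e c.1 z) r (v c) }) ?_ (fun z => ⟨?_, ?_⟩) ?_
  · rw [continuous_iff_continuousAt]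
    intro q
    have hq := (VB.pi_iff _ (V.powVB_finite a)).1
      (continuousAt_id (X := ((V.pow n).coef a).vb.Tot) (x := q))
    refine (VB.pi_iff _ (W.powVB_finite a)).2 ⟨hq.1, fun c => ?_⟩
    refine VB.piTensor_contAt _ (hq.2 c) (W.powVB c.1) hq.1
      (fun s => (Series.powEquiv e c.1 s.1).toLinearMap) fun v hv => ?_
    have h4 := VB.piTensor_cont (fun k => (W.coef (c.1 k)).vb.pull (fun z : SymN n X => z k)
      (SymN.continuous_eval k)) (g := fun s : ((V.pow n).coef a).vb.Tot => s.1)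
      (v := fun (s : ((V.pow n).coef a).vb.Tot) k => e (c.1 k) (s.1 k) (v s k)) hq.1 fun k => (VB.pull_iff _ _ _).2
      ⟨hq.1, (h2 (c.1 k)).continuousAt.comp
        ((VB.pull_iff _ (fun z : SymN n X => z k) (SymN.continuous_eval k)).1 (hv k)).2⟩
    exact h4.congr (.of_forall fun s => congrArg ((W.powVB c.1).pt s.1)
      (Series.powEquiv_tprod e c.1 s.1 (v s)).symm)
  · exact fun v w h => funext fun c => (Series.powEquiv e c.1 z).injective
      (congrFun h c)
  · exact fun w => ⟨fun c => (Series.powEquiv e c.1 z).symm (w c),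
      funext fun c => (Series.powEquiv e c.1 z).apply_symm_apply (w c)⟩
  · intro z z' A v
    funext c
    exact Series.powEquiv_perm e (fun a {x y} f v => h1 a x y f v) A
      (fun k => c.1 (A.perm k)) c.1 (fun i j h => congrArg c.1 h) (v ⟨fun k => c.1 (A.perm k), _⟩)

theorem GB.iso_of_subsingleton {V W : GB X} (hV : ∀ x, Subsingleton (V.vb.fib x))
    (hW : ∀ x, Subsingleton (W.vb.fib x)) : V.Iso W :=
  GB.iso_of_joint (I := Empty) (B' := fun _ => X) (fun _ => V.vb) (fun _ x => x) (fun i => i.elim)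
    (fun i => i.elim) (fun i => i.elim) (fun i => i.elim) (fun _ _ _ => Subsingleton.elim _ _)
    (fun _ _ _ => Subsingleton.elim _ _) (fun _ _ => ⟨0, fun i => i.elim⟩)
    (fun _ _ => ⟨0, fun i => i.elim⟩) fun _ _ _ _ _ _ i => i.elim

theorem Series.cls_eq_zero {V : Series ξ} (h : ∀ a x, Subsingleton ((V.coef a).vb.fib x)) : V.cls = 0 :=
  (Series.cls_eq (W := Series.zero ξ) fun a => GB.iso_of_subsingleton (h a) fun _ =>
    ⟨fun _ _ => funext fun i => i.elim⟩).trans Series.cls_zero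

end PowCongr

section PowZero

/-- A tensor product of no factors. -/
def Series.emptyEquiv {Y : Type u} [Groupoid.{u} Y] [TopologicalSpace Y] [ArrTop Y] {υ : Cen Y}
    (V : Series υ) (c : Fin 0 → ℚ≥0) (z : Fin 0 → Y) : (⨂[ℂ] k, (V.coef (c k)).vb.fib (z k)) ≃ₗ[ℂ] ℂ :=
  PiTensorProduct.isEmptyEquiv (Fin 0)

theorem Series.emptyEquiv_perm {Y : Type u} [Groupoid.{u} Y] [TopologicalSpace Y] [ArrTop Y] {υ : Cen Y}
    (V : Series υ) {z z' : Fin 0 → Y} (A : FamHom z z') (c c' : Fin 0 → ℚ≥0) (h) (v) :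
    V.emptyEquiv c' z' (V.perm A c c' h v) = V.emptyEquiv c z v := by
  suffices h : (V.emptyEquiv c' z').toLinearMap ∘ₗ V.perm A c c' h = (V.emptyEquiv c z).toLinearMap from
    LinearMap.congr_fun h v
  refine PiTensorProduct.ext (MultilinearMap.ext fun v => ?_)
  simp only [LinearMap.compMultilinearMap_apply, LinearMap.comp_apply, Series.perm_tprod,
    LinearEquiv.coe_coe, Series.emptyEquiv, PiTensorProduct.isEmptyEquiv_apply_tprod]

variable {Z : Type u} [Groupoid.{u} Z] [TopologicalSpace Z] [ArrTop Z]
  {Y : Type u} [Groupoid.{u} Y] [TopologicalSpace Y] [ArrTop Y] {ξ : Cen Z} {υ : Cen Y}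
  {K : Type} [Groupoid.{0} K] [Sized K] (D : Diag Z Y K) (hD : D.Compat ξ υ)
  (hid : Continuous fun z : Z => arr (𝟙 z))

/-- This applies if `n < m`, as the objects of `K` have positive size. -/
theorem Krot.inv_eq_zero {n m : ℕ} (h : IsEmpty (Ix K n m)) (x : Krot (υ.symN m)) :
    Krot.inv D hD hid n m x = 0 := by
  suffices h : Krot.inv D hD hid n m = 0 from DFunLike.congr_fun h x
  refine Krot.hom_ext fun V => ?_
  rw [Krot.inv_cls]
  exact Series.cls_eq_zero fun a z => ⟨fun v w => Subtype.ext (funext fun κ => h.elim κ)⟩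

/-- There is one empty family, and the empty tensor product is `ℂ`, in degree `0`. -/
theorem Series.inv_pow_zero (V : Series υ) : Series.inv D hD hid 0 0 (V.pow 0) ≈ Series.one ξ := by
  intro a
  let κ : Ix K 0 0 := ⟨fun i => i.elim0, rfl⟩
  let c : a = 0 → {c : Fin 0 → ℚ≥0 // ∑ k, c k = a} := fun h => ⟨fun i => i.elim0, h.symm⟩
  refine GB.iso_of_bij (fun z =>
    { toFun := fun v h => ⟨V.emptyEquiv (c h.down).1 (D.symN 0 |>.obj κ.1 z) (v.1 κ (c h.down))⟩
      map_add' := fun v w => funext fun h => ULift.ext _ _ (map_add (V.emptyEquiv _ _) _ _)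
      map_smul' := fun r v => funext fun h => ULift.ext _ _ (map_smul (V.emptyEquiv _ _) _ _) }) ?_
      (fun z => ⟨?_, ?_⟩) ?_
  · rw [continuous_iff_continuousAt]
    intro q
    have hq := (GB.lim_iff (D.symN 0) (Ix.fam (K := K) (n := 0)) ((V.pow 0).coef a) hid).1
      (continuousAt_id (X := ((Series.inv D hD hid 0 0 (V.pow 0)).coef a).vb.Tot) (x := q))
    refine (VB.pi_iff (fun _ : PLift (a = 0) => (GB.triv Z).vb) (GB.LocFin.of_finite _)).2 ⟨hq.1, fun h => ?_⟩
    refine VB.piTensor_contAt _ (((VB.pi_iff _ (V.powVB_finite a)).1 (hq.2 κ)).2 (c h.down)) (GB.triv Z).vb hq.1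
      (fun s => ULift.moduleEquiv.symm.toLinearMap ∘ₗ (V.emptyEquiv _ _).toLinearMap) fun v _ => ?_
    refine ContinuousAt.congr (f := fun s : ((Series.inv D hD hid 0 0 (V.pow 0)).coef a).vb.Tot =>
      (GB.triv Z).vb.pt s.1 ⟨1⟩) ?_ (.of_forall fun s => congrArg ((GB.triv Z).vb.pt s.1) ?_)
    · exact (Topology.IsInducing.continuousAt_iff (g := fun p : (GB.triv Z).vb.Tot => (p.1, p.2.down)) ⟨rfl⟩).2
        (hq.1.prodMk continuousAt_const)
    · exact ULift.ext _ _ (PiTensorProduct.isEmptyEquiv_apply_tprod (Fin 0) (v s)).symm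
  · intro v w h
    refine Subtype.ext (funext fun κ' => funext fun c' => ?_)
    obtain rfl : κ = κ' := Subtype.ext (funext fun i => i.elim0)
    obtain ⟨c', hc'⟩ := c'
    obtain rfl : c' = fun i => i.elim0 := funext fun i => i.elim0
    exact (V.emptyEquiv _ _).injective (congrArg ULift.down (congrFun h ⟨hc'.symm⟩))
  · intro w
    refine ⟨⟨fun κ' c' => (V.emptyEquiv _ _).symm (w ⟨c'.2.symm⟩).down, fun κ κ' A => ?_⟩, ?_⟩
    · funext c'
      refine (V.emptyEquiv c'.1 _).injective ((V.emptyEquiv_perm ((D.symN 0).map A (𝟙 z))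
        (fun k => c'.1 (A.perm k)) c'.1 (fun i j h => congrArg c'.1 h)
        ((V.emptyEquiv _ _).symm (w ⟨c'.2.symm⟩).down)).trans ?_)
      exact ((V.emptyEquiv _ _).apply_symm_apply _).trans ((V.emptyEquiv _ _).apply_symm_apply _).symm
    · funext h
      exact ULift.ext _ _ ((V.emptyEquiv _ _).apply_symm_apply _)
  · intro z z' f v
    funext h
    refine ULift.ext _ _ ?_
    have h1 := V.emptyEquiv_perm ((D.symN 0).map (𝟙 κ.fam) f) (c h.down).1 (c h.down).1
      (fun i => i.elim0) (v.1 κ (c h.down))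
    refine Eq.trans ?_ h1
    refine congrArg (V.emptyEquiv (c h.down).1 _) ?_
    have h2 : ∀ (c' : {c : Fin 0 → ℚ≥0 // ∑ k, c k = a}) (h1 : c' = c h.down) (h2 h3),
      V.perm ((D.symN 0).map (𝟙 κ.fam) f) c'.1 (c h.down).1 h2 (v.1 κ c') =
      V.perm ((D.symN 0).map (𝟙 κ.fam) f) (c h.down).1 (c h.down).1 h3 (v.1 κ (c h.down)) := by
      rintro _ rfl h2 h3; rfl
    exact h2 _ (Subtype.ext (funext fun i => i.elim0)) (fun i => i.elim0) fun i => i.elim0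

end PowZero

section TotalPower

variable {Z : Type u} [Groupoid.{u} Z] [TopologicalSpace Z] [ArrTop Z]
  {Y : Type u} [Groupoid.{u} Y] [TopologicalSpace Y] [ArrTop Y] {ξ : Cen Z} {υ : Cen Y}
  {K : Type} [Groupoid.{0} K] [Sized K] (D : Diag Z Y K) (hD : D.Compat ξ υ)
  (hid : Continuous fun z : Z => arr (𝟙 z))

/-- The generating function of the invariant sections of a sequence of elements of
`K_rot(Sₘ ∫ Y)`. -/
def Krot.total (f : ∀ m, Krot (υ.symN m)) : PowerSeries (Krot ξ) :=
  PowerSeries.mk fun n => ∑ m ∈ Finset.range (n + 1), Krot.inv D hD hid n m (f m)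

theorem Krot.coeff_total (f : ∀ m, Krot (υ.symN m)) {n N : ℕ} (h : n ≤ N) :
    PowerSeries.coeff n (Krot.total D hD hid f) =
      ∑ m ∈ Finset.range (N + 1), Krot.inv D hD hid n m (f m) := by
  rw [Krot.total, PowerSeries.coeff_mk]
  refine Finset.sum_subset (Finset.range_subset_range.2 (by omega)) fun m _ hm => ?_
  refine Krot.inv_eq_zero D hD hid ⟨fun κ => hm (Finset.mem_range.2 ?_)⟩ _
  have := κ.le
  omega

/-- A product formula for invariant sections is a product formula for generating functions. -/
theorem Krot.total_mul {f g h : ∀ m, Krot (υ.symN m)} (H : ∀ n m, Krot.inv D hD hid n m (h m) =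
      ∑ r ∈ Finset.HasAntidiagonal.antidiagonal m, ∑ q ∈ Finset.HasAntidiagonal.antidiagonal n,
        Krot.inv D hD hid q.1 r.1 (f r.1) * Krot.inv D hD hid q.2 r.2 (g r.2)) :
    Krot.total D hD hid h = Krot.total D hD hid f * Krot.total D hD hid g := by
  ext n
  rw [PowerSeries.coeff_mul, Krot.coeff_total D hD hid h (le_refl n)]
  simp only [H]
  have h1 : ∀ q ∈ Finset.HasAntidiagonal.antidiagonal n,
      PowerSeries.coeff q.1 (Krot.total D hD hid f) * PowerSeries.coeff q.2 (Krot.total D hD hid g) =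
      ∑ m ∈ Finset.range (n + 1), ∑ r ∈ Finset.HasAntidiagonal.antidiagonal m,
        Krot.inv D hD hid q.1 r.1 (f r.1) * Krot.inv D hD hid q.2 r.2 (g r.2) := by
    intro q hq
    have hq' := Finset.HasAntidiagonal.mem_antidiagonal.1 hq
    rw [Krot.coeff_total D hD hid f (show q.1 ≤ n by omega),
      Krot.coeff_total D hD hid g (show q.2 ≤ n by omega), Finset.sum_mul_sum, ← Finset.sum_product',
      Finset.sum_sigma']
    symm
    refine Finset.sum_bij_ne_zero (fun s _ _ => s.2) (fun s hs _ => ?_) (fun s hs _ t ht _ h => ?_)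
      (fun r _ hr => ?_) fun _ _ _ => rfl
    · simp only [Finset.mem_sigma, Finset.mem_range, Finset.HasAntidiagonal.mem_antidiagonal] at hs
      simp only [Finset.mem_product, Finset.mem_range]
      omega
    · simp only [Finset.mem_sigma, Finset.HasAntidiagonal.mem_antidiagonal] at hs ht
      exact Sigma.ext (by rw [← hs.2, ← ht.2, h]) (heq_of_eq h)
    · have h1 : r.1 ≤ q.1 := by
        by_contra h
        exact hr (by rw [Krot.inv_eq_zero D hD hid ⟨fun κ => h κ.le⟩, zero_mul])
      have h2 : r.2 ≤ q.2 := by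
        by_contra h
        exact hr (by rw [Krot.inv_eq_zero D hD hid ⟨fun κ => h κ.le⟩, mul_zero])
      exact ⟨⟨r.1 + r.2, r⟩, by simp; omega, hr, rfl⟩
  rw [Finset.sum_congr rfl h1, Finset.sum_comm]
  exact Finset.sum_congr rfl fun m _ => Finset.sum_comm

/-- The total power of a series: the generating function of the invariant sections of its tensor
powers. -/
def Series.total (V : Series υ) : PowerSeries (Krot ξ) :=
  Krot.total D hD hid fun m => (V.pow m).cls

theorem Krot.inv_pow_zero (n : ℕ) (V : Series υ) :
    Krot.inv D hD hid n 0 (V.pow 0).cls = if n = 0 then 1 else 0 := by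
  split_ifs with h
  · subst h
    rw [Krot.inv_cls, Series.cls_eq (Series.inv_pow_zero D hD hid V), Series.cls_one]
  · exact Krot.inv_eq_zero D hD hid ⟨fun κ => h (κ.2.symm.trans (by simp [SymN.size]))⟩ _

theorem Series.total_congr {V W : Series υ} (h : V ≈ W) : V.total D hD hid = W.total D hD hid := by
  unfold Series.total
  congr 1
  exact funext fun m => Series.cls_eq (Series.pow_congr h m)

variable (hY : Continuous fun y : Y => arr (𝟙 y))

/-- The total power of a direct sum is the product of the total powers. -/
theorem Series.total_sum (hY : Continuous fun y : Y => arr (𝟙 y)) (V W : Series υ) :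
    (V.sum W).total D hD hid = V.total D hD hid * W.total D hD hid := by
  refine Krot.total_mul D hD hid fun n m => ?_
  rw [Series.cls_eq (Series.pow_sum V W hY m fun q => finSumFinEquiv.trans (finCongr
    (Finset.HasAntidiagonal.mem_antidiagonal.1 q.2))), Series.cls_piFin, map_sum,
    ← Finset.sum_coe_sort (Finset.HasAntidiagonal.antidiagonal m)]
  refine Finset.sum_congr rfl fun q _ => ?_
  rw [← Krot.inv_star D hD hid hY (finSumFinEquiv.trans (finCongr
    (Finset.HasAntidiagonal.mem_antidiagonal.1 q.2)))]
  congr 1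
  rw [Krot.star, Series.ext_biAddOp.map_eq, Series.ext_biAddOp.hom_cls]
  exact ((Series.push_addOp _ _).map_cls _).symm

/-- The constant coefficient is `1`. -/
theorem Series.isUnit_total (V : Series υ) : IsUnit (V.total D hD hid) := by
  rw [PowerSeries.isUnit_iff_constantCoeff, ← PowerSeries.coeff_zero_eq_constantCoeff_apply,
    Series.total, Krot.coeff_total D hD hid _ (le_refl 0)]
  simp [Krot.inv_pow_zero]

/-- The total power of an element of `K_rot`. -/
def Krot.totalPow (x : Krot υ) : PowerSeries (Krot ξ) := Krot.total D hD hid fun m => x.pow hY m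

/-- The recursion which defines the power operations on differences, for generating functions. -/
theorem Krot.powDiff_total (V W : Series υ) :
    Krot.total D hD hid (fun m => Krot.powDiff hY V W m) * W.total D hD hid = V.total D hD hid := by
  symm
  refine Krot.total_mul D hD hid fun n m => ?_
  have h1 : (V.pow m).cls = Krot.powDiff hY V W m + ∑ i : Fin m, Krot.star hY
      (finSumFinEquiv.trans (finCongr (Nat.add_sub_cancel' i.isLt.le))) (Krot.powDiff hY V W i)
      (W.pow (m - i)).cls := by
    conv_rhs => rw [Krot.powDiff]
    exact (sub_add_cancel _ _).symm
  rw [h1, map_add, map_sum, Finset.Nat.sum_antidiagonal_eq_sum_range_succ_mk, Finset.sum_range_succ, add_comm]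
  congr 1
  · rw [← Fin.sum_univ_eq_sum_range (fun i => ∑ q ∈ Finset.HasAntidiagonal.antidiagonal n,
      Krot.inv D hD hid q.1 i (Krot.powDiff hY V W i) *
        Krot.inv D hD hid q.2 (m - i) (W.pow (m - i)).cls)]
    exact Finset.sum_congr rfl fun i _ => Krot.inv_star D hD hid hY _ n _ _
  · have h2 : ∀ b k, k = 0 → Krot.inv D hD hid b k (W.pow k).cls = if b = 0 then 1 else 0 := by
      rintro b _ rfl
      exact Krot.inv_pow_zero D hD hid b W
    simp only [h2 _ _ (Nat.sub_self m)]
    rw [Finset.sum_eq_single (n, 0)]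
    · simp
    · rintro ⟨i, j⟩ hq hne
      have hj : j ≠ 0 := by
        rintro rfl
        exact hne (by simpa using hq)
      simp [hj]
    · simp

/-- The total power turns differences into quotients. -/
theorem Krot.totalPow_mul {x : Krot υ} {V W : Series υ} (h : x + W.cls = V.cls) :
    x.totalPow D hD hid hY * W.total D hD hid = V.total D hD hid := by
  have h1 : x.totalPow D hD hid hY * x.rep.2.total D hD hid = x.rep.1.total D hD hid :=
    Krot.powDiff_total D hD hid hY _ _
  -- The two presentations of `x` agree after the addition of a series `U`, the total power of which is
  -- invertible.
  have h2 : (x.rep.1.sum W).cls = (V.sum x.rep.2).cls := by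
    rw [Series.cls_sum, Series.cls_sum, ← h]
    have h3 : x.rep.1.cls = x + x.rep.2.cls := sub_eq_iff_eq_add.1 x.rep_spec.symm
    rw [h3]
    abel
  obtain ⟨U, hU⟩ := Series.cls_eq_iff.1 h2
  have h3 := Series.total_congr D hD hid hU
  simp only [Series.total_sum D hD hid hY] at h3
  have h4 := (Series.isUnit_total D hD hid U).mul_right_cancel h3
  refine (Series.isUnit_total D hD hid x.rep.2).mul_right_cancel ?_
  rw [← h4, ← h1]
  ring

end TotalPower

/-! ### Cycle decompositions -/

section Cycles

/-- Every permutation is a union of standard cycles. -/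
theorem exists_cycles {n : ℕ} (σ : Equiv.Perm (Fin n)) : ∃ (m : ℕ) (c : Fin m → ℕ)
    (e : (Σ i, Fin (c i)) ≃ Fin n), (∀ i, 0 < c i) ∧ ∀ i a, σ (e ⟨i, a⟩) = e ⟨i, finRotate _ a⟩ := by
  classical
  -- The cycles are indexed by the orbits, and parametrized by the iterates of a representative `r i`.
  let Q := Quotient (Equiv.Perm.SameCycle.setoid σ)
  let s := (Fintype.equivFin Q).symm
  let r : Fin (Fintype.card Q) → Fin n := fun i => (s i).out
  let c := fun i => Function.minimalPeriod σ (r i)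
  have hpos : ∀ i, 0 < c i := fun i => Function.minimalPeriod_pos_of_mem_periodicPts
    (Function.mem_periodicPts.2 ⟨orderOf σ, orderOf_pos σ, by
      rw [Function.IsPeriodicPt, Function.IsFixedPt, ← Equiv.Perm.coe_pow, pow_orderOf_eq_one]; rfl⟩)
  have hsame : ∀ i a, σ.SameCycle (r i) (σ^[a] (r i)) := fun i a => ⟨a, by
    rw [zpow_natCast, Equiv.Perm.coe_pow]⟩
  let f : (Σ i, Fin (c i)) → Fin n := fun p => σ^[p.2] (r p.1)
  have hf : Function.Bijective f := by
    constructor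
    · rintro ⟨i, a⟩ ⟨j, b⟩ h
      change σ^[a] (r i) = σ^[b] (r j) at h
      obtain rfl : i = j := by
        have h1 : σ.SameCycle (r i) (r j) := (hsame i a).trans (h ▸ (hsame j b).symm)
        have h2 : (Quotient.mk (Equiv.Perm.SameCycle.setoid σ) (r i)) = Quotient.mk _ (r j) := Quotient.sound h1
        rw [Quotient.out_eq, Quotient.out_eq] at h2
        exact s.injective h2
      obtain rfl : a = b := Fin.ext (Function.iterate_injOn_Iio_minimalPeriod a.2 b.2 h)
      rfl
    · intro x
      obtain ⟨i, hi⟩ := s.surjective (Quotient.mk (Equiv.Perm.SameCycle.setoid σ) x)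
      have h1 : σ.SameCycle (r i) x := by
        refine Quotient.exact (s := Equiv.Perm.SameCycle.setoid σ) ?_
        rw [Quotient.out_eq, hi]
      obtain ⟨a, ha⟩ := h1.exists_nat_pow_eq
      refine ⟨⟨i, ⟨a % c i, Nat.mod_lt _ (hpos i)⟩⟩, ?_⟩
      change σ^[a % c i] (r i) = x
      rw [Function.iterate_mod_minimalPeriod_eq, ← Equiv.Perm.coe_pow, ha]
  refine ⟨_, c, Equiv.ofBijective f hf, hpos, fun i a => ?_⟩
  change σ (σ^[a] (r i)) = σ^[(finRotate _ a).val] (r i)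
  rw [finRotate_val, Function.iterate_mod_minimalPeriod_eq, Function.iterate_succ_apply']

/-- A map which commutes with the rotations sends each cycle to a single cycle. -/
theorem fst_eq_of_rotate {I J : Type} {c : I → ℕ} {d : J → ℕ} (b : (Σ i, Fin (c i)) → Σ j, Fin (d j))
    (hb : ∀ i a, b ⟨i, finRotate _ a⟩ = ⟨(b ⟨i, a⟩).1, finRotate _ (b ⟨i, a⟩).2⟩) (i : I)
    (a a' : Fin (c i)) : (b ⟨i, a⟩).1 = (b ⟨i, a'⟩).1 := by
  have h0 : 0 < c i := (Nat.zero_le _).trans_lt a.2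
  suffices h : ∀ k (hk : k < c i), (b ⟨i, ⟨k, hk⟩⟩).1 = (b ⟨i, ⟨0, h0⟩⟩).1 from
    (h a a.2).trans (h a' a'.2).symm
  intro k
  induction k with
  | zero => exact fun _ => rfl
  | succ k ih =>
    intro hk
    rw [← ih (by omega), show (⟨k + 1, hk⟩ : Fin (c i)) = finRotate _ ⟨k, by omega⟩ from
      Fin.ext (by rw [finRotate_val]; exact (Nat.mod_eq_of_lt hk).symm), hb]

/-- A bijection which intertwines unions of standard cycles permutes the cycles. -/
theorem exists_perm_of_rotate {I J : Type} {c : I → ℕ} {d : J → ℕ} (hc : ∀ i, 0 < c i) (hd : ∀ j, 0 < d j)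
    (b : (Σ i, Fin (c i)) ≃ Σ j, Fin (d j))
    (hb : ∀ i a, b ⟨i, finRotate _ a⟩ = ⟨(b ⟨i, a⟩).1, finRotate _ (b ⟨i, a⟩).2⟩) :
    ∃ s : I ≃ J, ∀ p, (b p).1 = s p.1 := by
  have hb' : ∀ j a, b.symm ⟨j, finRotate _ a⟩ = ⟨(b.symm ⟨j, a⟩).1, finRotate _ (b.symm ⟨j, a⟩).2⟩ := by
    intro j a
    rw [Equiv.symm_apply_eq, hb, Sigma.eta, Equiv.apply_symm_apply]
  refine ⟨⟨fun i => (b ⟨i, ⟨0, hc i⟩⟩).1, fun j => (b.symm ⟨j, ⟨0, hd j⟩⟩).1, fun i => ?_, fun j => ?_⟩,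
    fun p => fst_eq_of_rotate b hb _ _ _⟩
  · refine (fst_eq_of_rotate b.symm hb' _ _ (b ⟨i, ⟨0, hc i⟩⟩).2).trans ?_
    rw [Sigma.eta, Equiv.symm_apply_apply]
  · refine (fst_eq_of_rotate b hb _ _ (b.symm ⟨j, ⟨0, hd j⟩⟩).2).trans ?_
    rw [Sigma.eta, Equiv.apply_symm_apply]

end Cycles

/-! ### Concatenation is full and faithful -/

section Full

variable {X : Type u} [Groupoid.{u} X] {n m : ℕ}

theorem FamHom.hom_eq_of_eq {I J : Type} {x : I → X} {y : J → X} {A B : FamHom x y} (h : A = B) {i j}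
    (h1 : A.perm i = j) (h2 : B.perm i = j) : A.hom i j h1 = B.hom i j h2 := by subst h; rfl

theorem FamHom.join_perm {I J : Type} {x : I → Sym X} {y : J → Sym X} (A : FamHom x y) {i j}
    (h : A.perm i = j) (a) : A.join.perm ⟨i, a⟩ = ⟨j, (A.hom i j h).perm a⟩ := by subst h; rfl

/-- An arrow between disjoint unions of families which permutes the families comes from an arrow between
families of families. -/
theorem FamHom.exists_join {I J : Type} {x : I → Sym X} {y : J → Sym X}
    (H : FamHom (fun p : Σ i, Fin (x i).1 => (x p.1).2 p.2) (fun p : Σ j, Fin (y j).1 => (y p.1).2 p.2))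
    (s : I ≃ J) (hs : ∀ p, (H.perm p).1 = s p.1) : ∃ A : FamHom x y, A.join = H := by
  have key : ∀ i j, s i = j → ∃ f : Fin (x i).1 ≃ Fin (y j).1, ∀ a, H.perm ⟨i, a⟩ = ⟨j, f a⟩ := by
    intro i j h
    have h1 : ∀ a, ∃ c, H.perm ⟨i, a⟩ = ⟨j, c⟩ := fun a => by
      have h2 : (H.perm ⟨i, a⟩).1 = j := (hs _).trans h
      subst h2
      exact ⟨_, rfl⟩
    choose f hf using h1
    refine ⟨Equiv.ofBijective f ⟨fun a a' h => ?_, fun c => ?_⟩, hf⟩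
    · have h2 := H.perm.injective ((hf a).trans ((congrArg _ h).trans (hf a').symm))
      simpa using h2
    · obtain ⟨⟨i', a⟩, ha⟩ := H.perm.surjective ⟨j, c⟩
      obtain rfl : i' = i := s.injective ((hs ⟨i', a⟩).symm.trans ((congrArg Sigma.fst ha).trans h.symm))
      exact ⟨a, by simpa using (hf a).symm.trans ha⟩
  choose f hf using key
  let A : FamHom x y := ⟨s, fun i j h => (⟨f i j h, fun a c hac => H.hom ⟨i, a⟩ ⟨j, c⟩ (by rw [hf i j h, hac])⟩ :
    FamHom (x i).2 (y j).2)⟩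
  exact ⟨A, FamHom.ext (Equiv.ext fun p => (hf p.1 (s p.1) rfl p.2).symm) fun p q h h' => rfl⟩

/-- Empty families have to be excluded, as an arrow between disjoint unions does not see them. -/
theorem FamHom.join_injective {I J : Type} {x : I → Sym X} {y : J → Sym X} (hx : ∀ i, 0 < (x i).1)
    {A B : FamHom x y} (h : A.join = B.join) : A = B := by
  have h1 : ∀ p, A.join.perm p = B.join.perm p := fun p => by rw [h]
  refine FamHom.ext (Equiv.ext fun i => congrArg Sigma.fst (h1 ⟨i, ⟨0, hx i⟩⟩)) fun i j e e' => ?_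
  have h2 : ∀ a, (A.hom i j e).perm a = (B.hom i j e').perm a := fun a => by
    have h3 := h1 ⟨i, a⟩
    rw [A.join_perm e, B.join_perm e'] at h3
    simpa using h3
  refine FamHom.ext (Equiv.ext h2) fun a c ha hc => ?_
  exact FamHom.hom_eq_of_eq h (i := ⟨i, a⟩) (j := ⟨j, c⟩) (by rw [A.join_perm e, ha]) (by rw [B.join_perm e', hc])

theorem FamHom.arr_reindex {I J K L : Type} {x : I → X} {y : J → X} (A : FamHom x y) (e : I ≃ K)
    (e' : J ≃ L) (i : I) (l : L) (h) (j : J) (h') :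
    arr ((A.reindex e e').hom (e i) l h) = arr (A.hom i j h') :=
  arr_hom_congr A _ h' (e.symm_apply_apply i)

theorem FamHom.reindex_injective {I J K L : Type} {x : I → X} {y : J → X} (e : I ≃ K) (e' : J ≃ L)
    {A B : FamHom x y} (h : A.reindex e e' = B.reindex e e') : A = B := by
  have h1 : A.perm = B.perm := by
    have h2 := congrArg FamHom.perm h
    refine Equiv.ext fun i => ?_
    have h3 := congrFun (congrArg DFunLike.coe h2) (e i)
    simpa [FamHom.reindex] using h3
  refine FamHom.ext_of_arr h1 fun i => ?_
  rw [← A.arr_reindex e e' i _ rfl _ rfl, ← B.arr_reindex e e' i _ rfl _ rfl, h]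

theorem FamHom.exists_reindex {I J K L : Type} {x : I → X} {y : J → X} (e : I ≃ K) (e' : J ≃ L)
    (H : FamHom (x ∘ e.symm) (y ∘ e'.symm)) : ∃ A : FamHom x y, A.reindex e e' = H := by
  let A : FamHom x y := ⟨e.trans (H.perm.trans e'.symm), fun i j h =>
    eqToHom (by simp) ≫ H.hom (e i) (e' j) (by rw [← h]; simp) ≫ eqToHom (by simp)⟩
  refine ⟨A, FamHom.ext_of_arr (Equiv.ext fun k => by simp [FamHom.reindex, A]) fun k => ?_⟩
  obtain ⟨i, rfl⟩ := e.surjective k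
  refine (A.arr_reindex e e' i _ rfl _ rfl).trans ?_
  refine ((arr_left_eqToHom _ _).trans (arr_right_eqToHom _ _)).trans ?_
  exact arr_hom_congr H _ _ rfl

theorem Sym.catMap_injective {x : Fin n → Sym X} {y : Fin m → Sym X} (hx : ∀ i, 0 < (x i).1)
    {A B : FamHom x y} (h : Sym.catMap A = Sym.catMap B) : A = B :=
  FamHom.join_injective hx (FamHom.reindex_injective finSigmaFinEquiv finSigmaFinEquiv h)

theorem Phi.under_injective {I J : Type} {o : I → Phi X} {o' : J → Phi X} {f g : FamHom o o'}
    (h : Phi.under f = Phi.under g) : f = g :=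
  FamHom.ext (show (Phi.under f).perm = (Phi.under g).perm by rw [h]) fun i j e e' =>
    Subtype.ext (FamHom.hom_eq_of_eq h e e')

/-- The functor `Q` is faithful. -/
theorem Phi.cat_injective {o : Fin n → Phi X} {o' : Fin m → Phi X} {f g : FamHom o o'}
    (h : Sym.catMap (Phi.under f) = Sym.catMap (Phi.under g)) : f = g :=
  Phi.under_injective (Sym.catMap_injective (fun i => (o i).pos) h)

/-- The loops of a family in `Φ(X)`. -/
def Phi.loops {I : Type} (o : I → Phi X) : FamHom (fun i => (o i).base) fun i => (o i).base :=
  .diag fun i => (o i).loop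

theorem Phi.loops_hom {I : Type} (o : I → Phi X) (i h) : (Phi.loops o).hom i i h = (o i).loop :=
  FamHom.diag_hom (fun i => (o i).loop) i h

theorem Phi.loops_join {I : Type} (o : I → Phi X) (p : Σ i, Fin (o i).base.1) :
    (Phi.loops o).join.perm p = ⟨p.1, finRotate _ p.2⟩ :=
  ((Phi.loops o).join_perm (i := p.1) (j := p.1) rfl p.2).trans (congrArg (Sigma.mk p.1)
    ((congrArg (fun B : (o p.1).base ⟶ (o p.1).base => B.perm p.2) (Phi.loops_hom o p.1 rfl)).trans
      (congrArg (fun τ : Equiv.Perm _ => τ p.2) (o p.1).cyc)))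

/-- The loop of a concatenation. -/
def Phi.catLoop (o : Fin n → Phi X) : Sym.cat (fun i => (o i).base) ⟶ Sym.cat fun i => (o i).base :=
  Sym.catMap (Phi.loops o)

/-- The functor `Q` is full. -/
theorem Phi.exists_cat {o : Fin n → Phi X} {o' : Fin m → Phi X}
    (h : FamHom (Sym.cat fun i => (o i).base).2 (Sym.cat fun i => (o' i).base).2)
    (hc : FamHom.comp (Phi.catLoop o) h = FamHom.comp h (Phi.catLoop o')) : ∃ f : FamHom o o', Sym.catMap (Phi.under f) = h := by
  obtain ⟨H, rfl⟩ := FamHom.exists_reindex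
    (x := fun p : Σ i, Fin (o i).base.1 => (o p.1).base.2 p.2)
    (y := fun p : Σ i, Fin (o' i).base.1 => (o' p.1).base.2 p.2) finSigmaFinEquiv finSigmaFinEquiv h
  have h1 : (Phi.loops o).join.comp H =
      H.comp (Phi.loops o').join := by
    refine FamHom.reindex_injective finSigmaFinEquiv finSigmaFinEquiv ?_
    rw [FamHom.reindex_comp _ _ _ finSigmaFinEquiv, FamHom.reindex_comp _ _ _ finSigmaFinEquiv]
    exact hc
  -- An arrow which commutes with the loops permutes the cycles.
  obtain ⟨s, hs⟩ := exists_perm_of_rotate (fun i => (o i).pos) (fun i => (o' i).pos) H.perm fun i a => by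
    have h2 := congrFun (congrArg DFunLike.coe (congrArg FamHom.perm h1)) ⟨i, a⟩
    change H.perm ((Phi.loops o).join.perm ⟨i, a⟩) = (Phi.loops o').join.perm (H.perm ⟨i, a⟩) at h2
    rwa [Phi.loops_join, Phi.loops_join] at h2
  obtain ⟨A, rfl⟩ := FamHom.exists_join H s hs
  rw [← FamHom.join_comp, ← FamHom.join_comp] at h1
  have h2 := FamHom.join_injective (fun i => (o i).pos) h1
  let f : FamHom o o' := ⟨A.perm, fun i j h => ⟨A.hom i j h, by
    have h3 := FamHom.hom_eq_of_eq h2 (i := i) (j := j) h h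
    refine ((FamHom.comp_hom _ _ i i j rfl h _).trans (congrArg (· ≫ A.hom i j h) (Phi.loops_hom o i rfl))).symm.trans
      (h3.trans ((FamHom.comp_hom _ _ i j j h rfl _).trans ?_))
    exact congrArg (A.hom i j h ≫ ·) (Phi.loops_hom o' j rfl)⟩⟩
  exact ⟨f, rfl⟩

end Full

/-! ### The topology of the total symmetric power -/

section LiftSym

variable {Y : Type u} [Groupoid.{u} Y] [TopologicalSpace Y] [ArrTop Y] {n : ℕ}
  {T : Type*} [TopologicalSpace T] {t : T}

/-- An arrow of `Sₙ ∫ Y` as an arrow of the total symmetric power. -/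
def SymN.inclArr (a : Arr (SymN n Y)) : Arr (Sym Y) := arr ((SymN.incl n Y).map a.hom)

theorem SymN.inclArr_contAt {F : T → Arr (SymN n Y)} :
    ContinuousAt (fun s => SymN.inclArr (F s)) t ↔ ContinuousAt F t := by
  refine ⟨fun h => ?_, fun h => (SymN.incl n Y).contAt (f := fun s => (F s).hom) h⟩
  obtain ⟨-, h⟩ := (Sym.arr_iff (x := fun s => ⟨n, (F s).src⟩) (y := fun s => ⟨n, (F s).tgt⟩)
    (f := fun s => (F s).hom)).1 h
  refine (SymN.arr_iff (f := fun s => (F s).hom)).2 fun i => ?_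
  obtain ⟨h1, g, hg, hgf⟩ := h i
  exact ⟨h1.mono fun s hs => Fin.ext (hs i rfl), hg.congr (hgf.mono fun s hs => (hs i rfl).symm)⟩

theorem SymN.incl_contAt {O : T → SymN n Y} :
    ContinuousAt (fun s => (⟨n, O s⟩ : Sym Y)) t ↔ ContinuousAt O t :=
  (Topology.IsEmbedding.sigmaMk (σ := fun n => Fin n → Y) (i := n)).isInducing.continuousAt_iff.symm

/-- The number of members of a family is locally constant. -/
theorem SymN.exists_inclArr {f : T → Arr (Sym Y)} (h : ContinuousAt (fun s => (f s).src) t) :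
    ∃ F : T → Arr (SymN (f t).src.1 Y), ∀ᶠ s in 𝓝 t, f s = SymN.inclArr (F s) := by
  classical
  have key : ∀ a : Arr (Sym Y), a.src.1 = (f t).src.1 → ∃ F : Arr (SymN (f t).src.1 Y), a = SymN.inclArr F := by
    generalize (f t).src.1 = m
    rintro ⟨⟨m', x⟩, ⟨m'', y⟩, f⟩ rfl
    obtain rfl : m'' = m' := Sym.hn f
    exact ⟨⟨x, y, f⟩, rfl⟩
  refine ⟨fun s => if hs : (f s).src.1 = (f t).src.1 then (key _ hs).choose else (key _ rfl).choose, ?_⟩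
  filter_upwards [eventually_fam_card (c := fun s => (f s).src) h] with s hs
  rw [dif_pos hs]
  exact (key _ hs).choose_spec

end LiftSym

section TotalCat

variable {X : Type u} [Groupoid.{u} X] [TopologicalSpace X] [ArrTop X] {n : ℕ}
  {T : Type*} [TopologicalSpace T] {t : T}

variable (X) in
/-- The functor `Q` on the total symmetric power, without topology. -/
def totalFunctor : Sym (Phi X) ⥤ Inertia (Sym X) where
  obj o := ⟨Sym.cat fun i => (o.2 i).base, Phi.catLoop o.2⟩
  map {o o'} f := ⟨Sym.catMap (Phi.under f), by
      unfold Phi.catLoop Phi.loops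
      rw [← Sym.catMap_comp, ← Sym.catMap_comp, FamHom.diag_comm]
      exact fun i j e => Phi.comm (f.hom i j e)⟩
  map_id o := Subtype.ext ((congrArg Sym.catMap (Phi.under_id o.2)).trans
    (Sym.catMap_id fun i => (o.2 i).base))
  map_comp f g := Subtype.ext ((congrArg Sym.catMap (Phi.under_comp f g)).trans
    (Sym.catMap_comp (Phi.under f) (Phi.under g)))

variable (X) in
/-- The functor `Q` on the total symmetric power. -/
def totalCat : CFun (Sym (Phi X)) (Inertia (Sym X)) where
  toFunctor := totalFunctor X
  obj_cont := continuous_sigma fun n => (catFun X n).obj_cont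
  map_cont := continuous_iff_continuousAt.2 fun a => by
    obtain ⟨F, hF⟩ := SymN.exists_inclArr (f := id) (t := a) ArrTop.src_cont.continuousAt
    have h : ContinuousAt F a := SymN.inclArr_contAt.1 (continuousAt_id.congr hF)
    refine ((catFun X _).contAt (f := fun s => (F s).hom) h).congr (hF.mono fun s hs => ?_)
    exact congrArg (fun b : Arr (Sym (Phi X)) => arr ((totalFunctor X).map b.hom)) hs.symm

theorem finSigma_inj {n : ℕ} {c d : Fin n → ℕ} (h : c = d) {p : Σ i, Fin (c i)} {q : Σ i, Fin (d i)}
    (e : (finSigmaFinEquiv p).val = (finSigmaFinEquiv q).val) : p.1 = q.1 ∧ p.2.val = q.2.val := by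
  subst h
  obtain rfl := finSigmaFinEquiv.injective (Fin.ext e)
  exact ⟨rfl, rfl⟩

/-- Continuity of a family of arrows can be checked after concatenation. -/
theorem Phi.contAt_of_cat {F : T → Arr (SymN n (Phi X))} (h1 : ContinuousAt (fun s => (F s).src) t)
    (h2 : ContinuousAt (fun s => (F s).tgt) t)
    (h : ContinuousAt (fun s => arr (Sym.catMap (Phi.under (F s).hom))) t) : ContinuousAt F t := by
  have h1' := fun i => Phi.obj_iff.1 ((SymN.continuous_eval i).continuousAt.comp h1)
  have h2' := fun i => Phi.obj_iff.1 ((SymN.continuous_eval i).continuousAt.comp h2)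
  have hc : ∀ i, ∀ᶠ s in 𝓝 t, ((F s).src i).base.1 = ((F t).src i).base.1 := fun i =>
    (Sym.arr_iff.1 (h1' i)).1
  have hd : ∀ i, ∀ᶠ s in 𝓝 t, ((F s).tgt i).base.1 = ((F t).tgt i).base.1 := fun i =>
    (Sym.arr_iff.1 (h2' i)).1
  obtain ⟨-, hh⟩ := Sym.arr_iff.1 h
  have e : ∀ s i (b : Fin ((F s).src i).base.1), (Sym.catMap (Phi.under (F s).hom)).perm
      (finSigmaFinEquiv (n := fun i => ((F s).src i).base.1) ⟨i, b⟩) =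
      finSigmaFinEquiv (n := fun i => ((F s).tgt i).base.1)
        ⟨(F s).hom.perm i, (Phi.val ((F s).hom.hom i _ rfl)).perm b⟩ := fun s i b =>
    congrArg (fun p => finSigmaFinEquiv (n := fun i => ((F s).tgt i).base.1)
      ((Phi.under (F s).hom).join.perm p)) (finSigmaFinEquiv.symm_apply_apply _)
  have key : ∀ i (a : Fin ((F t).src i).base.1), ∀ᶠ s in 𝓝 t, ∀ b : Fin ((F s).src i).base.1,
      b.val = a.val → (F s).hom.perm i = (F t).hom.perm i ∧
      ((Phi.val ((F s).hom.hom i _ rfl)).perm b).val = ((Phi.val ((F t).hom.hom i _ rfl)).perm a).val := by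
    intro i a
    filter_upwards [(hh (finSigmaFinEquiv (n := fun i => ((F t).src i).base.1) ⟨i, a⟩)).1,
      eventually_all.2 hc, eventually_all.2 hd] with s hs hcs hds b hb
    have h3 := hs (finSigmaFinEquiv (n := fun i => ((F s).src i).base.1) ⟨i, b⟩)
      (finSigma_val (funext hcs) rfl hb)
    rw [e, e] at h3
    exact finSigma_inj (funext hds) h3
  have hp : ∀ i, ∀ᶠ s in 𝓝 t, (F s).hom.perm i = (F t).hom.perm i := fun i => by
    filter_upwards [key i ((F t).src i).zero] with s hs
    exact (hs ((F s).src i).zero rfl).1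
  refine (SymN.arr_iff (f := fun s => (F s).hom)).2 fun i => ⟨hp i, Phi.arr_iff.2 ⟨h1' i, ?_,
    Sym.arr_iff.2 ⟨hc i, fun a => ⟨(key i a).mono fun s hs b hb => (hs b hb).2, ?_⟩⟩⟩⟩
  · refine (h2' ((F t).hom.perm i)).congr ((hp i).mono fun s hs => ?_)
    exact congrArg (fun j => arr ((F s).tgt j).loop) hs.symm
  · obtain ⟨-, g, hg, hgf⟩ := hh (finSigmaFinEquiv (n := fun i => ((F t).src i).base.1) ⟨i, a⟩)
    refine ⟨g, hg, ?_⟩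
    filter_upwards [hgf, eventually_all.2 hc] with s hs hcs b hb
    refine Eq.trans ?_ (hs (finSigmaFinEquiv (n := fun i => ((F s).src i).base.1) ⟨i, b⟩)
      (finSigma_val (funext hcs) rfl hb))
    exact arr_hom_congr (Phi.under (F s).hom).join (i := ⟨i, b⟩) (j := ⟨_, _⟩) rfl
      (finSigmaFinEquiv.symm_apply_apply _).symm (finSigmaFinEquiv.symm_apply_apply _).symm

/-- The functor `Q` reflects the continuity of families of arrows. -/
theorem totalCat_reflect {o o' : T → Sym (Phi X)} {f : ∀ s, o s ⟶ o' s} (h1 : ContinuousAt o t)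
    (h2 : ContinuousAt o' t) (h : ContinuousAt (fun s => arr (Sym.catMap (Phi.under (f s)))) t) :
    ContinuousAt (fun s => arr (f s)) t := by
  obtain ⟨F, hF⟩ := SymN.exists_inclArr (f := fun s => arr (f s)) (t := t) h1
  refine (SymN.inclArr_contAt.2 (Phi.contAt_of_cat ?_ ?_ ?_)).congr (hF.mono fun s hs => hs.symm)
  · exact SymN.incl_contAt.1 (h1.congr (hF.mono fun s hs => congrArg Arr.src hs))
  · exact SymN.incl_contAt.1 (h2.congr (hF.mono fun s hs => congrArg Arr.tgt hs))
  · exact h.congr (hF.mono fun s hs => congrArg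
      (fun a : Arr (Sym (Phi X)) => arr (Sym.catMap (Phi.under a.hom))) hs)

end TotalCat

/-! ### The inverse equivalence -/

section Parts

variable {X : Type u} [Groupoid.{u} X] {n : ℕ}

/-- The number of cycles of a permutation. -/
def numCycles (σ : Equiv.Perm (Fin n)) : ℕ := (exists_cycles σ).choose

/-- The lengths of the cycles. -/
def cycleLen (σ : Equiv.Perm (Fin n)) : Fin (numCycles σ) → ℕ := (exists_cycles σ).choose_spec.choose

/-- The decomposition of the index set into cycles. -/
def cycleEquiv (σ : Equiv.Perm (Fin n)) : (Σ i, Fin (cycleLen σ i)) ≃ Fin n :=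
  (exists_cycles σ).choose_spec.choose_spec.choose

theorem cycleLen_pos (σ : Equiv.Perm (Fin n)) (i) : 0 < cycleLen σ i :=
  (exists_cycles σ).choose_spec.choose_spec.choose_spec.1 i

theorem cycleEquiv_rotate (σ : Equiv.Perm (Fin n)) (i a) :
    σ (cycleEquiv σ ⟨i, a⟩) = cycleEquiv σ ⟨i, finRotate _ a⟩ :=
  (exists_cycles σ).choose_spec.choose_spec.choose_spec.2 i a

/-- The cycles of an automorphism of a family. -/
def Phi.part {x : Fin n → X} (L : FamHom x x) (i : Fin (numCycles L.perm)) : Phi X :=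
  ⟨⟨⟨cycleLen L.perm i, fun a => x (cycleEquiv L.perm ⟨i, a⟩)⟩,
    (⟨finRotate _, fun a b h => L.hom _ _ (by rw [cycleEquiv_rotate, h])⟩ :
      FamHom (fun a => x (cycleEquiv L.perm ⟨i, a⟩)) fun a => x (cycleEquiv L.perm ⟨i, a⟩))⟩,
    cycleLen_pos _ i, rfl⟩

/-- The cycles of an object of the inertia groupoid. -/
def Phi.parts (p : Inertia (Sym X)) : Sym (Phi X) := ⟨numCycles p.loop.perm, Phi.part p.loop⟩

/-- The identification of an automorphism of a family with the concatenation of its cycles. -/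
def Phi.reassemble (p : Inertia (Sym X)) : Sym.cat (fun i => ((Phi.parts p).2 i).base) ⟶ p.pt :=
  FamHom.ofEq (x := (Sym.cat fun i => ((Phi.parts p).2 i).base).2) (y := p.pt.2)
    (finSigmaFinEquiv.symm.trans (cycleEquiv p.loop.perm)) fun k => rfl

theorem FamHom.comp_ofEq {I J K : Type} {x : I → X} {y : J → X} {z : K → X} (A : FamHom x y)
    (σ : J ≃ K) (h : ∀ k, y k = z (σ k)) (i k) (e) :
    arr ((A.comp (FamHom.ofEq σ h)).hom i k e) = arr (A.hom i _ rfl) :=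
  arr_right_eqToHom _ ((h _).trans (congrArg z e))

theorem FamHom.ofEq_comp' {I J K : Type} {x : I → X} {y : J → X} {z : K → X} (σ : I ≃ J)
    (h : ∀ k, x k = y (σ k)) (A : FamHom y z) (i k) (e) :
    arr (((FamHom.ofEq σ h).comp A).hom i k e) = arr (A.hom (σ i) _ rfl) :=
  (arr_left_eqToHom (h i) (A.hom (σ i) k e)).trans (arr_hom_congr A _ _ rfl)

theorem Phi.catLoop_perm (o : Fin n → Phi X) (i) (a : Fin (o i).base.1) :
    (Phi.catLoop o).perm (finSigmaFinEquiv (n := fun i => (o i).base.1) ⟨i, a⟩) =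
      finSigmaFinEquiv (n := fun i => (o i).base.1) ⟨i, finRotate _ a⟩ :=
  (congrArg (fun p => finSigmaFinEquiv (n := fun i => (o i).base.1) ((Phi.loops o).join.perm p))
    (finSigmaFinEquiv.symm_apply_apply _)).trans (congrArg _ (Phi.loops_join o ⟨i, a⟩))

theorem Phi.catLoop_arr (o : Fin n → Phi X) (i) (a : Fin (o i).base.1) (l h) :
    arr ((Phi.catLoop o).hom (finSigmaFinEquiv (n := fun i => (o i).base.1) ⟨i, a⟩) l h) =
      arr ((o i).loop.hom a _ rfl) := by
  refine ((Phi.loops o).join.arr_reindex finSigmaFinEquiv finSigmaFinEquiv ⟨i, a⟩ l h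
    ⟨i, (o i).loop.perm a⟩ ?_).trans ?_
  · exact ((Phi.loops o).join_perm (j := i) rfl a).trans (congrArg (fun B : (o i).base ⟶ (o i).base =>
      (⟨i, B.perm a⟩ : Σ i, Fin (o i).base.1)) (Phi.loops_hom o i rfl))
  · exact congrArg arr (FamHom.hom_eq_of_eq (Phi.loops_hom o i rfl) _ _)

/-- The identification is an isomorphism in the inertia groupoid. -/
theorem Phi.reassemble_loop (p : Inertia (Sym X)) :
    Phi.catLoop (Phi.parts p).2 ≫ Phi.reassemble p = Phi.reassemble p ≫ p.loop := by
  refine FamHom.ext_of_arr (Equiv.ext fun k => ?_) fun k => ?_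
  · obtain ⟨⟨i, a⟩, rfl⟩ := (finSigmaFinEquiv (n := fun i => cycleLen p.loop.perm i)).surjective k
    refine (congrArg (Phi.reassemble p).perm (Phi.catLoop_perm (Phi.parts p).2 i a)).trans ?_
    refine (congrArg (cycleEquiv p.loop.perm) (finSigmaFinEquiv.symm_apply_apply _)).trans ?_
    refine (cycleEquiv_rotate _ _ _).symm.trans ?_
    exact congrArg (fun q => p.loop.perm (cycleEquiv p.loop.perm q)) (finSigmaFinEquiv.symm_apply_apply _).symm
  · obtain ⟨⟨i, a⟩, rfl⟩ := (finSigmaFinEquiv (n := fun i => cycleLen p.loop.perm i)).surjective k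
    refine (FamHom.comp_ofEq _ _ _ _ _ _).trans (Eq.trans ?_ (FamHom.ofEq_comp' _ _ _ _ _ _).symm)
    refine (Phi.catLoop_arr (Phi.parts p).2 i a _ rfl).trans ?_
    exact arr_hom_congr p.loop _ rfl
      (congrArg (cycleEquiv p.loop.perm) (finSigmaFinEquiv.symm_apply_apply _).symm)

end Parts

section PartsFunctor

variable {X : Type u} [Groupoid.{u} X]

/-- Concatenation is full: an arrow of the inertia groupoid, conjugated by the isomorphisms which
reassemble a family from its cycles, commutes with the concatenated loops and hence comes from families of
cycles. -/
theorem Phi.exists_lift (p q : Inertia (Sym X)) (h : p ⟶ q) : ∃ f : Phi.parts p ⟶ Phi.parts q,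
    Sym.catMap (Phi.under f) = Phi.reassemble p ≫ h.1 ≫ Groupoid.inv (Phi.reassemble q) := by
  refine Phi.exists_cat (o := (Phi.parts p).2) (o' := (Phi.parts q).2) _ ?_
  change Phi.catLoop (Phi.parts p).2 ≫ (Phi.reassemble p ≫ h.1 ≫ Groupoid.inv (Phi.reassemble q)) =
    (Phi.reassemble p ≫ h.1 ≫ Groupoid.inv (Phi.reassemble q)) ≫ Phi.catLoop (Phi.parts q).2
  have h1 := Phi.reassemble_loop p
  have h2 := Phi.reassemble_loop q
  rw [Groupoid.inv_eq_inv, ← Category.assoc, h1, Category.assoc, ← Category.assoc p.loop, h.2]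
  simp only [Category.assoc]
  congr 2
  rw [IsIso.eq_inv_comp, ← Category.assoc, ← h2, Category.assoc, IsIso.hom_inv_id, Category.comp_id]

/-- The arrow between the families of cycles which is induced by an arrow of the inertia groupoid. -/
def Phi.partsMap {p q : Inertia (Sym X)} (h : p ⟶ q) : Phi.parts p ⟶ Phi.parts q :=
  (Phi.exists_lift p q h).choose

theorem Phi.partsMap_spec {p q : Inertia (Sym X)} (h : p ⟶ q) : Sym.catMap (Phi.under (Phi.partsMap h)) =
    Phi.reassemble p ≫ h.1 ≫ Groupoid.inv (Phi.reassemble q) :=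
  (Phi.exists_lift p q h).choose_spec

variable [TopologicalSpace X] [ArrTop X] {T : Type*} [TopologicalSpace T] {t : T}

theorem Phi.under_sym_comp {x y z : Sym (Phi X)} (f : x ⟶ y) (g : y ⟶ z) :
    Sym.catMap (Phi.under (f ≫ g)) = Sym.catMap (Phi.under f) ≫ Sym.catMap (Phi.under g) :=
  Sym.catMap_comp (Phi.under f) (Phi.under g)

theorem Phi.under_sym_id (x : Sym (Phi X)) :
    Sym.catMap (Phi.under (𝟙 x : x ⟶ x)) = 𝟙 (Sym.cat fun i => (x.2 i).base) :=
  (congrArg Sym.catMap (Phi.under_id x.2)).trans (Sym.catMap_id _)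

theorem SymN.perm_eventually {n : ℕ} {x y : T → SymN n X} {f : ∀ s, x s ⟶ y s}
    (h : ContinuousAt (fun s => arr (f s)) t) : ∀ᶠ s in 𝓝 t, (f s).perm = (f t).perm := by
  filter_upwards [eventually_all.2 fun i => (SymN.arr_iff.1 h i).1] with s hs
  exact Equiv.ext hs

/-- A continuous family of automorphisms of families is locally a family of automorphisms of families
of constant length, with constant permutation. -/
theorem Inertia.exists_lift {p : T → Inertia (Sym X)} (h : ContinuousAt p t) :
    ∃ (n : ℕ) (σ : Equiv.Perm (Fin n)) (G : T → SymN n X) (L : ∀ s, G s ⟶ G s),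
      ContinuousAt (fun s => arr (L s)) t ∧ (∀ s, (L s).perm = σ) ∧
      ∀ᶠ s in 𝓝 t, p s = ⟨⟨n, G s⟩, L s⟩ := by
  classical
  have h1 := Inertia.obj_iff.1 h
  have key : ∀ q : Inertia (Sym X), q.pt.1 = (p t).pt.1 → ∃ G : Σ x : SymN (p t).pt.1 X, (x ⟶ x),
      q = ⟨⟨_, G.1⟩, G.2⟩ := by
    generalize (p t).pt.1 = n
    rintro ⟨⟨m, x⟩, L⟩ rfl
    exact ⟨⟨x, L⟩, rfl⟩
  let G : T → Σ x : SymN (p t).pt.1 X, (x ⟶ x) := fun s =>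
    if hs : (p s).pt.1 = (p t).pt.1 then (key _ hs).choose else (key _ rfl).choose
  have hG : ∀ᶠ s in 𝓝 t, p s = ⟨⟨_, (G s).1⟩, (G s).2⟩ := by
    filter_upwards [(Sym.arr_iff.1 h1).1] with s hs
    simp only [G]
    rw [dif_pos hs]
    exact (key _ hs).choose_spec
  have hL : ContinuousAt (fun s => arr (G s).2) t := SymN.inclArr_contAt.1 (h1.congr (hG.mono fun s hs =>
    congrArg (fun q : Inertia (Sym X) => arr q.loop) hs))
  let G' := fun s => if (G s).2.perm = (G t).2.perm then G s else G t
  have hG' : ∀ᶠ s in 𝓝 t, G s = G' s := by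
    filter_upwards [SymN.perm_eventually hL] with s hs
    exact (if_pos hs).symm
  refine ⟨_, (G t).2.perm, fun s => (G' s).1, fun s => (G' s).2, hL.congr (hG'.mono fun s hs =>
    congrArg (fun g : Σ x : SymN (p t).pt.1 X, (x ⟶ x) => arr g.2) hs), fun s => ?_, ?_⟩
  · by_cases hs : (G s).2.perm = (G t).2.perm
    · exact (congrArg (fun g : Σ x : SymN (p t).pt.1 X, (x ⟶ x) => g.2.perm) (if_pos hs)).trans hs
    · exact congrArg (fun g : Σ x : SymN (p t).pt.1 X, (x ⟶ x) => g.2.perm) (if_neg hs)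
  · filter_upwards [hG, hG'] with s hs hs'
    rw [← hs', hs]

/-- The restriction of an automorphism of a family to a cycle. -/
def Phi.cycle {n k : ℕ} {x : Fin n → X} (L : FamHom x x) (hk : 0 < k) (e : Fin k → Fin n)
    (h : ∀ a, L.perm (e a) = e (finRotate _ a)) : Phi X :=
  ⟨⟨⟨k, fun a => x (e a)⟩, (⟨finRotate _, fun a b hab => L.hom _ _ (by rw [h, hab])⟩ :
    FamHom (fun a => x (e a)) fun a => x (e a))⟩, hk, rfl⟩

theorem Phi.cycle_contAt {n k : ℕ} {G : T → SymN n X} {L : ∀ s, G s ⟶ G s}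
    (hL : ContinuousAt (fun s => arr (L s)) t) (hk : 0 < k) (e : Fin k → Fin n)
    (h : ∀ s a, (L s).perm (e a) = e (finRotate _ a)) :
    ContinuousAt (fun s => Phi.cycle (L s) hk e (h s)) t := by
  refine Phi.obj_iff.2 (SymN.inclArr_contAt (F := fun s => @arr (SymN k X) _ _ _
    (Phi.cycle (L s) hk e (h s)).loop) |>.2 (SymN.arr_iff.2 fun a => ⟨.of_forall fun s => rfl, ?_⟩))
  refine (SymN.arr_iff.1 hL (e a)).2.congr (.of_forall fun s => ?_)
  exact arr_hom_congr (L s) _ _ rfl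

/-- The decomposition into cycles is chosen in terms of the permutation only. -/
theorem Phi.parts_eq {n : ℕ} {x : Fin n → X} (L : FamHom x x) (σ : Equiv.Perm (Fin n)) (h : L.perm = σ) :
    Phi.parts ⟨⟨n, x⟩, L⟩ = ⟨numCycles σ, fun i => Phi.cycle L (cycleLen_pos σ i)
      (fun a => cycleEquiv σ ⟨i, a⟩) fun a => by rw [h, cycleEquiv_rotate]⟩ := by
  subst h; rfl

/-- The permutation of an automorphism of a family is locally constant, so that the chosen decomposition
into cycles is locally constant as well. -/
theorem Phi.parts_contAt {p : T → Inertia (Sym X)} (h : ContinuousAt p t) :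
    ContinuousAt (fun s => Phi.parts (p s)) t := by
  obtain ⟨n, σ, G, L, hL, hσ, hp⟩ := Inertia.exists_lift h
  refine ContinuousAt.congr (f := fun s => (⟨numCycles σ, fun i => Phi.cycle (L s) (cycleLen_pos σ i)
      (fun a => cycleEquiv σ ⟨i, a⟩) fun a => by rw [hσ, cycleEquiv_rotate]⟩ : Sym (Phi X))) ?_
    (hp.mono fun s hs => ?_)
  · exact SymN.incl_contAt.2 (continuousAt_pi.2 fun i => Phi.cycle_contAt hL _ _ _)
  · exact ((congrArg Phi.parts hs).trans (Phi.parts_eq _ _ (hσ s))).symm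

variable [TopGpd X]

/-- The reassembling isomorphism consists of a permutation which depends on the permutation of `L` only,
and of identities. -/
theorem Phi.reassemble_eq {n : ℕ} {x : Fin n → X} (L : FamHom x x) (σ : Equiv.Perm (Fin n)) (h : L.perm = σ)
    (i : Fin (∑ i, cycleLen σ i)) (j : Fin (Sym.cat fun i => ((Phi.parts ⟨⟨n, x⟩, L⟩).2 i).base).1)
    (hj : j.val = i.val) :
    ((Phi.reassemble ⟨⟨n, x⟩, L⟩).perm j : ℕ) = cycleEquiv σ (finSigmaFinEquiv.symm i) ∧
    arr ((Phi.reassemble ⟨⟨n, x⟩, L⟩).hom j _ rfl) =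
      arr (𝟙 (x (cycleEquiv σ (finSigmaFinEquiv.symm i)))) := by
  subst h
  obtain rfl : j = i := Fin.ext hj
  exact ⟨rfl, rfl⟩

theorem Phi.reassemble_contAt {p : T → Inertia (Sym X)} (h : ContinuousAt p t) :
    ContinuousAt (fun s => arr (Phi.reassemble (p s))) t := by
  obtain ⟨n, σ, G, L, hL, hσ, hp⟩ := Inertia.exists_lift h
  refine ContinuousAt.congr (f := fun s => arr (Phi.reassemble ⟨⟨n, G s⟩, L s⟩)) ?_
    (hp.mono fun s hs => congrArg (fun q => arr (Phi.reassemble q)) hs.symm)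
  have hn : ∀ s, (Sym.cat fun i => ((Phi.parts ⟨⟨n, G s⟩, L s⟩).2 i).base).1 = ∑ i, cycleLen σ i :=
    fun s => by rw [← hσ s]; rfl
  refine Sym.arr_iff.2 ⟨.of_forall fun s => (hn s).trans (hn t).symm, fun i => ⟨.of_forall fun s j hj => ?_,
    fun s => arr (𝟙 (G s (cycleEquiv σ (finSigmaFinEquiv.symm ⟨i.val, i.isLt.trans_eq (hn t)⟩)))), ?_,
    .of_forall fun s j hj => (Phi.reassemble_eq (L s) σ (hσ s) _ j hj).2⟩⟩
  · exact (Phi.reassemble_eq (L s) σ (hσ s) ⟨i.val, i.isLt.trans_eq (hn t)⟩ j hj).1.trans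
      (Phi.reassemble_eq (L t) σ (hσ t) ⟨i.val, i.isLt.trans_eq (hn t)⟩ i rfl).1.symm
  · exact TopGpd.id_cont.continuousAt.comp ((continuousAt_pi.1 (contAt_src (X := SymN n X) hL)) _)

theorem Phi.reassemble_inv_contAt {p : T → Inertia (Sym X)} (h : ContinuousAt p t) :
    ContinuousAt (fun s => arr (Groupoid.inv (Phi.reassemble (p s)))) t :=
  TopGpd.inv_cont.continuousAt.comp (Phi.reassemble_contAt h)

variable (X) in
/-- The functor which sends an automorphism of a family to the family of its cycles; it is inverse to
the concatenation functor. -/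
def partsFunctor : CFun (Inertia (Sym X)) (Sym (Phi X)) where
  obj := Phi.parts
  map := Phi.partsMap
  map_id p := Phi.cat_injective (o := (Phi.parts p).2) (o' := (Phi.parts p).2) <| by
    refine (Phi.partsMap_spec (𝟙 p)).trans (Eq.trans ?_ (Phi.under_sym_id _).symm)
    exact (congrArg (Phi.reassemble p ≫ ·) (Category.id_comp _)).trans (Groupoid.comp_inv _)
  map_comp {p q r} f g := Phi.cat_injective (o := (Phi.parts p).2) (o' := (Phi.parts r).2) <| by
    refine (Phi.partsMap_spec (f ≫ g)).trans (Eq.trans ?_ (Phi.under_sym_comp _ _).symm)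
    rw [Phi.partsMap_spec, Phi.partsMap_spec]
    change _ ≫ (f.1 ≫ g.1) ≫ _ = _
    simp [Groupoid.inv_eq_inv]
  obj_cont := continuous_iff_continuousAt.2 fun p => Phi.parts_contAt continuousAt_id
  map_cont := continuous_iff_continuousAt.2 fun a => by
    have h1 : ContinuousAt (fun a : Arr (Inertia (Sym X)) => a.src) a := ArrTop.src_cont.continuousAt
    have h2 : ContinuousAt (fun a : Arr (Inertia (Sym X)) => a.tgt) a := ArrTop.tgt_cont.continuousAt
    -- Concatenation reflects continuity of arrows, and the concatenated arrow is a conjugate of `s.hom`.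
    refine totalCat_reflect (Phi.parts_contAt h1) (Phi.parts_contAt h2) ?_
    refine ContinuousAt.congr (f := fun s : Arr (Inertia (Sym X)) => arr
      (Phi.reassemble s.src ≫ s.hom.1 ≫ Groupoid.inv (Phi.reassemble s.tgt))) ?_
      (.of_forall fun s => congrArg arr (Phi.partsMap_spec s.hom).symm)
    exact Sym.contAt_comp (Phi.reassemble_contAt h1) (Sym.contAt_comp
      (Inertia.arr_iff.1 (continuousAt_id (X := Arr (Inertia (Sym X))) (x := a))).2.2
      (Phi.reassemble_inv_contAt h2))

/-- The natural isomorphism from the concatenation of the cycles to the identity. -/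
def Phi.counit (p : Inertia (Sym X)) : (totalCat X).obj (Phi.parts p) ⟶ p :=
  ⟨Phi.reassemble p, Phi.reassemble_loop p⟩

theorem Phi.counit_nat {p q : Inertia (Sym X)} (h : p ⟶ q) :
    (totalCat X).map ((partsFunctor X).map h) ≫ Phi.counit q = Phi.counit p ≫ h := by
  refine Subtype.ext ((congrArg (· ≫ Phi.reassemble q) (Phi.partsMap_spec h)).trans ?_)
  change _ = Phi.reassemble p ≫ h.1
  simp [Groupoid.inv_eq_inv]

theorem Phi.counit_cont : Continuous fun p : Inertia (Sym X) => arr (Phi.counit p) :=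
  continuous_iff_continuousAt.2 fun p => Inertia.arr_iff.2
    ⟨Inertia.obj_iff.1 ((totalCat X).obj_cont.comp (partsFunctor X).obj_cont).continuousAt,
      Inertia.obj_iff.1 continuousAt_id, Phi.reassemble_contAt continuousAt_id⟩

/-- Concatenation is full, so the reassembling isomorphism of a concatenation comes from an isomorphism of
families of cycles. -/
theorem Phi.exists_unit (o : Sym (Phi X)) : ∃ f : Phi.parts ((totalCat X).obj o) ⟶ o,
    Sym.catMap (Phi.under f) = Phi.reassemble ((totalCat X).obj o) :=
  Phi.exists_cat (o := (Phi.parts ((totalCat X).obj o)).2) (o' := o.2) _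
    (Phi.reassemble_loop ((totalCat X).obj o))

/-- The natural isomorphism from the cycles of a concatenation to the identity. -/
def Phi.unit (o : Sym (Phi X)) : Phi.parts ((totalCat X).obj o) ⟶ o := (Phi.exists_unit o).choose

theorem Phi.unit_spec (o : Sym (Phi X)) :
    Sym.catMap (Phi.under (Phi.unit o)) = Phi.reassemble ((totalCat X).obj o) :=
  (Phi.exists_unit o).choose_spec

theorem Phi.unit_nat {o o' : Sym (Phi X)} (h : o ⟶ o') :
    (partsFunctor X).map ((totalCat X).map h) ≫ Phi.unit o' = Phi.unit o ≫ h :=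
  Phi.cat_injective (o := (Phi.parts ((totalCat X).obj o)).2) (o' := o'.2) <| by
    refine (Phi.under_sym_comp _ _).trans (Eq.trans ?_ (Phi.under_sym_comp _ _).symm)
    refine (congrArg₂ (· ≫ ·) (Phi.partsMap_spec ((totalCat X).map h)) (Phi.unit_spec o')).trans
      (Eq.trans ?_ (congrArg (· ≫ Sym.catMap (Phi.under h)) (Phi.unit_spec o)).symm)
    have e : ∀ {a b c d : Sym X} (u : a ⟶ b) (v : b ⟶ c) (w : d ⟶ c),
        (u ≫ v ≫ Groupoid.inv w) ≫ w = u ≫ v := fun u v w => by simp [Groupoid.inv_eq_inv]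
    exact e _ _ _

theorem Phi.unit_cont : Continuous fun o : Sym (Phi X) => arr (Phi.unit o) :=
  continuous_iff_continuousAt.2 fun o => totalCat_reflect
    ((partsFunctor X).obj_cont.comp (totalCat X).obj_cont).continuousAt continuousAt_id <| by
    refine (Phi.reassemble_contAt (totalCat X).obj_cont.continuousAt).congr (.of_forall fun o => ?_)
    exact congrArg arr (Phi.unit_spec o).symm

end PartsFunctor

/-! ### Bundles on the total symmetric power -/

section SigmaBundle

variable {B : ℕ → Type u} [∀ n, TopologicalSpace (B n)] {T : Type*} [TopologicalSpace T] {t : T}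

/-- The vector bundle on a coproduct which is given by vector bundles on the summands. -/
def VB.sigma (E : ∀ n, VB (B n)) : VB (Σ n, B n) where
  fib b := (E b.1).fib b.2
  top := TopologicalSpace.induced (fun p : Σ b : Σ n, B n, (E b.1).fib b.2 =>
    (⟨p.1.1, (E p.1.1).pt p.1.2 p.2⟩ : Σ n, (E n).Tot)) inferInstance
  locTriv := locTriv_of_isLT _ fun ⟨n, b⟩ => by
    classical
    obtain ⟨k, U, τ, hb, h⟩ := (E n).exists_lt b
    -- The trivialization of `E n` near `b`, extended by zero to the other summands.
    let σ : ∀ m (y : B m), (E m).fib y →ₗ[ℂ] (Fin k → ℂ) := fun m y =>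
      if hm : m = n then by subst hm; exact τ y else 0
    have hσ : ∀ y, σ n y = τ y := fun b => by simp [σ]
    refine ⟨Fin k, inferInstance, Sigma.mk n '' U, fun b => σ b.1 b.2, ⟨b, hb, rfl⟩,
      isLT_of_induced (isOpenMap_sigmaMk _ h.isOpen) ?_
      (fun p : Σ n, (E n).Tot => ((⟨p.1, p.2.1⟩ : Σ n, B n), σ p.1 p.2.1 p.2.2)) id id ?_
      (fun y hy v => continuousAt_id) (fun y hy v => continuousAt_id) (fun p => rfl) (fun p hp => rfl)⟩
    · rintro _ ⟨y, hy, rfl⟩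
      have := h.bij y hy
      rwa [← hσ] at this
    · rintro _ ⟨y, hy, rfl⟩ v
      change 𝓝 (⟨n, (E n).pt y v⟩ : Σ n, (E n).Tot) = comap _ (𝓝 ((⟨n, y⟩ : Σ n, B n), σ n y v))
      rw [Sigma.nhds_mk, h.nhds' hy v, hσ, nhds_prod_eq (x := (⟨n, y⟩ : Σ n, B n)), Sigma.nhds_mk,
        ← Filter.map_id (f := 𝓝 (τ y v)), Filter.prod_map_map_eq, ← nhds_prod_eq]
      ext s
      simp only [mem_map, mem_comap]
      constructor
      · rintro ⟨r, hr, hs⟩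
        refine ⟨_, Filter.mem_of_superset hr (Set.subset_preimage_image _ r), ?_⟩
        rintro ⟨i, p⟩ ⟨⟨y', c⟩, hp, he⟩
        obtain rfl : n = i := congrArg (fun q : (Σ n, B n) × (Fin k → ℂ) => q.1.1) he
        have h1 : y' = p.1 := by simpa using congrArg Prod.fst he
        have h2 : c = τ p.1 p.2 := (congrArg Prod.snd he).trans (congrFun (congrArg DFunLike.coe (hσ p.1)) p.2)
        subst h1 h2
        exact hs hp
      · rintro ⟨r, hr, hs⟩
        refine ⟨_, hr, fun p hp => hs ?_⟩
        change ((⟨n, p.1⟩ : Σ n, B n), σ n p.1 p.2) ∈ r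
        rw [hσ]
        exact hp

theorem VB.sigma_iff (E : ∀ n, VB (B n)) {n : ℕ} {g : T → B n} {v : ∀ s, (E n).fib (g s)} :
    ContinuousAt (fun s => (VB.sigma E).pt ⟨n, g s⟩ (v s)) t ↔
      ContinuousAt (fun s => (E n).pt (g s) (v s)) t :=
  (Topology.IsInducing.continuousAt_iff (f := fun s => (VB.sigma E).pt ⟨n, g s⟩ (v s)) ⟨rfl⟩).trans
    (Topology.IsEmbedding.sigmaMk (σ := fun i => (E i).Tot)).isInducing.continuousAt_iff.symm

end SigmaBundle

section Glue

variable {Y : Type u} [Groupoid.{u} Y] [TopologicalSpace Y] [ArrTop Y]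

/-- The vector bundle underlying `GB.glue`. -/
def SymN.glueVB (W : ∀ n, GB (SymN n Y)) : VB (Sym Y) := VB.sigma fun n => (W n).vb

/-- The action of arrows on `GB.glue`. -/
def SymN.glueAct (W : ∀ n, GB (SymN n Y)) {x y : Sym Y} (f : x ⟶ y) :
    (SymN.glueVB W).fib x →ₗ[ℂ] (SymN.glueVB W).fib y :=
  match x, y, Sym.hn f, f with
  | ⟨n, x⟩, ⟨_, y⟩, rfl, f => (W n).act (x := x) (y := y) f

/-- Arrows only exist between families of the same size, so that they come from a summand. -/
theorem Sym.arrow_induction {P : ∀ {x y : Sym Y}, (x ⟶ y) → Prop}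
    (h : ∀ n (x y : SymN n Y) (f : x ⟶ y), P ((SymN.incl n Y).map f)) {x y : Sym Y} (f : x ⟶ y) : P f := by
  obtain ⟨n, x⟩ := x
  obtain ⟨m, y⟩ := y
  obtain rfl : m = n := Sym.hn f
  exact h _ x y f

/-- Locally, a continuous family of vectors in a bundle on the total symmetric power lies over one
summand. -/
theorem SymN.exists_tot {E : VB (Sym Y)} {T : Type*} [TopologicalSpace T] {t : T} {p : T → E.Tot}
    (h : ContinuousAt p t) : ∃ (n : ℕ) (q : T → (E.pull _ (SymN.incl n Y).obj_cont).Tot), ContinuousAt q t ∧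
      ∀ᶠ s in 𝓝 t, p s = E.pt ⟨n, (q s).1⟩ (q s).2 := by
  classical
  have key : ∀ a : E.Tot, a.1.1 = (p t).1.1 →
      ∃ q : (E.pull _ (SymN.incl (p t).1.1 Y).obj_cont).Tot, a = E.pt ⟨_, q.1⟩ q.2 := by
    generalize (p t).1.1 = m
    rintro ⟨⟨m', x⟩, v⟩ rfl
    exact ⟨⟨x, v⟩, rfl⟩
  have h1 : ContinuousAt (fun s => (p s).1) t := E.contFst.continuousAt.comp h
  let q : T → (E.pull _ (SymN.incl (p t).1.1 Y).obj_cont).Tot := fun s =>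
    if hs : (p s).1.1 = (p t).1.1 then (key _ hs).choose else (key _ rfl).choose
  have hq : ∀ᶠ s in 𝓝 t, p s = E.pt ⟨_, (q s).1⟩ (q s).2 := by
    filter_upwards [eventually_fam_card h1] with s hs
    simp only [q]
    rw [dif_pos hs]
    exact (key _ hs).choose_spec
  have h2 : ContinuousAt (fun s => E.pt ⟨_, (q s).1⟩ (q s).2) t := h.congr hq
  exact ⟨_, q, (E.pull_iff _ (SymN.incl _ Y).obj_cont (g := fun s => (q s).1) (v := fun s => (q s).2)).2
    ⟨SymN.incl_contAt.1 (E.contFst.continuousAt.comp h2), h2⟩, hq⟩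

/-- The vector bundle on the total symmetric power which is given by vector bundles on the summands. -/
def GB.glue (W : ∀ n, GB (SymN n Y)) : GB (Sym Y) where
  vb := SymN.glueVB W
  act f := SymN.glueAct W f
  act_id x v := (W x.1).act_id x.2 v
  act_comp {x y z} f g v := by
    obtain ⟨n, x⟩ := x
    obtain ⟨m, y⟩ := y
    obtain ⟨l, z⟩ := z
    obtain rfl : m = n := Sym.hn f
    obtain rfl : l = m := Sym.hn g
    exact (W _).act_comp (x := x) (y := y) (z := z) f g v
  act_cont := continuous_iff_continuousAt.2 fun p => by
    have h := ActDom.cont _ p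
    -- Near `p`, the pairs of an arrow and a vector come from the summand of `p`.
    obtain ⟨F, hF⟩ := SymN.exists_inclArr (f := fun q : ActDom (SymN.glueVB W) => q.1) (t := p)
      (ArrTop.src_cont.continuousAt.comp h.1)
    have hFc : ContinuousAt F p := SymN.inclArr_contAt.1 (h.1.congr hF)
    classical
    have key : ∀ (q : ActDom (SymN.glueVB W)) (a : Arr (SymN p.1.src.1 Y)), q.1 = SymN.inclArr a →
        ∃ v : (W p.1.src.1).vb.fib a.src, q = ⟨SymN.inclArr a, v⟩ := by
      rintro ⟨_, w⟩ a rfl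
      exact ⟨w, rfl⟩
    let v : ∀ q, (W p.1.src.1).vb.fib (F q).src := fun q =>
      if hq : q.1 = SymN.inclArr (F q) then (key q _ hq).choose else 0
    have hv : ∀ᶠ q in 𝓝 p, q = ⟨SymN.inclArr (F q), v q⟩ := by
      filter_upwards [hF] with q hq
      simp only [v, dif_pos hq]
      exact (key q _ hq).choose_spec
    refine ContinuousAt.congr (f := fun q => (SymN.glueVB W).pt ⟨_, (F q).tgt⟩ ((W _).act (F q).hom (v q))) ?_
      (hv.mono fun q hq => congrArg (fun q : ActDom (SymN.glueVB W) =>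
        (SymN.glueVB W).pt q.1.tgt (SymN.glueAct W q.1.hom q.2)) hq.symm)
    refine (VB.sigma_iff (fun n => (W n).vb)).2 ((W _).contAt hFc ((VB.sigma_iff (fun n => (W n).vb)).1 ?_))
    exact h.2.congr (hv.mono fun q hq => congrArg (fun q : ActDom (SymN.glueVB W) =>
      (SymN.glueVB W).pt q.1.src q.2) hq)

theorem GB.glue_incl (W : ∀ n, GB (SymN n Y)) (n : ℕ) : ((GB.glue W).pull (SymN.incl n Y)).Iso (W n) := by
  refine GB.iso_of_bij (fun x => LinearMap.id) (continuous_iff_continuousAt.2 fun p => ?_)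
    (fun x => Function.bijective_id) fun x y f v => rfl
  have h := ((GB.glue W).vb.pull_iff _ (SymN.incl n Y).obj_cont).1 (continuousAt_id (x := p))
  exact (VB.sigma_iff (fun n => (W n).vb)).1 h.2

/-- Vector bundles on the total symmetric power are isomorphic if their restrictions to the summands
are. -/
theorem GB.iso_of_incl {V W : GB (Sym Y)} (h : ∀ n, (V.pull (SymN.incl n Y)).Iso (W.pull (SymN.incl n Y))) :
    V.Iso W := by
  choose e h1 h2 h3 using h
  let e' : ∀ x : Sym Y, V.vb.fib x ≃ₗ[ℂ] W.vb.fib x := fun x => e x.1 (show SymN x.1 Y from x.2)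
  refine GB.iso_of_bij (fun x => (e' x).toLinearMap) (continuous_iff_continuousAt.2 fun p => ?_)
    (fun x => (e' x).bijective) fun x y f v => ?_
  · obtain ⟨n, q, hq, hp⟩ := SymN.exists_tot (continuousAt_id (x := p))
    refine ContinuousAt.congr (f := fun s => W.vb.pt ⟨n, (q s).1⟩ (e n (q s).1 (q s).2)) ?_
      (hp.mono fun s hs => congrArg (fun s : V.vb.Tot => W.vb.pt s.1 (e' s.1 s.2)) hs.symm)
    exact ((W.vb.pull_iff _ (SymN.incl n Y).obj_cont).1 ((h2 n).continuousAt.comp hq)).2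
  · revert v
    refine Sym.arrow_induction (P := fun {x y} f => ∀ v : V.vb.fib x,
      e' y (V.act f v) = W.act f (e' x v)) (fun n x y f v => h1 n x y f v) f

end Glue

section PullIso

variable {A B C : Type u} [Groupoid.{u} A] [TopologicalSpace A] [ArrTop A]
  [Groupoid.{u} B] [TopologicalSpace B] [ArrTop B] [Groupoid.{u} C] [TopologicalSpace C] [ArrTop C]

theorem GB.pull_congr (F : CFun A B) {V W : GB B} (h : V.Iso W) : (V.pull F).Iso (W.pull F) := by
  obtain ⟨e, h1, h2, h3⟩ := h
  refine GB.iso_of_bij (fun x => (e (F.obj x)).toLinearMap) (continuous_iff_continuousAt.2 fun p => ?_)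
    (fun x => (e (F.obj x)).bijective) fun x y f v => h1 _ _ _ _
  have h := (VB.pull_iff _ F.obj F.obj_cont).1 (continuousAt_id (X := (V.pull F).vb.Tot) (x := p))
  exact (VB.pull_iff _ F.obj F.obj_cont).2 ⟨h.1, h2.continuousAt.comp h.2⟩

theorem GB.pull_comp (F : CFun A B) (G : CFun B C) (V : GB C) : ((V.pull G).pull F).Iso (V.pull (F.comp G)) := by
  refine GB.iso_of_bij (fun x => LinearMap.id) (continuous_iff_continuousAt.2 fun p => ?_)
    (fun x => Function.bijective_id) fun x y f v => rfl
  have h := (VB.pull_iff _ F.obj F.obj_cont).1 (continuousAt_id (X := ((V.pull G).pull F).vb.Tot) (x := p))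
  exact (VB.pull_iff _ _ (F.comp G).obj_cont).2 ⟨h.1, ((VB.pull_iff _ G.obj G.obj_cont).1 h.2).2⟩

/-- Pull-backs along naturally isomorphic functors are isomorphic. -/
theorem GB.pull_natIso (F G : CFun A B) (V : GB B) (η : ∀ x, F.obj x ⟶ G.obj x)
    (hη : Continuous fun x => arr (η x)) (hn : ∀ x y (f : x ⟶ y), F.map f ≫ η y = η x ≫ G.map f) :
    (V.pull F).Iso (V.pull G) := by
  refine GB.iso_of_bij (fun x => V.act (η x)) (continuous_iff_continuousAt.2 fun p => ?_)
    (fun x => ⟨V.act_inj _, fun v => ⟨V.act (Groupoid.inv (η x)) v, ?_⟩⟩) fun x y f v => ?_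
  · have h := (VB.pull_iff _ F.obj F.obj_cont).1 (continuousAt_id (X := (V.pull F).vb.Tot) (x := p))
    exact (VB.pull_iff _ _ G.obj_cont).2 ⟨h.1, V.contAt (hη.continuousAt.comp h.1) h.2⟩
  · refine (V.act_comp _ _ _).symm.trans (Eq.trans ?_ (V.act_id _ v))
    exact congrArg (fun k => V.act k v) (Groupoid.inv_comp _)
  · refine (V.act_comp _ _ _).symm.trans (Eq.trans ?_ (V.act_comp _ _ _))
    exact congrArg (fun k => V.act k v) (hn _ _ _)

/-- The pull-back along a functor which is naturally isomorphic to the identity is isomorphic to the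
bundle. -/
theorem GB.pull_id (V : GB A) (F : CFun A A) (η : ∀ x, F.obj x ⟶ x) (hη : Continuous fun x => arr (η x))
    (hn : ∀ x y (f : x ⟶ y), F.map f ≫ η y = η x ≫ f) : (V.pull F).Iso V := by
  let I : CFun A A := ⟨𝟭 A, continuous_id, continuous_id⟩
  refine (GB.pull_natIso F I V η hη hn).trans (GB.iso_of_bij (fun x => LinearMap.id)
    (continuous_iff_continuousAt.2 fun p => ?_) (fun x => Function.bijective_id) fun x y f v => rfl)
  exact ((VB.pull_iff _ I.obj I.obj_cont).1 (continuousAt_id (X := (V.pull I).vb.Tot) (x := p))).2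

end PullIso

section Bijective

variable {Y : Type u} [Groupoid.{u} Y] [TopologicalSpace Y] [ArrTop Y] (ξ : Cen Y)

/-- The center element of the total symmetric power. -/
def Cen.sym : Cen (Sym Y) where
  app x := (SymN.incl x.1 Y).map ((ξ.symN x.1).app x.2)
  nat {x y} f := Sym.arrow_induction (P := fun {x y} f => (SymN.incl x.1 Y).map ((ξ.symN x.1).app x.2) ≫ f =
    f ≫ (SymN.incl y.1 Y).map ((ξ.symN y.1).app y.2)) (fun n x y f => (ξ.symN n).nat f) f
  cont := continuous_sigma fun n => (SymN.incl n Y).map_cont.comp (ξ.symN n).cont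

/-- The series on the total symmetric power which is given by series on the summands. -/
def Series.glue {ξ : Cen Y} (V : ∀ n, Series (ξ.symN n)) : Series ξ.sym where
  coef a := GB.glue fun n => (V n).coef a
  rot a x v := (V x.1).rot a x.2 v
  locfin x := by
    obtain ⟨N, hN, h⟩ := (V x.1).locfin x.2
    refine ⟨N, hN, ?_⟩
    have h1 : 𝓝 x = map (Sigma.mk x.1) (𝓝 x.2) := Sigma.nhds_eq x
    rw [h1]
    exact h

variable {X : Type u} [Groupoid.{u} X] [TopologicalSpace X] [ArrTop X] [TopGpd X]

theorem partsFunctor_compat : (partsFunctor X).Compat (Inertia.cen (Sym X)) (Phi.cen X).sym := fun p =>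
  Phi.cat_injective (o := (Phi.parts p).2) (o' := (Phi.parts p).2) <| by
    refine (Phi.partsMap_spec ((Inertia.cen (Sym X)).app p)).trans ?_
    have h := congrArg Subtype.val (catFun_compat X (Phi.parts p).1 (Phi.parts p).2)
    refine Eq.trans ?_ h.symm
    change Phi.reassemble p ≫ p.loop ≫ _ = Phi.catLoop (Phi.parts p).2
    rw [← Category.assoc, ← Phi.reassemble_loop]
    simp [Groupoid.inv_eq_inv]

/-- Every sequence of bundles on the groupoids of `n` cycles is the restriction along `Q` of a bundle on
the inertia groupoid. -/
theorem GB.catFun_parts_glue (W : ∀ n, GB (SymN n (Phi X))) (n : ℕ) :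
    (((GB.glue W).pull (partsFunctor X)).pull (catFun X n)).Iso (W n) := by
  refine Iso.trans ?_ (GB.glue_incl W n)
  have h := GB.pull_congr (SymN.incl n (Phi X)) (GB.pull_id (GB.glue W) ((totalCat X).comp (partsFunctor X))
    Phi.unit Phi.unit_cont fun x y f => Phi.unit_nat f)
  refine Iso.trans ?_ h
  exact (GB.pull_comp _ _ _).trans (GB.pull_comp (SymN.incl n (Phi X)) ((totalCat X).comp (partsFunctor X))
    (GB.glue W)).symm

/-- `Q` is an equivalence, so bundles on the inertia groupoid are isomorphic if their restrictions along
`Q` are. -/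
theorem GB.iso_of_catFun {V W : GB (Inertia (Sym X))} (h : ∀ n, (V.pull (catFun X n)).Iso (W.pull (catFun X n))) :
    V.Iso W := by
  have key : ∀ V : GB (Inertia (Sym X)), ((V.pull (totalCat X)).pull (partsFunctor X)).Iso V := fun V =>
    (GB.pull_comp _ _ _).trans (GB.pull_id V ((partsFunctor X).comp (totalCat X)) Phi.counit Phi.counit_cont
      fun x y f => Phi.counit_nat f)
  refine (key V).symm.trans (Iso.trans (GB.pull_congr _ (GB.iso_of_incl fun n => ?_)) (key W))
  exact (GB.pull_comp _ _ _).trans ((h n).trans (GB.pull_comp (SymN.incl n (Phi X)) (totalCat X) W).symm)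

/-- The pull-back `Q^*` is bijective. -/
theorem KTate.pullQ_bijective : Function.Bijective (KTate.pullQ X) := by
  have hQ : ∀ x n, KTate.pullQ X x n = (Series.pull_addOp (catFun X n) (catFun_compat X n)).hom x :=
    fun x n => (Series.pull_addOp (catFun X n) (catFun_compat X n)).map_eq x
  -- Every sequence of series is, up to isomorphism, the pull-back of one series.
  have hex : ∀ V : ∀ n, Series ((Phi.cen X).symN n), ∃ U : Series (Inertia.cen (Sym X)),
      ∀ n, U.pull (catFun X n) (catFun_compat X n) ≈ V n := fun V =>
    ⟨(Series.glue V).pull (partsFunctor X) partsFunctor_compat, fun n a => GB.catFun_parts_glue _ n⟩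
  constructor
  · intro x y h
    rw [← sub_eq_zero]
    have h1 : ∀ n, (Series.pull_addOp (catFun X n) (catFun_compat X n)).hom (x - y) = 0 := fun n => by
      rw [map_sub, ← hQ, ← hQ, h, sub_self]
    generalize x - y = z at h1
    obtain ⟨⟨A, B⟩, rfl⟩ := z.exists_rep
    simp only [map_sub, AddOp.hom_cls, sub_eq_zero] at h1
    -- The two series become isomorphic over each summand after adding some `C n`; the series `C n` are the
    -- restrictions of a single series `U`.
    choose C hC using fun n => Series.cls_eq_iff.1 (h1 n)
    obtain ⟨U, hU⟩ := hex C
    refine sub_eq_zero.2 (Series.cls_eq_iff.2 ⟨U, fun a => GB.iso_of_catFun fun n => ?_⟩)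
    have h2 : ∀ A : Series (Inertia.cen (Sym X)), (A.sum U).pull (catFun X n) (catFun_compat X n) ≈
        (A.pull (catFun X n) (catFun_compat X n)).sum (C n) := fun A =>
      Setoid.trans ((Series.pull_addOp (catFun X n) (catFun_compat X n)).add A U)
        (Series.sum_congr (Setoid.refl _) (hU n))
    exact (Setoid.trans (h2 A) (Setoid.trans (hC n) (Setoid.symm (h2 B)))) a
  · intro y
    obtain ⟨A, hA⟩ := hex fun n => (y n).rep.1
    obtain ⟨B, hB⟩ := hex fun n => (y n).rep.2
    refine ⟨A.cls - B.cls, funext fun n => ?_⟩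
    rw [hQ, map_sub, AddOp.hom_cls, AddOp.hom_cls, Series.cls_eq (hA n), Series.cls_eq (hB n)]
    exact (y n).rep_spec.symm

end Bijective

/-! ### Limits over equivalent diagrams -/

section LimEquiv

variable {Z : Type u} [Groupoid.{u} Z] [TopologicalSpace Z] [ArrTop Z]
  {Y : Type u} [Groupoid.{u} Y] [TopologicalSpace Y] [ArrTop Y] {K : Type} [Groupoid.{0} K]

/-- The limit only depends on the isomorphism classes of those objects of the diagram at which the
bundle does not vanish. -/
theorem GB.lim_equiv (D : Diag Z Y K) {I J : Type} (o : I → K) (o' : J → K) (V : GB Y) [Finite I] [Finite J]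
    [∀ k k' : K, Finite (k ⟶ k')] (hid : Continuous fun z : Z => arr (𝟙 z))
    (h1 : ∀ i, (∃ j, Nonempty (o' j ⟶ o i)) ∨ ∀ z, Subsingleton (V.vb.fib (D.obj (o i) z)))
    (h2 : ∀ j, (∃ i, Nonempty (o i ⟶ o' j)) ∨ ∀ z, Subsingleton (V.vb.fib (D.obj (o' j) z))) :
    (GB.lim D o V hid).Iso (GB.lim D o' V hid) := by
  -- A compatible family at the objects `o i` determines one at the objects `o' j`.
  have key : ∀ {I J : Type} (o : I → K) (o' : J → K) [Finite I] [Finite J]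
      (h2 : ∀ j, (∃ i, Nonempty (o i ⟶ o' j)) ∨ ∀ z, Subsingleton (V.vb.fib (D.obj (o' j) z)))
      z (v : (GB.lim D o V hid).vb.fib z),
      ∃ w : (GB.lim D o' V hid).vb.fib z, ∀ i j (α : o i ⟶ o' j),
        V.act (D.map α (𝟙 z)) (v.1 i) = w.1 j := by
    intro I J o o' _ _ h2 z v
    have h : ∀ j, ∃ w : V.vb.fib (D.obj (o' j) z), ∀ i (α : o i ⟶ o' j),
        V.act (D.map α (𝟙 z)) (v.1 i) = w := fun j => by
      rcases h2 j with ⟨i, ⟨a⟩⟩ | h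
      · refine ⟨V.act (D.map a (𝟙 z)) (v.1 i), fun i' α => ?_⟩
        rw [← v.2 i' i (α ≫ Groupoid.inv a), ← V.act_comp, ← D.map_comp]
        simp
      · exact ⟨0, fun _ _ => (h z).elim _ _⟩
    choose w hw using h
    refine ⟨⟨w, fun j j' β => ?_⟩, fun i j => hw j i⟩
    rcases h2 j with ⟨i, ⟨a⟩⟩ | h
    · rw [← hw j i a, ← V.act_comp, ← D.map_comp, Category.id_comp]
      exact hw _ _ _
    · refine V.act_inj (D.map (Groupoid.inv β) (𝟙 z)) ((h z).elim _ _)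
  refine GB.iso_of_joint (I := Σ i j, (o i ⟶ o' j)) (fun _ => V.vb) (fun q => D.obj (o' q.2.1))
    (fun q z => V.act (D.map q.2.2 (𝟙 z)) ∘ₗ GB.limEv D o V hid q.1 z)
    (fun q z => GB.limEv D o' V hid q.2.1 z) (fun q => ?_) (fun q => GB.limEv_cont D o' V hid q.2.1)
    (fun z v h => ?_) (fun z w h => ?_) (fun z v => ?_) (fun z w => ?_) (fun z z' k v w h q => ?_)
  · exact continuous_iff_continuousAt.2 fun p => V.contAt ((D.map_cont _).continuousAt.comp
      (hid.continuousAt.comp ((GB.lim D o V hid).vb.contFst.continuousAt)))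
      (GB.limEv_cont D o V hid q.1).continuousAt
  · refine GB.lim_ext D o V hid fun i => ?_
    rcases h1 i with ⟨j, ⟨β⟩⟩ | h'
    · exact V.act_inj (D.map (Groupoid.inv β) (𝟙 z)) ((h ⟨i, j, Groupoid.inv β⟩).trans (map_zero _).symm)
    · exact (h' z).elim _ _
  · refine GB.lim_ext D o' V hid fun j => ?_
    rcases h2 j with ⟨i, ⟨α⟩⟩ | h'
    · exact h ⟨i, j, α⟩
    · exact (h' z).elim _ _
  · obtain ⟨w, hw⟩ := key o o' h2 z v
    exact ⟨w, fun q => hw _ _ _⟩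
  · obtain ⟨v, hv⟩ := key o' o h1 z w
    refine ⟨v, fun q => ?_⟩
    change V.act (D.map q.2.2 (𝟙 z)) (v.1 q.1) = w.1 q.2.1
    rw [← hv q.2.1 q.1 (Groupoid.inv q.2.2), ← V.act_comp, ← D.map_comp, Groupoid.inv_comp,
      Category.id_comp, D.map_id, V.act_id]
  · change V.act _ (V.act _ (v.1 q.1)) = V.act _ (w.1 q.2.1)
    rw [← V.act_comp, ← D.map_left, D.map_right, V.act_comp]
    exact congrArg _ (h q)

end LimEquiv

/-! ### The shapes of the symmetric powers -/

/-- The groupoid with a single arrow. -/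
def Pt : Type := PUnit

/-- The only object. -/
def Pt.pt : Pt := ⟨⟩

instance : Groupoid.{0} Pt where
  Hom _ _ := PUnit
  id _ := ⟨⟩
  comp _ _ := ⟨⟩
  inv _ := ⟨⟩

instance : Finite Pt := inferInstanceAs (Finite PUnit)
instance : Subsingleton Pt := inferInstanceAs (Subsingleton PUnit)

instance : TopologicalSpace Pt := ⊥

instance : ArrTop Pt := ArrTop.ofCode fun _ => ()

instance : Sized Pt where
  len _ := 1
  len_pos _ := one_pos
  fin_len _ := inferInstance
  fin_hom _ _ := inferInstanceAs (Finite PUnit)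
  len_eq _ := rfl

theorem FamHom.ext_pt {I J : Type} {x : I → Pt} {y : J → Pt} {A B : FamHom x y} (h : A.perm = B.perm) :
    A = B := FamHom.ext h fun _ _ _ _ => Subsingleton.elim (α := PUnit) _ _

theorem Phi.ext_pt {k k' : Phi Pt} {f g : k ⟶ k'} (h : (Phi.val f).perm = (Phi.val g).perm) : f = g :=
  Subtype.ext (FamHom.ext_pt h)

/-- There is one standard cycle of each length in the point. -/
theorem Phi.ext_len {k k' : Phi Pt} (h : k.len = k'.len) : k = k' := by
  obtain ⟨⟨⟨n, x⟩, L⟩, h1, h2⟩ := k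
  obtain ⟨⟨⟨n', x'⟩, L'⟩, h1', h2'⟩ := k'
  obtain rfl : n = n' := h
  obtain rfl : x = x' := funext fun _ => Subsingleton.elim (α := Pt) _ _
  obtain rfl : L = L' := FamHom.ext_pt (h2.trans h2'.symm)
  rfl

instance : Sized (Phi Pt) where
  len := Phi.len
  len_pos k := k.pos
  fin_len n := Finite.of_injective (β := Fin (n + 1)) (fun k => ⟨k.1.len, Nat.lt_succ_of_le k.2⟩)
    fun k k' h => Subtype.ext (Phi.ext_len (congrArg Fin.val h))
  fin_hom k k' := Finite.of_injective (β := Fin k.base.1 ≃ Fin k'.base.1) (fun f => (Phi.val f).perm)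
    fun f g h => Phi.ext_pt h
  len_eq f := Phi.len_eq f

instance (p q : Inertia (Sym Pt)) : Finite (p ⟶ q) :=
  Finite.of_injective (β := Fin p.pt.1 ≃ Fin q.pt.1) (fun f => f.1.perm) fun f g h => Subtype.ext (FamHom.ext_pt h)

section Const

variable {X : Type u} [Groupoid.{u} X]

/-- A constant family of arrows. -/
def FamHom.const {I J : Type} (e : I ≃ J) {x y : X} (f : x ⟶ y) :
    FamHom (fun _ : I => x) fun _ : J => y := ⟨e, fun _ _ _ => f⟩

variable [TopologicalSpace X] [ArrTop X]

theorem FamHom.const_contAt {T : Type*} [TopologicalSpace T] {t : T} {n m : ℕ} (e : Fin n ≃ Fin m)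
    {x y : T → X} {f : ∀ s, x s ⟶ y s} (hf : ContinuousAt (fun s => arr (f s)) t) :
    ContinuousAt (fun s => @arr (Sym X) _ ⟨n, fun _ => x s⟩ ⟨m, fun _ => y s⟩ (FamHom.const e (f s))) t :=
  Sym.arr_iff.2 ⟨.of_forall fun _ => rfl, fun i => ⟨.of_forall fun s j hj => by rw [Fin.ext hj]; rfl,
    fun s => arr (f s), hf, .of_forall fun _ _ _ => rfl⟩⟩

theorem Diag.inertia_aux {σ τ : Inertia (Sym Pt)} {p q : Inertia X} (α : σ ⟶ τ) (f : p ⟶ q) :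
    FamHom.const (σ.loop.perm.trans α.1.perm) (p.loop ≫ f.1) =
      FamHom.const (α.1.perm.trans τ.loop.perm) (f.1 ≫ q.loop) := by
  have h : σ.loop.perm.trans α.1.perm = α.1.perm.trans τ.loop.perm := congrArg FamHom.perm α.2
  rw [h, f.2]

variable (X) in
/-- An automorphism of a finite set and an automorphism in `X` give an automorphism of a constant family
in `X`. -/
def Diag.inertia : Diag (Inertia X) (Inertia (Sym X)) (Inertia (Sym Pt)) where
  obj σ p := ⟨⟨σ.pt.1, fun _ => p.pt⟩, FamHom.const σ.loop.perm p.loop⟩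
  map α f := ⟨FamHom.const α.1.perm f.1, Diag.inertia_aux α f⟩
  map_id _ _ := rfl
  map_comp _ _ _ _ := rfl
  obj_cont σ := continuous_iff_continuousAt.2 fun p => Inertia.obj_iff.2
    (FamHom.const_contAt _ (Inertia.obj_iff.1 continuousAt_id))
  map_cont α := continuous_iff_continuousAt.2 fun a => by
    have h := Inertia.arr_iff.1 (continuousAt_id (X := Arr (Inertia X)) (x := a))
    exact Inertia.arr_iff.2 ⟨FamHom.const_contAt _ h.1, FamHom.const_contAt _ h.2.1,
      FamHom.const_contAt _ h.2.2⟩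

variable (X) in
/-- A standard cycle and an automorphism in `X` give an object of `Φ(X)`. -/
def Diag.cycle : Diag (Inertia X) (Phi X) (Phi Pt) where
  obj k p := ⟨(Diag.inertia X).obj k.ob p, k.pos, k.cyc⟩
  map {k k' p p'} α f := (Diag.inertia X).map (k := k.ob) (k' := k'.ob) α f
  map_id _ _ := rfl
  map_comp _ _ _ _ := rfl
  obj_cont k := continuous_iff_continuousAt.2 fun p => Phi.obj_iff.2
    (FamHom.const_contAt _ (Inertia.obj_iff.1 continuousAt_id))
  map_cont α := continuous_iff_continuousAt.2 fun a => by
    have h := Inertia.arr_iff.1 (continuousAt_id (X := Arr (Inertia X)) (x := a))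
    exact Phi.arr_iff.2 ⟨FamHom.const_contAt _ h.1, FamHom.const_contAt _ h.2.1,
      FamHom.const_contAt _ h.2.2⟩

/-- The automorphism of a constant cycle is the product of the rotation and of the automorphism in `X`. -/
theorem Diag.cycle_compat : (Diag.cycle X).Compat (Inertia.cen X) (Phi.cen X) := fun k p =>
  ⟨(Phi.cen Pt).app k, rfl⟩

variable (X) in
/-- The identity, as a diagram with one object. -/
def Diag.one : Diag X X Pt where
  obj _ x := x
  map _ f := f
  map_id _ _ := rfl
  map_comp _ _ _ _ := rfl
  obj_cont _ := continuous_id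
  map_cont _ := continuous_iff_continuousAt.2 fun _ => continuousAt_id

theorem Diag.one_compat (ξ : Cen X) : (Diag.one X).Compat ξ ξ := fun k p => ⟨𝟙 _, rfl⟩

end Const

section Fixed

variable {X : Type u} [Groupoid.{u} X] [TopologicalSpace X] [ArrTop X] {m : ℕ}

/-- Families of constant families. -/
def FamHom.constFam {x y : Fin m → Sym Pt} {a b : X} (A : FamHom x y) (f : a ⟶ b) :
    FamHom (X := Sym X) (fun i => ⟨(x i).1, fun _ => a⟩) fun i => ⟨(y i).1, fun _ => b⟩ :=
  ⟨A.perm, fun i j h => FamHom.const (A.hom i j h).perm f⟩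

theorem Sym.catMap_constFam {x y : Fin m → Sym Pt} {a b : X} (A : FamHom x y) (f : a ⟶ b) :
    Sym.catMap (FamHom.constFam A f) = FamHom.const (X := X) (Sym.catMap A).perm f :=
  FamHom.ext rfl fun i j h h' => rfl

theorem Diag.cycle_loops (κ : SymN m (Phi Pt)) (p : Inertia X) :
    Phi.catLoop (((Diag.cycle X).symN m).obj κ p) = FamHom.const (Phi.catLoop κ).perm p.loop := by
  have e : Phi.loops (((Diag.cycle X).symN m).obj κ p) =
      FamHom.constFam (Phi.loops κ) p.loop :=
    FamHom.ext rfl fun i j h h' => by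
      cases (show i = j from h')
      refine (Phi.loops_hom _ i h).trans ?_
      exact congrArg (fun C : (κ i).base ⟶ (κ i).base => FamHom.const C.perm p.loop)
        (Phi.loops_hom κ i h').symm
  exact (congrArg Sym.catMap e).trans
    (Sym.catMap_constFam (Phi.loops κ) p.loop)

/-- The concatenation of constant families of cycles is a constant family. -/
def Diag.cycleCat (κ : SymN m (Phi Pt)) (p : Inertia X) :
    (catFun X m).obj (((Diag.cycle X).symN m).obj κ p) ⟶
      (Diag.inertia X).obj ((totalCat Pt).obj ((SymN.incl m (Phi Pt)).obj κ)) p :=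
  let B : Sym X := Sym.cat fun i => ((((Diag.cycle X).symN m).obj κ p) i).base
  let g : B ⟶ B := FamHom.const (Phi.catLoop κ).perm p.loop
  ⟨𝟙 B, (Category.comp_id (Phi.catLoop (((Diag.cycle X).symN m).obj κ p))).trans
      ((Diag.cycle_loops κ p).trans (Category.id_comp g).symm)⟩

theorem Diag.cycleCat_nat {κ κ' : SymN m (Phi Pt)} (A : κ ⟶ κ') {p p' : Inertia X} (f : p ⟶ p') :
    (catFun X m).map (((Diag.cycle X).symN m).map A f) ≫ Diag.cycleCat κ' p' =
      Diag.cycleCat κ p ≫ (Diag.inertia X).map ((totalCat Pt).map ((SymN.incl m (Phi Pt)).map A)) f := by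
  let B : Sym X := Sym.cat fun i => ((((Diag.cycle X).symN m).obj κ p) i).base
  let B' : Sym X := Sym.cat fun i => ((((Diag.cycle X).symN m).obj κ' p') i).base
  let g : B ⟶ B' := FamHom.const (Sym.catMap (Phi.under A)).perm f.1
  let g' : B ⟶ B' := Sym.catMap (Phi.under (((Diag.cycle X).symN m).map A f))
  have e : g' = g := Sym.catMap_constFam (Phi.under A) f.1
  exact Subtype.ext ((Category.comp_id g').trans (e.trans (Category.id_comp g).symm))

variable [TopGpd X]

theorem Diag.cycleCat_cont (κ : SymN m (Phi Pt)) : Continuous fun p : Inertia X => arr (Diag.cycleCat κ p) :=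
  continuous_iff_continuousAt.2 fun p => by
    have h1 : ContinuousAt (fun p : Inertia X => (catFun X m).obj (((Diag.cycle X).symN m).obj κ p)) p :=
      ((catFun X m).obj_cont.comp (((Diag.cycle X).symN m).obj_cont κ)).continuousAt
    have h := Inertia.obj_iff.1 h1
    exact Inertia.arr_iff.2 ⟨h, Inertia.obj_iff.1 ((Diag.inertia X).obj_cont _).continuousAt,
      (TopGpd.id_cont (X := Sym X)).continuousAt.comp (contAt_src h)⟩

end Fixed

/-! ### The transfer in Tate K-theory as a sum over cycle types -/

section CycleType

variable {X : Type u} [Groupoid.{u} X] [TopologicalSpace X] [ArrTop X] [TopGpd X] {n m : ℕ}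

/-- A permutation, as an automorphism of a family of points. -/
def Inertia.ofPerm (σ : Equiv.Perm (Fin n)) : Inertia (Sym Pt) :=
  ⟨⟨n, fun _ => Pt.pt⟩, FamHom.const σ (𝟙 Pt.pt)⟩

/-- The transfer along `(pt // Sₙ) × X ⟶ X` in Tate K-theory is a limit over all permutations. -/
theorem GB.push_inertiaCover (V : GB (Inertia (Sym X))) :
    (GB.push (BS.inertiaCover n (X := X) TopGpd.id_cont)
      (V.pull (Inertia.map ((BS.diag n X).comp (SymN.incl n X))))).Iso
    (GB.lim (Diag.inertia X) (Inertia.ofPerm (n := n)) V Inertia.id_cont) := by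
  let C := BS.inertiaCover n (X := X) TopGpd.id_cont
  let U := V.pull (Inertia.map ((BS.diag n X).comp (SymN.incl n X)))
  refine GB.iso_of_bij (fun p =>
    { toFun := fun v => ⟨v.1, fun σ τ α => ?_⟩
      map_add' := fun _ _ => rfl
      map_smul' := fun _ _ => rfl }) ?_ (fun p => ⟨fun v w h => Subtype.ext (congrArg (fun u => u.1) h),
        fun v => ⟨⟨v.1, fun (γ σ τ : Equiv.Perm (Fin n)) h => ?_⟩, rfl⟩⟩) fun p q f v => rfl
  · let γ : Equiv.Perm (Fin n) := α.1.perm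
    have e : γ * σ = τ * γ := congrArg FamHom.perm α.2
    exact v.2 γ σ τ (show γ * σ * γ⁻¹ = τ by rw [e, mul_inv_cancel_right])
  · rw [continuous_iff_continuousAt]
    intro p
    have hp := (GB.push_iff C U).1 (continuousAt_id (X := (GB.push C U).vb.Tot) (x := p))
    exact (GB.lim_iff (Diag.inertia X) Inertia.ofPerm V Inertia.id_cont).2
      ⟨hp.1, fun σ => ((VB.pull_iff _ _ (Inertia.map ((BS.diag n X).comp (SymN.incl n X))).obj_cont).1 (hp.2 σ)).2⟩
  · have e : γ * σ = τ * γ := by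
      rw [← (show γ * σ * γ⁻¹ = τ from h), inv_mul_cancel_right]
    let α : Inertia.ofPerm σ ⟶ Inertia.ofPerm τ :=
      ⟨FamHom.const γ (𝟙 Pt.pt), FamHom.ext_pt e⟩
    exact v.2 σ τ α

/-- The families of standard cycles of total length `n`. -/
abbrev CycleFam (n : ℕ) : Type := Σ m : Fin (n + 1), Ix (Phi Pt) n m

/-- The concatenation of a family of standard cycles. -/
def CycleFam.cat (q : CycleFam n) : Inertia (Sym Pt) := (totalCat Pt).obj ((SymN.incl q.1 (Phi Pt)).obj q.2.1)

/-- Every permutation is conjugate to a concatenation of standard cycles. -/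
theorem CycleFam.exists_hom (σ : Equiv.Perm (Fin n)) : ∃ q : CycleFam n, Nonempty (q.cat ⟶ Inertia.ofPerm σ) := by
  let p : Inertia (Sym Pt) := Inertia.ofPerm σ
  have h : SymN.size (Phi.parts p).2 = n := (Sym.hn (Phi.reassemble p)).symm
  exact ⟨⟨⟨(Phi.parts p).1, Nat.lt_succ_of_le (Ix.le ⟨(Phi.parts p).2, h⟩)⟩, ⟨(Phi.parts p).2, h⟩⟩,
    ⟨⟨Phi.reassemble p, Phi.reassemble_loop p⟩⟩⟩

theorem CycleFam.exists_perm (q : CycleFam n) : ∃ σ : Equiv.Perm (Fin n), Nonempty (Inertia.ofPerm σ ⟶ q.cat) := by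
  have key : ∀ p : Inertia (Sym Pt), p.pt.1 = n →
      ∃ σ : Equiv.Perm (Fin n), Nonempty (Inertia.ofPerm σ ⟶ p) := by
    rintro ⟨⟨n, x⟩, L⟩ rfl
    exact ⟨L.perm, ⟨⟨⟨.refl _, fun _ _ _ => ⟨⟩⟩, FamHom.ext_pt rfl⟩⟩⟩
  exact key _ q.2.2

/-- Arrows between concatenations of standard cycles are arrows of families of cycles. -/
theorem CycleFam.exists_arrow {q q' : CycleFam n} (α : q.cat ⟶ q'.cat) :
    ∃ (h : q.1 = q'.1) (A : FamHom q.2.1 q'.2.1), (Sym.catMap (Phi.under A)) = α.1 := by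
  obtain ⟨A, hA⟩ := Phi.exists_cat α.1 α.2
  exact ⟨Fin.ext (by simpa only [Fintype.card_fin] using Fintype.card_congr (α := Fin q.1) (β := Fin q'.1) A.perm), A, hA⟩

/-- The naturality of `Diag.cycleCat`, for the action on a bundle. -/
theorem CycleFam.act_cycleCat (V : GB (Inertia (Sym X))) {κ κ' : SymN m (Phi Pt)} (A : κ ⟶ κ') {p p' : Inertia X}
    (f : p ⟶ p') (v : V.vb.fib ((catFun X m).obj (((Diag.cycle X).symN m).obj κ p))) :
    V.act ((Diag.inertia X).map ((totalCat Pt).map ((SymN.incl m (Phi Pt)).map A)) f) (V.act (Diag.cycleCat κ p) v) =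
      V.act (Diag.cycleCat κ' p') (V.act ((catFun X m).map (((Diag.cycle X).symN m).map A f)) v) := by
  rw [← V.act_comp, ← V.act_comp, Diag.cycleCat_nat]

/-- A limit over all permutations decomposes according to the number of cycles. -/
theorem GB.lim_cycleFam (V : GB (Inertia (Sym X))) :
    (GB.lim (Diag.inertia X) (CycleFam.cat (n := n)) V Inertia.id_cont).Iso
      (GB.pi (fun m : Fin (n + 1) => GB.lim ((Diag.cycle X).symN m) (Ix.fam (K := Phi Pt) (n := n))
        (V.pull (catFun X m)) Inertia.id_cont) (GB.LocFin.of_finite _)) := by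
  let L := fun m : Fin (n + 1) => GB.lim ((Diag.cycle X).symN m) (Ix.fam (K := Phi Pt) (n := n))
        (V.pull (catFun X m)) Inertia.id_cont
  let ev := fun (q : CycleFam n) p => GB.limEv ((Diag.cycle X).symN q.1) (Ix.fam (K := Phi Pt) (n := n))
        (V.pull (catFun X q.1)) Inertia.id_cont q.2 p
  let g := fun (q : CycleFam n) p => V.act (Diag.cycleCat q.2.1 p) ∘ₗ ev q p ∘ₗ
    LinearMap.proj (φ := fun m => (L m).vb.fib p) q.1
  -- At each family of cycles, both limits embed in the fibre of `V` at the concatenation.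
  refine GB.iso_of_joint (I := CycleFam n) (fun _ => V.vb) (fun q => (Diag.inertia X).obj q.cat)
    (fun q p => GB.limEv (Diag.inertia X) CycleFam.cat V Inertia.id_cont q p) g
    (fun q => GB.limEv_cont _ _ _ _ q) (fun q => ?_) (fun p v h => ?_) (fun p w h => ?_) (fun p v => ?_)
    (fun p w => ?_) (fun p p' f v w h q => ?_)
  · refine continuous_iff_continuousAt.2 fun s => ?_
    have h1 := (VB.pi_iff (fun m => (L m).vb) (GB.LocFin.of_finite _)).1 (continuousAt_id (x := s))
    have h2 := ((GB.lim_iff _ _ _ _).1 (h1.2 q.1)).2 q.2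
    exact V.contAt ((Diag.cycleCat_cont q.2.1).continuousAt.comp h1.1) ((VB.pull_iff _ _ (catFun X q.1).obj_cont).1 h2).2
  · exact GB.lim_ext (Diag.inertia X) _ _ _ h
  · refine funext fun m => GB.lim_ext ((Diag.cycle X).symN m) _ _ _ fun κ => ?_
    exact V.act_inj _ ((h ⟨m, κ⟩).trans (map_zero _).symm)
  · have hi : ∀ q : CycleFam n, V.act (Diag.cycleCat q.2.1 p) (V.act (Groupoid.inv (Diag.cycleCat q.2.1 p))
        (v.1 q)) = v.1 q := fun q =>
      (V.act_comp _ _ _).symm.trans ((congrArg (fun f => V.act f (v.1 q)) (Groupoid.inv_comp _)).trans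
        (V.act_id _ _))
    refine ⟨fun m => ⟨fun κ => V.act (Groupoid.inv (Diag.cycleCat κ.1 p)) (v.1 ⟨m, κ⟩), fun κ κ' A => ?_⟩,
      fun q => ?_⟩
    · refine V.act_inj (Diag.cycleCat κ'.1 p) ?_
      refine (CycleFam.act_cycleCat V A (𝟙 p) _).symm.trans ?_
      exact (congrArg _ (hi ⟨m, κ⟩)).trans ((v.2 ⟨m, κ⟩ ⟨m, κ'⟩ _).trans (hi ⟨m, κ'⟩).symm)
    · exact (hi q).symm
  · refine ⟨⟨fun q => g q p w, fun q q' α => ?_⟩, fun q => rfl⟩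
    obtain ⟨h, A, hA⟩ := CycleFam.exists_arrow α
    obtain ⟨m, κ⟩ := q
    obtain ⟨m', κ'⟩ := q'
    obtain rfl : m = m' := h
    obtain rfl : (totalCat Pt).map ((SymN.incl m (Phi Pt)).map A) = α := Subtype.ext hA
    exact (CycleFam.act_cycleCat V A (𝟙 p) _).trans (congrArg _ ((w m).2 κ κ' A))
  · change V.act _ (v.1 q) = V.act _ (V.act _ ((w q.1).1 q.2))
    rw [show v.1 q = V.act (Diag.cycleCat q.2.1 p) ((w q.1).1 q.2) from h q]
    refine Eq.trans ?_ (CycleFam.act_cycleCat V (𝟙 q.2.1) f _)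
    rw [(SymN.incl q.1 (Phi Pt)).map_id, (totalCat Pt).map_id]
    rfl

/-- The transfer along `(pt // Sₙ) × X ⟶ X` in Tate K-theory, in terms of the restrictions along `Q`. -/
theorem KTate.transfer_eq_sum (x : KTate (Sym X)) (n : ℕ) :
    Krot.transfer (BS.inertiaCover n TopGpd.id_cont) (BS.inertiaCover_compat n TopGpd.id_cont)
      (Krot.pull (Inertia.map ((BS.diag n X).comp (SymN.incl n X))) (fun _ => rfl) x) =
    ∑ m ∈ Finset.range (n + 1), Krot.inv (Diag.cycle X) Diag.cycle_compat Inertia.id_cont n m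
      (KTate.pullQ X x m) := by
  have h1 : ∀ x m, KTate.pullQ X x m = (Series.pull_addOp (catFun X m) (catFun_compat X m)).hom x :=
    fun x m => (Series.pull_addOp (catFun X m) (catFun_compat X m)).map_eq x
  have hC := Series.pull_addOp (Inertia.map ((BS.diag n X).comp (SymN.incl n X)))
    (ξ := Inertia.cen (BS n X)) (υ := Inertia.cen (Sym X)) fun _ => rfl
  have hP := Series.push_addOp (BS.inertiaCover n (X := X) TopGpd.id_cont)
    (BS.inertiaCover_compat n TopGpd.id_cont)
  refine (hP.map_eq _).trans ((congrArg hP.hom (hC.map_eq x)).trans ?_)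
  -- Both sides are additive, so it suffices to compare them on series. There the limit over all
  -- permutations is a limit over the families of standard cycles, one factor for each number `m` of cycles.
  have h2 : (hP.hom.comp hC.hom) = ∑ m ∈ Finset.range (n + 1),
      (Krot.inv (Diag.cycle X) Diag.cycle_compat Inertia.id_cont n m).comp
        (Series.pull_addOp (catFun X m) (catFun_compat X m)).hom := Krot.hom_ext fun V => by
    rw [AddMonoidHom.comp_apply, AddMonoidHom.finsetSum_apply, AddOp.hom_cls, AddOp.hom_cls, Finset.sum_range]
    simp only [AddMonoidHom.comp_apply, AddOp.hom_cls, Krot.inv_cls]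
    rw [← Series.cls_piFin]
    exact Series.cls_eq fun a => (GB.push_inertiaCover (V.coef a)).trans ((GB.lim_equiv _ _ CycleFam.cat _ _
      (fun σ => .inl (CycleFam.exists_hom σ))
      fun q => .inl (CycleFam.exists_perm q)).trans (GB.lim_cycleFam (V.coef a)))
  have h3 := DFunLike.congr_fun h2 x
  rw [AddMonoidHom.finsetSum_apply] at h3
  simp only [h1]
  exact h3

theorem KTate.pullQ_pow (F : KTate X) (m : ℕ) :
    KTate.pullQ X F.pow m = (KTate.theta F).pow Phi.id_cont m :=
  congrFun (Function.invFun_eq (KTate.pullQ_bijective.2 fun n => (KTate.theta F).pow Phi.id_cont n)) m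

/-- The symmetric powers in Tate K-theory are the coefficients of the total power of `θ(F)` along the
standard cycles. -/
theorem KTate.symTate_eq (F : KTate X) (n : ℕ) : KTate.symTate F n =
    PowerSeries.coeff n (Krot.totalPow (Diag.cycle X) Diag.cycle_compat Inertia.id_cont Phi.id_cont (KTate.theta F)) := by
  refine (KTate.transfer_eq_sum F.pow n).trans ?_
  simp only [KTate.pullQ_pow]
  rw [Krot.totalPow, Krot.total, PowerSeries.coeff_mk]

end CycleType

/-! ### Symmetric powers and wreath products -/

section Wreath

/-- A tensor which is invariant under all tensor products of the operators `f i j` is invariant under the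
tensor product of their averages. -/
theorem piTensor_map_avg {m : ℕ} {V : Fin m → Type*} [∀ i, AddCommGroup (V i)] [∀ i, Module ℂ (V i)]
    {J : Type} [Fintype J] (f : ∀ i, J → V i →ₗ[ℂ] V i) {c : ℂ} (hc : c * Fintype.card J = 1)
    {t : ⨂[ℂ] i, V i} (h : ∀ r : Fin m → J, PiTensorProduct.map (fun i => f i (r i)) t = t) :
    PiTensorProduct.map (fun i => ∑ j, c • f i j) t = t := by
  have h1 : PiTensorProduct.map (fun i => ∑ j, c • f i j) =
      ∑ r : Fin m → J, c ^ m • PiTensorProduct.map fun i => f i (r i) := by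
    change PiTensorProduct.mapMultilinear ℂ V V (fun i => ∑ j, c • f i j) = _
    rw [MultilinearMap.map_sum]
    refine Finset.sum_congr rfl fun r _ => ?_
    rw [MultilinearMap.map_smul_univ, Finset.prod_const, Finset.card_univ, Fintype.card_fin]
    rfl
  rw [h1, LinearMap.sum_apply]
  simp only [LinearMap.smul_apply, h, Finset.sum_const, Finset.card_univ, Fintype.card_pi, Finset.prod_const,
    Fintype.card_fin]
  rw [← Nat.cast_smul_eq_nsmul ℂ, smul_smul, Nat.cast_pow, ← mul_pow, mul_comm, hc, one_pow, one_smul]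

variable {Z : Type u} [Groupoid.{u} Z] [TopologicalSpace Z] [ArrTop Z]
  {Y : Type u} [Groupoid.{u} Y] [TopologicalSpace Y] [ArrTop Y] {ξ : Cen Z} {υ : Cen Y}
  {K : Type} [Groupoid.{0} K] [Sized K] (D : Diag Z Y K) (hD : D.Compat ξ υ)
  (hid : Continuous fun z : Z => arr (𝟙 z)) (k : K) {m : ℕ} (A : Series υ)

/-- The invariants of the automorphism group of `k`. -/
def Series.fix : Series ξ := Series.lim D (fun _ : Unit => k) hid hD A

theorem Series.fix_addOp : AddOp (Series.fix D hD hid k) := Series.lim_addOp D _ hid hD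

/-- The inclusion of the invariants of the automorphism group of `k`. -/
def Series.fixEv (a : ℚ≥0) (z : Z) :
    ((A.fix D hD hid k).coef a).vb.fib z →ₗ[ℂ] (A.coef a).vb.fib (D.obj k z) :=
  GB.limEv D (fun _ : Unit => k) (A.coef a) hid () z

theorem Series.fixEv_tr {a b : ℚ≥0} (h : a = b) {z z' : Z} (f : z ⟶ z') (α : k ⟶ k)
    (v : ((A.fix D hD hid k).coef a).vb.fib z) :
    A.fixEv D hD hid k b z' ((A.fix D hD hid k).tr h f v) = A.tr h (D.map α f) (A.fixEv D hD hid k a z v) := by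
  subst h
  refine (GB.limEv_act D (fun _ : Unit => k) (A.coef a) hid () f v).trans ?_
  refine Eq.trans ?_ (congrArg (fun g => (A.coef a).act g (v.1 ())) (D.map_right α f)).symm
  exact (congrArg ((A.coef a).act (D.map (𝟙 k) f)) (v.2 () () α)).symm.trans ((A.coef a).act_comp _ _ _).symm

/-- The inclusion of the tensor power of the invariants. -/
def Series.fixPow (c : Fin m → ℚ≥0) (z : Z) :
    (⨂[ℂ] i, ((A.fix D hD hid k).coef (c i)).vb.fib z) →ₗ[ℂ] ⨂[ℂ] i, (A.coef (c i)).vb.fib (D.obj k z) :=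
  PiTensorProduct.map fun i => A.fixEv D hD hid k (c i) z

theorem Series.fixPow_tprod (c : Fin m → ℚ≥0) (z : Z) (v : ∀ i, ((A.fix D hD hid k).coef (c i)).vb.fib z) :
    A.fixPow D hD hid k c z (PiTensorProduct.tprod ℂ v) =
      PiTensorProduct.tprod ℂ fun i => A.fixEv D hD hid k (c i) z (v i) := PiTensorProduct.map_tprod _ _

/-- The inclusion of the tensor power of the invariants is equivariant for the wreath product; the
components of `B` in the automorphism group of `k` act trivially on the invariants. -/
theorem Series.fixPow_perm {z z' : Z} (f : z ⟶ z') (B : FamHom (fun _ : Fin m => k) fun _ : Fin m => k)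
    (c c' : Fin m → ℚ≥0) (h : ∀ i j, B.perm i = j → c i = c' j) (w : ⨂[ℂ] i, ((A.fix D hD hid k).coef (c i)).vb.fib z) :
    A.fixPow D hD hid k c' z' ((A.fix D hD hid k).perm (FamHom.const B.perm f) c c' h w) =
      A.perm (((D.symN m).map (k := fun _ => k) (k' := fun _ => k) B f) : FamHom (fun _ : Fin m => D.obj k z) fun _ => D.obj k z')
        c c' h (A.fixPow D hD hid k c z w) := by
  let E : FamHom (fun _ : Fin m => D.obj k z) fun _ => D.obj k z' :=
    (D.symN m).map (k := fun _ => k) (k' := fun _ => k) B f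
  suffices h : A.fixPow D hD hid k c' z' ∘ₗ (A.fix D hD hid k).perm (FamHom.const B.perm f) c c' h =
      A.perm E c c' h ∘ₗ A.fixPow D hD hid k c z from LinearMap.congr_fun h w
  refine PiTensorProduct.ext (MultilinearMap.ext fun v => ?_)
  refine (congrArg _ (Series.perm_tprod _ (FamHom.const B.perm f) h v)).trans ((Series.fixPow_tprod D hD hid k A c' z' _).trans ?_)
  refine Eq.trans ?_ ((congrArg _ (Series.fixPow_tprod D hD hid k A c z v)).trans (A.perm_tprod E h _)).symm
  refine congrArg (PiTensorProduct.tprod ℂ) (funext fun j => ?_)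
  exact Series.fixEv_tr D hD hid k A _ f _ _

/-- The projection to the invariants of the automorphism group of `k`. -/
def Series.fixMean (a : ℚ≥0) (z : Z) :
    (A.coef a).vb.fib (D.obj k z) →ₗ[ℂ] ((A.fix D hD hid k).coef a).vb.fib z :=
  D.meanLim (fun _ : Unit => k) (A.coef a) hid z ∘ₗ LinearMap.pi fun _ => LinearMap.id

theorem Series.fixMean_fixEv (a : ℚ≥0) (z : Z) :
    A.fixMean D hD hid k a z ∘ₗ A.fixEv D hD hid k a z = LinearMap.id :=
  LinearMap.ext fun v => D.meanLim_of_mem (fun _ : Unit => k) (A.coef a) hid z v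

/-- The projection to the invariants is the average over the automorphism group. -/
theorem Series.fixEv_fixMean (a : ℚ≥0) (z : Z) [Fintype (k ⟶ k)] :
    A.fixEv D hD hid k a z ∘ₗ A.fixMean D hD hid k a z =
      ∑ α : (k ⟶ k), ((Fintype.card (k ⟶ k) : ℂ)⁻¹) • (A.coef a).act (D.map α (𝟙 z)) := by
  let _ : ∀ i : Unit, Fintype (Σ _ : Unit, (k ⟶ k)) := fun _ => inferInstance
  have e : Nat.card (Σ _ : Unit, (k ⟶ k)) = Fintype.card (k ⟶ k) := by
    rw [Nat.card_congr (Equiv.uniqueSigma fun _ : Unit => (k ⟶ k)), Nat.card_eq_fintype_card]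
  refine LinearMap.ext fun v => (D.mean_apply (fun _ : Unit => k) (A.coef a) z (fun _ => v) ()).trans ?_
  rw [e, LinearMap.sum_apply]
  exact Fintype.sum_equiv (Equiv.uniqueSigma fun _ : Unit => (k ⟶ k)) _ _ fun p => rfl

/-- The inclusion of the tensor power is split by the tensor power of the projection. -/
theorem Series.fixPow_inj (c : Fin m → ℚ≥0) (z : Z) {w : ⨂[ℂ] i, ((A.fix D hD hid k).coef (c i)).vb.fib z}
    (h : A.fixPow D hD hid k c z w = 0) : w = 0 := by
  have h1 : PiTensorProduct.map (fun i => A.fixMean D hD hid k (c i) z) (A.fixPow D hD hid k c z w) = w := by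
    refine (LinearMap.congr_fun (PiTensorProduct.map_comp (fun i => A.fixMean D hD hid k (c i) z)
      fun i => A.fixEv D hD hid k (c i) z) w).symm.trans ?_
    simp only [Series.fixMean_fixEv, PiTensorProduct.map_id]
    rfl
  rw [← h1, h, map_zero]

/-- A tensor which is invariant under the power of the automorphism group comes from the tensor power of
the invariants. -/
theorem Series.fixPow_surj (c : Fin m → ℚ≥0) (z : Z) {t : ⨂[ℂ] i, (A.coef (c i)).vb.fib (D.obj k z)}
    (h : ∀ α : Fin m → (k ⟶ k), PiTensorProduct.map (fun i => (A.coef (c i)).act (D.map (α i) (𝟙 z))) t = t) :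
    ∃ w, A.fixPow D hD hid k c z w = t := by
  let _ := Fintype.ofFinite (k ⟶ k)
  refine ⟨PiTensorProduct.map (fun i => A.fixMean D hD hid k (c i) z) t, ?_⟩
  refine (LinearMap.congr_fun (PiTensorProduct.map_comp (fun i => A.fixEv D hD hid k (c i) z)
    fun i => A.fixMean D hD hid k (c i) z) t).symm.trans ?_
  simp only [Series.fixEv_fixMean]
  refine piTensor_map_avg (fun i (α : (k ⟶ k)) => (A.coef (c i)).act (D.map α (𝟙 z))) (inv_mul_cancel₀ ?_) h
  have : Nonempty (k ⟶ k) := ⟨𝟙 k⟩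
  exact_mod_cast Fintype.card_ne_zero

theorem Series.perm_refl {z : Fin m → Y} (g : ∀ i j, Equiv.refl (Fin m) i = j → (z i ⟶ z j)) (c : Fin m → ℚ≥0) (h) :
    A.perm (⟨.refl _, g⟩ : FamHom z z) c c h = PiTensorProduct.map fun i => (A.coef (c i)).act (g i i rfl) := by
  refine PiTensorProduct.ext (MultilinearMap.ext fun v => ?_)
  simp only [LinearMap.compMultilinearMap_apply, Series.perm_tprod, PiTensorProduct.map_tprod]
  rfl

/-- The symmetric power of the invariants of a group `Aut k` consists of the invariants of the wreath product
`Sₘ ≀ Aut k`, which is the automorphism group of the constant family at `k`. -/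
theorem Series.lim_pow (a : ℚ≥0) :
    (GB.lim (D.symN m) (fun _ : Unit => (fun _ => k : SymN m K)) ((A.pow m).coef a) hid).Iso
      (GB.lim ((Diag.one Z).symN m) (fun _ : Unit => (fun _ => Pt.pt : SymN m Pt))
        (((A.fix D hD hid k).pow m).coef a) hid) := by
  let κ : SymN m K := fun _ => k
  let κ' : SymN m Pt := fun _ => Pt.pt
  let C := A.fix D hD hid k
  let I := {c : Fin m → ℚ≥0 // ∑ i, c i = a}
  let L := GB.lim (D.symN m) (fun _ : Unit => κ) ((A.pow m).coef a) hid
  let L' := GB.lim ((Diag.one Z).symN m) (fun _ : Unit => κ') ((C.pow m).coef a) hid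
  let f := fun (c : I) z => LinearMap.proj (φ := fun c : I => (A.powVB c.1).fib ((D.symN m).obj κ z)) c ∘ₗ
    GB.limEv (D.symN m) (fun _ : Unit => κ) ((A.pow m).coef a) hid () z
  let g : ∀ (c : I) z, L'.vb.fib z →ₗ[ℂ] (A.powVB c.1).fib ((D.symN m).obj κ z) := fun c z =>
    A.fixPow D hD hid k c.1 z ∘ₗ
    LinearMap.proj (φ := fun c : I => (C.powVB c.1).fib (((Diag.one Z).symN m).obj κ' z)) c ∘ₗ
    GB.limEv ((Diag.one Z).symN m) (fun _ : Unit => κ') ((C.pow m).coef a) hid () z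
  have hf : ∀ c : I, Continuous fun p : L.vb.Tot => (A.powVB c.1).pt ((D.symN m).obj κ p.1) (f c p.1 p.2) :=
    fun c => continuous_iff_continuousAt.2 fun p => by
      have h1 := ((GB.lim_iff _ _ _ _).1 (continuousAt_id (X := L.vb.Tot) (x := p))).2 ()
      exact ((VB.pi_iff _ (A.powVB_finite a)).1 h1).2 c
  have hg : ∀ c : I, Continuous fun p : L'.vb.Tot => (A.powVB c.1).pt ((D.symN m).obj κ p.1) (g c p.1 p.2) :=
    fun c => continuous_iff_continuousAt.2 fun p => by
      have h0 := (GB.lim_iff _ _ _ _).1 (continuousAt_id (X := L'.vb.Tot) (x := p))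
      have h1 := ((VB.pi_iff _ (C.powVB_finite a)).1 (h0.2 ())).2 c
      have h2 := ((D.symN m).obj_cont κ).continuousAt.comp h0.1
      refine VB.piTensor_contAt _ h1 (A.powVB c.1) h2
        (fun s => A.fixPow D hD hid k c.1 s.1) fun v hv => ?_
      have h3 := VB.piTensor_cont (fun i => (A.coef (c.1 i)).vb.pull (fun y : SymN m Y => y i)
        (SymN.continuous_eval i)) (g := fun s : L'.vb.Tot => (D.symN m).obj κ s.1)
        (v := fun (s : L'.vb.Tot) i => A.fixEv D hD hid k (c.1 i) s.1 (v s i)) h2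
        fun i => (VB.pull_iff _ _ _).2 ⟨h2, (GB.limEv_cont D (fun _ : Unit => k) (A.coef (c.1 i)) hid ()).continuousAt.comp
          ((VB.pull_iff _ (fun z : SymN m Z => z i) (SymN.continuous_eval i)).1 (hv i)).2⟩
      exact h3.congr (.of_forall fun s => congrArg ((A.powVB c.1).pt ((D.symN m).obj κ s.1))
        (Series.fixPow_tprod D hD hid k A c.1 s.1 (v s)).symm)
  -- The wreath product acts on the image of the tensor power of the invariants through the permutations.
  have hact : ∀ (B : κ ⟶ κ) {z z' : Z} (e : z ⟶ z') (t : ((A.pow m).coef a).vb.fib ((D.symN m).obj κ z))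
      (w : ((C.pow m).coef a).vb.fib (((Diag.one Z).symN m).obj κ' z)),
      (∀ c, t c = A.fixPow D hD hid k c.1 z (w c)) → ∀ c : I, ((A.pow m).coef a).act ((D.symN m).map B e) t c =
        A.fixPow D hD hid k c.1 z' (((C.pow m).coef a).act (((Diag.one Z).symN m).map
          (⟨B.perm, fun _ _ _ => 𝟙 Pt.pt⟩ : κ' ⟶ κ') e) w c) := fun B z z' e t w h c => by
    refine Eq.trans ?_ (Series.fixPow_perm D hD hid k A e B (fun i => c.1 (B.perm i)) c.1
      (fun i j h => congrArg c.1 h) (w ⟨fun i => c.1 (B.perm i), (Equiv.sum_comp B.perm c.1).trans c.2⟩)).symm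
    let E : FamHom (fun _ : Fin m => D.obj k z) fun _ => D.obj k z' := (D.symN m).map B e
    exact congrArg (A.perm E (fun i => c.1 (B.perm i)) c.1 (fun i j h => congrArg c.1 h))
      (h ⟨fun i => c.1 (B.perm i), (Equiv.sum_comp B.perm c.1).trans c.2⟩)
  refine GB.iso_of_joint (I := I) (fun c => A.powVB c.1) (fun c => (D.symN m).obj κ) f g hf hg
    (fun z v h => ?_) (fun z w h => ?_) (fun z v => ?_) (fun z w => ?_) (fun z z' e v w h c => ?_)
  · exact GB.lim_ext _ _ _ _ fun _ => funext h
  · exact GB.lim_ext _ _ _ _ fun _ => funext fun c => Series.fixPow_inj D hD hid k A c.1 z (h c)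
  -- Invariance under the arrows with trivial permutation gives a tensor of invariants, and invariance under
  -- the permutations gives the invariance of that tensor.
  · have h1 : ∀ c : I, ∃ w, A.fixPow D hD hid k c.1 z w = v.1 () c := fun c =>
      Series.fixPow_surj D hD hid k A c.1 z fun α => by
        let B : κ ⟶ κ := ⟨.refl _, fun i _ _ => α i⟩
        have h2 := congrFun (v.2 () () B) c
        exact (LinearMap.congr_fun (Series.perm_refl A (fun i j h => D.map (α i) (𝟙 z)) c.1
          (fun i j h => congrArg c.1 h)) (v.1 () c)).symm.trans h2
    choose w hw using h1
    refine ⟨⟨fun _ => w, fun _ _ α => funext fun c => ?_⟩, fun c => (hw c).symm⟩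
    refine sub_eq_zero.1 (Series.fixPow_inj D hD hid k A c.1 z ?_)
    let B : κ ⟶ κ := ⟨α.perm, fun _ _ _ => 𝟙 k⟩
    have h2 := hact B (𝟙 z) (v.1 ()) w (fun c => (hw c).symm) c
    refine (map_sub _ _ _).trans (sub_eq_zero.2 ?_)
    exact h2.symm.trans ((congrFun (v.2 () () B) c).trans (hw c).symm)
  · refine ⟨⟨fun _ c => g c z w, fun _ _ B => funext fun c => ?_⟩, fun c => rfl⟩
    refine (hact B (𝟙 z) _ (w.1 ()) (fun c => rfl) c).trans (congrArg _ ?_)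
    exact congrFun (w.2 () () _) c
  · exact hact (𝟙 κ) e (v.1 ()) (w.1 ()) h c

end Wreath

section TotalPower

variable {Z : Type u} [Groupoid.{u} Z] [TopologicalSpace Z] [ArrTop Z]
  {Y : Type u} [Groupoid.{u} Y] [TopologicalSpace Y] [ArrTop Y] {ξ : Cen Z} {υ : Cen Y}
  {K : Type} [Groupoid.{0} K] [Sized K] (D : Diag Z Y K) (hD : D.Compat ξ υ)
  (hid : Continuous fun z : Z => arr (𝟙 z)) {n m : ℕ} (A : Series υ)

theorem Series.pow_subsingleton {y : SymN m Y} (i : Fin m) (h : ∀ a, Subsingleton ((A.coef a).vb.fib (y i)))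
    (a : ℚ≥0) : Subsingleton (((A.pow m).coef a).vb.fib y) := by
  refine ⟨fun v w => funext fun c => ?_⟩
  let F : Fin m → Type u := fun i => (A.coef (c.1 i)).vb.fib (y i)
  let _ : ∀ i, AddCommGroup (F i) := fun i => inferInstanceAs (AddCommGroup ((A.coef (c.1 i)).vb.fib (y i)))
  let _ : ∀ i, Module ℂ (F i) := fun i => inferInstanceAs (Module ℂ ((A.coef (c.1 i)).vb.fib (y i)))
  have hF : Subsingleton (F i) := h (c.1 i)
  exact (piTensor_subsingleton (V := F) i).elim (v c) (w c)

/-- If every family of total length `n` has a member at which the series vanishes, the invariants of its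
power vanish. -/
theorem Series.inv_pow_eq_zero (h : ∀ κ : Ix K n m, ∃ i, ∀ z a, Subsingleton ((A.coef a).vb.fib (D.obj (κ.1 i) z))) :
    Krot.inv D hD hid n m (A.pow m).cls = 0 := by
  rw [Krot.inv_cls]
  refine Series.cls_eq_zero fun a z => ⟨fun v w => GB.lim_ext _ _ _ _ fun κ => ?_⟩
  obtain ⟨i, hi⟩ := h κ
  exact (A.pow_subsingleton (y := (D.symN m).obj κ.1 z) i (fun a => hi z a) a).elim _ _

theorem Ix.exists_len_ne {l : ℕ} (h : n ≠ l * m) (κ : Ix K n m) : ∃ i, Sized.len (κ.1 i) ≠ l := by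
  by_contra hc
  simp only [not_exists, not_not] at hc
  refine h (κ.2.symm.trans ?_)
  simp [SymN.size, hc, mul_comm]

variable {k : K}

/-- If the series only lives on the object `k`, only the constant family at `k` contributes to the
invariants of its power. -/
theorem Series.inv_pow (hk : ∀ κ : K, Sized.len κ = Sized.len k → κ = k)
    (hA : ∀ κ z a, Sized.len κ ≠ Sized.len k → Subsingleton ((A.coef a).vb.fib (D.obj κ z))) :
    Series.inv D hD hid (Sized.len k * m) m (A.pow m) ≈
      Series.inv (Diag.one Z) (Diag.one_compat ξ) hid m m ((A.fix D hD hid k).pow m) := fun a => by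
  refine (GB.lim_equiv (D.symN m) _ (fun _ : Unit => (fun _ => k : SymN m K)) _ hid (fun κ => ?_)
    fun _ => .inl ⟨⟨fun _ => k, ?_⟩, ⟨𝟙 (_ : SymN m K)⟩⟩).trans ((Series.lim_pow D hD hid k A a).trans
    (GB.lim_equiv ((Diag.one Z).symN m) _ _ _ hid (fun _ => .inl ⟨⟨fun _ => Pt.pt, ?_⟩, ⟨𝟙 (_ : SymN m Pt)⟩⟩) fun κ =>
      .inl ⟨(), ⟨?_⟩⟩))
  · by_cases h : ∀ i, Sized.len (κ.1 i) = Sized.len k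
    · obtain ⟨κ, hκ⟩ := κ
      obtain rfl : κ = fun _ => k := funext fun i => hk _ (h i)
      exact .inl ⟨(), ⟨𝟙 (_ : SymN m K)⟩⟩
    · obtain ⟨i, hi⟩ := not_forall.1 h
      exact .inr fun z => A.pow_subsingleton (y := (D.symN m).obj κ.1 z) i (fun a => hA _ _ _ hi) a
  · simp [SymN.size, Sized.len]
  · exact ⟨.refl _, fun _ _ _ => ⟨⟩⟩
  · simp [SymN.size, mul_comm]

/-- The total power of a series which is concentrated at an object of the diagram. -/
theorem Series.total_eq_expand (hk : ∀ κ : K, Sized.len κ = Sized.len k → κ = k)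
    (hA : ∀ κ z a, Sized.len κ ≠ Sized.len k → Subsingleton ((A.coef a).vb.fib (D.obj κ z))) :
    A.total D hD hid = PowerSeries.expand (Sized.len k) (Sized.len_pos k).ne'
      ((A.fix D hD hid k).total (Diag.one Z) (Diag.one_compat ξ) hid) := by
  ext n
  -- In the coefficient of `t ^ n`, only the families of `m` copies of `k` with `n = len k * m` contribute.
  have h0 : ∀ m, n ≠ Sized.len k * m → Krot.inv D hD hid n m (A.pow m).cls = 0 := fun m h =>
    A.inv_pow_eq_zero D hD hid fun κ => (Ix.exists_len_ne h κ).imp fun i hi z a => hA _ z a hi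
  have h1 : ∀ n m, n ≠ m → Krot.inv (Diag.one Z) (Diag.one_compat ξ) hid n m ((A.fix D hD hid k).pow m).cls = 0 :=
    fun n m h => Krot.inv_eq_zero _ _ _ ⟨fun κ => h (κ.2.symm.trans (by simp [SymN.size, Sized.len]))⟩ _
  rw [Series.total, Krot.coeff_total D hD hid _ le_rfl, PowerSeries.coeff_expand]
  split_ifs with h
  · obtain ⟨m, rfl⟩ := h
    have hp := Sized.len_pos k
    have hm : m ≤ Sized.len k * m := Nat.le_mul_of_pos_left _ hp
    rw [Nat.mul_div_cancel_left _ hp, Series.total, Krot.coeff_total _ _ _ _ le_rfl,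
      Finset.sum_eq_single m (fun m' _ h => h0 m' fun e => h (Nat.eq_of_mul_eq_mul_left hp e).symm)
        (fun h => (h (by simp; omega)).elim),
      Finset.sum_eq_single m (fun m' _ h => h1 _ _ h.symm) (fun h => (h (by simp)).elim),
      Krot.inv_cls, Krot.inv_cls]
    exact Series.cls_eq (Series.inv_pow D hD hid A hk hA)
  · exact Finset.sum_eq_zero fun m _ => h0 m fun e => h ⟨m, e⟩

/-- A series which vanishes at the objects of length at most `M` has trivial total power up to order `M`. -/
theorem Series.coeff_total_of_vanish {M : ℕ}
    (hA : ∀ κ z a, Sized.len κ ≤ M → Subsingleton ((A.coef a).vb.fib (D.obj κ z))) (hn : n ≤ M) :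
    PowerSeries.coeff n (A.total D hD hid) = if n = 0 then 1 else 0 := by
  rw [Series.total, Krot.coeff_total D hD hid _ le_rfl, Finset.sum_eq_single 0, Krot.inv_pow_zero]
  · intro m _ hm
    refine A.inv_pow_eq_zero D hD hid fun κ => ⟨⟨0, Nat.pos_of_ne_zero hm⟩, fun z a => hA _ z a ?_⟩
    refine (Finset.single_le_sum (f := fun i => Sized.len (κ.1 i)) (fun _ _ => Nat.zero_le _)
      (Finset.mem_univ _)).trans (le_trans (le_of_eq κ.2) hn)
  · simp

/-- The symmetric power is the limit over the families of points. -/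
theorem Krot.coeff_totalPow (x : Krot ξ) (n : ℕ) :
    PowerSeries.coeff n (x.totalPow (Diag.one Z) (Diag.one_compat ξ) hid hid) = x.symPow hid n := by
  have h1 : ∀ m, n ≠ m → Krot.inv (Diag.one Z) (Diag.one_compat ξ) hid n m (x.pow hid m) = 0 :=
    fun m h => Krot.inv_eq_zero _ _ _ ⟨fun κ => h (κ.2.symm.trans (by simp [SymN.size, Sized.len]))⟩ _
  rw [Krot.totalPow, Krot.coeff_total _ _ _ _ le_rfl,
    Finset.sum_eq_single n (fun m _ h => h1 m h.symm) (fun h => (h (by simp)).elim)]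
  have hC := Series.pull_addOp (BS.diag n Z) (BS.diag_compat n ξ)
  have hP := Series.push_addOp (BS.cover n hid) (BS.cover_compat n hid ξ)
  refine Eq.trans ?_ ((hP.map_eq _).trans (congrArg hP.hom (hC.map_eq _))).symm
  -- There is one family of `n` points, and its automorphism group is the symmetric group.
  have h2 : Krot.inv (Diag.one Z) (Diag.one_compat ξ) hid n n = hP.hom.comp hC.hom := Krot.hom_ext fun V => by
    rw [AddMonoidHom.comp_apply, AddOp.hom_cls, AddOp.hom_cls, Krot.inv_cls]
    refine Series.cls_eq fun a => ?_
    let D := (Diag.one Z).symN n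
    let W := V.coef a
    let U := W.pull (BS.diag n Z)
    let C := BS.cover n hid
    have : Nonempty (Ix Pt n n) := ⟨⟨fun _ => Pt.pt, by simp [SymN.size, Sized.len]⟩⟩
    refine GB.Iso.symm (GB.iso_of_bij (V := GB.push C U) (W := GB.lim D Ix.fam W hid) (fun z =>
      { toFun := fun v => ⟨fun κ => v.1 (), fun κ κ' α => v.2 α.perm () () rfl⟩
        map_add' := fun _ _ => rfl
        map_smul' := fun _ _ => rfl }) ?_ (fun z => ⟨fun v w h => ?_, fun v => ?_⟩) fun z z' f v => rfl)
    · rw [continuous_iff_continuousAt]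
      intro p
      have hp := (GB.push_iff C U).1 (continuousAt_id (X := (GB.push C U).vb.Tot) (x := p))
      exact (GB.lim_iff D Ix.fam W hid).2 ⟨hp.1, fun κ => ((VB.pull_iff _ _ (BS.diag n Z).obj_cont).1 (hp.2 ())).2⟩
    · exact Subtype.ext (funext fun _ => congrFun (congrArg (fun u => u.1) h) this.some)
    · have e : ∀ κ κ' : Ix Pt n n, κ = κ' := fun κ κ' => Subtype.ext (funext fun _ => Subsingleton.elim (α := Pt) _ _)
      refine ⟨⟨fun _ => v.1 this.some, fun (γ : Equiv.Perm (Fin n)) _ _ _ => ?_⟩, Subtype.ext (funext fun κ => ?_)⟩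
      · exact v.2 this.some this.some ⟨γ, fun _ _ _ => ⟨⟩⟩
      · cases e κ this.some; rfl
  exact DFunLike.congr_fun h2 _

end TotalPower

/-! ### Restriction of a series to an open and closed part -/

section Cut

variable {Y : Type u} [Groupoid.{u} Y] [TopologicalSpace Y] [ArrTop Y] {υ : Cen Y}

/-- A property of the objects which is invariant under arrows and locally constant. -/
structure Clopen (p : Y → Prop) : Prop where
  inv : ∀ {x y : Y}, (x ⟶ y) → p x → p y
  loc : ∀ x, ∀ᶠ y in 𝓝 x, (p y ↔ p x)

variable {p q r : Y → Prop} (hp : Clopen p)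

/-- The restriction of a bundle to the part defined by `p`, extended by zero. -/
def GB.cut (V : GB Y) : GB Y where
  vb := V.vb.embed (fun x => ({ carrier := {v | ¬ p x → v = 0}
                                add_mem' := fun h h' hx => by rw [h hx, h' hx, add_zero]
                                zero_mem' := fun _ => rfl
                                smul_mem' := fun c v h hx => by rw [h hx, smul_zero] } : Submodule ℂ (V.vb.fib x)))
    (fun x => Submodule.subtype _) (fun x => Subtype.val_injective) (by
      classical
      -- The projection is multiplication by the indicator function of `p`, which is locally constant.
      refine ⟨fun x => (if p x then (1 : ℂ) else 0) • LinearMap.id, ?_, fun x v => ?_, fun x v => ⟨⟨_, fun h => ?_⟩, rfl⟩⟩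
      · rw [continuous_iff_continuousAt]
        intro s
        have hc : ContinuousAt (fun s : V.vb.Tot => if p s.1 then (1 : ℂ) else 0) s := by
          refine ContinuousAt.congr (f := fun _ => if p s.1 then (1 : ℂ) else 0) continuousAt_const ?_
          filter_upwards [(V.vb.contFst.continuousAt (x := s)).eventually (hp.loc s.1)] with s' h
          simp only [h]
        refine (V.vb.continuousAt_sum (κ := Unit) (c := fun _ s => if p s.1 then (1 : ℂ) else 0)
          V.vb.contFst.continuousAt (fun _ => hc) fun _ => continuousAt_id (x := s)).congr (.of_forall fun s' => ?_)
        exact congrArg (V.vb.pt s'.1) (Fintype.sum_unique _)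
      · by_cases h : p x
        · simp [h]
        · have := v.2 h
          simp [h, this]
      · simp [h])
  act {x y} f := (V.act f).restrict fun v hv hy => by
    rw [hv fun hx => hy (hp.inv f hx), map_zero]
  act_id x v := Subtype.ext (V.act_id _ _)
  act_comp f g v := Subtype.ext (V.act_comp _ _ _)
  act_cont := continuous_iff_continuousAt.2 fun s => by
    have h := ActDom.cont _ s
    exact (V.vb.embed_iff _ _ _ _).2 (V.contAt h.1 ((V.vb.embed_iff _ _ _ _).1 h.2))

theorem GB.cut_iff (V : GB Y) {T : Type*} [TopologicalSpace T] {t : T} {g : T → Y}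
    {v : ∀ s, (V.cut hp).vb.fib (g s)} : ContinuousAt (fun s => (V.cut hp).vb.pt (g s) (v s)) t ↔
      ContinuousAt (fun s => V.vb.pt (g s) (v s).1) t :=
  Topology.IsInducing.continuousAt_iff (f := fun s => (V.cut hp).vb.pt (g s) (v s))
    (g := fun q : (V.cut hp).vb.Tot => V.vb.pt q.1 q.2.1) ⟨rfl⟩

/-- The restriction of a series to the part defined by `p`. -/
def Series.cut (V : Series υ) : Series υ where
  coef a := (V.coef a).cut hp
  rot a x v := Subtype.ext (V.rot a x v.1)
  locfin x := by
    obtain ⟨N, hN, h⟩ := V.locfin x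
    refine ⟨N, hN, h.mono fun y hy a hn => hy a ?_⟩
    obtain ⟨v, w, hvw⟩ := hn
    exact ⟨v.1, w.1, fun e => hvw (Subtype.ext e)⟩

theorem Series.cut_subsingleton (V : Series υ) (a : ℚ≥0) {x : Y} (h : ¬ p x) :
    Subsingleton (((V.cut hp).coef a).vb.fib x) := ⟨fun v w => Subtype.ext ((v.2 h).trans (w.2 h).symm)⟩

theorem Series.cut_of_forall (V : Series υ) (h : ∀ x, p x) : V.cut hp ≈ V := fun a =>
  GB.iso_of_bij (fun x => Submodule.subtype _)
    (continuous_iff_continuousAt.2 fun s => (GB.cut_iff hp (V.coef a)).1 (continuousAt_id (x := s)))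
    (fun x => ⟨Subtype.val_injective, fun v => ⟨⟨v, fun hx => (hx (h x)).elim⟩, rfl⟩⟩) fun _ _ _ _ => rfl

/-- A series on a disjoint union of two open and closed parts is the sum of its restrictions. -/
theorem Series.cut_sum (V : Series υ) (hq : Clopen q) (hr : Clopen r) (h : ∀ x, p x ↔ q x ∨ r x)
    (hd : ∀ x, q x → ¬ r x) : V.cut hp ≈ (V.cut hq).sum (V.cut hr) := fun a => by
  have H : ∀ (x : Y) (v : (((V.coef a).cut hq).prod ((V.coef a).cut hr)).vb.fib x), ¬ p x →
      (v.1.1 + v.2.1 : (V.coef a).vb.fib x) = 0 := fun x v hx => by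
    rw [v.1.2 fun hq => hx ((h x).2 (.inl hq)), v.2.2 fun hr => hx ((h x).2 (.inr hr)), add_zero]
  let L : ∀ x, (((V.coef a).cut hq).prod ((V.coef a).cut hr)).vb.fib x →ₗ[ℂ] ((V.coef a).cut hp).vb.fib x :=
    fun x =>
    { toFun := fun v => ⟨v.1.1 + v.2.1, H x v⟩
      map_add' := fun v w => Subtype.ext (add_add_add_comm _ _ _ _)
      map_smul' := fun c v => Subtype.ext (smul_add c _ _).symm }
  refine GB.Iso.symm (GB.iso_of_bij L ?_ (fun x => ⟨?_, fun v => ?_⟩)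
    fun x y f v => Subtype.ext (map_add ((V.coef a).act f) _ _).symm)
  · rw [continuous_iff_continuousAt]
    intro s
    have hs := (VB.prod_iff _ _).1 (continuousAt_id (X := (((V.coef a).cut hq).prod ((V.coef a).cut hr)).vb.Tot) (x := s))
    refine (GB.cut_iff hp (V.coef a)).2 ?_
    refine ((V.coef a).vb.continuousAt_sum (κ := Bool) (c := fun _ _ => 1)
      (u := fun (b : Bool) (s : (((V.coef a).cut hq).prod ((V.coef a).cut hr)).vb.Tot) => if b then s.2.1.1 else s.2.2.1)
      (VB.contFst _).continuousAt (fun _ => continuousAt_const) fun b => ?_).congr (.of_forall fun s' => ?_)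
    · cases b
      · exact (GB.cut_iff hr (V.coef a)).1 hs.2
      · exact (GB.cut_iff hq (V.coef a)).1 hs.1
    · refine congrArg ((V.coef a).vb.pt s'.1) ?_
      exact (Fintype.sum_bool _).trans (congrArg₂ (· + ·) (one_smul _ _) (one_smul _ _))
  · refine (injective_iff_map_eq_zero (L x)).2 fun v hv => ?_
    have e : v.1.1 + v.2.1 = 0 := congrArg Subtype.val hv
    by_cases hx : q x
    · have e2 : v.2.1 = 0 := v.2.2 (hd x hx)
      rw [e2, add_zero] at e
      exact Prod.ext (Subtype.ext e) (Subtype.ext e2)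
    · have e2 : v.1.1 = 0 := v.1.2 hx
      rw [e2, zero_add] at e
      exact Prod.ext (Subtype.ext e2) (Subtype.ext e)
  · by_cases hx : q x
    · exact ⟨(⟨v.1, fun h => (h hx).elim⟩, 0), Subtype.ext (add_zero _)⟩
    · exact ⟨(0, ⟨v.1, fun hr => v.2 fun hp => ((h x).1 hp).elim hx hr⟩), Subtype.ext (zero_add _)⟩

variable {Z : Type u} [Groupoid.{u} Z] [TopologicalSpace Z] [ArrTop Z] {ξ : Cen Z}
  {K : Type} [Groupoid.{0} K] [Sized K] (D : Diag Z Y K) (hD : D.Compat ξ υ)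
  (hid : Continuous fun z : Z => arr (𝟙 z))

/-- The restriction to a part which contains `k` does not change the invariants of the automorphisms
of `k`. -/
theorem Series.fix_cut (V : Series υ) (k : K) (h : ∀ z, p (D.obj k z)) :
    (V.cut hp).fix D hD hid k ≈ V.fix D hD hid k := fun a => by
  refine GB.iso_of_bij (V := GB.lim D (fun _ : Unit => k) ((V.coef a).cut hp) hid)
    (W := GB.lim D (fun _ : Unit => k) (V.coef a) hid) (fun z =>
    { toFun := fun v => ⟨fun i => (v.1 i).1, fun i j α => congrArg Subtype.val (v.2 i j α)⟩
      map_add' := fun _ _ => rfl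
      map_smul' := fun _ _ => rfl }) ?_ (fun z => ⟨fun v w e => ?_, fun v => ?_⟩) fun z z' f v => rfl
  · rw [continuous_iff_continuousAt]
    intro s
    have hs := (GB.lim_iff D (fun _ : Unit => k) ((V.coef a).cut hp) hid).1 (continuousAt_id (x := s))
    exact (GB.lim_iff D (fun _ : Unit => k) (V.coef a) hid).2
      ⟨hs.1, fun i => (GB.cut_iff hp (V.coef a)).1 (hs.2 i)⟩
  · exact Subtype.ext (funext fun i => Subtype.ext (congrFun (congrArg (fun u => u.1) e) i))
  · exact ⟨⟨fun i => ⟨v.1 i, fun hn => (hn (h z)).elim⟩, fun i j α => Subtype.ext (v.2 i j α)⟩, rfl⟩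

end Cut

/-! ### The operations `θ` and `β_k` -/

section ThetaAdd

variable {X : Type u} [Groupoid.{u} X] [TopologicalSpace X] [ArrTop X] [TopGpd X]

variable (V : Series (Inertia.cen X)) (a : ℚ≥0)

/-- The value of a vector in a fibre of `θ(V)`, transported to a fixed coefficient; zero at the objects
of a different length. -/
def Series.thetaAt (n : ℕ) (o : Phi X) (v : ((V.theta).coef a).vb.fib o) :
    (V.coef (n * a)).vb.fib o.zeta := by
  classical
  exact if h : o.len * a = n * a then V.tr h (𝟙 _) v else 0

theorem Series.theta_iff {T : Type*} [TopologicalSpace T] {t : T} {o : T → Phi X} (ho : ContinuousAt o t)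
    {v : ∀ s, ((V.theta).coef a).vb.fib (o s)} :
    ContinuousAt (fun s => ((V.theta).coef a).vb.pt (o s) (v s)) t ↔
      ContinuousAt (fun s => (V.coef ((o t).len * a)).vb.pt (o s).zeta (V.thetaAt a (o t).len (o s) (v s))) t :=
  V.thetaVB_iff a ho _ (Phi.len_eventually ho) _ (.of_forall fun s h => dif_pos h)

/-- `θ` is compatible with isomorphisms and direct sums; continuity is checked after the transport to a
fixed coefficient, as the length of the cycle is locally constant. -/
theorem Series.theta_addOp : AddOp (Series.theta (X := X)) where
  congr V W e := by
    choose φ hφ h1 h2 using e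
    have key : ∀ n a (o : Phi X) v, W.thetaAt a n o (φ (o.len * a) o.zeta v) = φ (n * a) o.zeta (V.thetaAt a n o v) := by
      intro n a o v
      unfold Series.thetaAt
      split_ifs with h
      · exact (Series.tr_equiv φ hφ h (𝟙 _) v).symm
      · exact (map_zero _).symm
    intro a
    refine GB.iso_of_bij (V := (V.theta).coef a) (W := (W.theta).coef a) (fun o => (φ (o.len * a) o.zeta).toLinearMap)
      (continuous_iff_continuousAt.2 fun p => ?_) (fun o => (φ _ _).bijective) fun o o' A v => ?_
    · have hp := ((V.theta).coef a).vb.contFst.continuousAt (x := p)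
      refine (W.theta_iff a hp).2 ?_
      have h := (V.theta_iff a hp).1 (continuousAt_id (X := ((V.theta).coef a).vb.Tot) (x := p))
      refine ((h1 (p.1.len * a)).continuousAt.comp h).congr (.of_forall fun s => ?_)
      exact congrArg ((W.coef (p.1.len * a)).vb.pt s.1.zeta) (key _ a s.1 s.2).symm
    · exact (map_smul (φ _ _) _ _).trans (congrArg (ph (-(Phi.defect A * a)) • ·) (Series.tr_equiv φ hφ _ _ v))
  add V W a := by
    refine GB.iso_of_bij (V := ((V.sum W).theta).coef a) (W := ((V.theta).sum W.theta).coef a)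
      (fun o => { toFun := fun v => v, map_add' := fun _ _ => rfl, map_smul' := fun _ _ => rfl })
      (continuous_iff_continuousAt.2 fun p => ?_) (fun o => Function.bijective_id) fun o o' A v => ?_
    · have hp := (((V.sum W).theta).coef a).vb.contFst.continuousAt (x := p)
      have h := ((V.sum W).theta_iff a hp).1 (continuousAt_id (X := (((V.sum W).theta).coef a).vb.Tot) (x := p))
      have key : ∀ (o : Phi X) v, (V.sum W).thetaAt a p.1.len o v =
          (V.thetaAt a p.1.len o v.1, W.thetaAt a p.1.len o v.2) := by
        intro o v
        unfold Series.thetaAt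
        split_ifs with h
        · exact Prod.ext (V.sum_tr_fst W h _ v) (V.sum_tr_snd W h _ v)
        · rfl
      have h' := (VB.prod_iff _ _).1 (h.congr (.of_forall fun s =>
        congrArg (((V.sum W).coef (p.1.len * a)).vb.pt s.1.zeta) (key s.1 s.2)))
      exact (VB.prod_iff _ _).2 ⟨(V.theta_iff a hp).2 h'.1, (W.theta_iff a hp).2 h'.2⟩
    · exact Prod.ext (congrArg (ph (-(Phi.defect A * a)) • ·) (V.sum_tr_fst W _ _ v))
        (congrArg (ph (-(Phi.defect A * a)) • ·) (V.sum_tr_snd W _ _ v))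

end ThetaAdd

section Std

/-- The standard cycle of length `k`. -/
def Phi.std (k : ℕ) (hk : 0 < k) : Phi Pt :=
  ⟨⟨⟨k, fun _ => Pt.pt⟩, ⟨finRotate k, fun _ _ _ => ⟨⟩⟩⟩, hk, rfl⟩

/-- Every automorphism of a standard cycle is a rotation. -/
theorem Phi.eq_rot {o : Phi Pt} (α : o ⟶ o) : α = o.rot ((Phi.val α).perm o.zero) := by
  refine Phi.ext_pt (Equiv.ext fun i => Fin.ext ?_)
  rw [Phi.rot_val]
  refine Eq.trans ?_ (o.iter_perm _ i).symm
  have h1 : (iter o.loop i).perm o.zero = i := Fin.ext ((o.iter_perm _ _).trans 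
    ((congrArg (· % o.len) (zero_add (i : ℕ))).trans (Nat.mod_eq_of_lt i.isLt)))
  have h2 : (iter o.loop i ≫ Phi.val α).perm o.zero = (Phi.val α ≫ iter o.loop i).perm o.zero :=
    congrArg (fun B => FamHom.perm B o.zero) (iter_comm (Phi.comm α) i)
  have h3 : (Phi.val α).perm i = (iter o.loop i).perm ((Phi.val α).perm o.zero) :=
    (congrArg (Phi.val α).perm h1).symm.trans h2
  rw [h3, Phi.iter_perm, add_comm]

variable {X : Type u} [Groupoid.{u} X] [TopologicalSpace X] [ArrTop X] [TopGpd X]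

/-- The components of the powers of a constant family of arrows are the powers of the arrow. -/
theorem Sym.iter_const {n : ℕ} (σ : Equiv.Perm (Fin n)) {x : X} (g : x ⟶ x) (r : ℕ) (i j : Fin n) (h) :
    (iter (X := Sym X) (x := ⟨n, fun _ => x⟩) (FamHom.const σ g) r).hom i j h = iter g r := by
  suffices H : ∃ τ, iter (X := Sym X) (x := ⟨n, fun _ => x⟩) (FamHom.const σ g) r = FamHom.const τ (iter g r) by
    obtain ⟨τ, hτ⟩ := H
    exact FamHom.hom_congr hτ h ((congrArg (fun B => FamHom.perm B i) hτ).symm.trans h)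
  clear h
  induction r with
  | zero => exact ⟨Equiv.refl _, FamHom.ext rfl fun i j h h' => by cases (show i = j from h'); rfl⟩
  | succ r ih =>
    obtain ⟨τ, hτ⟩ := ih
    exact ⟨τ.trans σ, congrArg (fun B => FamHom.comp B (FamHom.const σ g)) hτ⟩

variable (k : ℕ) (hk : 0 < k)

/-- Going once around a constant cycle of length `k` is the `k`-th power. -/
def Phi.zetaStd (z : Inertia X) : ((Diag.cycle X).obj (Phi.std k hk) z).zeta ⟶ (Inertia.powMap X k).obj z :=
  ⟨𝟙 z.pt, (Category.comp_id _).trans ((Sym.iter_const _ _ _ _ _ _).trans (Category.id_comp _).symm)⟩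

theorem Phi.zetaStd_cont : Continuous fun z : Inertia X => arr (Phi.zetaStd k hk z) :=
  continuous_iff_continuousAt.2 fun z => by
    have h : ContinuousAt (fun z : Inertia X => arr z.loop) z :=
      Inertia.obj_iff.1 (continuousAt_id (X := Inertia X))
    exact Inertia.arr_iff.2 ⟨Inertia.obj_iff.1 (Phi.zeta_cont.comp ((Diag.cycle X).obj_cont _)).continuousAt,
      Inertia.obj_iff.1 (Inertia.powMap X k).obj_cont.continuousAt,
      (TopGpd.id_cont (X := X)).continuousAt.comp (contAt_src h)⟩

variable (V : Series (Inertia.cen X)) (a : ℚ≥0)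

/-- The identification of the coefficients of `θ(V)` at a constant cycle of length `k` with those of
`V` at the `k`-th power. -/
def Series.thetaStd (z : Inertia X) : ((V.theta).coef a).vb.fib ((Diag.cycle X).obj (Phi.std k hk) z) →ₗ[ℂ]
    (V.coef (k * a)).vb.fib ((Inertia.powMap X k).obj z) :=
  (V.coef (k * a)).act (Phi.zetaStd k hk z)

/-- The identification is equivariant for the arrows of the inertia groupoid. -/
theorem Series.thetaStd_act {z z' : Inertia X} (f : z ⟶ z') (v) :
    V.thetaStd k hk a z' (((V.theta).coef a).act ((Diag.cycle X).map (𝟙 (Phi.std k hk)) f) v) =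
      (V.coef (k * a)).act ((Inertia.powMap X k).map f) (V.thetaStd k hk a z v) := by
  let A : (Diag.cycle X).obj (Phi.std k hk) z ⟶ (Diag.cycle X).obj (Phi.std k hk) z' :=
    (Diag.cycle X).map (𝟙 (Phi.std k hk)) f
  -- `A` fixes the first index, so that it acts through `V` without a root of unity.
  have h0 : Phi.Fix A 0 := rfl
  have e1 : ((V.theta).coef a).act A v = (V.coef (k * a)).act (Phi.zetaMap (A ≫ Phi.rot _ 0) h0) v := by
    refine (LinearMap.congr_fun (V.thetaAct_eq a A (Phi.fix_defect A) h0) v).trans ?_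
    have e : ph (-((0 : ℕ) * a)) = 1 := by rw [Nat.cast_zero, zero_mul, neg_zero, ph_zero]
    exact (congrArg (· • (V.coef (k * a)).act (Phi.zetaMap (A ≫ Phi.rot _ 0) h0) v) e).trans (one_smul ℂ _)
  have e2 : Phi.zetaMap (A ≫ Phi.rot _ 0) h0 ≫ Phi.zetaStd k hk z' =
      Phi.zetaStd k hk z ≫ (Inertia.powMap X k).map f := by
    refine Subtype.ext ?_
    have e3 : A ≫ Phi.rot _ 0 = A := Category.comp_id A
    refine (Category.comp_id _).trans (Eq.trans ?_ (Category.id_comp _).symm)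
    exact FamHom.hom_congr (congrArg Phi.val e3) h0 rfl
  refine (congrArg _ e1).trans ?_
  exact ((V.coef (k * a)).act_comp _ _ _).symm.trans ((congrArg (fun g => (V.coef (k * a)).act g v) e2).trans
    ((V.coef (k * a)).act_comp _ _ _))

theorem Series.thetaStd_cont {T : Type*} [TopologicalSpace T] {t : T} {g : T → Inertia X} (hg : ContinuousAt g t)
    {v : ∀ s, ((V.theta).coef a).vb.fib ((Diag.cycle X).obj (Phi.std k hk) (g s))}
    (hv : ContinuousAt (fun s => ((V.theta).coef a).vb.pt ((Diag.cycle X).obj (Phi.std k hk) (g s)) (v s)) t) :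
    ContinuousAt (fun s => (V.coef (k * a)).vb.pt ((Inertia.powMap X k).obj (g s)) (V.thetaStd k hk a (g s) (v s))) t := by
  have ho : ContinuousAt (fun s => (Diag.cycle X).obj (Phi.std k hk) (g s)) t :=
    ((Diag.cycle X).obj_cont _).continuousAt.comp hg
  have h := (V.thetaVB_iff a ho k (.of_forall fun s => rfl) v (.of_forall fun s h =>
    ((V.coef (k * a)).act_id _ _).symm)).1 hv
  exact (V.coef (k * a)).contAt ((Phi.zetaStd_cont k hk).continuousAt.comp hg) h

/-- A vector is invariant under the automorphisms of the standard cycle if and only if the canonical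
center element of the inertia groupoid acts on it as `exp (2 π i a)`: the loop, which acts by this scalar
on `θ(V)`, is the product of the rotation and this center element. -/
theorem Series.thetaStd_invariant (z : Inertia X)
    (v : ((V.theta).coef a).vb.fib ((Diag.cycle X).obj (Phi.std k hk) z)) :
    (∀ α : Phi.std k hk ⟶ Phi.std k hk, ((V.theta).coef a).act ((Diag.cycle X).map α (𝟙 z)) v = v) ↔
      (V.coef (k * a)).act ((Inertia.powMap X k).map ((Inertia.cen X).app z)) (V.thetaStd k hk a z v) =
        ph a • V.thetaStd k hk a z v := by
  let A := (V.theta).coef a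
  let c := (Phi.cen Pt).app (Phi.std k hk)
  have h1 : A.act ((Diag.cycle X).map (𝟙 _) ((Inertia.cen X).app z)) (A.act ((Diag.cycle X).map c (𝟙 z)) v) =
      ph a • v := by
    rw [← A.act_comp, ← Diag.map_right]
    exact (V.theta).rot a _ v
  have h2 := V.thetaStd_act k hk a ((Inertia.cen X).app z) v
  have hj : Function.Injective (V.thetaStd k hk a z) := (V.coef (k * a)).act_inj _
  constructor
  · intro h
    rw [← h2, ← map_smul, ← h1, h c]
  · intro h
    have h3 : A.act ((Diag.cycle X).map c (𝟙 z)) v = v := by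
      refine A.act_inj ((Diag.cycle X).map (𝟙 _) ((Inertia.cen X).app z)) (h1.trans (hj ?_))
      rw [map_smul, ← h, ← h2]
    -- The loop of the standard cycle generates its automorphism group.
    have h4 : ∀ r, A.act ((Diag.cycle X).map ((Phi.std k hk).rot r) (𝟙 z)) v = v := by
      intro r
      induction r with
      | zero => exact A.act_id _ v
      | succ r ih =>
        have e : (Diag.cycle X).map ((Phi.std k hk).rot (r + 1)) (𝟙 z) =
            (Diag.cycle X).map ((Phi.std k hk).rot r) (𝟙 z) ≫ (Diag.cycle X).map c (𝟙 z) := by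
          rw [← Diag.map_comp, Category.comp_id]; rfl
        rw [e, A.act_comp, ih, h3]
    intro α
    rw [Phi.eq_rot α]
    exact h4 _

/-- The invariants of the automorphism group of the standard cycle of length `k` in `θ(V)` are `β_k(V)`. -/
theorem Series.fix_theta : (V.theta).fix (Diag.cycle X) Diag.cycle_compat Inertia.id_cont (Phi.std k hk) ≈
    V.beta k hk := fun a => by
  refine GB.iso_of_joint (I := Unit) (fun _ => (V.coef (k * a)).vb) (fun _ => (Inertia.powMap X k).obj)
    (fun _ z => V.thetaStd k hk a z ∘ₗ (V.theta).fixEv (Diag.cycle X) Diag.cycle_compat Inertia.id_cont (Phi.std k hk) a z)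
    (fun _ z => Submodule.subtype _) (fun _ => ?_) (fun _ => ?_) (fun z v h => ?_) (fun z w h => Subtype.ext (h ()))
    (fun z v => ?_) (fun z w => ?_) fun z z' f v w h _ => ?_
  · exact continuous_iff_continuousAt.2 fun p => V.thetaStd_cont k hk a (VB.contFst _).continuousAt
      ((GB.limEv_cont (Diag.cycle X) (fun _ : Unit => Phi.std k hk) ((V.theta).coef a) Inertia.id_cont ()).continuousAt)
  · exact continuous_iff_continuousAt.2 fun p => (VB.pull_iff _ _ (Inertia.powMap X k).obj_cont).1
      ((VB.embed_iff _ _ _ _ _).1 (continuousAt_id (X := ((V.beta k hk).coef a).vb.Tot) (x := p))) |>.2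
  · exact GB.lim_ext _ _ _ _ fun _ => (V.coef (k * a)).act_inj _ ((h ()).trans (map_zero _).symm)
  · exact ⟨⟨_, (V.thetaStd_invariant k hk a z _).1 fun α => v.2 () () α⟩, fun _ => rfl⟩
  · let v : ((V.theta).coef a).vb.fib ((Diag.cycle X).obj (Phi.std k hk) z) :=
      (V.coef (k * a)).act (Groupoid.inv (Phi.zetaStd k hk z)) w.1
    have hv : V.thetaStd k hk a z v = w.1 := by
      refine ((V.coef (k * a)).act_comp _ _ _).symm.trans ?_
      rw [Groupoid.inv_comp]
      exact (V.coef (k * a)).act_id _ _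
    refine ⟨⟨fun _ => v, fun _ _ α => (V.thetaStd_invariant k hk a z v).2 ?_ α⟩, fun _ => hv⟩
    rw [hv]
    exact w.2
  · exact (V.thetaStd_act k hk a _ _).trans (congrArg ((V.coef (k * a)).act _) (h ()))

theorem Series.beta_addOp : AddOp (Series.beta k hk (X := X)) where
  congr V W e := Setoid.trans (Setoid.symm (V.fix_theta k hk))
    (Setoid.trans ((Series.fix_addOp _ _ _ _).congr _ _ (Series.theta_addOp.congr V W e)) (W.fix_theta k hk))
  add V W := Setoid.trans (Setoid.symm ((V.sum W).fix_theta k hk))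
    (Setoid.trans ((Series.fix_addOp _ _ _ _).congr _ _ (Series.theta_addOp.add V W))
      (Setoid.trans ((Series.fix_addOp _ _ _ _).add _ _)
        (Series.sum_congr (V.fix_theta k hk) (W.fix_theta k hk))))

end Std

/-! ### The product formula -/

section Product

variable {X : Type u} [Groupoid.{u} X] [TopologicalSpace X] [ArrTop X]

theorem Phi.clopen (p : ℕ → Prop) : Clopen fun o : Phi X => p o.len where
  inv f h := by rwa [← Phi.len_eq f]
  loc o := by
    filter_upwards [Phi.len_eventually (continuousAt_id (X := Phi X) (x := o))] with o' h
    exact Iff.of_eq (congrArg p h)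

variable [TopGpd X]

/-- The total Atiyah symmetric power of a series on the inertia groupoid. -/
def Series.symTotal (V : Series (Inertia.cen X)) : PowerSeries (KTate X) :=
  V.total (Diag.one (Inertia X)) (Diag.one_compat _) Inertia.id_cont

/-- The generating function of the symmetric powers, along the standard cycles, of a series on `Φ(X)`. -/
def Series.cycleTotal (V : Series (Phi.cen X)) : PowerSeries (KTate X) :=
  V.total (Diag.cycle X) Diag.cycle_compat Inertia.id_cont

/-- The cycles of length `k` contribute the total symmetric power of `β_k(V)` in the variable `t ^ k`. -/
theorem Series.cycleTotal_cut (V : Series (Inertia.cen X)) (k : ℕ) (hk : k ≠ 0) :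
    ((V.theta).cut (Phi.clopen (· = k))).cycleTotal =
      PowerSeries.expand k hk (V.beta k (Nat.pos_of_ne_zero hk)).symTotal := by
  have hk' := Nat.pos_of_ne_zero hk
  refine (Series.total_eq_expand (Diag.cycle X) Diag.cycle_compat Inertia.id_cont
    ((V.theta).cut (Phi.clopen (· = k))) (k := Phi.std k hk') (fun κ h => Phi.ext_len h)
    fun κ z a h => Series.cut_subsingleton _ _ _ h).trans ?_
  refine congrArg (PowerSeries.expand k hk) (Series.total_congr _ _ _ ?_)
  exact Setoid.trans (Series.fix_cut _ _ _ _ _ _ fun z => rfl) (V.fix_theta k hk')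

/-- The decomposition of `Φ(X)` by the length of the cycle. -/
theorem Series.cycleTotal_theta (V : Series (Inertia.cen X)) (M : ℕ) :
    (V.theta).cycleTotal = (∏ k ∈ Finset.range M,
      PowerSeries.expand (k + 1) k.succ_ne_zero (V.beta (k + 1) k.succ_pos).symTotal) *
        ((V.theta).cut (Phi.clopen (M < ·))).cycleTotal := by
  induction M with
  | zero =>
    rw [Finset.prod_range_zero, one_mul]
    exact (Series.total_congr _ _ _ (Series.cut_of_forall _ _ fun o => o.pos)).symm
  | succ M ih =>
    rw [ih, Finset.prod_range_succ, mul_assoc, ← Series.cycleTotal_cut]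
    refine congrArg _ ((Series.total_congr _ _ _ (Series.cut_sum _ _ (Phi.clopen (· = M + 1))
      (Phi.clopen (M + 1 < ·)) (fun o => ?_) fun o h => ?_)).trans (Series.total_sum _ _ _ Phi.id_cont _ _))
    · omega
    · omega

/-- The cycles of length greater than `M` do not contribute up to order `M`. -/
theorem Series.coeff_cycleTotal_cut (V : Series (Phi.cen X)) {n M : ℕ} (h : n ≤ M) :
    PowerSeries.coeff n (V.cut (Phi.clopen (M < ·))).cycleTotal = if n = 0 then 1 else 0 :=
  Series.coeff_total_of_vanish _ _ _ _ (fun κ z a hκ => Series.cut_subsingleton _ _ _ (not_lt.2 hκ)) h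

/-- The total Atiyah symmetric power. -/
def KTate.symTotal (F : KTate X) : PowerSeries (KTate X) :=
  Krot.totalPow (Diag.one (Inertia X)) (Diag.one_compat _) Inertia.id_cont Inertia.id_cont F

theorem KTate.coeff_expand_symTotal (F : KTate X) (k : ℕ) (hk : k ≠ 0) (n : ℕ) :
    PowerSeries.coeff n (PowerSeries.expand k hk F.symTotal) = KTate.symAtiyah k F n := by
  rw [PowerSeries.coeff_expand, KTate.symAtiyah]
  exact if_congr Iff.rfl (Krot.coeff_totalPow _ F _) rfl

theorem KTate.partialProd_eq (F : KTate X) (M n : ℕ) : F.partialProd M n = PowerSeries.coeff n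
    (∏ k ∈ Finset.range M, PowerSeries.expand (k + 1) k.succ_ne_zero (KTate.beta (k + 1) k.succ_pos F).symTotal) := by
  induction M generalizing n with
  | zero =>
    rw [Finset.prod_range_zero, PowerSeries.coeff_one, ← Series.cls_one]
    rfl
  | succ M ih =>
    rw [Finset.prod_range_succ, PowerSeries.coeff_mul]
    rw [KTate.partialProd, KTate.mulSeries]
    simp only [Krot.mul_eq, ih, KTate.coeff_expand_symTotal]

/-- The product formula for virtual elements `F = V - W`: the formulas for `V` and `W` are compared by
multiplicativity, and the product for `W`, a unit, is cancelled. -/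
theorem KTate.symTate_eq_partialProd (F : KTate X) (n M : ℕ) (h : n ≤ M) :
    F.symTate n = F.partialProd M n := by
  obtain ⟨V, W, hF⟩ : ∃ V W : Series (Inertia.cen X), F + W.cls = V.cls :=
    ⟨F.rep.1, F.rep.2, sub_eq_iff_eq_add.1 F.rep_spec.symm |>.symm⟩
  have hθ : KTate.theta F + (W.theta).cls = (V.theta).cls := by
    rw [KTate.theta, Series.theta_addOp.map_eq, ← Series.theta_addOp.hom_cls, ← map_add, hF,
      Series.theta_addOp.hom_cls]
  have hβ : ∀ k hk, (KTate.beta k hk F).symTotal * (W.beta k hk).symTotal = (V.beta k hk).symTotal := by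
    intro k hk
    refine Krot.totalPow_mul _ _ _ _ ?_
    rw [KTate.beta, (Series.beta_addOp k hk).map_eq, ← (Series.beta_addOp k hk).hom_cls, ← map_add, hF,
      (Series.beta_addOp k hk).hom_cls]
  have h1 := Krot.totalPow_mul (Diag.cycle X) Diag.cycle_compat Inertia.id_cont Phi.id_cont hθ
  change _ * (W.theta).cycleTotal = (V.theta).cycleTotal at h1
  rw [W.cycleTotal_theta M, V.cycleTotal_theta M] at h1
  simp only [← hβ, map_mul, Finset.prod_mul_distrib] at h1
  set T := Krot.totalPow (Diag.cycle X) Diag.cycle_compat Inertia.id_cont Phi.id_cont F.theta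
  set P := ∏ k ∈ Finset.range M, PowerSeries.expand (k + 1) k.succ_ne_zero (KTate.beta (k + 1) k.succ_pos F).symTotal
    with hP
  set Q := ∏ k ∈ Finset.range M, PowerSeries.expand (k + 1) k.succ_ne_zero (W.beta (k + 1) k.succ_pos).symTotal
  have hQ : IsUnit Q := IsUnit.prod_iff.2 fun k _ => IsUnit.map _ (Series.isUnit_total _ _ _ _)
  have h2 : T * ((W.theta).cut (Phi.clopen (M < ·))).cycleTotal =
      P * ((V.theta).cut (Phi.clopen (M < ·))).cycleTotal := by
    refine hQ.mul_right_cancel ?_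
    rw [mul_assoc, mul_comm _ Q, h1]
    ring
  -- The factors of the cycles of length greater than `M` do not contribute to the coefficients up to `M`.
  have h3 : ∀ (G : PowerSeries (KTate X)) (A : Series (Phi.cen X)),
      PowerSeries.coeff n (G * (A.cut (Phi.clopen (M < ·))).cycleTotal) = PowerSeries.coeff n G := by
    intro G A
    rw [PowerSeries.coeff_mul, Finset.sum_eq_single (n, 0)]
    · rw [A.coeff_cycleTotal_cut M.zero_le, if_pos rfl, mul_one]
    · intro p hp hne
      have hs := Finset.HasAntidiagonal.mem_antidiagonal.1 hp
      rw [A.coeff_cycleTotal_cut (by omega), if_neg fun h0 => hne (Prod.ext (by omega) h0), mul_zero]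
    · intro hn
      exact (hn (Finset.HasAntidiagonal.mem_antidiagonal.2 (add_zero n))).elim
  rw [KTate.symTate_eq, KTate.partialProd_eq]
  exact (h3 T W.theta).symm.trans ((congrArg _ h2).trans (h3 P V.theta))

end Product

end OrbTate

end

theorem mainTheorem1 {X : Type u} [CategoryTheory.Groupoid.{u} X] [TopologicalSpace X]
    [OrbTate.ArrTop X] [OrbTate.TopGpd X] :
    Function.Bijective (OrbTate.KTate.pullQ X) ∧
      ∀ (F : OrbTate.KTate X) (n M : ℕ), n ≤ M →
        OrbTate.KTate.symTate F n = OrbTate.KTate.partialProd F M n :=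
  ⟨OrbTate.KTate.pullQ_bijective, OrbTate.KTate.symTate_eq_partialProd⟩
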